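/- **Conventions.** All vector spaces are over $\mathbb C$. For a $\mathbb Z$-graded vector space $Q$ let $S(Q)$ be its free graded commutative algebra with its usual coproduct. A formal function on $Q$ is a linear map $S(Q)\to\mathbb C$, and a formal vector field is a linear map $V\colon S(Q)\to Q$ (its Taylor coefficients at $0$); $\hat V$ is the corresponding coderivation of $S(Q)$ and $[V,W]=V\hat W-(-1)^{|V||W|}W\hat V$. A *dg manifold* is a pair $(Q,X)$ with $X$ a vector field of degree one, $X(0)=0$, $[X,X]=0$. Its functions are $H(\mathrm{Fun}(Q),X)$ and its vector fields are $TQ_X=H(TQ,[X,\cdot])$. A *cohomology F-manifold* is a dg manifold $(Q,X)$ with a graded commutative associative product $\star$ on $TQ_X$ which is even and linear over the functions of $(Q,X)$. Morphisms of dg manifolds are $L_\infty$-morphisms; a morphism is a quasi-isomorphism if its linear part induces an isomorphism on the cohomology of the linear parts of the vector fields. A quasi-isomorphism $\varphi\colon(Q',X')\to(Q,X)$ identifies $TQ'_{X'}$ with $TQ_X$ ($[V']$ corresponds to $[V]$ if the fields $d\varphi(V')$ and $V\circ\varphi$ along $\varphi$ differ by an exact one); it is an *equivalence* of cohomology F-manifolds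 if this identification is a well-defined linear isomorphism preserving the products. A dg manifold is *smooth* if there is a quasi-isomorphism $(K,0)\to(Q,X)$ for some $K$. A cohomology F-manifold *lifts to a Frobenius manifold* if there is an equivalence to it from the cohomology F-manifold $(K,0,\star)$ of some formal Frobenius manifold, that is, a graded vector space $K$ with an even nondegenerate graded symmetric constant metric $\eta$ and an even potential $\Phi$ such that $\eta(\partial_x\star\partial_y,\partial_z)=\partial_x\partial_y\partial_z\Phi$ defines an associative product $\star$ of vector fields (neither a unit nor an Euler vector field is required). For a complex manifold $M$ let $A(M)=\bigoplus_{p,q}A^{0,q}(M,\bigwedge^pT_M)$ be the smooth $(0,*)$-forms with values in polyvector fields, with the Dolbeault operator $\bar\partial$, the Schouten bracket $[\cdot,\cdot]$ and the wedge product $\wedge$, and let $H(M)=\bigoplus_{p,q} H^q(M,\bigwedge^pT_M)$ be its $\bar\partial$-cohomology. As graded linear spaces underlying dg manifolds, both have their $(p,q)$-part in degree $p+q-2$. **Theorem.** (1) Let $M$ be a non-compact (Hausdorff, second countable, pure-dimensional) complex manifold, Calabi-Yau or not. Then $(A(M),\bar\partial,[\cdot,\cdot],\wedge)$ is a dg Gerstenhaber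 algebra; the vector field $X(q)=\bar\partial q+\frac12[q,q]$ on $A(M)$ is cohomological, the product of any two $[X,\cdot]$-closed vector fields given by $\wedge$ on every tangent space $T_qA(M)=A(M)$ is closed, and it descends to a product $\star$ which makes $(A(M),X,\star)$ a cohomology F-manifold. This structure transfers to $H(M)$: there is a cohomology F-manifold $(H(M),X',\star')$ such that the linear part of $X'$ vanishes, an equivalence $(H(M),X',\star')\to(A(M),X,\star)$ whose linear part sends each class to a representative of it, and such that on the tangent space at $0$ the product $\star'$ is the wedge product of $H(M)$. (2) In general this structure cannot be lifted to a Frobenius manifold structure: there is a connected non-compact Calabi-Yau manifold $M$ (Kähler, with a nowhere vanishing holomorphic volume form) such that every cohomology F-manifold on $H(M)$ as in (1) is not smooth and does not lift to a Frobenius manifold. -/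

import Mathlib

open scoped TensorProduct Manifold ContDiff

namespace PolyForm

/-- The fibre `⋀(Ē* ⊕ E)`, `E = ℂⁿ`: the exterior algebra on `dz̄_1, …, dz̄_n` and
`∂/∂z_1, …, ∂/∂z_n`. -/
abbrev Fib (n : ℕ) : Type := ExteriorAlgebra ℂ ((Fin n → ℂ) × (Fin n → ℂ))

/-- The generator `ζ_i = dz̄_i`. -/
noncomputable def zeta {n : ℕ} (i : Fin n) : Fib n :=
  ExteriorAlgebra.ι ℂ ((Pi.single i 1, 0) : (Fin n → ℂ) × (Fin n → ℂ))

/-- The generator `θ_i = ∂/∂z_i`. -/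
noncomputable def theta {n : ℕ} (i : Fin n) : Fib n :=
  ExteriorAlgebra.ι ℂ ((0, Pi.single i 1) : (Fin n → ℂ) × (Fin n → ℂ))

/-- The odd left derivation `∂/∂θ_i` of the fibre. -/
noncomputable def dTheta {n : ℕ} (i : Fin n) : Fib n →ₗ[ℂ] Fib n :=
  CliffordAlgebra.contractLeft (LinearMap.proj i ∘ₗ LinearMap.snd ℂ (Fin n → ℂ) (Fin n → ℂ))

/-- The sign `(-1)^k` on `⋀^k`. -/
noncomputable def fibSgn {n : ℕ} : Fib n →ₐ[ℂ] Fib n := CliffordAlgebra.involute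

section Algebra
variable {R : Type*} [CommRing R] [Algebra ℂ R] {n : ℕ}

/-- The sign `(-1)^k` on forms of total degree `k`, with coefficients in `R`. -/
noncomputable def locSgn : R ⊗[ℂ] Fib n →ₐ[ℂ] R ⊗[ℂ] Fib n :=
  Algebra.TensorProduct.map (AlgHom.id ℂ R) fibSgn

/-- The odd left derivation `∂/∂θ_i`. -/
noncomputable def locTheta (i : Fin n) : R ⊗[ℂ] Fib n →ₗ[ℂ] R ⊗[ℂ] Fib n :=
  (dTheta i).lTensor R

/-- A derivation of `R` acting on coefficients. -/
noncomputable def locDer (δ : Derivation ℂ R R) : R ⊗[ℂ] Fib n →ₗ[ℂ] R ⊗[ℂ] Fib n :=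
  (δ : R →ₗ[ℂ] R).rTensor (Fib n)

/-- `∂̄ = ∑ dz̄_i ∧ δ_i`. -/
noncomputable def locDbar (δ : Fin n → Derivation ℂ R R) :
    R ⊗[ℂ] Fib n →ₗ[ℂ] R ⊗[ℂ] Fib n :=
  ∑ i, LinearMap.mulLeft ℂ ((1 : R) ⊗ₜ[ℂ] zeta i) ∘ₗ locDer (δ i)

/-- The Schouten bracket
`[x, y] = ∑ ((-1)^{|x|-1} (∂x/∂θ_i) ∧ δ_i y - δ_i x ∧ ∂y/∂θ_i)`. -/
noncomputable def locBracket (δ : Fin n → Derivation ℂ R R) :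
    R ⊗[ℂ] Fib n →ₗ[ℂ] R ⊗[ℂ] Fib n →ₗ[ℂ] R ⊗[ℂ] Fib n :=
  ∑ i, ((LinearMap.mul ℂ (R ⊗[ℂ] Fib n)).compl₁₂
          (locSgn.toLinearMap ∘ₗ locTheta i) (locDer (δ i))
        - (LinearMap.mul ℂ (R ⊗[ℂ] Fib n)).compl₁₂ (locDer (δ i)) (locTheta i))

theorem locBracket_apply (δ : Fin n → Derivation ℂ R R) (x y : R ⊗[ℂ] Fib n) :
    locBracket δ x y = ∑ i, (locSgn (locTheta i x) * locDer (δ i) y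
      - locDer (δ i) x * locTheta i y) := by
  simp [locBracket]

theorem locDbar_apply (δ : Fin n → Derivation ℂ R R) (x : R ⊗[ℂ] Fib n) :
    locDbar δ x = ∑ i, ((1 : R) ⊗ₜ[ℂ] zeta i) * locDer (δ i) x := by
  simp [locDbar]

/-- induction: R and odd generators generate. -/
theorem loc_induction {motive : R ⊗[ℂ] Fib n → Prop}
    (coef : ∀ f : R, motive (f ⊗ₜ 1))
    (mul : ∀ (v : (Fin n → ℂ) × (Fin n → ℂ)) (a : R ⊗[ℂ] Fib n), motive a →
      motive (((1 : R) ⊗ₜ[ℂ] ExteriorAlgebra.ι ℂ v) * a))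
    (add : ∀ a b, motive a → motive b → motive (a + b)) (a : R ⊗[ℂ] Fib n) : motive a := by
  induction a using TensorProduct.induction_on with
  | zero => simpa using coef 0
  | add x y hx hy => exact add x y hx hy
  | tmul f l =>
    revert f
    induction l using CliffordAlgebra.left_induction with
    | algebraMap r =>
      intro f
      have := coef (r • f)
      rwa [TensorProduct.smul_tmul, ← Algebra.algebraMap_eq_smul_one] at this
    | add x y hx hy =>
      intro f; rw [TensorProduct.tmul_add]; exact add _ _ (hx f) (hy f)
    | ι_mul x v hx =>
      intro f
      have := mul v _ (hx f)
      rwa [Algebra.TensorProduct.tmul_mul_tmul, one_mul] at this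

theorem locDer_mul (δ : Derivation ℂ R R) (a b : R ⊗[ℂ] Fib n) :
    locDer δ (a * b) = locDer δ a * b + a * locDer δ b := by
  induction a using TensorProduct.induction_on with
  | zero => simp
  | add x y hx hy => simp only [add_mul, map_add, hx, hy]; abel
  | tmul f l =>
    induction b using TensorProduct.induction_on with
    | zero => simp
    | add x y hx hy => simp only [mul_add, map_add, hx, hy]; abel
    | tmul g m =>
      simp [locDer, TensorProduct.add_tmul, mul_comm, add_comm]

theorem locSgn_gen (v : (Fin n → ℂ) × (Fin n → ℂ)) :
    locSgn ((1 : R) ⊗ₜ[ℂ] ExteriorAlgebra.ι ℂ v) = - ((1 : R) ⊗ₜ[ℂ] ExteriorAlgebra.ι ℂ v) := by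
  have : fibSgn (ExteriorAlgebra.ι ℂ v) = - ExteriorAlgebra.ι ℂ v := CliffordAlgebra.involute_ι v
  simp [locSgn, this, TensorProduct.tmul_neg]

theorem locSgn_coef (f : R) : locSgn (f ⊗ₜ[ℂ] (1 : Fib n)) = f ⊗ₜ 1 := by
  simp [locSgn]

theorem locSgn_locSgn (a : R ⊗[ℂ] Fib n) : locSgn (locSgn a) = a := by
  induction a using loc_induction with
  | coef f => simp [locSgn_coef]
  | mul v a h => simp [h, locSgn_gen]
  | add a b ha hb => simp [ha, hb]

theorem locTheta_coef (i : Fin n) (f : R) : locTheta i (f ⊗ₜ[ℂ] (1 : Fib n)) = 0 := by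
  have : dTheta i (1 : Fib n) = 0 := CliffordAlgebra.contractLeft_one _ _
  simp [locTheta, this]

theorem locTheta_gen_mul (i : Fin n) (v : (Fin n → ℂ) × (Fin n → ℂ)) (a : R ⊗[ℂ] Fib n) :
    locTheta i (((1 : R) ⊗ₜ[ℂ] ExteriorAlgebra.ι ℂ v) * a) =
      v.2 i • a - ((1 : R) ⊗ₜ[ℂ] ExteriorAlgebra.ι ℂ v) * locTheta i a := by
  induction a using TensorProduct.induction_on with
  | zero => simp
  | add x y hx hy => simp only [mul_add, map_add, hx, hy, smul_add]; abel
  | tmul f l =>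
    have : dTheta i (ExteriorAlgebra.ι ℂ v * l) = v.2 i • l - ExteriorAlgebra.ι ℂ v * dTheta i l :=
      CliffordAlgebra.contractLeft_ι_mul _ _ _
    simp [locTheta, this, TensorProduct.tmul_sub]

/-- Odd derivation rule. -/
theorem locTheta_mul (i : Fin n) (a b : R ⊗[ℂ] Fib n) :
    locTheta i (a * b) = locTheta i a * b + locSgn a * locTheta i b := by
  induction a using loc_induction with
  | coef f =>
    induction b using TensorProduct.induction_on with
    | zero => simp
    | add x y hx hy => simp only [mul_add, map_add, hx, hy]; abel
    | tmul g m => rw [locTheta_coef, locSgn_coef]; simp [locTheta]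
  | mul v a h =>
    rw [mul_assoc, locTheta_gen_mul, h, locTheta_gen_mul, map_mul, locSgn_gen]
    simp only [sub_mul, mul_add, neg_mul, smul_mul_assoc, mul_assoc]
    abel
  | add x y hx hy => simp only [add_mul, map_add, hx, hy]; abel

theorem gen_mul_comm (v w : (Fin n → ℂ) × (Fin n → ℂ)) :
    ((1 : R) ⊗ₜ[ℂ] ExteriorAlgebra.ι ℂ v) * ((1 : R) ⊗ₜ[ℂ] ExteriorAlgebra.ι ℂ w) =
     - (((1 : R) ⊗ₜ[ℂ] ExteriorAlgebra.ι ℂ w) * ((1 : R) ⊗ₜ[ℂ] ExteriorAlgebra.ι ℂ v)) := by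
  have := ExteriorAlgebra.ι_add_mul_swap (R := ℂ) v w
  rw [Algebra.TensorProduct.tmul_mul_tmul, Algebra.TensorProduct.tmul_mul_tmul,
    ← TensorProduct.tmul_neg, eq_neg_of_add_eq_zero_left this]

theorem coef_mul_comm (f : R) (a : R ⊗[ℂ] Fib n) :
    (f ⊗ₜ[ℂ] (1 : Fib n)) * a = a * (f ⊗ₜ[ℂ] (1 : Fib n)) := by
  induction a using TensorProduct.induction_on with
  | zero => simp
  | add x y hx hy => simp [mul_add, add_mul, hx, hy]
  | tmul g m => simp [mul_comm]

theorem gen_mul (v : (Fin n → ℂ) × (Fin n → ℂ)) (a : R ⊗[ℂ] Fib n) :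
    ((1 : R) ⊗ₜ[ℂ] ExteriorAlgebra.ι ℂ v) * a = locSgn a * ((1 : R) ⊗ₜ[ℂ] ExteriorAlgebra.ι ℂ v) := by
  induction a using loc_induction with
  | coef f => rw [locSgn_coef, coef_mul_comm]
  | mul w a h =>
    rw [map_mul, locSgn_gen, ← mul_assoc, gen_mul_comm, neg_mul, mul_assoc, h,
      neg_mul, neg_mul, ← mul_assoc]
  | add x y hx hy => simp [mul_add, add_mul, hx, hy]

/-- graded commutativity. -/
theorem loc_mul_comm (a b : R ⊗[ℂ] Fib n) (p q : ℕ) (ha : locSgn a = (-1 : ℂ) ^ p • a)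
    (hb : locSgn b = (-1 : ℂ) ^ q • b) : a * b = (-1 : ℂ) ^ (p * q) • (b * a) := by
  have key : ∀ a b : R ⊗[ℂ] Fib n, (2 : ℂ) • (a * b) =
      b * (a + locSgn a) + locSgn b * (a - locSgn a) := by
    intro a b
    induction a using loc_induction with
    | coef f => rw [locSgn_coef, sub_self, mul_zero, coef_mul_comm, add_zero, ← two_smul ℂ, mul_smul_comm]
    | mul v a h =>
      rw [mul_assoc, ← mul_smul_comm, h, mul_add, ← mul_assoc, ← mul_assoc, gen_mul, gen_mul,
        locSgn_locSgn, map_mul, locSgn_gen]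
      simp only [mul_add, mul_sub, mul_assoc, neg_mul, mul_neg]
      abel
    | add x y hx hy => simp only [map_add, add_mul, smul_add, hx, hy, mul_add, mul_sub]; abel
  have h2 := key a b
  rw [ha, hb] at h2
  have h3 : (2 : ℂ) • (a * b) = (2 : ℂ) • ((-1 : ℂ) ^ (p * q) • (b * a)) := by
    rw [h2]
    rcases Nat.even_or_odd p with hp | hp <;> rcases Nat.even_or_odd q with hq | hq <;>
      simp [hp.neg_one_pow, hq.neg_one_pow, pow_mul, two_smul, mul_add]
  exact smul_right_injective _ (two_ne_zero) h3

/-- span of generators -/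
theorem lin_mul {w : R ⊗[ℂ] Fib n}
    (hw : w ∈ LinearMap.range ((ExteriorAlgebra.ι ℂ :
      ((Fin n → ℂ) × (Fin n → ℂ)) →ₗ[ℂ] Fib n).lTensor R)) :
    locSgn w = -w ∧ ∀ a, w * a = locSgn a * w := by
  obtain ⟨t, rfl⟩ := hw
  induction t using TensorProduct.induction_on with
  | zero => simp
  | add x y hx hy =>
    refine ⟨by rw [map_add, map_add, hx.1, hy.1]; abel, fun a => ?_⟩
    rw [map_add, add_mul, hx.2, hy.2, mul_add]
  | tmul f v =>
    have e : f ⊗ₜ[ℂ] (ExteriorAlgebra.ι ℂ v) =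
        (f ⊗ₜ[ℂ] (1 : Fib n)) * ((1 : R) ⊗ₜ[ℂ] ExteriorAlgebra.ι ℂ v) := by simp
    rw [LinearMap.lTensor_tmul, e]
    refine ⟨by rw [map_mul, locSgn_coef, locSgn_gen, mul_neg], fun a => ?_⟩
    rw [mul_assoc, gen_mul, ← mul_assoc, coef_mul_comm, mul_assoc]

theorem lin_sq {w : R ⊗[ℂ] Fib n}
    (hw : w ∈ LinearMap.range ((ExteriorAlgebra.ι ℂ :
      ((Fin n → ℂ) × (Fin n → ℂ)) →ₗ[ℂ] Fib n).lTensor R)) : w * w = 0 := by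
  have h := (lin_mul hw).2 w
  rw [(lin_mul hw).1, neg_mul] at h
  have h2 : (2 : ℂ) • (w * w) = 0 := by rw [two_smul]; nth_rewrite 1 [h]; simp
  exact (smul_eq_zero.mp h2).resolve_left two_ne_zero

/-- The linear map with `ζ_j ↦ ∑ P_{ji} ζ_i`, `θ_j ↦ ∑ G_{ji} θ_i`. -/
noncomputable def frameLin (P G : Fin n → Fin n → R) :
    ((Fin n → ℂ) × (Fin n → ℂ)) →ₗ[ℂ] R ⊗[ℂ] Fib n :=
  ∑ j, ∑ i, (((LinearMap.proj j ∘ₗ LinearMap.fst ℂ (Fin n → ℂ) (Fin n → ℂ)).smulRight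
        (P j i ⊗ₜ[ℂ] zeta i))
      + ((LinearMap.proj j ∘ₗ LinearMap.snd ℂ (Fin n → ℂ) (Fin n → ℂ)).smulRight
        (G j i ⊗ₜ[ℂ] theta i)))

theorem frameLin_apply (P G : Fin n → Fin n → R) (v : (Fin n → ℂ) × (Fin n → ℂ)) :
    frameLin P G v = ∑ j, ∑ i, (v.1 j • (P j i ⊗ₜ[ℂ] zeta i) + v.2 j • (G j i ⊗ₜ[ℂ] theta i)) := by
  simp [frameLin]

theorem frameLin_mem (P G : Fin n → Fin n → R) (v : (Fin n → ℂ) × (Fin n → ℂ)) :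
    frameLin P G v ∈ LinearMap.range ((ExteriorAlgebra.ι ℂ :
      ((Fin n → ℂ) × (Fin n → ℂ)) →ₗ[ℂ] Fib n).lTensor R) := by
  rw [frameLin_apply]
  refine Submodule.sum_mem _ fun j _ => Submodule.sum_mem _ fun i _ => Submodule.add_mem _ ?_ ?_
  · exact Submodule.smul_mem _ _ ⟨_, LinearMap.lTensor_tmul _ _ _ _⟩
  · exact Submodule.smul_mem _ _ ⟨_, LinearMap.lTensor_tmul _ _ _ _⟩

/-- The `R`-algebra map with `ζ_j ↦ ∑ P_{ji} ζ_i`, `θ_j ↦ ∑ G_{ji} θ_i`. -/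
noncomputable def frameChange (P G : Fin n → Fin n → R) : R ⊗[ℂ] Fib n →ₐ[ℂ] R ⊗[ℂ] Fib n :=
  Algebra.TensorProduct.lift Algebra.TensorProduct.includeLeft
    (ExteriorAlgebra.lift ℂ ⟨frameLin P G, fun v => lin_sq (frameLin_mem P G v)⟩)
    (fun f l => by
      rw [Algebra.TensorProduct.includeLeft_apply]
      exact coef_mul_comm f _)

theorem frameChange_coef (P G : Fin n → Fin n → R) (f : R) :
    frameChange P G (f ⊗ₜ 1) = f ⊗ₜ 1 := by
  simp [frameChange]

theorem frameChange_gen (P G : Fin n → Fin n → R) (v : (Fin n → ℂ) × (Fin n → ℂ)) :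
    frameChange P G ((1 : R) ⊗ₜ[ℂ] ExteriorAlgebra.ι ℂ v) = frameLin P G v := by
  simp [frameChange, ← Algebra.TensorProduct.one_def]

theorem frameChange_locSgn (P G : Fin n → Fin n → R) (a : R ⊗[ℂ] Fib n) :
    locSgn (frameChange P G a) = frameChange P G (locSgn a) := by
  induction a using loc_induction with
  | coef f => simp only [locSgn_coef, frameChange_coef]
  | mul v a h =>
    rw [map_mul, map_mul, frameChange_gen, (lin_mul (frameLin_mem P G v)).1, h, map_mul, map_mul,
      locSgn_gen, map_neg, frameChange_gen]
  | add x y hx hy => simp only [map_add, hx, hy]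

theorem locTheta_smul (i : Fin n) (f : R) (l : Fib n) :
    locTheta i (f ⊗ₜ[ℂ] l) = f ⊗ₜ dTheta i l := rfl

theorem dTheta_zeta (i j : Fin n) : dTheta i (zeta j : Fib n) = 0 := by
  have := CliffordAlgebra.contractLeft_ι (Q := (0 : QuadraticForm ℂ ((Fin n → ℂ) × (Fin n → ℂ))))
    (LinearMap.proj i ∘ₗ LinearMap.snd ℂ (Fin n → ℂ) (Fin n → ℂ)) (Pi.single j 1, 0)
  refine Eq.trans this ?_
  simp

theorem dTheta_theta (i j : Fin n) : dTheta i (theta j : Fib n) = if i = j then 1 else 0 := by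
  have := CliffordAlgebra.contractLeft_ι (Q := (0 : QuadraticForm ℂ ((Fin n → ℂ) × (Fin n → ℂ))))
    (LinearMap.proj i ∘ₗ LinearMap.snd ℂ (Fin n → ℂ) (Fin n → ℂ)) (0, Pi.single j 1)
  refine Eq.trans this ?_
  by_cases h : i = j <;> simp [h]

theorem locTheta_frameChange (P G : Fin n → Fin n → R) (i : Fin n) (a : R ⊗[ℂ] Fib n) :
    locTheta i (frameChange P G a) =
      ∑ j, (G j i ⊗ₜ[ℂ] (1 : Fib n)) * frameChange P G (locTheta j a) := by
  induction a using loc_induction with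
  | coef f => simp [frameChange_coef, locTheta_coef]
  | mul v a h =>
    rw [map_mul, frameChange_gen, locTheta_mul, h, (lin_mul (frameLin_mem P G v)).1, neg_mul,
      Finset.mul_sum, ← Finset.sum_neg_distrib]
    have e : locTheta i (frameLin P G v) = ∑ j, v.2 j • (G j i ⊗ₜ[ℂ] (1 : Fib n)) := by
      rw [frameLin_apply]
      simp only [map_sum, map_add, map_smul, locTheta_smul, dTheta_zeta, dTheta_theta]
      simp [TensorProduct.tmul_ite]
    rw [e, Finset.sum_mul, ← Finset.sum_add_distrib]
    refine Finset.sum_congr rfl fun j _ => ?_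
    rw [locTheta_gen_mul, map_sub, map_mul, frameChange_gen, map_smul, mul_sub, ← mul_assoc,
      ← mul_assoc, coef_mul_comm (G j i) (frameLin P G v), smul_mul_assoc, mul_smul_comm,
      sub_eq_add_neg]
  | add x y hx hy => simp only [map_add, hx, hy, mul_add, Finset.sum_add_distrib]

theorem locDer_coef (δ : Derivation ℂ R R) (f : R) :
    locDer δ (f ⊗ₜ[ℂ] (1 : Fib n)) = δ f ⊗ₜ 1 := rfl

theorem locDer_gen (δ : Derivation ℂ R R) (l : Fib n) :
    locDer δ ((1 : R) ⊗ₜ[ℂ] l) = 0 := by simp [locDer]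

theorem frameLin_zero_single (P G : Fin n → Fin n → R) (k : Fin n) :
    frameLin P G (0, Pi.single k 1) = ∑ i, (G k i ⊗ₜ[ℂ] theta i) := by
  rw [frameLin_apply]
  rw [Finset.sum_eq_single k] <;> simp +contextual

theorem locDer_frameLin (P G : Fin n → Fin n → R) (δ : Derivation ℂ R R)
    (hP : ∀ j i, δ (P j i) = 0) (v : (Fin n → ℂ) × (Fin n → ℂ)) :
    locDer δ (frameLin P G v) = ∑ k, v.2 k • locDer δ (frameLin P G (0, Pi.single k 1)) := by
  simp only [frameLin_zero_single]
  simp only [frameLin_apply, map_sum, map_add, map_smul]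
  refine Finset.sum_congr rfl fun j _ => ?_
  rw [Finset.smul_sum]
  refine Finset.sum_congr rfl fun i _ => ?_
  simp [locDer, hP]

theorem locDer_frameChange (P G : Fin n → Fin n → R) (δ : Derivation ℂ R R)
    (δ' : Fin n → Derivation ℂ R R) (J : Fin n → R) (hP : ∀ j i, δ (P j i) = 0)
    (hJ : ∀ f, δ f = ∑ j, J j * δ' j f) (a : R ⊗[ℂ] Fib n) :
    locDer δ (frameChange P G a) =
      ∑ j, (J j ⊗ₜ[ℂ] (1 : Fib n)) * frameChange P G (locDer (δ' j) a)
      + ∑ k, locDer δ (frameLin P G (0, Pi.single k 1)) * frameChange P G (locTheta k a) := by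
  induction a using loc_induction with
  | coef f =>
    simp only [frameChange_coef, locDer_coef, locTheta_coef, hJ f, map_zero, mul_zero,
      Finset.sum_const_zero, add_zero, TensorProduct.sum_tmul]
    simp
  | mul v a h =>
    rw [map_mul, frameChange_gen, locDer_mul, h, mul_add, Finset.mul_sum, Finset.mul_sum,
      locDer_frameLin P G δ hP v, Finset.sum_mul]
    have e1 : ∀ j, frameChange P G (locDer (δ' j) (((1 : R) ⊗ₜ[ℂ] ExteriorAlgebra.ι ℂ v) * a)) =
        frameLin P G v * frameChange P G (locDer (δ' j) a) := by
      intro j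
      rw [locDer_mul, locDer_gen, zero_mul, zero_add, map_mul, frameChange_gen]
    have e2 : ∀ k, frameChange P G (locTheta k (((1 : R) ⊗ₜ[ℂ] ExteriorAlgebra.ι ℂ v) * a)) =
        v.2 k • frameChange P G a - frameLin P G v * frameChange P G (locTheta k a) := by
      intro k
      rw [locTheta_gen_mul, map_sub, map_smul, map_mul, frameChange_gen]
    have e3 : ∀ k, frameLin P G v * (locDer δ (frameLin P G (0, Pi.single k 1))
          * frameChange P G (locTheta k a))
        = - (locDer δ (frameLin P G (0, Pi.single k 1)) * (frameLin P G v
          * frameChange P G (locTheta k a))) := by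
      intro k
      have hmem : locDer δ (frameLin P G (0, Pi.single k 1)) ∈
          LinearMap.range ((ExteriorAlgebra.ι ℂ :
            ((Fin n → ℂ) × (Fin n → ℂ)) →ₗ[ℂ] Fib n).lTensor R) := by
        rw [frameLin_zero_single, map_sum]
        exact Submodule.sum_mem _ fun i _ => ⟨δ (G k i) ⊗ₜ (0, Pi.single i 1), rfl⟩
      rw [← mul_assoc, (lin_mul (frameLin_mem P G v)).2, (lin_mul hmem).1, neg_mul, neg_mul,
        mul_assoc]
    have e4 : ∀ j, frameLin P G v * ((J j ⊗ₜ[ℂ] (1 : Fib n)) * frameChange P G (locDer (δ' j) a))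
        = (J j ⊗ₜ[ℂ] (1 : Fib n)) * (frameLin P G v * frameChange P G (locDer (δ' j) a)) := by
      intro j
      rw [← mul_assoc, ← coef_mul_comm, mul_assoc]
    simp only [e1, e2, e3, e4, mul_sub, Finset.sum_sub_distrib, mul_smul_comm, smul_mul_assoc,
      Finset.sum_neg_distrib]
    abel
  | add x y hx hy => simp only [map_add, hx, hy, mul_add, Finset.sum_add_distrib]; abel

theorem locDbar_frameChange (P G : Fin n → Fin n → R) (δ δ' : Fin n → Derivation ℂ R R)
    (h2 : ∀ i f, δ i f = ∑ j, P j i * δ' j f) (h4 : ∀ j i k, δ k (P j i) = δ i (P j k))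
    (h5 : ∀ j i k, δ k (G j i) = 0) (a : R ⊗[ℂ] Fib n) :
    locDbar δ (frameChange P G a) = frameChange P G (locDbar δ' a) := by
  have hz : ∀ j, frameChange P G ((1 : R) ⊗ₜ[ℂ] zeta j) = ∑ i, (P j i ⊗ₜ[ℂ] zeta i) := by
    intro j
    have := frameChange_gen P G (Pi.single j 1, 0)
    rw [frameLin_apply, Finset.sum_eq_single j] at this
    · refine Eq.trans this ?_
      simp
    · simp +contextual
    · simp
  have hcl : ∀ v, ∑ k, ((1 : R) ⊗ₜ[ℂ] (zeta k : Fib n)) * locDer (δ k) (frameLin P G v) = 0 := by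
    intro v
    simp only [frameLin_apply, map_sum, map_add, map_smul]
    have e1 : ∀ k j i, locDer (δ k) (P j i ⊗ₜ[ℂ] (zeta i : Fib n)) = δ k (P j i) ⊗ₜ zeta i :=
      fun _ _ _ => rfl
    have e2 : ∀ k j i, locDer (δ k) (G j i ⊗ₜ[ℂ] (theta i : Fib n)) = 0 := by
      intro k j i
      have : locDer (δ k) (G j i ⊗ₜ[ℂ] (theta i : Fib n)) = δ k (G j i) ⊗ₜ theta i := rfl
      rw [this, h5, TensorProduct.zero_tmul]
    simp only [e1, e2, smul_zero, add_zero, Finset.mul_sum, mul_smul_comm,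
      Algebra.TensorProduct.tmul_mul_tmul, one_mul]
    rw [Finset.sum_comm]
    refine Finset.sum_eq_zero fun j _ => ?_
    simp only [← Finset.smul_sum]
    refine smul_eq_zero_of_right _ ?_
    have anti : ∀ k i : Fin n, (zeta k : Fib n) * zeta i = - (zeta i * zeta k) := fun k i =>
      eq_neg_of_add_eq_zero_left (ExteriorAlgebra.ι_add_mul_swap _ _)
    set S := ∑ k, ∑ i, δ k (P j i) ⊗ₜ[ℂ] ((zeta k : Fib n) * zeta i) with hS
    have : S = -S := by
      nth_rewrite 1 [hS]
      rw [Finset.sum_comm, hS, ← Finset.sum_neg_distrib]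
      refine Finset.sum_congr rfl fun i _ => ?_
      rw [← Finset.sum_neg_distrib]
      refine Finset.sum_congr rfl fun k _ => ?_
      rw [h4, anti, TensorProduct.tmul_neg]
    have h2 : (2 : ℂ) • S = 0 := by rw [two_smul]; nth_rewrite 1 [this]; simp
    exact (smul_eq_zero.mp h2).resolve_left two_ne_zero
  induction a using loc_induction with
  | coef f =>
    rw [frameChange_coef, locDbar_apply, locDbar_apply, map_sum]
    simp only [locDer_coef, map_mul, frameChange_coef, hz, h2, TensorProduct.sum_tmul,
      Finset.mul_sum, Finset.sum_mul]
    rw [Finset.sum_comm]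
    simp
  | mul v a h =>
    rw [map_mul, frameChange_gen, locDbar_apply, locDbar_apply]
    rw [locDbar_apply, locDbar_apply] at h
    simp only [locDer_mul, locDer_gen, zero_mul, zero_add, mul_add, Finset.sum_add_distrib,
      ← mul_assoc]
    rw [← Finset.sum_mul, hcl, zero_mul, zero_add]
    have e : ∀ k, ((1 : R) ⊗ₜ[ℂ] (zeta k : Fib n)) * frameLin P G v =
        - (frameLin P G v * ((1 : R) ⊗ₜ[ℂ] (zeta k : Fib n))) := by
      intro k
      rw [(lin_mul (frameLin_mem P G v)).2]
      unfold zeta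
      rw [locSgn_gen, neg_mul, neg_neg]
    have e' : ∀ k, ((1 : R) ⊗ₜ[ℂ] (zeta k : Fib n)) * ((1 : R) ⊗ₜ[ℂ] ExteriorAlgebra.ι ℂ v) =
        - (((1 : R) ⊗ₜ[ℂ] ExteriorAlgebra.ι ℂ v) * ((1 : R) ⊗ₜ[ℂ] (zeta k : Fib n))) := by
      intro k; exact gen_mul_comm _ _
    simp only [e, e', neg_mul, mul_assoc, Finset.sum_neg_distrib]
    rw [← Finset.mul_sum, h, ← Finset.mul_sum, map_neg, map_mul, frameChange_gen]
  | add x y hx hy => simp only [map_add, hx, hy]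

theorem locBracket_frameChange (P G J : Fin n → Fin n → R) (δ δ' : Fin n → Derivation ℂ R R)
    (h1 : ∀ i f, δ i f = ∑ j, J i j * δ' j f)
    (h3 : ∀ j k, ∑ i, G j i * J i k = if j = k then 1 else 0)
    (h6 : ∀ j k l, ∑ i, G j i * δ i (G k l) = ∑ i, G k i * δ i (G j l))
    (h7 : ∀ j i k, δ k (P j i) = 0) (x y : R ⊗[ℂ] Fib n) :
    locBracket δ (frameChange P G x) (frameChange P G y) =
      frameChange P G (locBracket δ' x y) := by
  have comm3 : ∀ (f : R) (a b : R ⊗[ℂ] Fib n), a * ((f ⊗ₜ[ℂ] (1 : Fib n)) * b) =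
      (f ⊗ₜ[ℂ] (1 : Fib n)) * (a * b) := by
    intro f a b; rw [← mul_assoc, ← coef_mul_comm, mul_assoc]
  set T := frameChange P G with hT
  set c : R → R ⊗[ℂ] Fib n := fun f => f ⊗ₜ[ℂ] (1 : Fib n) with hc
  have hcm : ∀ f g, c f * c g = c (f * g) := by intro f g; simp [hc]
  have hcs : ∀ (s : Finset (Fin n)) (u : Fin n → R), ∑ i ∈ s, c (u i) = c (∑ i ∈ s, u i) := by
    intro s u; simp [hc, TensorProduct.sum_tmul]
  set W : Fin n → Fin n → R ⊗[ℂ] Fib n := fun i k =>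
    locDer (δ i) (frameLin P G (0, Pi.single k 1)) with hW
  have hWmem : ∀ i k, W i k ∈ LinearMap.range ((ExteriorAlgebra.ι ℂ :
      ((Fin n → ℂ) × (Fin n → ℂ)) →ₗ[ℂ] Fib n).lTensor R) := by
    intro i k
    rw [hW]; dsimp only
    rw [frameLin_zero_single, map_sum]
    exact Submodule.sum_mem _ fun l _ => ⟨δ i (G k l) ⊗ₜ (0, Pi.single l 1), rfl⟩
  have hWsym : ∀ j k, ∑ i, c (G j i) * W i k = ∑ i, c (G k i) * W i j := by
    intro j k
    have : ∀ j k, ∑ i, c (G j i) * W i k = ∑ l, (∑ i, G j i * δ i (G k l)) ⊗ₜ[ℂ] (theta l : Fib n) := by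
      intro j k
      simp only [hW, hc, frameLin_zero_single, map_sum, Finset.mul_sum, TensorProduct.sum_tmul]
      rw [Finset.sum_comm]
      refine Finset.sum_congr rfl fun l _ => Finset.sum_congr rfl fun i _ => ?_
      have : locDer (δ i) (G k l ⊗ₜ[ℂ] (theta l : Fib n)) = δ i (G k l) ⊗ₜ theta l := rfl
      rw [this, Algebra.TensorProduct.tmul_mul_tmul, one_mul]
    rw [this, this]
    simp only [h6 j k]
  have hD : ∀ i a, locDer (δ i) (T a) = ∑ j, c (J i j) * T (locDer (δ' j) a)
      + ∑ k, W i k * T (locTheta k a) := fun i a =>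
    locDer_frameChange P G (δ i) δ' (J i) (fun j l => h7 j l i) (h1 i) a
  have hΘ : ∀ i a, locTheta i (T a) = ∑ j, c (G j i) * T (locTheta j a) := fun i a =>
    locTheta_frameChange P G i a
  have hS : ∀ a, locSgn (T a) = T (locSgn a) := frameChange_locSgn P G
  have hSc : ∀ f, locSgn (c f) = c f := locSgn_coef
  have main : ∀ U V : Fin n → R ⊗[ℂ] Fib n,
      ∑ i, (∑ j, c (G j i) * U j) * (∑ k, c (J i k) * V k) = ∑ j, U j * V j := by
    intro U V
    calc ∑ i, (∑ j, c (G j i) * U j) * (∑ k, c (J i k) * V k)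
        = ∑ i, ∑ j, ∑ k, c (G j i * J i k) * (U j * V k) := by
          refine Finset.sum_congr rfl fun i _ => ?_
          rw [Finset.sum_mul]
          refine Finset.sum_congr rfl fun j _ => ?_
          rw [Finset.mul_sum]
          refine Finset.sum_congr rfl fun k _ => ?_
          rw [mul_assoc, comm3, ← mul_assoc, hcm]
      _ = ∑ j, ∑ k, c (∑ i, G j i * J i k) * (U j * V k) := by
          rw [Finset.sum_comm]
          refine Finset.sum_congr rfl fun j _ => ?_
          rw [Finset.sum_comm]
          refine Finset.sum_congr rfl fun k _ => ?_
          rw [← Finset.sum_mul, hcs]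
      _ = ∑ j, U j * V j := by
          refine Finset.sum_congr rfl fun j _ => ?_
          rw [Finset.sum_eq_single j]
          · rw [h3, if_pos rfl]; simp [hc, ← Algebra.TensorProduct.one_def]
          · intro k _ hk; rw [h3, if_neg (Ne.symm hk)]; simp [hc]
          · simp
  have main' : ∀ U V : Fin n → R ⊗[ℂ] Fib n,
      ∑ i, (∑ k, c (J i k) * V k) * (∑ j, c (G j i) * U j) = ∑ j, V j * U j := by
    intro U V
    calc ∑ i, (∑ k, c (J i k) * V k) * (∑ j, c (G j i) * U j)
        = ∑ i, ∑ j, ∑ k, c (G j i * J i k) * (V k * U j) := by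
          refine Finset.sum_congr rfl fun i _ => ?_
          rw [Finset.mul_sum]
          refine Finset.sum_congr rfl fun j _ => ?_
          rw [Finset.sum_mul]
          refine Finset.sum_congr rfl fun k _ => ?_
          rw [comm3, mul_assoc, ← mul_assoc, hcm]
      _ = ∑ j, ∑ k, c (∑ i, G j i * J i k) * (V k * U j) := by
          rw [Finset.sum_comm]
          refine Finset.sum_congr rfl fun j _ => ?_
          rw [Finset.sum_comm]
          refine Finset.sum_congr rfl fun k _ => ?_
          rw [← Finset.sum_mul, hcs]
      _ = ∑ j, V j * U j := by
          refine Finset.sum_congr rfl fun j _ => ?_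
          rw [Finset.sum_eq_single j]
          · rw [h3, if_pos rfl]; simp [hc, ← Algebra.TensorProduct.one_def]
          · intro k _ hk; rw [h3, if_neg (Ne.symm hk)]; simp [hc]
          · simp
  have err : ∑ i, (∑ j, c (G j i) * T (locSgn (locTheta j x))) * (∑ k, W i k * T (locTheta k y))
      = ∑ i, (∑ k, W i k * T (locTheta k x)) * (∑ j, c (G j i) * T (locTheta j y)) := by
    have hA : ∀ j k i, c (G j i) * T (locSgn (locTheta j x)) * (W i k * T (locTheta k y)) =
        (c (G j i) * W i k) * (T (locTheta j x) * T (locTheta k y)) := by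
      intro j k i
      have : T (locSgn (locTheta j x)) * W i k = W i k * T (locTheta j x) := by
        rw [(lin_mul (hWmem i k)).2, hS]
      rw [mul_assoc, ← mul_assoc (T (locSgn (locTheta j x))), this, mul_assoc, mul_assoc]
    have hB : ∀ j k i, W i k * T (locTheta k x) * (c (G j i) * T (locTheta j y)) =
        (c (G j i) * W i k) * (T (locTheta k x) * T (locTheta j y)) := by
      intro j k i
      rw [hc] at *
      rw [comm3]; simp only [mul_assoc]
    have hsum : ∀ A : Fin n → Fin n → Fin n → R ⊗[ℂ] Fib n,
        ∑ i, ∑ j, ∑ k, A i j k = ∑ j, ∑ k, ∑ i, A i j k := by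
      intro A
      rw [Finset.sum_comm]
      exact Finset.sum_congr rfl fun j _ => Finset.sum_comm
    simp only [Finset.sum_mul_sum, hA, hB]
    refine (hsum _).trans (Eq.trans ?_ (hsum _).symm)
    refine Finset.sum_congr rfl fun k _ => Finset.sum_congr rfl fun j _ => ?_
    rw [← Finset.sum_mul, ← Finset.sum_mul, hWsym]
  rw [locBracket_apply, locBracket_apply, map_sum]
  have e1 : ∀ i, locSgn (locTheta i (T x)) * locDer (δ i) (T y)
      - locDer (δ i) (T x) * locTheta i (T y) =
      (∑ j, c (G j i) * T (locSgn (locTheta j x))) * (∑ k, c (J i k) * T (locDer (δ' k) y))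
      - (∑ k, c (J i k) * T (locDer (δ' k) x)) * (∑ j, c (G j i) * T (locTheta j y))
      + ((∑ j, c (G j i) * T (locSgn (locTheta j x))) * (∑ k, W i k * T (locTheta k y))
      - (∑ k, W i k * T (locTheta k x)) * (∑ j, c (G j i) * T (locTheta j y))) := by
    intro i
    have : locSgn (locTheta i (T x)) = ∑ j, c (G j i) * T (locSgn (locTheta j x)) := by
      rw [hΘ, map_sum]
      simp only [map_mul, hS, hSc]
    rw [this, hΘ, hD, hD, mul_add, add_mul]
    abel
  simp only [e1, Finset.sum_add_distrib, Finset.sum_sub_distrib]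
  rw [main, main', err, sub_self, add_zero, ← Finset.sum_sub_distrib]
  simp only [map_sub, map_mul]

end Algebra
end PolyForm

namespace PolyForm

section Grading
variable {R : Type*} [CommRing R] [Algebra ℂ R] {n : ℕ}

/-- Projection of the fibre to `⋀^k`. -/
noncomputable def fibProj (k : ℕ) : Fib n →ₗ[ℂ] Fib n :=
  GradedAlgebra.proj (fun i : ℕ => ⋀[ℂ]^i ((Fin n → ℂ) × (Fin n → ℂ))) k

theorem ι_mem (v : (Fin n → ℂ) × (Fin n → ℂ)) :
    ExteriorAlgebra.ι ℂ v ∈ ⋀[ℂ]^1 ((Fin n → ℂ) × (Fin n → ℂ)) := by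
  unfold ExteriorAlgebra.exteriorPower; rw [pow_one]; exact ⟨v, rfl⟩

theorem fibProj_one (k : ℕ) : fibProj k (1 : Fib n) = if k = 0 then 1 else 0 := by
  have h : (1 : Fib n) ∈ ⋀[ℂ]^0 ((Fin n → ℂ) × (Fin n → ℂ)) := by
    unfold ExteriorAlgebra.exteriorPower; rw [pow_zero]; exact Submodule.one_le.1 le_rfl
  split_ifs with hk
  · subst hk
    exact DirectSum.decompose_of_mem_same (fun i : ℕ => ⋀[ℂ]^i ((Fin n → ℂ) × (Fin n → ℂ))) h
  · exact DirectSum.decompose_of_mem_ne (fun i : ℕ => ⋀[ℂ]^i ((Fin n → ℂ) × (Fin n → ℂ))) h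
      (Ne.symm hk)

theorem fibProj_succ (k : ℕ) (v : (Fin n → ℂ) × (Fin n → ℂ)) (l : Fib n) :
    fibProj (k + 1) (ExteriorAlgebra.ι ℂ v * l) = ExteriorAlgebra.ι ℂ v * fibProj k l := by
  rw [add_comm]
  exact DirectSum.coe_decompose_mul_add_of_left_mem
    (fun i : ℕ => ⋀[ℂ]^i ((Fin n → ℂ) × (Fin n → ℂ))) (ι_mem v)

theorem fibProj_zero (v : (Fin n → ℂ) × (Fin n → ℂ)) (l : Fib n) :
    fibProj 0 (ExteriorAlgebra.ι ℂ v * l) = 0 :=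
  DirectSum.coe_decompose_mul_of_left_mem_of_not_le
    (fun i : ℕ => ⋀[ℂ]^i ((Fin n → ℂ) × (Fin n → ℂ))) (ι_mem v) (by simp)

theorem fibProj_sum (l : Fib n) : ∑ k ∈ Finset.range (2 * n + 1), fibProj k l = l := by
  induction l using DirectSum.Decomposition.inductionOn
    (fun i : ℕ => ⋀[ℂ]^i ((Fin n → ℂ) × (Fin n → ℂ))) with
  | zero => simp
  | add x y hx hy => simp only [map_add, Finset.sum_add_distrib, hx, hy]
  | @homogeneous i x =>
    by_cases hi : i < 2 * n + 1
    · rw [Finset.sum_eq_single i]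
      · exact DirectSum.decompose_of_mem_same
          (fun i : ℕ => ⋀[ℂ]^i ((Fin n → ℂ) × (Fin n → ℂ))) x.2
      · intro j _ hj
        exact DirectSum.decompose_of_mem_ne
          (fun i : ℕ => ⋀[ℂ]^i ((Fin n → ℂ) × (Fin n → ℂ))) x.2 (Ne.symm hj)
      · intro h; exact absurd (Finset.mem_range.2 hi) h
    · have h0 : Module.finrank ℂ (⋀[ℂ]^i ((Fin n → ℂ) × (Fin n → ℂ))) = 0 := by
        rw [exteriorPower.finrank_eq]
        apply Nat.choose_eq_zero_of_lt
        simp; omega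
      have : Subsingleton (⋀[ℂ]^i ((Fin n → ℂ) × (Fin n → ℂ))) :=
        Module.finrank_zero_iff.1 h0
      rw [Subsingleton.elim x 0]; simp

/-- Projection of local forms to the part of total degree `k`. -/
noncomputable def locProj (k : ℕ) : R ⊗[ℂ] Fib n →ₗ[ℂ] R ⊗[ℂ] Fib n := (fibProj k).lTensor R

theorem locProj_coef (k : ℕ) (f : R) :
    locProj k (f ⊗ₜ[ℂ] (1 : Fib n)) = if k = 0 then f ⊗ₜ 1 else 0 := by
  simp only [locProj, LinearMap.lTensor_tmul, fibProj_one]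
  split_ifs <;> simp

theorem locProj_succ (k : ℕ) {w : R ⊗[ℂ] Fib n}
    (hw : w ∈ LinearMap.range ((ExteriorAlgebra.ι ℂ :
      ((Fin n → ℂ) × (Fin n → ℂ)) →ₗ[ℂ] Fib n).lTensor R)) (a : R ⊗[ℂ] Fib n) :
    locProj (k + 1) (w * a) = w * locProj k a := by
  obtain ⟨t, rfl⟩ := hw
  induction t using TensorProduct.induction_on with
  | zero => simp
  | add x y hx hy => simp only [map_add, add_mul, hx, hy]
  | tmul f v =>
    induction a using TensorProduct.induction_on with
    | zero => simp
    | add x y hx hy => simp only [map_add, mul_add, hx, hy]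
    | tmul g l => simp [locProj, fibProj_succ]

theorem locProj_zero {w : R ⊗[ℂ] Fib n}
    (hw : w ∈ LinearMap.range ((ExteriorAlgebra.ι ℂ :
      ((Fin n → ℂ) × (Fin n → ℂ)) →ₗ[ℂ] Fib n).lTensor R)) (a : R ⊗[ℂ] Fib n) :
    locProj 0 (w * a) = 0 := by
  obtain ⟨t, rfl⟩ := hw
  induction t using TensorProduct.induction_on with
  | zero => simp
  | add x y hx hy => simp only [map_add, add_mul, hx, hy, add_zero]
  | tmul f v =>
    induction a using TensorProduct.induction_on with
    | zero => simp
    | add x y hx hy => simp only [map_add, mul_add, hx, hy, add_zero]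
    | tmul g l => simp [locProj, fibProj_zero]

theorem gen_mem (v : (Fin n → ℂ) × (Fin n → ℂ)) :
    (1 : R) ⊗ₜ[ℂ] ExteriorAlgebra.ι ℂ v ∈ LinearMap.range ((ExteriorAlgebra.ι ℂ :
      ((Fin n → ℂ) × (Fin n → ℂ)) →ₗ[ℂ] Fib n).lTensor R) := ⟨1 ⊗ₜ v, rfl⟩

theorem locProj_sum (a : R ⊗[ℂ] Fib n) : ∑ k ∈ Finset.range (2 * n + 1), locProj k a = a := by
  induction a using TensorProduct.induction_on with
  | zero => simp
  | add x y hx hy => simp only [map_add, Finset.sum_add_distrib, hx, hy]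
  | tmul f l =>
    simp only [locProj, LinearMap.lTensor_tmul, ← TensorProduct.tmul_sum, fibProj_sum]

theorem locProj_locProj (j k : ℕ) (a : R ⊗[ℂ] Fib n) :
    locProj j (locProj k a) = if j = k then locProj k a else 0 := by
  induction a using loc_induction generalizing j k with
  | coef f =>
    rw [locProj_coef]
    by_cases hk : k = 0
    · subst hk; rw [if_pos rfl, locProj_coef]
    · simp [hk]
  | mul v a h =>
    cases k with
    | zero => simp [locProj_zero (gen_mem v)]
    | succ k =>
      rw [locProj_succ k (gen_mem v)]
      cases j with
      | zero => simp [locProj_zero (gen_mem v)]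
      | succ j =>
        rw [locProj_succ j (gen_mem v), h]
        by_cases hjk : j = k <;> simp [hjk]
  | add x y hx hy => simp only [map_add, hx, hy]; split_ifs <;> simp

theorem frameChange_locProj (P G : Fin n → Fin n → R) (k : ℕ) (a : R ⊗[ℂ] Fib n) :
    locProj k (frameChange P G a) = frameChange P G (locProj k a) := by
  induction a using loc_induction generalizing k with
  | coef f => rw [frameChange_coef, locProj_coef]; split_ifs <;> simp [frameChange_coef]
  | mul v a h =>
    rw [map_mul, frameChange_gen]
    cases k with
    | zero => simp [locProj_zero (gen_mem v), locProj_zero (frameLin_mem P G v)]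
    | succ k =>
      rw [locProj_succ k (gen_mem v), locProj_succ k (frameLin_mem P G v), h, map_mul,
        frameChange_gen]
  | add x y hx hy => simp only [map_add, hx, hy]

theorem locSgn_locProj (k : ℕ) (a : R ⊗[ℂ] Fib n) :
    locSgn (locProj k a) = (-1 : ℂ) ^ k • locProj k a := by
  induction a using loc_induction generalizing k with
  | coef f => rw [locProj_coef]; split_ifs with h <;> simp [h, locSgn_coef]
  | mul v a h =>
    cases k with
    | zero => simp [locProj_zero (gen_mem v)]
    | succ k => rw [locProj_succ k (gen_mem v), map_mul, h, locSgn_gen]; simp [pow_succ]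
  | add x y hx hy => simp only [map_add, hx, hy, smul_add]

theorem locDer_locProj (δ : Derivation ℂ R R) (k : ℕ) (a : R ⊗[ℂ] Fib n) :
    locDer δ (locProj k a) = locProj k (locDer δ a) := by
  induction a using TensorProduct.induction_on with
  | zero => simp
  | add x y hx hy => simp only [map_add, hx, hy]
  | tmul f l => rfl

theorem locDbar_locProj (δ : Fin n → Derivation ℂ R R) (k : ℕ) (a : R ⊗[ℂ] Fib n) :
    locProj (k + 1) (locDbar δ a) = locDbar δ (locProj k a) := by
  rw [locDbar_apply, locDbar_apply, map_sum]
  refine Finset.sum_congr rfl fun i _ => ?_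
  rw [locDer_locProj]
  exact locProj_succ k (gen_mem _) _

theorem locDbar_locProj_zero (δ : Fin n → Derivation ℂ R R) (a : R ⊗[ℂ] Fib n) :
    locProj 0 (locDbar δ a) = 0 := by
  rw [locDbar_apply, map_sum]
  exact Finset.sum_eq_zero fun i _ => locProj_zero (gen_mem _) _

theorem locTheta_locSgn (i : Fin n) (a : R ⊗[ℂ] Fib n) :
    locTheta i (locSgn a) = - locSgn (locTheta i a) := by
  induction a using loc_induction with
  | coef f => simp [locSgn_coef, locTheta_coef]
  | mul v a h =>
    rw [map_mul, locSgn_gen, neg_mul, map_neg, locTheta_gen_mul, locTheta_gen_mul, h]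
    simp [locSgn_gen]
  | add x y hx hy => simp only [map_add, hx, hy]; abel

theorem locDer_locSgn (δ : Derivation ℂ R R) (a : R ⊗[ℂ] Fib n) :
    locDer δ (locSgn a) = locSgn (locDer δ a) := by
  induction a using TensorProduct.induction_on with
  | zero => simp
  | add x y hx hy => simp only [map_add, hx, hy]
  | tmul f l => rfl

theorem locBracket_symm (δ : Fin n → Derivation ℂ R R) (p q : ℕ) (x y : R ⊗[ℂ] Fib n)
    (hx : locSgn x = (-1 : ℂ) ^ p • x) (hy : locSgn y = (-1 : ℂ) ^ q • y) :
    locBracket δ (locSgn x) y = (-1 : ℂ) ^ (p * q) • locBracket δ (locSgn y) x := by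
  have par : ∀ (r : ℕ) (z : R ⊗[ℂ] Fib n), locSgn z = (-1 : ℂ) ^ r • z → ∀ i,
      locSgn (locTheta i z) = (-1 : ℂ) ^ (r + 1) • locTheta i z ∧
      locSgn (locDer (δ i) z) = (-1 : ℂ) ^ r • locDer (δ i) z := by
    intro r z hz i
    constructor
    · have := locTheta_locSgn i z
      rw [hz, map_smul] at this
      rw [pow_succ, mul_neg_one, neg_smul, this, neg_neg]
    · rw [← locDer_locSgn, hz, map_smul]
  rw [locBracket_apply, locBracket_apply, Finset.smul_sum]
  refine Finset.sum_congr rfl fun i _ => ?_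
  have e1 := loc_mul_comm _ _ _ _ (par q y hy i).1 (par p x hx i).2
  have e2 := loc_mul_comm _ _ _ _ (par q y hy i).2 (par p x hx i).1
  rw [locTheta_locSgn, locTheta_locSgn, map_neg, map_neg, locSgn_locSgn, locSgn_locSgn, hx, hy,
    map_smul, map_smul, neg_mul, neg_mul, smul_mul_assoc, smul_mul_assoc, e1, e2]
  rcases Nat.even_or_odd p with hp | hp <;> rcases Nat.even_or_odd q with hq | hq <;>
    simp [hp.neg_one_pow, hq.neg_one_pow, pow_mul, pow_succ] <;> abel

end Grading

section Naturality
variable {R S : Type*} [CommRing R] [Algebra ℂ R] [CommRing S] [Algebra ℂ S] {n : ℕ} (r : R →ₐ[ℂ] S)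

/-- Change of coefficients. -/
noncomputable def baseMap : R ⊗[ℂ] Fib n →ₐ[ℂ] S ⊗[ℂ] Fib n :=
  Algebra.TensorProduct.map r (AlgHom.id ℂ _)

theorem baseMap_locSgn (a : R ⊗[ℂ] Fib n) : baseMap r (locSgn a) = locSgn (baseMap r a) := by
  induction a using TensorProduct.induction_on with
  | zero => simp
  | add x y hx hy => simp only [map_add, hx, hy]
  | tmul f l => rfl

theorem baseMap_locProj (k : ℕ) (a : R ⊗[ℂ] Fib n) :
    baseMap r (locProj k a) = locProj k (baseMap r a) := by
  induction a using TensorProduct.induction_on with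
  | zero => simp
  | add x y hx hy => simp only [map_add, hx, hy]
  | tmul f l => rfl

theorem baseMap_locTheta (i : Fin n) (a : R ⊗[ℂ] Fib n) :
    baseMap r (locTheta i a) = locTheta i (baseMap r a) := by
  induction a using TensorProduct.induction_on with
  | zero => simp
  | add x y hx hy => simp only [map_add, hx, hy]
  | tmul f l => rfl

variable {r} in
theorem baseMap_locDer {δ : Derivation ℂ R R} {δ' : Derivation ℂ S S} (h : ∀ f, r (δ f) = δ' (r f))
    (a : R ⊗[ℂ] Fib n) : baseMap r (locDer δ a) = locDer δ' (baseMap r a) := by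
  induction a using TensorProduct.induction_on with
  | zero => simp
  | add x y hx hy => simp only [map_add, hx, hy]
  | tmul f l => exact congrArg (fun g => g ⊗ₜ[ℂ] l) (h f)

variable {r} in
theorem baseMap_locDbar {δ : Fin n → Derivation ℂ R R} {δ' : Fin n → Derivation ℂ S S}
    (h : ∀ i f, r (δ i f) = δ' i (r f)) (a : R ⊗[ℂ] Fib n) :
    baseMap r (locDbar δ a) = locDbar δ' (baseMap r a) := by
  rw [locDbar_apply, locDbar_apply, map_sum]
  refine Finset.sum_congr rfl fun i _ => ?_
  rw [map_mul, baseMap_locDer (h i)]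
  simp [baseMap]

variable {r} in
theorem baseMap_locBracket {δ : Fin n → Derivation ℂ R R} {δ' : Fin n → Derivation ℂ S S}
    (h : ∀ i f, r (δ i f) = δ' i (r f)) (a b : R ⊗[ℂ] Fib n) :
    baseMap r (locBracket δ a b) = locBracket δ' (baseMap r a) (baseMap r b) := by
  rw [locBracket_apply, locBracket_apply, map_sum]
  refine Finset.sum_congr rfl fun i _ => ?_
  rw [map_sub, map_mul, map_mul, baseMap_locDer (h i), baseMap_locDer (h i), baseMap_locSgn,
    baseMap_locTheta, baseMap_locTheta]

end Naturality
end PolyForm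

namespace PolyForm

section Geometry
variable {n : ℕ} {M : Type*} [TopologicalSpace M] [ChartedSpace (Fin n → ℂ) M]

open Classical in
/-- Extension by zero. -/
noncomputable def extz (W : TopologicalSpace.Opens M) (f : W → ℂ) : M → ℂ :=
  fun x => if h : x ∈ W then f ⟨x, h⟩ else 0

theorem extz_of_mem {W : TopologicalSpace.Opens M} (f : W → ℂ) {x : M} (h : x ∈ W) :
    extz W f x = f ⟨x, h⟩ := dif_pos h

variable (n) in
/-- The algebra of smooth complex functions on the open set `W`, for the underlying real manifold. -/
def smoothSub (W : TopologicalSpace.Opens M) : Subalgebra ℂ (W → ℂ) where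
  carrier := {f | ContMDiffOn 𝓘(ℝ, Fin n → ℂ) 𝓘(ℝ, ℂ) ∞ (extz W f) W}
  mul_mem' {f g} hf hg := by
    refine (ContMDiffOn.congr (f := fun x => (extz W f x) * (extz W g x)) ?_ ?_)
    · exact ContMDiff.comp_contMDiffOn (ContDiff.contMDiff (contDiff_mul (𝕜 := ℝ) (𝔸 := ℂ))) (hf.prodMk_space hg)
    · intro x hx; simp [extz_of_mem _ hx]
  add_mem' {f g} hf hg := by
    refine (ContMDiffOn.congr (f := fun x => (extz W f x) + (extz W g x)) ?_ ?_)
    · exact ContMDiff.comp_contMDiffOn (ContDiff.contMDiff (contDiff_add (𝕜 := ℝ) (F := ℂ))) (hf.prodMk_space hg)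
    · intro x hx; simp [extz_of_mem _ hx]
  algebraMap_mem' c := by
    refine (ContMDiffOn.congr (f := fun _ => c) contMDiffOn_const ?_)
    intro x hx; simp [extz_of_mem _ hx]

variable (n) in
/-- Smooth complex functions on the open set `W`. -/
def SmoothFun (W : TopologicalSpace.Opens M) : Type _ := smoothSub n W

instance (W : TopologicalSpace.Opens M) : CommRing (SmoothFun n W) :=
  inferInstanceAs (CommRing (smoothSub n W))

instance (W : TopologicalSpace.Opens M) : Algebra ℂ (SmoothFun n W) :=
  inferInstanceAs (Algebra ℂ (smoothSub n W))

/-- Evaluation at a point. -/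
def evalAt {W : TopologicalSpace.Opens M} (x : W) : SmoothFun n W →ₐ[ℂ] ℂ where
  toFun f := f.1 x
  map_one' := rfl
  map_mul' _ _ := rfl
  map_zero' := rfl
  map_add' _ _ := rfl
  commutes' _ := rfl

theorem contDiffGroupoid_mem {f : OpenPartialHomeomorph (Fin n → ℂ) (Fin n → ℂ)}
    (hf : f ∈ contDiffGroupoid ω 𝓘(ℂ, Fin n → ℂ)) : ContDiffOn ℂ ω f f.source := by
  rw [contDiffGroupoid, mem_groupoid_of_pregroupoid] at hf
  simpa [contDiffPregroupoid] using hf.1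

theorem realManifold [IsManifold 𝓘(ℂ, Fin n → ℂ) ω M] : IsManifold 𝓘(ℝ, Fin n → ℂ) ∞ M := by
  refine isManifold_of_contDiffOn _ _ _ fun e e' he he' => ?_
  have h := (contDiffGroupoid_mem (HasGroupoid.compatible (G := contDiffGroupoid ω 𝓘(ℂ, Fin n → ℂ)) he he'))
  have h2 := (h.of_le (m := ∞) (by simp)).restrict_scalars ℝ
  simpa using h2

theorem smooth_iff [IsManifold 𝓘(ℂ, Fin n → ℂ) ω M] {e : OpenPartialHomeomorph M (Fin n → ℂ)}
    (he : e ∈ atlas (Fin n → ℂ) M) {W : TopologicalSpace.Opens M} (hW : (W : Set M) ⊆ e.source)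
    (g : M → ℂ) :
    ContMDiffOn 𝓘(ℝ, Fin n → ℂ) 𝓘(ℝ, ℂ) ∞ g W ↔
      ∀ x ∈ W, ContDiffAt ℝ ∞ (g ∘ e.symm) (e x) := by
  have : IsManifold 𝓘(ℝ, Fin n → ℂ) ∞ M := realManifold
  have he' : e ∈ IsManifold.maximalAtlas 𝓘(ℝ, Fin n → ℂ) ∞ M :=
    IsManifold.subset_maximalAtlas he
  rw [contMDiffOn_iff_of_mem_maximalAtlas' he' (e' := OpenPartialHomeomorph.refl ℂ)
    (by exact IsManifold.subset_maximalAtlas (by simp)) hW (by simp [Set.MapsTo])]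
  have himg : IsOpen (e '' W) := e.isOpen_image_of_subset_source W.isOpen hW
  have : (e.extend 𝓘(ℝ, Fin n → ℂ) '' (W : Set M)) = e '' W := by simp
  rw [this]
  constructor
  · intro h x hx
    have := (h.contDiffAt (himg.mem_nhds ⟨x, hx, rfl⟩))
    simpa using this
  · rintro h _ ⟨x, hx, rfl⟩
    have := (h x hx).contDiffWithinAt (s := e '' W)
    simpa using this

/-- Real directional derivative in the coordinates of the chart `e`. -/
noncomputable def pd (e : OpenPartialHomeomorph M (Fin n → ℂ)) (v : Fin n → ℂ) (f : M → ℂ) (x : M) : ℂ :=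
  fderiv ℝ (f ∘ e.symm) (e x) v

/-- `∂g/∂z_i` in the coordinates of the chart `e`. -/
noncomputable def wirt (e : OpenPartialHomeomorph M (Fin n → ℂ)) (i : Fin n) (f : M → ℂ) (x : M) : ℂ :=
  (1 / 2) * (pd e (Pi.single i 1) f x - Complex.I * pd e (Pi.single i Complex.I) f x)

/-- points near `e x` come from points of `W` -/
theorem near {e : OpenPartialHomeomorph M (Fin n → ℂ)}
    {W : TopologicalSpace.Opens M} (hW : (W : Set M) ⊆ e.source) {x : M} (hx : x ∈ W) :
    ∀ᶠ z in nhds (e x), e.symm z ∈ W ∧ e (e.symm z) = z := by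
  have himg : IsOpen (e '' W) := e.isOpen_image_of_subset_source W.isOpen hW
  filter_upwards [himg.mem_nhds ⟨x, hx, rfl⟩]
  rintro _ ⟨y, hy, rfl⟩
  rw [e.left_inv (hW hy)]
  exact ⟨hy, rfl⟩

theorem contDiffAt_pd {e : OpenPartialHomeomorph M (Fin n → ℂ)}
    {W : TopologicalSpace.Opens M} (hW : (W : Set M) ⊆ e.source) {g : M → ℂ}
    {x : M} (hx : x ∈ W) (hg : ContDiffAt ℝ ∞ (g ∘ e.symm) (e x)) (v : Fin n → ℂ) :
    ContDiffAt ℝ ∞ (pd e v g ∘ e.symm) (e x) := by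
  have h1 : ContDiffAt ℝ ∞ (fun z => fderiv ℝ (g ∘ e.symm) z v) (e x) :=
    (hg.fderiv_right (m := ∞) (by simp)).clm_apply contDiffAt_const
  refine h1.congr_of_eventuallyEq ?_
  filter_upwards [near hW hx] with z hz
  simp [pd, hz.2]

theorem pd_congr {e : OpenPartialHomeomorph M (Fin n → ℂ)}
    {W : TopologicalSpace.Opens M} (hW : (W : Set M) ⊆ e.source) {g h : M → ℂ}
    (hgh : ∀ x ∈ W, g x = h x) {x : M} (hx : x ∈ W) (v : Fin n → ℂ) : pd e v g x = pd e v h x := by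
  have : g ∘ e.symm =ᶠ[nhds (e x)] h ∘ e.symm := by
    filter_upwards [near hW hx] with z hz using hgh _ hz.1
  simp [pd, this.fderiv_eq]

variable [IsManifold 𝓘(ℂ, Fin n → ℂ) ω M]

/-- Real directional derivatives as derivations of smooth functions. -/
noncomputable def pdDer (e : atlas (Fin n → ℂ) M) {W : TopologicalSpace.Opens M}
    (hW : (W : Set M) ⊆ e.1.source) (v : Fin n → ℂ) :
    Derivation ℂ (SmoothFun n W) (SmoothFun n W) :=
  have hs : ∀ f : SmoothFun n W, ∀ x ∈ W, ContDiffAt ℝ ∞ (extz W f.1 ∘ e.1.symm) (e.1 x) :=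
    fun f => (smooth_iff e.2 hW _).1 f.2
  have hd : ∀ f : SmoothFun n W, ∀ x ∈ W, DifferentiableAt ℝ (extz W f.1 ∘ e.1.symm) (e.1 x) :=
    fun f x hx => (hs f x hx).differentiableAt (by simp)
  Derivation.mk'
    { toFun := fun f => ⟨fun x => pd e.1 v (extz W f.1) x.1, by
        change ContMDiffOn _ _ _ _ _
        refine (smooth_iff e.2 hW _).2 fun x hx => ?_
        refine (contDiffAt_pd hW hx (hs f x hx) v).congr_of_eventuallyEq ?_
        filter_upwards [near hW hx] with z hz
        simp [extz_of_mem _ hz.1]⟩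
      map_add' := fun f g => by
        refine Subtype.ext (funext fun x => ?_)
        have : pd e.1 v (extz W (f + g).1) x.1 = pd e.1 v (fun y => extz W f.1 y + extz W g.1 y) x :=
          pd_congr hW (fun y hy => by simp [extz_of_mem _ hy]; rfl) x.2 v
        simp only [this]
        exact congrArg (fun L => L v) (fderiv_fun_add (hd f x x.2) (hd g x x.2))
      map_smul' := fun c f => by
        refine Subtype.ext (funext fun x => ?_)
        have : pd e.1 v (extz W (c • f).1) x.1 = pd e.1 v (fun y => c • extz W f.1 y) x :=
          pd_congr hW (fun y hy => by simp [extz_of_mem _ hy]; rfl) x.2 v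
        simp only [this]
        exact congrArg (fun L => L v) (fderiv_fun_const_smul (hd f x x.2) c) }
    (fun f g => by
      refine Subtype.ext (funext fun x => ?_)
      have : pd e.1 v (extz W (f * g).1) x.1 = pd e.1 v (fun y => extz W f.1 y * extz W g.1 y) x :=
        pd_congr hW (fun y hy => by simp [extz_of_mem _ hy]; rfl) x.2 v
      have h2 := congrArg (fun L => L v) (fderiv_fun_mul (hd f x x.2) (hd g x x.2))
      have hx : e.1.symm (e.1 x) = x := e.1.left_inv (hW x.2)
      have h3 : pd e.1 v (extz W (f * g).1) x.1 =
        f.1 x * pd e.1 v (extz W g.1) x + g.1 x * pd e.1 v (extz W f.1) x := by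
        rw [this]
        refine Eq.trans h2 ?_
        simp [hx, extz_of_mem _ x.2, pd]
      exact h3)

/-- The derivation `∂/∂z_i` in the coordinates of the chart `e`. -/
noncomputable def dz (e : atlas (Fin n → ℂ) M) {W : TopologicalSpace.Opens M}
    (hW : (W : Set M) ⊆ e.1.source) (i : Fin n) :
    Derivation ℂ (SmoothFun n W) (SmoothFun n W) :=
  (1 / 2 : ℂ) • (pdDer e hW (Pi.single i 1) - Complex.I • pdDer e hW (Pi.single i Complex.I))

/-- The derivation `∂/∂z̄_i` in the coordinates of the chart `e`. -/
noncomputable def dzbar (e : atlas (Fin n → ℂ) M) {W : TopologicalSpace.Opens M}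
    (hW : (W : Set M) ⊆ e.1.source) (i : Fin n) :
    Derivation ℂ (SmoothFun n W) (SmoothFun n W) :=
  (1 / 2 : ℂ) • (pdDer e hW (Pi.single i 1) + Complex.I • pdDer e hW (Pi.single i Complex.I))

theorem pdDer_apply (e : atlas (Fin n → ℂ) M) {W : TopologicalSpace.Opens M}
    (hW : (W : Set M) ⊆ e.1.source) (v : Fin n → ℂ) (f : SmoothFun n W) (x : W) :
    (pdDer e hW v f).1 x = fderiv ℝ (extz W f.1 ∘ e.1.symm) (e.1 x) v := rfl

/-- The coordinate function `z_i`. -/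
noncomputable def coordFun (e : atlas (Fin n → ℂ) M) {W : TopologicalSpace.Opens M}
    (hW : (W : Set M) ⊆ e.1.source) (i : Fin n) : SmoothFun n W :=
  ⟨fun x => e.1 x.1 i, by
    change ContMDiffOn _ _ _ _ _
    refine (smooth_iff e.2 hW _).2 fun x hx => ?_
    have : ContDiffAt ℝ ∞ (fun z : Fin n → ℂ => z i) (e.1 x) := by fun_prop
    refine this.congr_of_eventuallyEq ?_
    filter_upwards [near hW hx] with z hz
    simp [extz_of_mem _ hz.1, hz.2]⟩

/-- The conjugate coordinate function `z̄_i`. -/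
noncomputable def conjCoordFun (e : atlas (Fin n → ℂ) M) {W : TopologicalSpace.Opens M}
    (hW : (W : Set M) ⊆ e.1.source) (i : Fin n) : SmoothFun n W :=
  ⟨fun x => (starRingEnd ℂ) (e.1 x.1 i), by
    change ContMDiffOn _ _ _ _ _
    refine (smooth_iff e.2 hW _).2 fun x hx => ?_
    have : ContDiffAt ℝ ∞ (fun z : Fin n → ℂ => Complex.conjCLE (z i)) (e.1 x) :=
      Complex.conjCLE.contDiff.contDiffAt.comp _ (by fun_prop)
    refine this.congr_of_eventuallyEq ?_
    filter_upwards [near hW hx] with z hz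
    simp [extz_of_mem _ hz.1, hz.2]⟩

theorem pdDer_comm (e : atlas (Fin n → ℂ) M) {W : TopologicalSpace.Opens M}
    (hW : (W : Set M) ⊆ e.1.source) (v w : Fin n → ℂ) (f : SmoothFun n W) :
    pdDer e hW v (pdDer e hW w f) = pdDer e hW w (pdDer e hW v f) := by
  have hs : ∀ x ∈ W, ContDiffAt ℝ ∞ (extz W f.1 ∘ e.1.symm) (e.1 x) :=
    (smooth_iff e.2 hW _).1 f.2
  have key : ∀ (v w : Fin n → ℂ) (x : W), (pdDer e hW v (pdDer e hW w f)).1 x =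
      fderiv ℝ (fderiv ℝ (extz W f.1 ∘ e.1.symm)) (e.1 x) v w := by
    intro v w x
    rw [pdDer_apply]
    have h1 : extz W (pdDer e hW w f).1 ∘ e.1.symm =ᶠ[nhds (e.1 x)]
        fun z => fderiv ℝ (extz W f.1 ∘ e.1.symm) z w := by
      filter_upwards [near hW x.2] with z hz
      simp [extz_of_mem _ hz.1, pdDer_apply, hz.2]
    have h2 : DifferentiableAt ℝ (fderiv ℝ (extz W f.1 ∘ e.1.symm)) (e.1 x) :=
      ((hs x x.2).fderiv_right (m := ∞) (by simp)).differentiableAt (by simp)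
    rw [h1.fderiv_eq, fderiv_clm_apply h2 (by fun_prop)]
    simp
  apply Subtype.ext; funext x
  rw [key, key]
  exact ((hs x x.2).isSymmSndFDerivAt (by
    rw [minSmoothness_of_isRCLikeNormedField]
    exact WithTop.coe_le_coe.2 (le_top : (2 : ℕ∞) ≤ ⊤))).eq v w

theorem dz_dzbar (e : atlas (Fin n → ℂ) M) {W : TopologicalSpace.Opens M}
    (hW : (W : Set M) ⊆ e.1.source) (i j : Fin n) (f : SmoothFun n W) :
    dz e hW i (dzbar e hW j f) = dzbar e hW j (dz e hW i f) := by
  simp only [dz, dzbar, Derivation.smul_apply, Derivation.add_apply, Derivation.sub_apply,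
    Derivation.map_smul, Derivation.map_add, Derivation.map_sub]
  rw [pdDer_comm e hW (Pi.single j 1) (Pi.single i 1),
    pdDer_comm e hW (Pi.single j 1) (Pi.single i Complex.I),
    pdDer_comm e hW (Pi.single j Complex.I) (Pi.single i 1),
    pdDer_comm e hW (Pi.single j Complex.I) (Pi.single i Complex.I)]
  module

theorem dz_dz (e : atlas (Fin n → ℂ) M) {W : TopologicalSpace.Opens M}
    (hW : (W : Set M) ⊆ e.1.source) (i j : Fin n) (f : SmoothFun n W) :
    dz e hW i (dz e hW j f) = dz e hW j (dz e hW i f) := by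
  simp only [dz, Derivation.smul_apply, Derivation.sub_apply, Derivation.map_smul,
    Derivation.map_sub]
  rw [pdDer_comm e hW (Pi.single j 1) (Pi.single i 1),
    pdDer_comm e hW (Pi.single j 1) (Pi.single i Complex.I),
    pdDer_comm e hW (Pi.single j Complex.I) (Pi.single i 1),
    pdDer_comm e hW (Pi.single j Complex.I) (Pi.single i Complex.I)]
  module

theorem dzbar_dzbar (e : atlas (Fin n → ℂ) M) {W : TopologicalSpace.Opens M}
    (hW : (W : Set M) ⊆ e.1.source) (i j : Fin n) (f : SmoothFun n W) :
    dzbar e hW i (dzbar e hW j f) = dzbar e hW j (dzbar e hW i f) := by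
  simp only [dzbar, Derivation.smul_apply, Derivation.add_apply, Derivation.map_smul,
    Derivation.map_add]
  rw [pdDer_comm e hW (Pi.single j 1) (Pi.single i 1),
    pdDer_comm e hW (Pi.single j 1) (Pi.single i Complex.I),
    pdDer_comm e hW (Pi.single j Complex.I) (Pi.single i 1),
    pdDer_comm e hW (Pi.single j Complex.I) (Pi.single i Complex.I)]
  module

theorem transition_diff (e e' : atlas (Fin n → ℂ) M) {x : M} (hx : x ∈ e.1.source)
    (hx' : x ∈ e'.1.source) : DifferentiableAt ℂ (e'.1 ∘ e.1.symm) (e.1 x) := by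
  have h := (contDiffGroupoid_mem (HasGroupoid.compatible (G := contDiffGroupoid ω 𝓘(ℂ, Fin n → ℂ)) e.2 e'.2))
  have h3 : e.1 x ∈ (e.1.symm ≫ₕ e'.1).source := by
    simp [hx, hx', e.1.map_source hx]
  have h4 := h.contDiffAt (x := e.1 x) ((e.1.symm ≫ₕ e'.1).open_source.mem_nhds h3)
  have := h4.differentiableAt (by simp)
  simpa using this

/-- real derivative of coordinates -/
theorem fderiv_coord (e e' : atlas (Fin n → ℂ) M) {W : TopologicalSpace.Opens M}
    (hW : (W : Set M) ⊆ e.1.source) (hW' : (W : Set M) ⊆ e'.1.source) (j : Fin n) (v : Fin n → ℂ)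
    (x : W) : (pdDer e hW v (coordFun e' hW' j)).1 x =
      fderiv ℂ (e'.1 ∘ e.1.symm) (e.1 x) v j := by
  rw [pdDer_apply]
  have h1 : extz W (coordFun e' hW' j).1 ∘ e.1.symm =ᶠ[nhds (e.1 x)]
      fun z => (e'.1 ∘ e.1.symm) z j := by
    filter_upwards [near hW x.2] with z hz
    simp [extz_of_mem _ hz.1, coordFun]
  have h2 := (transition_diff e e' (hW x.2) (hW' x.2)).hasFDerivAt.restrictScalars ℝ
  have h3 := (hasFDerivAt_pi'.1 h2) j
  rw [h1.fderiv_eq, h3.fderiv]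
  rfl

theorem fderiv_conjCoord (e e' : atlas (Fin n → ℂ) M) {W : TopologicalSpace.Opens M}
    (hW : (W : Set M) ⊆ e.1.source) (hW' : (W : Set M) ⊆ e'.1.source) (j : Fin n) (v : Fin n → ℂ)
    (x : W) : (pdDer e hW v (conjCoordFun e' hW' j)).1 x =
      (starRingEnd ℂ) (fderiv ℂ (e'.1 ∘ e.1.symm) (e.1 x) v j) := by
  rw [pdDer_apply]
  have h1 : extz W (conjCoordFun e' hW' j).1 ∘ e.1.symm =ᶠ[nhds (e.1 x)]
      fun z => Complex.conjCLE ((e'.1 ∘ e.1.symm) z j) := by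
    filter_upwards [near hW x.2] with z hz
    simp [extz_of_mem _ hz.1, conjCoordFun]
  have h2 := (transition_diff e e' (hW x.2) (hW' x.2)).hasFDerivAt.restrictScalars ℝ
  have h3 := (hasFDerivAt_pi'.1 h2) j
  have h4 := Complex.conjCLE.hasFDerivAt.comp _ h3
  rw [h1.fderiv_eq]
  exact congrArg (fun L => L v) h4.fderiv

theorem chain (e e' : atlas (Fin n → ℂ) M) {W : TopologicalSpace.Opens M}
    (hW : (W : Set M) ⊆ e.1.source) (hW' : (W : Set M) ⊆ e'.1.source) (v : Fin n → ℂ)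
    (f : SmoothFun n W) (x : W) : (pdDer e hW v f).1 x =
      (pdDer e' hW' (fderiv ℂ (e'.1 ∘ e.1.symm) (e.1 x) v) f).1 x := by
  rw [pdDer_apply, pdDer_apply]
  have h1 : extz W f.1 ∘ e.1.symm =ᶠ[nhds (e.1 x)]
      (extz W f.1 ∘ e'.1.symm) ∘ (e'.1 ∘ e.1.symm) := by
    filter_upwards [near hW x.2] with z hz
    simp [e'.1.left_inv (hW' hz.1)]
  have h2 := (transition_diff e e' (hW x.2) (hW' x.2)).hasFDerivAt.restrictScalars ℝ
  have h3 : DifferentiableAt ℝ (extz W f.1 ∘ e'.1.symm) ((e'.1 ∘ e.1.symm) (e.1 x)) := by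
    have := ((smooth_iff e'.2 hW' _).1 f.2 x x.2).differentiableAt (by simp)
    simpa [e.1.left_inv (hW x.2)] using this
  have h4 := (h3.hasFDerivAt.comp _ h2).fderiv
  rw [h1.fderiv_eq, h4]
  simp [e.1.left_inv (hW x.2)]

theorem pdDer_expand (e : atlas (Fin n → ℂ) M) {W : TopologicalSpace.Opens M}
    (hW : (W : Set M) ⊆ e.1.source) (v : Fin n → ℂ) (f : SmoothFun n W) (x : W) :
    (pdDer e hW v f).1 x = ∑ j, (v j * (dz e hW j f).1 x
      + (starRingEnd ℂ) (v j) * (dzbar e hW j f).1 x) := by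
  have hv : v = ∑ j, ((v j).re • (Pi.single j 1 : Fin n → ℂ)
      + (v j).im • (Pi.single j Complex.I : Fin n → ℂ)) := by
    ext k
    simp [Finset.sum_apply, Pi.single_apply, Complex.re_add_im, Finset.sum_add_distrib]
  conv_lhs => rw [hv, pdDer_apply]
  simp only [map_sum, map_add, map_smul]
  refine Finset.sum_congr rfl fun j _ => ?_
  have e1 : (dz e hW j f).1 x = (1 / 2) * ((pdDer e hW (Pi.single j 1) f).1 x
      - Complex.I * (pdDer e hW (Pi.single j Complex.I) f).1 x) := rfl
  have e2 : (dzbar e hW j f).1 x = (1 / 2) * ((pdDer e hW (Pi.single j 1) f).1 x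
      + Complex.I * (pdDer e hW (Pi.single j Complex.I) f).1 x) := rfl
  rw [e1, e2, pdDer_apply, pdDer_apply]
  generalize fderiv ℝ (extz W f.1 ∘ e.1.symm) (e.1 x) (Pi.single j 1) = a
  generalize fderiv ℝ (extz W f.1 ∘ e.1.symm) (e.1 x) (Pi.single j Complex.I) = b
  rw [Complex.real_smul, Complex.real_smul]
  have r : v j = (v j).re + (v j).im * Complex.I := (Complex.re_add_im (v j)).symm
  have rc : (starRingEnd ℂ) (v j) = (v j).re - (v j).im * Complex.I := by
    apply Complex.ext <;> simp
  rw [rc]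
  generalize (v j).re = s at *
  generalize (v j).im = t at *
  rw [r]
  linear_combination (t * b) * Complex.I_sq


theorem dz_apply (e : atlas (Fin n → ℂ) M) {W : TopologicalSpace.Opens M}
    (hW : (W : Set M) ⊆ e.1.source) (i : Fin n) (f : SmoothFun n W) (x : W) :
    (dz e hW i f).1 x = (1 / 2) * ((pdDer e hW (Pi.single i 1) f).1 x
      - Complex.I * (pdDer e hW (Pi.single i Complex.I) f).1 x) := rfl

theorem dzbar_apply (e : atlas (Fin n → ℂ) M) {W : TopologicalSpace.Opens M}
    (hW : (W : Set M) ⊆ e.1.source) (i : Fin n) (f : SmoothFun n W) (x : W) :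
    (dzbar e hW i f).1 x = (1 / 2) * ((pdDer e hW (Pi.single i 1) f).1 x
      + Complex.I * (pdDer e hW (Pi.single i Complex.I) f).1 x) := rfl

theorem single_I (L : (Fin n → ℂ) →L[ℂ] (Fin n → ℂ)) (i : Fin n) :
    L (Pi.single i Complex.I) = Complex.I • L (Pi.single i 1) := by
  rw [← map_smul, ← Pi.single_smul]; simp

section
variable (e e' : atlas (Fin n → ℂ) M) {W : TopologicalSpace.Opens M}
    (hW : (W : Set M) ⊆ e.1.source) (hW' : (W : Set M) ⊆ e'.1.source)

theorem dz_coordFun (i j : Fin n) (x : W) : (dz e hW i (coordFun e' hW' j)).1 x =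
    fderiv ℂ (e'.1 ∘ e.1.symm) (e.1 x) (Pi.single i 1) j := by
  rw [dz_apply, fderiv_coord, fderiv_coord, single_I, Pi.smul_apply, smul_eq_mul]
  linear_combination (-1 / 2 * fderiv ℂ (e'.1 ∘ e.1.symm) (e.1 x) (Pi.single i 1) j) * Complex.I_sq

theorem dzbar_coordFun (i j : Fin n) : dzbar e hW i (coordFun e' hW' j) = 0 := by
  apply Subtype.ext; funext x
  rw [dzbar_apply, fderiv_coord, fderiv_coord, single_I, Pi.smul_apply, smul_eq_mul]
  change _ = (0 : ℂ)
  linear_combination (1 / 2 * fderiv ℂ (e'.1 ∘ e.1.symm) (e.1 x) (Pi.single i 1) j) * Complex.I_sq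

theorem dzbar_conjCoordFun (i j : Fin n) (x : W) : (dzbar e hW i (conjCoordFun e' hW' j)).1 x =
    (starRingEnd ℂ) (fderiv ℂ (e'.1 ∘ e.1.symm) (e.1 x) (Pi.single i 1) j) := by
  rw [dzbar_apply, fderiv_conjCoord, fderiv_conjCoord, single_I, Pi.smul_apply, smul_eq_mul,
    map_mul, Complex.conj_I]
  linear_combination (-1 / 2 * (starRingEnd ℂ)
    (fderiv ℂ (e'.1 ∘ e.1.symm) (e.1 x) (Pi.single i 1) j)) * Complex.I_sq

theorem dz_conjCoordFun (i j : Fin n) : dz e hW i (conjCoordFun e' hW' j) = 0 := by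
  apply Subtype.ext; funext x
  rw [dz_apply, fderiv_conjCoord, fderiv_conjCoord, single_I, Pi.smul_apply, smul_eq_mul,
    map_mul, Complex.conj_I]
  change _ = (0 : ℂ)
  linear_combination (1 / 2 * (starRingEnd ℂ)
    (fderiv ℂ (e'.1 ∘ e.1.symm) (e.1 x) (Pi.single i 1) j)) * Complex.I_sq

/-- `∂_i f = ∑_j (∂_i z'_j) ∂'_j f` -/
theorem dz_change (i : Fin n) (f : SmoothFun n W) :
    dz e hW i f = ∑ j, dz e hW i (coordFun e' hW' j) * dz e' hW' j f := by
  apply Subtype.ext; funext x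
  have hsum : (∑ j, dz e hW i (coordFun e' hW' j) * dz e' hW' j f).1 x =
      ∑ j, (dz e hW i (coordFun e' hW' j)).1 x * (dz e' hW' j f).1 x := by
    exact (map_sum (evalAt x) _ _).trans (Finset.sum_congr rfl fun j _ => map_mul (evalAt x) _ _)
  rw [hsum, dz_apply, chain e e' hW hW', chain e e' hW hW', pdDer_expand, pdDer_expand, single_I,
    Finset.mul_sum, ← Finset.sum_sub_distrib, Finset.mul_sum]
  refine Finset.sum_congr rfl fun j _ => ?_
  rw [dz_coordFun, Pi.smul_apply, smul_eq_mul, map_mul, Complex.conj_I]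
  generalize fderiv ℂ (e'.1 ∘ e.1.symm) (e.1 x) (Pi.single i 1) j = a
  generalize (dz e' hW' j f).1 x = b
  generalize (dzbar e' hW' j f).1 x = d
  linear_combination (-1 / 2 * a * b + 1 / 2 * (starRingEnd ℂ) a * d) * Complex.I_sq

/-- `∂̄_i f = ∑_j (∂̄_i z̄'_j) ∂̄'_j f` -/
theorem dzbar_change (i : Fin n) (f : SmoothFun n W) :
    dzbar e hW i f = ∑ j, dzbar e hW i (conjCoordFun e' hW' j) * dzbar e' hW' j f := by
  apply Subtype.ext; funext x
  have hsum : (∑ j, dzbar e hW i (conjCoordFun e' hW' j) * dzbar e' hW' j f).1 x =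
      ∑ j, (dzbar e hW i (conjCoordFun e' hW' j)).1 x * (dzbar e' hW' j f).1 x := by
    exact (map_sum (evalAt x) _ _).trans (Finset.sum_congr rfl fun j _ => map_mul (evalAt x) _ _)
  rw [hsum, dzbar_apply, chain e e' hW hW', chain e e' hW hW', pdDer_expand, pdDer_expand,
    single_I, Finset.mul_sum, ← Finset.sum_add_distrib, Finset.mul_sum]
  refine Finset.sum_congr rfl fun j _ => ?_
  rw [dzbar_conjCoordFun, Pi.smul_apply, smul_eq_mul, map_mul, Complex.conj_I]
  generalize fderiv ℂ (e'.1 ∘ e.1.symm) (e.1 x) (Pi.single i 1) j = a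
  generalize (dz e' hW' j f).1 x = b
  generalize (dzbar e' hW' j f).1 x = d
  linear_combination (1 / 2 * a * b - 1 / 2 * (starRingEnd ℂ) a * d) * Complex.I_sq

theorem dz_coordFun_self (i j : Fin n) :
    dz e hW i (coordFun e hW j) = if i = j then 1 else 0 := by
  apply Subtype.ext; funext x
  rw [dz_coordFun]
  have : fderiv ℂ (e.1 ∘ e.1.symm) (e.1 x) = fderiv ℂ id (e.1 x) := by
    refine Filter.EventuallyEq.fderiv_eq ?_
    filter_upwards [near hW x.2] with z hz using hz.2
  rw [this, fderiv_id]
  by_cases h : i = j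
  · subst h; simp; rfl
  · simp [h, Ne.symm h]; rfl

end

end Geometry
end PolyForm

namespace ExtDef

universe u

/-- A `ℤ`-graded complex vector space. The parity operator `sgn` is `(-1)^d` in degree `d`
(so it is determined by the grading). -/
structure GradedSpace where
  carrier : Type u
  [addCommGroup : AddCommGroup carrier]
  [module : Module ℂ carrier]
  deg : ℤ → Submodule ℂ carrier
  internal : DirectSum.IsInternal deg
  sgn : carrier →ₗ[ℂ] carrier
  sgn_apply : ∀ d, ∀ x ∈ deg d, sgn x = (-1 : ℂ) ^ d • x

attribute [instance] GradedSpace.addCommGroup GradedSpace.module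

instance : CoeSort GradedSpace.{u} (Type u) := ⟨GradedSpace.carrier⟩

namespace GradedSpace

/-- `x` has parity `p`. -/
def HasParity (Q : GradedSpace.{u}) (p : ℕ) (x : Q) : Prop := Q.sgn x = (-1 : ℂ) ^ p • x

/-- The even part of a vector. -/
noncomputable def even (Q : GradedSpace.{u}) : Q →ₗ[ℂ] Q := (1 / 2 : ℂ) • (LinearMap.id + Q.sgn)

/-- The odd part of a vector. -/
noncomputable def odd (Q : GradedSpace.{u}) : Q →ₗ[ℂ] Q := (1 / 2 : ℂ) • (LinearMap.id - Q.sgn)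

theorem even_apply {Q : GradedSpace.{u}} {p : ℕ} {x : Q} (hx : Q.HasParity p x) :
    Q.even x = if Even p then x else 0 := by
  have hx' : Q.sgn x = (-1 : ℂ) ^ p • x := hx
  simp only [even, LinearMap.smul_apply, LinearMap.add_apply, LinearMap.id_apply, hx']
  split_ifs with h
  · rw [h.neg_one_pow]; module
  · rw [(Nat.not_even_iff_odd.1 h).neg_one_pow]; module

theorem odd_apply {Q : GradedSpace.{u}} {p : ℕ} {x : Q} (hx : Q.HasParity p x) :
    Q.odd x = if Even p then 0 else x := by
  have hx' : Q.sgn x = (-1 : ℂ) ^ p • x := hx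
  simp only [odd, LinearMap.smul_apply, LinearMap.sub_apply, LinearMap.id_apply, hx']
  split_ifs with h
  · rw [h.neg_one_pow]; module
  · rw [(Nat.not_even_iff_odd.1 h).neg_one_pow]; module

theorem sgn_sgn (Q : GradedSpace.{u}) (x : Q) : Q.sgn (Q.sgn x) = x := by
  have hx : x ∈ ⨆ d, Q.deg d := by rw [Q.internal.submodule_iSup_eq_top]; trivial
  induction hx using Submodule.iSup_induction' with
  | mem d x hx =>
    rw [Q.sgn_apply d x hx, map_smul, Q.sgn_apply d x hx, smul_smul, ← mul_zpow]; simp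
  | zero => simp
  | add x y _ _ hx hy => simp [hx, hy]

end GradedSpace

/-- The relations of graded commutativity. -/
inductive SymRel (Q : GradedSpace.{u}) : TensorAlgebra ℂ Q → TensorAlgebra ℂ Q → Prop
  | swap (p q : ℕ) (x y : Q) (hx : Q.HasParity p x) (hy : Q.HasParity q y) :
      SymRel Q (TensorAlgebra.ι ℂ x * TensorAlgebra.ι ℂ y)
        ((-1 : ℂ) ^ (p * q) • (TensorAlgebra.ι ℂ y * TensorAlgebra.ι ℂ x))

/-- The free graded commutative algebra `S(Q)`. -/
abbrev GSym (Q : GradedSpace.{u}) : Type u := RingQuot (SymRel Q)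

namespace GSym
variable {Q : GradedSpace.{u}}

noncomputable def ι (Q : GradedSpace.{u}) : Q →ₗ[ℂ] GSym Q :=
  (RingQuot.mkAlgHom ℂ (SymRel Q)).toLinearMap ∘ₗ TensorAlgebra.ι ℂ

noncomputable def lift {B : Type*} [Semiring B] [Algebra ℂ B] (f : Q →ₗ[ℂ] B)
    (hf : ∀ (p q : ℕ) (x y : Q), Q.HasParity p x → Q.HasParity q y →
      f x * f y = (-1 : ℂ) ^ (p * q) • (f y * f x)) : GSym Q →ₐ[ℂ] B :=
  RingQuot.liftAlgHom ℂ ⟨TensorAlgebra.lift ℂ f, by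
    rintro _ _ ⟨p, q, x, y, hx, hy⟩
    simpa using hf p q x y hx hy⟩

theorem lift_ι {B : Type*} [Semiring B] [Algebra ℂ B] (f : Q →ₗ[ℂ] B) (hf) (x : Q) :
    lift f hf (ι Q x) = f x := by
  simp [lift, ι]

theorem hom_ext {B : Type*} [Semiring B] [Algebra ℂ B] {f g : GSym Q →ₐ[ℂ] B}
    (h : ∀ x, f (ι Q x) = g (ι Q x)) : f = g := by
  apply RingQuot.ringQuot_ext'
  apply TensorAlgebra.hom_ext
  ext x
  exact h x

theorem ι_comm (p q : ℕ) (x y : Q) (hx : Q.HasParity p x) (hy : Q.HasParity q y) :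
    ι Q x * ι Q y = (-1 : ℂ) ^ (p * q) • (ι Q y * ι Q x) := by
  have := RingQuot.mkAlgHom_rel ℂ (SymRel.swap p q x y hx hy)
  simpa [ι] using this

/-- The parity operator of `S(Q)`. -/
noncomputable def sgn (Q : GradedSpace.{u}) : GSym Q →ₐ[ℂ] GSym Q :=
  lift (ι Q ∘ₗ Q.sgn) (by
    intro p q x y hx hy
    have hx' : Q.sgn x = (-1 : ℂ) ^ p • x := hx
    have hy' : Q.sgn y = (-1 : ℂ) ^ q • y := hy
    simp only [LinearMap.comp_apply, hx', hy', map_smul, smul_mul_smul_comm]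
    rw [ι_comm p q x y hx hy, mul_comm, smul_comm])

theorem sgn_ι (x : Q) : sgn Q (ι Q x) = ι Q (Q.sgn x) := lift_ι _ _ _

theorem sgn_sgn (a : GSym Q) : sgn Q (sgn Q a) = a := by
  have : (sgn Q).comp (sgn Q) = AlgHom.id ℂ _ := hom_ext fun x => by
    simp [sgn_ι, Q.sgn_sgn]
  exact congrArg (fun f => f a) this

theorem iter_sgn_ι (p q : ℕ) (x : Q) (hx : Q.HasParity q x) (a : GSym Q) :
    (sgn Q)^[p] (ι Q x * a) = (-1 : ℂ) ^ (p * q) • (ι Q x * (sgn Q)^[p] a) := by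
  have hx' : Q.sgn x = (-1 : ℂ) ^ q • x := hx
  induction p with
  | zero => simp
  | succ p ih =>
    rw [Function.iterate_succ_apply', ih, Function.iterate_succ_apply', map_smul, map_mul, sgn_ι,
      hx', map_smul, smul_mul_assoc, smul_smul, ← pow_add, add_mul, one_mul]

/-- The counit `S(Q) → ℂ`. -/
noncomputable def counit (Q : GradedSpace.{u}) : GSym Q →ₐ[ℂ] ℂ := lift 0 (by simp)

/-- Left multiplication by `x ⊗ 1 + 1 ⊗ x` on the graded tensor product `S(Q) ⊗ S(Q)`:
`a ⊗ b ↦ xa ⊗ b + (-1)^{|x||a|} a ⊗ xb`. -/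
noncomputable def comulGen (Q : GradedSpace.{u}) :
    Q →ₗ[ℂ] Module.End ℂ (GSym Q ⊗[ℂ] GSym Q) :=
  (LinearMap.rTensorHom (GSym Q)) ∘ₗ (LinearMap.mul ℂ (GSym Q)) ∘ₗ ι Q
  + (LinearMap.lTensorHom (GSym Q)) ∘ₗ (LinearMap.mul ℂ (GSym Q)) ∘ₗ ι Q ∘ₗ Q.even
  + (LinearMap.mulRight ℂ (LinearMap.rTensor (GSym Q) (sgn Q).toLinearMap :
      Module.End ℂ (GSym Q ⊗[ℂ] GSym Q))) ∘ₗ (LinearMap.lTensorHom (GSym Q)) ∘ₗ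
      (LinearMap.mul ℂ (GSym Q)) ∘ₗ ι Q ∘ₗ Q.odd

theorem comulGen_tmul (x : Q) (a b : GSym Q) :
    comulGen Q x (a ⊗ₜ b) = (ι Q x * a) ⊗ₜ b + a ⊗ₜ (ι Q (Q.even x) * b)
      + sgn Q a ⊗ₜ (ι Q (Q.odd x) * b) := by
  simp [comulGen]

theorem comulGen_parity (p : ℕ) (x : Q) (hx : Q.HasParity p x) (a b : GSym Q) :
    comulGen Q x (a ⊗ₜ b) = (ι Q x * a) ⊗ₜ b + ((sgn Q)^[p] a) ⊗ₜ (ι Q x * b) := by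
  have inv : Function.Involutive (sgn Q) := sgn_sgn
  rw [comulGen_tmul, GradedSpace.even_apply hx, GradedSpace.odd_apply hx]
  split_ifs with h
  · rw [inv.iterate_even h]; simp
  · rw [inv.iterate_odd (Nat.not_even_iff_odd.1 h)]; simp

theorem comulGen_comm (p q : ℕ) (x y : Q) (hx : Q.HasParity p x) (hy : Q.HasParity q y) :
    comulGen Q x * comulGen Q y = (-1 : ℂ) ^ (p * q) • (comulGen Q y * comulGen Q x) := by
  refine TensorProduct.ext' fun a b => ?_
  have h1 : (-1 : ℂ) ^ (p * q) * (-1 : ℂ) ^ (p * q) = 1 := by rw [← mul_pow]; simp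
  have h2 : ((sgn Q)^[p] ((sgn Q)^[q] a)) = ((sgn Q)^[q] ((sgn Q)^[p] a)) := by
    rw [← Function.iterate_add_apply, add_comm, Function.iterate_add_apply]
  simp only [Module.End.mul_apply, LinearMap.smul_apply, comulGen_parity p x hx,
    comulGen_parity q y hy, map_add, iter_sgn_ι p q y hy, iter_sgn_ι q p x hx, ← mul_assoc,
    ι_comm p q x y hx hy, h2, mul_comm q p]
  simp only [smul_add, TensorProduct.smul_tmul', smul_mul_assoc, TensorProduct.tmul_smul,
    smul_smul, h1, one_smul]
  abel

/-- The coproduct of `S(Q)`: the algebra map to the graded tensor product `S(Q) ⊗ S(Q)` with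
`x ↦ x ⊗ 1 + 1 ⊗ x`. -/
noncomputable def comul (Q : GradedSpace.{u}) : GSym Q →ₗ[ℂ] GSym Q ⊗[ℂ] GSym Q :=
  LinearMap.applyₗ ((1 : GSym Q) ⊗ₜ[ℂ] (1 : GSym Q)) ∘ₗ
    (lift (B := Module.End ℂ (GSym Q ⊗[ℂ] GSym Q)) (comulGen Q) comulGen_comm).toLinearMap

/-- The linear map `S(Q) → Q` with `x ↦ d x` and `x y ↦ b(x, y)`, zero in the other symmetric
degrees, `b` graded symmetric. As a formal map of `Q` it is `q ↦ d q + b(q, q)/2`. -/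
noncomputable def quad (d : Q →ₗ[ℂ] Q) (b : Q →ₗ[ℂ] Q →ₗ[ℂ] Q)
    (hb : ∀ (p q : ℕ) (x y : Q), Q.HasParity p x → Q.HasParity q y →
      b x y = (-1 : ℂ) ^ (p * q) • b y x) : GSym Q →ₗ[ℂ] Q :=
  LinearMap.snd ℂ Q Q ∘ₗ LinearMap.snd ℂ ℂ (Q × Q) ∘ₗ
    LinearMap.applyₗ ((1, 0, 0) : ℂ × Q × Q) ∘ₗ
    (lift (B := Module.End ℂ (ℂ × Q × Q))
      ((LinearMap.mk₂ ℂ (fun (x : Q) (v : ℂ × Q × Q) => ((0, v.1 • x, v.1 • d x + b x v.2.1) : ℂ × Q × Q))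
        (fun x y v => by ext <;> simp; abel)
        (fun c x v => by ext <;> simp [smul_comm c])
        (fun x v w => by ext <;> simp [add_smul]; abel)
        (fun c x v => by ext <;> simp [mul_smul])))
      (by
        intro p q x y hx hy
        ext v <;> simp [hb p q x y hx hy])).toLinearMap

theorem quad_ι (d : Q →ₗ[ℂ] Q) (b : Q →ₗ[ℂ] Q →ₗ[ℂ] Q) (hb) (x : Q) :
    quad d b hb (ι Q x) = d x := by
  simp [quad, lift_ι]

theorem quad_ι_mul_ι (d : Q →ₗ[ℂ] Q) (b : Q →ₗ[ℂ] Q →ₗ[ℂ] Q) (hb) (x y : Q) :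
    quad d b hb (ι Q x * ι Q y) = b x y := by
  simp [quad, lift_ι]

/-- The projection `S(Q) → Q` to symmetric degree one. -/
noncomputable def proj (Q : GradedSpace.{u}) : GSym Q →ₗ[ℂ] Q :=
  quad LinearMap.id 0 (by simp)

/-- Convolution: `w ↦ ∑ β(F(w₁), G(w₂))`, where `∑ w₁ ⊗ w₂` is the coproduct of `w`. -/
noncomputable def conv {A B C : Type*} [AddCommGroup A] [Module ℂ A] [AddCommGroup B] [Module ℂ B]
    [AddCommGroup C] [Module ℂ C] (β : A →ₗ[ℂ] B →ₗ[ℂ] C) (F : GSym Q →ₗ[ℂ] A)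
    (G : GSym Q →ₗ[ℂ] B) : GSym Q →ₗ[ℂ] C :=
  TensorProduct.lift β ∘ₗ TensorProduct.map F G ∘ₗ comul Q

theorem conv_add {A B C : Type*} [AddCommGroup A] [Module ℂ A] [AddCommGroup B] [Module ℂ B]
    [AddCommGroup C] [Module ℂ C] (β : A →ₗ[ℂ] B →ₗ[ℂ] C) (F F' : GSym Q →ₗ[ℂ] A)
    (G : GSym Q →ₗ[ℂ] B) : conv β (F + F') G = conv β F G + conv β F' G := by
  simp only [conv, TensorProduct.map_add_left, LinearMap.add_comp, LinearMap.comp_add]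

theorem conv_smul {A B C : Type*} [AddCommGroup A] [Module ℂ A] [AddCommGroup B] [Module ℂ B]
    [AddCommGroup C] [Module ℂ C] (β : A →ₗ[ℂ] B →ₗ[ℂ] C) (c : ℂ) (F : GSym Q →ₗ[ℂ] A)
    (G : GSym Q →ₗ[ℂ] B) : conv β (c • F) G = c • conv β F G := by
  simp only [conv, TensorProduct.map_smul_left, LinearMap.smul_comp, LinearMap.comp_smul]

end GSym

/-- Formal functions on `Q` at the origin: `f` stands for the power series with Taylor
coefficients `f(x₁ ⋯ x_k)`. -/
abbrev Fun (Q : GradedSpace.{u}) : Type u := GSym Q →ₗ[ℂ] ℂ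

/-- Formal vector fields along a formal map `P → Q` of pointed formal manifolds: `V` has Taylor
coefficients `V(x₁ ⋯ x_k) ∈ Q`. -/
abbrev VF (P Q : GradedSpace.{u}) : Type u := GSym P →ₗ[ℂ] Q

section VectorFields
variable {P Q : GradedSpace.{u}}

/-- The parity operator on vector fields. -/
noncomputable def conj : VF P Q →ₗ[ℂ] VF P Q :=
  LinearMap.lcomp ℂ Q (GSym.sgn P).toLinearMap ∘ₗ LinearMap.llcomp ℂ (GSym P) Q Q Q.sgn

/-- The even part of a vector field. -/
noncomputable def evenPart : VF P Q →ₗ[ℂ] VF P Q := (1 / 2 : ℂ) • (LinearMap.id + conj)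

/-- The odd part of a vector field. -/
noncomputable def oddPart : VF P Q →ₗ[ℂ] VF P Q := (1 / 2 : ℂ) • (LinearMap.id - conj)

/-- The field `V` has degree `m`. -/
def HasDegree (V : VF P Q) (m : ℤ) : Prop :=
  ∀ (k : ℕ) (d : Fin k → ℤ) (x : Fin k → P), (∀ i, x i ∈ P.deg (d i)) →
    V (List.ofFn fun i => GSym.ι P (x i)).prod ∈ Q.deg (∑ i, d i + m)

/-- The coderivation of `S(Q)` along `φ : S(P) → S(Q)` with components `Z`. -/
noncomputable def hatAlong (φ : GSym P →ₗ[ℂ] GSym Q) (Z : VF P Q) : GSym P →ₗ[ℂ] GSym Q :=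
  GSym.conv (LinearMap.mul ℂ (GSym Q)) (GSym.ι Q ∘ₗ Z) φ

/-- The coderivation of `S(Q)` given by a vector field. -/
noncomputable def hat (V : VF Q Q) : GSym Q →ₗ[ℂ] GSym Q := hatAlong LinearMap.id V

/-- The graded Lie bracket `V ∘ Ŵ - (-1)^{|V||W|} W ∘ V̂` of vector fields. -/
noncomputable def bracket (V W : VF Q Q) : VF Q Q :=
  V ∘ₗ hat W - evenPart W ∘ₗ hat V - oddPart W ∘ₗ hat (conj V)

/-- The product of vector fields given by a product on the linear space `Q` (a constant product on
the tangent bundle). -/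
noncomputable def vmul (μ : Q →ₗ[ℂ] Q →ₗ[ℂ] Q) (V W : VF Q Q) : VF Q Q :=
  GSym.conv μ V (evenPart W) + GSym.conv μ (V ∘ₗ (GSym.sgn Q).toLinearMap) (oddPart W)

/-- The product of a function and a vector field. -/
noncomputable def fsmul (f : Fun Q) (V : VF Q Q) : VF Q Q :=
  GSym.conv (LinearMap.lsmul ℂ Q) f (evenPart V)
    + GSym.conv (LinearMap.lsmul ℂ Q) (f ∘ₗ (GSym.sgn Q).toLinearMap) (oddPart V)

/-- A cohomological vector field: of degree one, vanishing at the origin, `[X, X] = 0`. -/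
structure IsCohomological (X : VF Q Q) : Prop where
  degree : HasDegree X 1
  zero : X 1 = 0
  sq : bracket X X = 0

/-- The differential `[X, ·]` on vector fields, for `X` odd. -/
noncomputable def dX (X : VF Q Q) : VF Q Q →ₗ[ℂ] VF Q Q where
  toFun V := X ∘ₗ hat V - conj V ∘ₗ hat X
  map_add' V W := by
    simp only [hat, hatAlong, LinearMap.comp_add, GSym.conv_add, map_add, LinearMap.add_comp]
    abel
  map_smul' c V := by
    simp only [hat, hatAlong, LinearMap.comp_smul, GSym.conv_smul, map_smul, LinearMap.smul_comp,
      RingHom.id_apply, smul_sub]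

end VectorFields
/-- The space `H(T Q, [X, ·])` of vector fields of a dg manifold. -/
abbrev VFH {Q : GradedSpace.{u}} (X : VF Q Q) : Type u :=
  ↥(LinearMap.ker (dX X)) ⧸ (LinearMap.range (dX X)).comap (LinearMap.ker (dX X)).subtype

/-- The class of an `[X, ·]`-closed vector field. -/
noncomputable def VFH.mk {Q : GradedSpace.{u}} (X : VF Q Q) : LinearMap.ker (dX X) →ₗ[ℂ] VFH X :=
  Submodule.mkQ _

/-- The class `a` is represented by a closed vector field of parity `p`. -/
def VFH.HasParity {Q : GradedSpace.{u}} (X : VF Q Q) (p : ℕ) (a : VFH X) : Prop :=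
  ∃ V : LinearMap.ker (dX X), conj V.1 = (-1 : ℂ) ^ p • V.1 ∧ VFH.mk X V = a

/-- A cohomology F-manifold with underlying graded linear space `Q`: a cohomological vector field
`X` and a graded commutative, associative product on the vector fields of `(Q, X)`, which is linear
over the functions of `(Q, X)`, that is, a tensor field. -/
structure CohomologyFManifold (Q : GradedSpace.{u}) where
  X : VF Q Q
  isCohomological : IsCohomological X
  star : VFH X →ₗ[ℂ] VFH X →ₗ[ℂ] VFH X
  star_parity : ∀ p q a b, VFH.HasParity X p a → VFH.HasParity X q b →
    VFH.HasParity X (p + q) (star a b)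
  star_comm : ∀ p q a b, VFH.HasParity X p a → VFH.HasParity X q b →
    star a b = (-1 : ℂ) ^ (p * q) • star b a
  star_assoc : ∀ a b c, star (star a b) c = star a (star b c)
  star_fsmul : ∀ f : Fun Q, f ∘ₗ hat X = 0 → ∀ V W U V' U' : LinearMap.ker (dX X),
    V'.1 = fsmul f V.1 → U'.1 = fsmul f U.1 →
    star (VFH.mk X V) (VFH.mk X W) = VFH.mk X U → star (VFH.mk X V') (VFH.mk X W) = VFH.mk X U'

/-- A morphism `(P, X) → (Q, Y)` of dg manifolds (an `L_∞`-morphism): a map of coalgebras of degree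
zero preserving the base point and intertwining the vector fields. -/
structure DGMorphism {P Q : GradedSpace.{u}} (X : VF P P) (Y : VF Q Q) where
  φ : GSym P →ₗ[ℂ] GSym Q
  map_one : φ 1 = 1
  counit : (GSym.counit Q).toLinearMap ∘ₗ φ = (GSym.counit P).toLinearMap
  comul : GSym.comul Q ∘ₗ φ = TensorProduct.map φ φ ∘ₗ GSym.comul P
  degree : HasDegree (GSym.proj Q ∘ₗ φ) 0
  intertwines : φ ∘ₗ hat X = hat Y ∘ₗ φ

namespace DGMorphism
variable {P Q : GradedSpace.{u}} {X : VF P P} {Y : VF Q Q}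

/-- The differential at the base point. -/
noncomputable def linearPart (F : DGMorphism X Y) : P →ₗ[ℂ] Q := GSym.proj Q ∘ₗ F.φ ∘ₗ GSym.ι P

/-- The linear part induces an isomorphism on the cohomology of the tangent complexes at the base
points, whose differentials are the linear parts of the vector fields. -/
structure IsQuasiIso (F : DGMorphism X Y) : Prop where
  inj : ∀ x, X (GSym.ι P x) = 0 → (∃ y, F.linearPart x = Y (GSym.ι Q y)) →
    ∃ z, x = X (GSym.ι P z)
  surj : ∀ y, Y (GSym.ι Q y) = 0 → ∃ x z, X (GSym.ι P x) = 0 ∧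
    y = F.linearPart x + Y (GSym.ι Q z)

/-- The closed vector fields `V` on `P` and `W` on `Q` are related by `F` up to homotopy: the vector
fields `dF(V)` and `W ∘ F` along `F` differ by an exact one. -/
def Related (F : DGMorphism X Y) (V : VF P P) (W : VF Q Q) : Prop :=
  ∃ Z : VF P Q, (GSym.proj Q ∘ₗ F.φ) ∘ₗ hat V - W ∘ₗ F.φ =
    Y ∘ₗ hatAlong F.φ Z - conj Z ∘ₗ hat X

end DGMorphism

/-- An equivalence of cohomology F-manifolds up to homotopy: a quasi-isomorphism of dg manifolds
such that the induced isomorphism of spaces of vector fields preserves the products. -/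
structure CohomologyFManifold.Equivalence {P Q : GradedSpace.{u}} (𝓟 : CohomologyFManifold P)
    (𝓠 : CohomologyFManifold Q) where
  toMorphism : DGMorphism 𝓟.X 𝓠.X
  isQuasiIso : toMorphism.IsQuasiIso
  vf : VFH 𝓟.X ≃ₗ[ℂ] VFH 𝓠.X
  vf_mk : ∀ V W, vf (VFH.mk 𝓟.X V) = VFH.mk 𝓠.X W ↔ toMorphism.Related V.1 W.1
  vf_star : ∀ a b, vf (𝓟.star a b) = 𝓠.star (vf a) (vf b)

/-- A dg manifold is smooth if it is quasi-isomorphic to a graded linear space with zero vector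
field. -/
def IsSmooth {Q : GradedSpace.{u}} (Y : VF Q Q) : Prop :=
  ∃ (K : GradedSpace.{u}) (F : DGMorphism (0 : VF K K) Y), F.IsQuasiIso

/-- A formal Frobenius manifold structure on the graded linear space `K`: an even flat metric `η`
and an even potential `Φ` whose third derivatives give, by raising an index, an associative
product of vector fields. Here `c w x y` is the Taylor coefficient in direction `w` of the product
of the constant vector fields `x` and `y`. -/
structure FrobeniusStructure (K : GradedSpace.{u}) where
  η : K →ₗ[ℂ] K →ₗ[ℂ] ℂ
  η_even : ∀ x y, η (K.sgn x) (K.sgn y) = η x y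
  η_symm : ∀ p q x y, K.HasParity p x → K.HasParity q y → η x y = (-1 : ℂ) ^ (p * q) • η y x
  η_nondegenerate : ∀ x, (∀ y, η x y = 0) → x = 0
  Φ : Fun K
  Φ_even : Φ ∘ₗ (GSym.sgn K).toLinearMap = Φ
  c : GSym K →ₗ[ℂ] K →ₗ[ℂ] K →ₗ[ℂ] K
  c_potential : ∀ w x y z, η (c w x y) z = Φ (w * GSym.ι K x * GSym.ι K y * GSym.ι K z)

namespace FrobeniusStructure
variable {K : GradedSpace.{u}} (𝓕 : FrobeniusStructure K)

/-- The product `∑ c(w₁)(V(w₂), W(w₃))` (with Koszul signs) of vector fields. -/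
noncomputable def star (V W : VF K K) : VF K K :=
  let C : GSym K →ₗ[ℂ] K ⊗[ℂ] K →ₗ[ℂ] K := TensorProduct.uncurry (.id ℂ) K K K ∘ₗ 𝓕.c
  let T : VF K K → VF K K → GSym K →ₗ[ℂ] K ⊗[ℂ] K := fun V W =>
    GSym.conv (TensorProduct.mk ℂ K K) V (evenPart W)
      + GSym.conv (TensorProduct.mk ℂ K K) (V ∘ₗ (GSym.sgn K).toLinearMap) (oddPart W)
  GSym.conv LinearMap.id C ((1 / 2 : ℂ) • (T V W + T (conj V) (conj W)))
    + GSym.conv LinearMap.id (C ∘ₗ (GSym.sgn K).toLinearMap)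
        ((1 / 2 : ℂ) • (T V W - T (conj V) (conj W)))

/-- The product of vector fields is associative (the WDVV equations hold). -/
def IsAssociative : Prop := ∀ V W U, 𝓕.star (𝓕.star V W) U = 𝓕.star V (𝓕.star W U)

end FrobeniusStructure

/-- The cohomology F-manifold lifts to a Frobenius manifold: it is equivalent to the one given by the
product of vector fields of a formal Frobenius manifold (with zero vector field). No unit and no
Euler vector field are required. -/
def LiftsToFrobenius {Q : GradedSpace.{u}} (𝓠 : CohomologyFManifold Q) : Prop :=
  ∃ (K : GradedSpace.{u}) (𝓕 : FrobeniusStructure K) (𝓚 : CohomologyFManifold K),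
    𝓕.IsAssociative ∧ 𝓚.X = 0 ∧
    (∀ V W U : LinearMap.ker (dX 𝓚.X), U.1 = 𝓕.star V.1 W.1 →
      𝓚.star (VFH.mk 𝓚.X V) (VFH.mk 𝓚.X W) = VFH.mk 𝓚.X U) ∧
    Nonempty (CohomologyFManifold.Equivalence 𝓚 𝓠)

/-- A dg Gerstenhaber algebra `(Q, d, [·,·], ·)`. The degree of an element of `Q.deg i` as an element
of the algebra is `i + 2`. -/
structure IsDGGerstenhaber (Q : GradedSpace.{u}) (mul : Q →ₗ[ℂ] Q →ₗ[ℂ] Q) (d : Q →ₗ[ℂ] Q)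
    (br : Q →ₗ[ℂ] Q →ₗ[ℂ] Q) : Prop where
  mul_mem : ∀ i j, ∀ x ∈ Q.deg i, ∀ y ∈ Q.deg j, mul x y ∈ Q.deg (i + j + 2)
  mul_comm : ∀ i j, ∀ x ∈ Q.deg i, ∀ y ∈ Q.deg j, mul x y = (-1 : ℂ) ^ (i * j) • mul y x
  mul_assoc : ∀ x y z, mul (mul x y) z = mul x (mul y z)
  d_mem : ∀ i, ∀ x ∈ Q.deg i, d x ∈ Q.deg (i + 1)
  d_sq : ∀ x, d (d x) = 0
  d_mul : ∀ i, ∀ x ∈ Q.deg i, ∀ y, d (mul x y) = mul (d x) y + (-1 : ℂ) ^ i • mul x (d y)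
  br_mem : ∀ i j, ∀ x ∈ Q.deg i, ∀ y ∈ Q.deg j, br x y ∈ Q.deg (i + j + 1)
  br_symm : ∀ i j, ∀ x ∈ Q.deg i, ∀ y ∈ Q.deg j,
    br x y = -((-1 : ℂ) ^ ((i - 1) * (j - 1)) • br y x)
  jacobi : ∀ i j, ∀ x ∈ Q.deg i, ∀ y ∈ Q.deg j, ∀ z,
    br x (br y z) = br (br x y) z + (-1 : ℂ) ^ ((i - 1) * (j - 1)) • br y (br x z)
  d_br : ∀ i, ∀ x ∈ Q.deg i, ∀ y, d (br x y) = br (d x) y + (-1 : ℂ) ^ (i - 1) • br x (d y)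
  br_mul : ∀ i j, ∀ x ∈ Q.deg i, ∀ y ∈ Q.deg j, ∀ z,
    br x (mul y z) = mul (br x y) z + (-1 : ℂ) ^ ((i - 1) * j) • mul y (br x z)

theorem isInternal_of_proj {V : Type*} [AddCommGroup V] [Module ℂ V] (D : ℤ → Submodule ℂ V)
    (p : ℤ → V →ₗ[ℂ] V) (h1 : ∀ i, ∀ x ∈ D i, p i x = x) (h2 : ∀ i j, i ≠ j → ∀ x ∈ D i, p j x = 0)
    (h3 : ⨆ i, D i = ⊤) : DirectSum.IsInternal D := by
  classical
  have key : ∀ (f : DirectSum ℤ fun i => D i) j,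
      p j (DirectSum.coeAddMonoidHom D f) = f j := by
    intro f j
    induction f using DirectSum.induction_on with
    | zero => simp
    | of i x =>
      rw [DirectSum.coeAddMonoidHom_of]
      by_cases h : i = j
      · subst h; simp [h1 i x.1 x.2]
      · rw [h2 i j h x.1 x.2, DirectSum.of_eq_of_ne _ _ _ (Ne.symm h)]; rfl
    | add f g hf hg => simp [hf, hg]
  constructor
  · intro f g hfg
    ext j
    rw [← key, ← key, hfg]
  · intro x
    have hx : x ∈ ⨆ i, D i := by rw [h3]; trivial
    induction hx using Submodule.iSup_induction' with
    | mem i x hx => exact ⟨DirectSum.of (fun i => D i) i ⟨x, hx⟩, by simp⟩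
    | zero => exact ⟨0, by simp⟩
    | add x y _ _ hx hy =>
      obtain ⟨f, rfl⟩ := hx
      obtain ⟨g, rfl⟩ := hy
      exact ⟨f + g, by simp⟩

namespace GradedSpace
variable (Q : GradedSpace.{u})

theorem bijective : Function.Bijective (DirectSum.coeLinearMap Q.deg) := Q.internal

/-- The homogeneous component of degree `i`. -/
noncomputable def comp (i : ℤ) : Q →ₗ[ℂ] Q :=
  (Q.deg i).subtype ∘ₗ DirectSum.component ℂ ℤ (fun i => Q.deg i) i ∘ₗ
    (LinearEquiv.ofBijective (DirectSum.coeLinearMap Q.deg) Q.bijective).symm.toLinearMap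

theorem comp_apply (i j : ℤ) (x : Q) (hx : x ∈ Q.deg i) :
    Q.comp j x = if i = j then x else 0 := by
  have : (LinearEquiv.ofBijective (DirectSum.coeLinearMap Q.deg) Q.bijective).symm x =
      DirectSum.lof ℂ ℤ (fun i => Q.deg i) i ⟨x, hx⟩ := by
    rw [LinearEquiv.symm_apply_eq, LinearEquiv.ofBijective_apply, DirectSum.coeLinearMap_lof]
  simp only [comp, LinearMap.comp_apply, LinearEquiv.coe_coe, this]
  split_ifs with h
  · subst h; simp
  · rw [DirectSum.component.of, dif_neg h]; rfl

theorem comp_mem (i : ℤ) (x : Q) : Q.comp i x ∈ Q.deg i := Subtype.prop _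

theorem induction {motive : Q → Prop} (mem : ∀ i, ∀ x ∈ Q.deg i, motive x) (zero : motive 0)
    (add : ∀ x y, motive x → motive y → motive (x + y)) (x : Q) : motive x := by
  have hx : x ∈ ⨆ d, Q.deg d := by rw [Q.internal.submodule_iSup_eq_top]; trivial
  exact Submodule.iSup_induction Q.deg (motive := motive) hx mem zero add

theorem exists_sum (x : Q) : ∃ s : Finset ℤ, x = ∑ i ∈ s, Q.comp i x := by
  have h2 : ∀ x : Q, ∃ t : Finset ℤ, ∀ s, t ⊆ s → x = ∑ i ∈ s, Q.comp i x := by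
    intro x
    induction x using Q.induction with
    | mem i x hx =>
      refine ⟨{i}, fun s hs => ?_⟩
      rw [Finset.sum_eq_single i]
      · rw [Q.comp_apply i i x hx, if_pos rfl]
      · intro j _ hj; rw [Q.comp_apply i j x hx, if_neg (Ne.symm hj)]
      · intro h; exact absurd (hs (Finset.mem_singleton_self i)) h
    | zero => exact ⟨∅, by simp⟩
    | add x y hx hy =>
      obtain ⟨s, hs⟩ := hx
      obtain ⟨t, ht⟩ := hy
      refine ⟨s ∪ t, fun r hr => ?_⟩
      simp only [map_add, Finset.sum_add_distrib]
      rw [← hs r (Finset.union_subset_left hr), ← ht r (Finset.union_subset_right hr)]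
  obtain ⟨t, ht⟩ := h2 x
  exact ⟨t, ht t subset_rfl⟩


theorem comp_d (d : Q →ₗ[ℂ] Q) (hd : ∀ i, ∀ x ∈ Q.deg i, d x ∈ Q.deg (i + 1)) (i : ℤ) (x : Q) :
    Q.comp (i + 1) (d x) = d (Q.comp i x) := by
  induction x using Q.induction with
  | mem j x hx =>
    rw [Q.comp_apply (j + 1) _ _ (hd j x hx), Q.comp_apply j i x hx]
    by_cases h : j = i <;> simp [h]
  | zero => simp
  | add x y hx hy => simp [hx, hy]

theorem sgn_d (d : Q →ₗ[ℂ] Q) (hd : ∀ i, ∀ x ∈ Q.deg i, d x ∈ Q.deg (i + 1)) (x : Q) :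
    Q.sgn (d x) = - d (Q.sgn x) := by
  induction x using Q.induction with
  | mem j x hx =>
    rw [Q.sgn_apply _ _ (hd j x hx), Q.sgn_apply j x hx, map_smul, zpow_add_one₀ (by simp)]
    simp
  | zero => simp
  | add x y hx hy => simp [hx, hy]; abel

/-- The quotient `ker d / im d` (the kernel of `d` modulo its intersection with the image). -/
abbrev Coh (d : Q →ₗ[ℂ] Q) : Type u :=
  ↥(LinearMap.ker d) ⧸ (LinearMap.range d).comap (LinearMap.ker d).subtype

/-- The cohomology class of a cocycle. -/
noncomputable def cls (d : Q →ₗ[ℂ] Q) : LinearMap.ker d →ₗ[ℂ] Q.Coh d := Submodule.mkQ _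

/-- The map on cohomology induced by a linear map which preserves kernel and image of `d`. -/
noncomputable def cohMap (d : Q →ₗ[ℂ] Q) (f : Q →ₗ[ℂ] Q) (h1 : ∀ x, d x = 0 → d (f x) = 0)
    (h2 : ∀ y, ∃ z, f (d y) = d z) : Q.Coh d →ₗ[ℂ] Q.Coh d :=
  Submodule.mapQ _ _ (f.restrict (p := LinearMap.ker d) (q := LinearMap.ker d)
    (fun x hx => LinearMap.mem_ker.2 (h1 x (LinearMap.mem_ker.1 hx))))
    (by
      rintro x ⟨y, hy⟩
      obtain ⟨z, hz⟩ := h2 y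
      refine ⟨z, ?_⟩
      rw [← hz, hy]; rfl)

/-- The cohomology of a graded vector space with respect to a linear map of degree one. -/
noncomputable def cohomology (d : Q →ₗ[ℂ] Q) (hd : ∀ i, ∀ x ∈ Q.deg i, d x ∈ Q.deg (i + 1)) :
    GradedSpace.{u} where
  carrier := Q.Coh d
  deg i := ((Q.deg i).comap (LinearMap.ker d).subtype).map (Q.cls d)
  internal := by
    have h1 : ∀ i x, d x = 0 → d (Q.comp i x) = 0 := fun i x hx => by
      rw [← Q.comp_d d hd, hx, map_zero]
    have h2 : ∀ i y, ∃ z, Q.comp i (d y) = d z := fun i y =>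
      ⟨Q.comp (i - 1) y, by rw [← Q.comp_d d hd, sub_add_cancel]⟩
    refine isInternal_of_proj _ (fun i => Q.cohMap d (Q.comp i) (h1 i) (h2 i)) ?_ ?_ ?_
    · rintro i _ ⟨x, hx, rfl⟩
      refine congrArg (Q.cls d) (Subtype.ext ?_)
      exact (Q.comp_apply i i x hx).trans (if_pos rfl)
    · rintro i j hij _ ⟨x, hx, rfl⟩
      refine Eq.trans (congrArg (Q.cls d) (a₂ := 0) (Subtype.ext ?_)) (map_zero _)
      exact (Q.comp_apply i j x hx).trans (if_neg hij)
    · refine eq_top_iff.2 fun a _ => ?_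
      obtain ⟨x, rfl⟩ := Submodule.mkQ_surjective _ a
      obtain ⟨s, hs⟩ := Q.exists_sum x.1
      have : x = ∑ i ∈ s, (⟨Q.comp i x.1, h1 i x.1 x.2⟩ : LinearMap.ker d) := by
        apply Subtype.ext; rw [AddSubmonoidClass.coe_finsetSum]; exact hs
      rw [this, map_sum]
      refine Submodule.sum_mem _ fun i _ => Submodule.mem_iSup_of_mem i ?_
      exact ⟨_, Q.comp_mem i x.1, rfl⟩
  sgn := Q.cohMap d Q.sgn
    (fun x hx => by rw [← neg_eq_zero, ← Q.sgn_d d hd, hx, map_zero])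
    (fun y => ⟨- Q.sgn y, by rw [Q.sgn_d d hd, map_neg]⟩)
  sgn_apply := by
    rintro i _ ⟨x, hx, rfl⟩
    rw [← map_smul]
    exact congrArg (Q.cls d) (Subtype.ext (Q.sgn_apply i x hx))

/-- The cohomology class of a cocycle. -/
noncomputable def classOf (d : Q →ₗ[ℂ] Q) (hd : ∀ i, ∀ x ∈ Q.deg i, d x ∈ Q.deg (i + 1)) :
    LinearMap.ker d →ₗ[ℂ] Q.cohomology d hd := Q.cls d

end GradedSpace

/-- The cohomology F-manifold `𝓕` on a dg Gerstenhaber algebra `Q` with differential `d`, bracket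
`br` and product `mul`: its vector field is `q ↦ d q + [q, q]/2` (for `q` even), and its product is
induced by the constant product of vector fields given by `mul`. -/
structure IsGerstenhaberFManifold {Q : GradedSpace.{u}} (mul : Q →ₗ[ℂ] Q →ₗ[ℂ] Q) (d : Q →ₗ[ℂ] Q)
    (br : Q →ₗ[ℂ] Q →ₗ[ℂ] Q)
    (hbr : ∀ (p q : ℕ) (x y : Q), Q.HasParity p x → Q.HasParity q y →
      br (Q.sgn x) y = (-1 : ℂ) ^ (p * q) • br (Q.sgn y) x)
    (𝓕 : CohomologyFManifold Q) : Prop where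
  X_eq : 𝓕.X = GSym.quad d (br ∘ₗ Q.sgn) hbr
  vmul_closed : ∀ V W : LinearMap.ker (dX 𝓕.X), dX 𝓕.X (vmul mul V.1 W.1) = 0
  star_mk : ∀ V W U : LinearMap.ker (dX 𝓕.X), U.1 = vmul mul V.1 W.1 →
    𝓕.star (VFH.mk 𝓕.X V) (VFH.mk 𝓕.X W) = VFH.mk 𝓕.X U

/-- The cohomology F-manifold `𝓗` on the cohomology of `Q` is obtained from the cohomology F-manifold
`𝓕` on `Q` by homotopy transfer: its vector field has no linear part, it is equivalent to `𝓕` by a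
morphism whose linear part chooses representatives of cohomology classes, and at the tangent space
at zero its product is the one induced by `mul`. -/
structure IsTransfer {Q : GradedSpace.{u}} (mul : Q →ₗ[ℂ] Q →ₗ[ℂ] Q) (d : Q →ₗ[ℂ] Q)
    (hd : ∀ i, ∀ x ∈ Q.deg i, d x ∈ Q.deg (i + 1)) (𝓕 : CohomologyFManifold Q)
    (𝓗 : CohomologyFManifold (Q.cohomology d hd)) : Prop where
  minimal : ∀ x, 𝓗.X (GSym.ι (Q.cohomology d hd) x) = 0
  equivalent : ∃ E : CohomologyFManifold.Equivalence 𝓗 𝓕, ∀ x : Q.cohomology d hd,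
    ∃ a : LinearMap.ker d, E.toMorphism.linearPart x = a.1 ∧ x = Q.classOf d hd a
  star_zero : ∀ V W U : LinearMap.ker (dX 𝓗.X),
    𝓗.star (VFH.mk 𝓗.X V) (VFH.mk 𝓗.X W) = VFH.mk 𝓗.X U →
    ∀ a b c : LinearMap.ker d, V.1 1 = Q.classOf d hd a → W.1 1 = Q.classOf d hd b → c.1 = mul a.1 b.1 →
      U.1 1 = Q.classOf d hd c

end ExtDef

namespace PolyForm

section Global
variable {n : ℕ} {M : Type*} [TopologicalSpace M] [ChartedSpace (Fin n → ℂ) M]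

/-- Restriction of smooth functions. -/
def restr {W W' : TopologicalSpace.Opens M} (h : W' ≤ W) : SmoothFun n W →ₐ[ℂ] SmoothFun n W' where
  toFun f := ⟨fun x => f.1 ⟨x.1, h x.2⟩, by
    change ContMDiffOn _ _ _ _ _
    refine ContMDiffOn.congr (f := extz W f.1) (ContMDiffOn.mono f.2 h) fun x hx => ?_
    rw [extz_of_mem _ hx, extz_of_mem _ (h hx)]⟩
  map_one' := rfl
  map_mul' _ _ := rfl
  map_zero' := rfl
  map_add' _ _ := rfl
  commutes' _ := rfl

/-- The domain of a chart. -/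
def dom (e : atlas (Fin n → ℂ) M) : TopologicalSpace.Opens M := ⟨e.1.source, e.1.open_source⟩

theorem dom_subset (e : atlas (Fin n → ℂ) M) : (dom e : Set M) ⊆ e.1.source := fun _ h => h

/-- Polyvector-valued forms over the open set `W`, written in the frame of a chart. -/
abbrev LocForm (n : ℕ) {M : Type*} [TopologicalSpace M] [ChartedSpace (Fin n → ℂ) M]
    (W : TopologicalSpace.Opens M) : Type _ := SmoothFun n W ⊗[ℂ] Fib n

variable [IsManifold 𝓘(ℂ, Fin n → ℂ) ω M]

theorem restr_pdDer (e : atlas (Fin n → ℂ) M) {W W' : TopologicalSpace.Opens M} (h : W' ≤ W)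
    (hW : (W : Set M) ⊆ e.1.source) (v : Fin n → ℂ) (f : SmoothFun n W) :
    restr h (pdDer e hW v f) = pdDer e (Set.Subset.trans h hW) v (restr h f) := by
  apply Subtype.ext; funext x
  change fderiv ℝ (extz W f.1 ∘ e.1.symm) (e.1 x) v =
    fderiv ℝ (extz W' (restr h f).1 ∘ e.1.symm) (e.1 x) v
  have : extz W f.1 ∘ e.1.symm =ᶠ[nhds (e.1 x)] extz W' (restr h f).1 ∘ e.1.symm := by
    filter_upwards [near (Set.Subset.trans h hW) x.2] with z hz
    simp only [Function.comp_apply]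
    rw [extz_of_mem _ hz.1, extz_of_mem _ (h hz.1)]; rfl
  rw [this.fderiv_eq]

theorem restr_dz (e : atlas (Fin n → ℂ) M) {W W' : TopologicalSpace.Opens M} (h : W' ≤ W)
    (hW : (W : Set M) ⊆ e.1.source) (i : Fin n) (f : SmoothFun n W) :
    restr h (dz e hW i f) = dz e (Set.Subset.trans h hW) i (restr h f) := by
  simp only [dz, Derivation.smul_apply, Derivation.sub_apply, map_smul, map_sub, restr_pdDer]

theorem restr_dzbar (e : atlas (Fin n → ℂ) M) {W W' : TopologicalSpace.Opens M} (h : W' ≤ W)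
    (hW : (W : Set M) ⊆ e.1.source) (i : Fin n) (f : SmoothFun n W) :
    restr h (dzbar e hW i f) = dzbar e (Set.Subset.trans h hW) i (restr h f) := by
  simp only [dzbar, Derivation.smul_apply, Derivation.add_apply, map_smul, map_add, restr_pdDer]

section
variable (e e' : atlas (Fin n → ℂ) M) {W : TopologicalSpace.Opens M}
    (hW : (W : Set M) ⊆ e.1.source) (hW' : (W : Set M) ⊆ e'.1.source)

/-- The change of frames: rewrites a form given in the frame `dz̄'_j, ∂/∂z'_j` of `e'` in the frame
`dz̄_i, ∂/∂z_i` of `e`, by `dz̄'_j = ∑ (∂z̄'_j/∂z̄_i) dz̄_i`, `∂/∂z'_j = ∑ (∂z_i/∂z'_j) ∂/∂z_i`. -/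
noncomputable def transition : LocForm n W →ₐ[ℂ] LocForm n W :=
  frameChange (fun j i => dzbar e hW i (conjCoordFun e' hW' j))
    (fun j i => dz e' hW' j (coordFun e hW i))

theorem locDbar_transition (a : LocForm n W) :
    locDbar (dzbar e hW) (transition e e' hW hW' a) =
      transition e e' hW hW' (locDbar (dzbar e' hW') a) := by
  refine locDbar_frameChange _ _ _ _ (dzbar_change e e' hW hW') ?_ ?_ a
  · intro j i k
    exact dzbar_dzbar e hW k i _
  · intro j i k
    rw [dzbar_change e e' hW hW']
    refine Finset.sum_eq_zero fun l _ => ?_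
    rw [← dz_dzbar, dzbar_coordFun, map_zero, mul_zero]

theorem locBracket_transition (a b : LocForm n W) :
    locBracket (dz e hW) (transition e e' hW hW' a) (transition e e' hW hW' b) =
      transition e e' hW hW' (locBracket (dz e' hW') a b) := by
  refine locBracket_frameChange _ _ (fun i j => dz e hW i (coordFun e' hW' j)) _ _
    (dz_change e e' hW hW') ?_ ?_ ?_ a b
  · intro j k
    rw [← dz_change e' e hW' hW, dz_coordFun_self]
  · intro j k l
    rw [← dz_change e' e hW' hW, ← dz_change e' e hW' hW, dz_dz]
  · intro j i k
    rw [dz_dzbar, dz_conjCoordFun, map_zero]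

end

theorem inter_left (e e' : atlas (Fin n → ℂ) M) :
    ((dom e ⊓ dom e' : TopologicalSpace.Opens M) : Set M) ⊆ e.1.source := Set.inter_subset_left

theorem inter_right (e e' : atlas (Fin n → ℂ) M) :
    ((dom e ⊓ dom e' : TopologicalSpace.Opens M) : Set M) ⊆ e'.1.source := Set.inter_subset_right

theorem restr_locDbar (e : atlas (Fin n → ℂ) M) {W W' : TopologicalSpace.Opens M} (h : W' ≤ W)
    (hW : (W : Set M) ⊆ e.1.source) (hW' : (W' : Set M) ⊆ e.1.source) (a : LocForm n W) :
    baseMap (restr h) (locDbar (dzbar e hW) a) = locDbar (dzbar e hW') (baseMap (restr h) a) :=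
  baseMap_locDbar (fun i f => restr_dzbar e h hW i f) a

theorem restr_locBracket (e : atlas (Fin n → ℂ) M) {W W' : TopologicalSpace.Opens M} (h : W' ≤ W)
    (hW : (W : Set M) ⊆ e.1.source) (hW' : (W' : Set M) ⊆ e.1.source) (a b : LocForm n W) :
    baseMap (restr h) (locBracket (dz e hW) a b) =
      locBracket (dz e hW') (baseMap (restr h) a) (baseMap (restr h) b) :=
  baseMap_locBracket (r := restr h) (δ := dz e hW) (δ' := dz e hW') (restr_dz e h hW) a b

variable (n M) in
/-- Families of local representations in the charts of the atlas. -/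
def Fam : Type _ := ∀ e : atlas (Fin n → ℂ) M, LocForm n (dom e)

noncomputable instance : Ring (Fam n M) :=
  inferInstanceAs (Ring (∀ e : atlas (Fin n → ℂ) M, LocForm n (dom e)))

noncomputable instance : Algebra ℂ (Fam n M) :=
  inferInstanceAs (Algebra ℂ (∀ e : atlas (Fin n → ℂ) M, LocForm n (dom e)))

/-- The local representations `a e`, `a e'` in two charts agree on the intersection of the chart
domains. -/
def Agree (a : Fam n M) (e e' : atlas (Fin n → ℂ) M) : Prop :=
  baseMap (restr (inf_le_left : dom e ⊓ dom e' ≤ dom e)) (a e) =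
    transition e e' (inter_left e e') (inter_right e e')
      (baseMap (restr (inf_le_right : dom e ⊓ dom e' ≤ dom e')) (a e'))

variable (n M) in
/-- The algebra `⨁ A^{0,q}(⋀^p T)` of smooth `(0,*)`-forms with values in polyvector fields on the
complex manifold `M`: families of local representations in the charts of the atlas, compatible with
the change of frames. -/
noncomputable def forms : Subalgebra ℂ (Fam n M) where
  carrier := {a | ∀ e e', Agree a e e'}
  mul_mem' {a b} ha hb e e' := by
    have h1 := ha e e'
    have h2 := hb e e'
    unfold Agree at h1 h2 ⊢
    refine (map_mul _ (a e) (b e)).trans (Eq.trans ?_ (congrArg _ (map_mul _ (a e') (b e')).symm))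
    rw [map_mul, h1, h2]
  add_mem' {a b} ha hb e e' := by
    have h1 := ha e e'
    have h2 := hb e e'
    unfold Agree at h1 h2 ⊢
    refine (map_add _ (a e) (b e)).trans (Eq.trans ?_ (congrArg _ (map_add _ (a e') (b e')).symm))
    rw [map_add, h1, h2]
  algebraMap_mem' c e e' := by
    refine (AlgHom.commutes _ c).trans (Eq.trans ?_ (congrArg _ (AlgHom.commutes _ c).symm))
    rw [AlgHom.commutes]

variable (n M) in
/-- The type of polyvector-valued forms. -/
def Forms : Type _ := forms n M

noncomputable instance : Ring (Forms n M) := inferInstanceAs (Ring (forms n M))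

noncomputable instance : Algebra ℂ (Forms n M) := inferInstanceAs (Algebra ℂ (forms n M))

/-- The local representation of a form in a chart. -/
noncomputable def at_ (e : atlas (Fin n → ℂ) M) : Forms n M →ₗ[ℂ] LocForm n (dom e) where
  toFun a := a.1 e
  map_add' _ _ := rfl
  map_smul' _ _ := rfl

theorem Forms.ext {a b : Forms n M} (h : ∀ e, at_ e a = at_ e b) : a = b :=
  Subtype.ext (funext h)

theorem Forms.agree (a : Forms n M) (e e' : atlas (Fin n → ℂ) M) :
    baseMap (restr (inf_le_left : dom e ⊓ dom e' ≤ dom e)) (at_ e a) =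
    transition e e' (inter_left e e') (inter_right e e')
      (baseMap (restr (inf_le_right : dom e ⊓ dom e' ≤ dom e')) (at_ e' a)) := a.2 e e' 

/-- A linear operator on forms given by linear operators in the charts. -/
noncomputable def glue (L : ∀ e : atlas (Fin n → ℂ) M, LocForm n (dom e) →ₗ[ℂ] LocForm n (dom e))
    (h : ∀ a : Forms n M, ∀ e e', Agree (fun e => L e (at_ e a)) e e') :
    Forms n M →ₗ[ℂ] Forms n M where
  toFun a := ⟨fun e => L e (at_ e a), h a⟩
  map_add' a b := by
    exact Forms.ext fun e => map_add (L e) (at_ e a) (at_ e b)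
  map_smul' c a := by
    exact Forms.ext fun e => map_smul (L e) c (at_ e a)

variable (n M)

/-- The Dolbeault operator `∂̄`, in a chart `∑ dz̄_i ∧ ∂/∂z̄_i`. -/
noncomputable def dbar : Forms n M →ₗ[ℂ] Forms n M :=
  glue (fun e => locDbar (dzbar e (dom_subset e))) fun a e e' => by
    have h := a.agree e e'
    unfold Agree
    beta_reduce
    rw [restr_locDbar e _ _ (inter_left e e'), restr_locDbar e' _ _ (inter_right e e'), h,
      locDbar_transition]

/-- The parity operator. -/
noncomputable def sgn : Forms n M →ₗ[ℂ] Forms n M :=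
  glue (fun _ => locSgn.toLinearMap) fun a e e' => by
    have h := a.agree e e'
    unfold Agree
    beta_reduce
    simp only [AlgHom.toLinearMap_apply]
    rw [baseMap_locSgn, baseMap_locSgn, h]
    exact frameChange_locSgn _ _ _

/-- The projection to the forms in `⨁_{p+q=k} A^{0,q}(⋀^p T)`. -/
noncomputable def degProj (k : ℕ) : Forms n M →ₗ[ℂ] Forms n M :=
  glue (fun _ => locProj k) fun a e e' => by
    have h := a.agree e e'
    unfold Agree
    beta_reduce
    rw [baseMap_locProj, baseMap_locProj, h]
    exact frameChange_locProj _ _ _ _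

/-- The Schouten bracket of polyvector-valued forms, in a chart
`[x, y] = ∑ ((-1)^{|x|-1} (∂x/∂θ_i) ∧ ∂y/∂z_i - ∂x/∂z_i ∧ ∂y/∂θ_i)`, where `θ_i = ∂/∂z_i`. -/
noncomputable def schouten : Forms n M →ₗ[ℂ] Forms n M →ₗ[ℂ] Forms n M :=
  LinearMap.mk₂ ℂ (fun a b => (⟨fun e => locBracket (dz e (dom_subset e)) (at_ e a) (at_ e b), by
      intro e e'
      unfold Agree
      beta_reduce
      rw [restr_locBracket e _ _ (inter_left e e'), restr_locBracket e' _ _ (inter_right e e'),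
        a.agree e e', b.agree e e', locBracket_transition]⟩ : Forms n M))
    (fun a a' b => Forms.ext fun e => by exact LinearMap.map_add₂ _ _ _ _)
    (fun c a b => Forms.ext fun e => by exact LinearMap.map_smul₂ _ _ _ _)
    (fun a b b' => Forms.ext fun e => by exact map_add (locBracket (dz e (dom_subset e)) (at_ e a)) _ _)
    (fun c a b => Forms.ext fun e => by exact map_smul (locBracket (dz e (dom_subset e)) (at_ e a)) c _)

/-- The projection to the part of degree `d`, where elements of `A^{0,q}(⋀^p T)` have degree
`p + q - 2`. -/
noncomputable def shiftProj (d : ℤ) : Forms n M →ₗ[ℂ] Forms n M :=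
  if 0 ≤ d + 2 then degProj n M (d + 2).toNat else 0

theorem degProj_degProj (j k : ℕ) (a : Forms n M) :
    degProj n M j (degProj n M k a) = if j = k then degProj n M k a else 0 := by
  have : ∀ e, at_ e (degProj n M j (degProj n M k a)) =
      if j = k then at_ e (degProj n M k a) else 0 := fun e => locProj_locProj j k (at_ e a)
  refine Forms.ext fun e => ?_
  rw [this]
  split_ifs <;> simp

theorem shiftProj_shiftProj (i j : ℤ) (a : Forms n M) :
    shiftProj n M i (shiftProj n M j a) = if i = j then shiftProj n M j a else 0 := by
  unfold shiftProj
  by_cases hi : 0 ≤ i + 2 <;> by_cases hj : 0 ≤ j + 2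
  · rw [if_pos hi, if_pos hj, degProj_degProj]
    exact if_congr (by omega) rfl rfl
  · simp [hj]
  · rw [if_neg hi, LinearMap.zero_apply, if_neg (by omega)]
  · simp [hi, hj]

theorem dbar_shiftProj (d : ℤ) (a : Forms n M) :
    shiftProj n M (d + 1) (dbar n M a) = dbar n M (shiftProj n M d a) := by
  unfold shiftProj
  by_cases h1 : 0 ≤ d + 1 + 2 <;> by_cases h2 : 0 ≤ d + 2 <;>
    simp only [h1, h2, if_true, if_false]
  · obtain ⟨k, hk⟩ : ∃ k : ℕ, d + 2 = k := ⟨(d + 2).toNat, by omega⟩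
    have e1 : (d + 1 + 2).toNat = k + 1 := by omega
    have e2 : (d + 2).toNat = k := by omega
    rw [e1, e2]
    refine Forms.ext fun e => ?_
    exact locDbar_locProj _ k (at_ e a)
  · have e1 : (d + 1 + 2).toNat = 0 := by omega
    rw [e1, LinearMap.zero_apply, map_zero]
    refine Forms.ext fun e => ?_
    exact locDbar_locProj_zero _ (at_ e a)
  · omega
  · simp

open ExtDef

/-- The graded vector space of polyvector-valued forms, `A^{0,q}(⋀^p T)` in degree `p + q - 2`. -/
noncomputable def formsGraded : GradedSpace where
  carrier := Forms n M
  deg d := LinearMap.eqLocus (shiftProj n M d) LinearMap.id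
  internal := by
    refine isInternal_of_proj _ (shiftProj n M) (fun i x hx => hx) ?_ ?_
    · intro i j hij x hx
      have hx' : shiftProj n M i x = x := hx
      rw [← hx', shiftProj_shiftProj, if_neg (Ne.symm hij)]
    · refine eq_top_iff.2 fun a _ => ?_
      have : a = ∑ k ∈ Finset.range (2 * n + 1), shiftProj n M ((k : ℤ) - 2) a := by
        have e0 : ∀ k : ℕ, shiftProj n M ((k : ℤ) - 2) = degProj n M k := by
          intro k
          simp [shiftProj]
        simp only [e0]
        refine Forms.ext fun e => ?_
        rw [map_sum]
        exact (locProj_sum (at_ e a)).symm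
      rw [this]
      refine Submodule.sum_mem _ fun k _ => Submodule.mem_iSup_of_mem ((k : ℤ) - 2) ?_
      change shiftProj n M _ (shiftProj n M _ a) = shiftProj n M _ a
      rw [shiftProj_shiftProj, if_pos rfl]
  sgn := sgn n M
  sgn_apply := by
    intro d x hx
    have hx' : shiftProj n M d x = x := hx
    by_cases h : 0 ≤ d + 2
    · obtain ⟨k, hk⟩ : ∃ k : ℕ, d + 2 = k := ⟨(d + 2).toNat, by omega⟩
      have e2 : (d + 2).toNat = k := by omega
      have hs : (-1 : ℂ) ^ d = (-1 : ℂ) ^ k := by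
        have : d = (k : ℤ) - 2 := by omega
        rw [this, zpow_sub₀ (by simp)]; simp
      rw [shiftProj, if_pos h, e2] at hx'
      rw [hs, ← hx']
      refine Forms.ext fun e => ?_
      rw [map_smul]
      exact locSgn_locProj k (at_ e x)
    · rw [shiftProj, if_neg h] at hx'
      have hx0 : x = 0 := hx'.symm
      rw [hx0, map_zero, smul_zero]

/-- The wedge product of polyvector-valued forms. -/
noncomputable def wedge : formsGraded n M →ₗ[ℂ] formsGraded n M →ₗ[ℂ] formsGraded n M :=
  LinearMap.mul ℂ (Forms n M)

/-- The Dolbeault operator on the graded vector space of forms. -/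
noncomputable def del : formsGraded n M →ₗ[ℂ] formsGraded n M := dbar n M

/-- The Schouten bracket on the graded vector space of forms. -/
noncomputable def brk : formsGraded n M →ₗ[ℂ] formsGraded n M →ₗ[ℂ] formsGraded n M := schouten n M

theorem dbar_degree (i : ℤ) (x : Forms n M) (hx : shiftProj n M i x = x) :
    shiftProj n M (i + 1) (dbar n M x) = dbar n M x := by
  rw [dbar_shiftProj, hx]

theorem schouten_symm (p q : ℕ) (x y : Forms n M) (hx : sgn n M x = (-1 : ℂ) ^ p • x)
    (hy : sgn n M y = (-1 : ℂ) ^ q • y) : schouten n M (sgn n M x) y =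
      (-1 : ℂ) ^ (p * q) • schouten n M (sgn n M y) x := by
  have hx' : ∀ e, locSgn (at_ e x) = (-1 : ℂ) ^ p • at_ e x := fun e =>
    (congrArg (at_ e) hx).trans (map_smul _ _ _)
  have hy' : ∀ e, locSgn (at_ e y) = (-1 : ℂ) ^ q • at_ e y := fun e =>
    (congrArg (at_ e) hy).trans (map_smul _ _ _)
  refine Forms.ext fun e => ?_
  rw [map_smul]
  exact locBracket_symm _ p q _ _ (hx' e) (hy' e)

theorem del_degree : ∀ i, ∀ x ∈ (formsGraded n M).deg i, del n M x ∈ (formsGraded n M).deg (i + 1) :=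
  dbar_degree n M

theorem brk_symm : ∀ (p q : ℕ) (x y : formsGraded n M), (formsGraded n M).HasParity p x →
    (formsGraded n M).HasParity q y → brk n M ((formsGraded n M).sgn x) y =
      (-1 : ℂ) ^ (p * q) • brk n M ((formsGraded n M).sgn y) x :=
  schouten_symm n M

/-- The Dolbeault cohomology `⨁ H^q(M, ⋀^p T)`, with `H^q(M, ⋀^p T)` in degree `p + q - 2`. -/
noncomputable def dolbeault : GradedSpace :=
  (formsGraded n M).cohomology (del n M) (del_degree n M)

/-- The extended deformation theory of complex structures on `M` equips the Dolbeault cohomology of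
polyvector fields with the cohomology F-manifold structure `𝓗`: it is obtained by homotopy transfer
from the cohomology F-manifold of the dg Gerstenhaber algebra of polyvector-valued forms. -/
def IsDeformationFManifold (𝓗 : CohomologyFManifold (dolbeault n M)) : Prop :=
  ∃ 𝓕 : CohomologyFManifold (formsGraded n M),
    IsGerstenhaberFManifold (wedge n M) (del n M) (brk n M) (brk_symm n M) 𝓕 ∧
    IsTransfer (wedge n M) (del n M) (del_degree n M) 𝓕 𝓗

end Global

section CalabiYau
variable (n : ℕ) (M : Type*) [TopologicalSpace M] [ChartedSpace (Fin n → ℂ) M]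

/-- The entry `∂z'_k/∂z_i` of the Jacobian matrix of a change of coordinates. -/
noncomputable def jac {n : ℕ} {M : Type*} [TopologicalSpace M] [ChartedSpace (Fin n → ℂ) M]
    (e e' : atlas (Fin n → ℂ) M) (x : M) : Matrix (Fin n) (Fin n) ℂ :=
  fun k i => fderiv ℂ (e'.1 ∘ e.1.symm) (e.1 x) (Pi.single i 1) k

/-- A nowhere vanishing holomorphic `n`-form, in the chart `e` equal to `w e • dz_1 ∧ ⋯ ∧ dz_n`. -/
structure IsHolomorphicVolumeForm (w : atlas (Fin n → ℂ) M → M → ℂ) : Prop where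
  ne_zero : ∀ e, ∀ x ∈ e.1.source, w e x ≠ 0
  holomorphic : ∀ e, DifferentiableOn ℂ (w e ∘ e.1.symm) e.1.target
  change : ∀ e e', ∀ x ∈ e.1.source ∩ e'.1.source, w e x = (jac e e' x).det * w e' x

/-- A Kähler metric, in the chart `e` equal to `∑ (h e)_{ij} dz_i dz̄_j`. -/
structure IsKahlerMetric (h : atlas (Fin n → ℂ) M → M → Matrix (Fin n) (Fin n) ℂ) : Prop where
  smooth : ∀ e i j, ContDiffOn ℝ ∞ (fun z => h e (e.1.symm z) i j) e.1.target
  hermitian : ∀ e, ∀ x ∈ e.1.source, (h e x).IsHermitian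
  posDef : ∀ e, ∀ x ∈ e.1.source, ∀ v : Fin n → ℂ, v ≠ 0 →
    0 < (∑ i, ∑ j, v i * (starRingEnd ℂ) (v j) * h e x i j).re
  change : ∀ e e', ∀ x ∈ e.1.source ∩ e'.1.source, ∀ i j,
    h e x i j = ∑ k, ∑ l, jac e e' x k i * (starRingEnd ℂ) (jac e e' x l j) * h e' x k l
  closed : ∀ e, ∀ x ∈ e.1.source, ∀ i j k,
    wirt e.1 k (fun y => h e y i j) x = wirt e.1 i (fun y => h e y k j) x

/-- A Calabi-Yau manifold: a Kähler manifold with a holomorphic volume form. -/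
def IsCalabiYau : Prop :=
  (∃ w, IsHolomorphicVolumeForm n M w) ∧ ∃ h, IsKahlerMetric n M h

end CalabiYau
end PolyForm

/-!
The polyvector-valued forms of a complex manifold are a dg Gerstenhaber algebra. In a chart the
Schouten bracket is generated by the second order operator `bv = ∑ ∂/∂θ_i ∂/∂z_i`: it is the failure of
`bv` to be a derivation of the wedge product (`locBracket_locSgn`). Since `bv` squares to zero and
anticommutes with `∂̄`, the Jacobi identity and the Leibniz rule for `∂̄` follow formally
(`isDGGerstenhaber_forms`).

All the rest of the first part is algebra, and holds for every dg Gerstenhaber algebra `Q`. In the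
grading of the dg manifold the bracket becomes a graded symmetric operation `b` of degree one
(`IsDGGerstenhaber.isShifted`), and the vector field is `X(q) = d q + b(q, q)/2`. Let `c = (i, p, h)` be
a contraction of `Q` onto its cohomology (`exists_contraction`). The equation `f = i - h(b(f, f)/2)` has
a solution among formal power series, and `f` is a morphism to `X` from the vector field
`X' = p(b(f, f)/2)`, whose linear part vanishes (`exists_homotopyTransfer`). The vector fields along `f`
form a complex with the differential `alongD`, on which the product of `Q` acts by the Leibniz rule
(`IsMC.alongD_mul`). Both pushing forward vector fields from the cohomology and pulling back vector
fields from `Q` are quasi-isomorphisms to this complex (`IsHomotopyTransfer.exists_pushEquiv`,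
`IsHomotopyTransfer.exists_pullEquiv`), so that the product of the fields along `f` gives products on
both sides which correspond to each other. For the push-forward one brings a field `Z` along `f` into
the gauge `h Z = 0` by solving a fixed point equation. For the pull-back, which is surjective, one shows
that the fields vanishing along `f` are acyclic: the contraction induces a homotopy of the symmetric
algebra (`exists_symHomotopy`) which inverts the differential up to terms of higher order. Formal maps
are treated as coalgebra maps throughout: the exponential of `f` is the solution of a linear
differential equation (`IsExp`), and identities between formal functions are proved by comparing
derivatives at the origin, or order by order.

For the second part let `M` be the affine line, with its flat metric and `dz`. A formal Frobenius
manifold has the zero vector field, so that lifting to one implies smoothness. If the structure on the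
cohomology is smooth, every cohomology class is, up to a coboundary, in the image of the linear part of
a morphism `F` from some `(K, 0)` to `(A(M), X)`. The coefficient of `X ∘ F = 0` at a product `x y` of two
elements of `K` says that `b` of the linear parts of `F` at `x` and `y` is exact, so that the bracket on
cohomology vanishes (`IsTransfer.exists_br_eq_d`). But `[∂/∂z, z ∂/∂z] = ∂/∂z` is not `∂̄`-exact, as exact
forms have no component without `dz̄` (`exists_bracket_ne_dbar`).
-/

/-! ### Parity, induction on words, and convolution in the symmetric algebra -/

namespace ExtDef

universe u

namespace GradedSpace
variable (Q : GradedSpace.{u})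

theorem hasParity_even (x : Q) : Q.HasParity 0 (Q.even x) := by
  simp only [HasParity, even, LinearMap.smul_apply, LinearMap.add_apply, LinearMap.id_apply,
    map_smul, map_add, Q.sgn_sgn]
  module

theorem hasParity_odd (x : Q) : Q.HasParity 1 (Q.odd x) := by
  simp only [HasParity, odd, LinearMap.smul_apply, LinearMap.sub_apply, LinearMap.id_apply,
    map_smul, map_sub, Q.sgn_sgn]
  module

theorem even_add_odd (x : Q) : Q.even x + Q.odd x = x := by
  simp only [even, odd, LinearMap.smul_apply, LinearMap.add_apply, LinearMap.sub_apply,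
    LinearMap.id_apply]
  module

/-- Integral degrees give rise to parities. The latter are natural numbers, so that Koszul signs are
powers of `-1` with exponents built from `+` and `*` alone. -/
theorem exists_parity_of_mem {i : ℤ} : ∃ p : ℕ, (-1 : ℂ) ^ p = (-1 : ℂ) ^ i ∧
    ∀ x ∈ Q.deg i, Q.HasParity p x := by
  have h : (-1 : ℂ) ^ i.natAbs = (-1 : ℂ) ^ i := by
    rcases Int.natAbs_eq i with h | h
    · conv_rhs => rw [h]
      rw [zpow_natCast]
    · conv_rhs => rw [h]
      rw [zpow_neg, zpow_natCast]
      rcases Nat.even_or_odd i.natAbs with h | h <;> simp [h.neg_one_pow]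
  exact ⟨i.natAbs, h, fun x hx => by rw [HasParity, Q.sgn_apply i x hx, h]⟩

end GradedSpace

theorem neg_one_pow_mul_self (n : ℕ) : (-1 : ℂ) ^ n * (-1 : ℂ) ^ n = 1 := by
  rw [← mul_pow]; simp

namespace GSym
variable {P Q : GradedSpace.{u}}

/-- `a ∈ S(Q)` has parity `p`. -/
def HasParity (p : ℕ) (a : GSym Q) : Prop := sgn Q a = (-1 : ℂ) ^ p • a

theorem hasParity_one : HasParity 0 (1 : GSym Q) := by simp [HasParity]

theorem hasParity_ι {p : ℕ} {x : Q} (hx : Q.HasParity p x) : HasParity p (ι Q x) := by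
  have : Q.sgn x = (-1 : ℂ) ^ p • x := hx
  rw [HasParity, sgn_ι, this, map_smul]

theorem HasParity.mul {p q : ℕ} {a b : GSym Q} (ha : HasParity p a) (hb : HasParity q b) :
    HasParity (p + q) (a * b) := by
  rw [HasParity] at *
  rw [map_mul, ha, hb, smul_mul_smul_comm, pow_add]

/-- Induction on words: `S(Q)` is spanned by `1` under multiplication from the left by generators. -/
theorem induction {motive : GSym Q → Prop} (one : motive 1)
    (mul : ∀ (p : ℕ) (x : Q) (a : GSym Q), Q.HasParity p x → motive a → motive (ι Q x * a))
    (add : ∀ a b, motive a → motive b → motive (a + b))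
    (smul : ∀ (c : ℂ) a, motive a → motive (c • a)) (a : GSym Q) : motive a := by
  have key : ∀ (t : TensorAlgebra ℂ Q) (b : GSym Q), motive b →
      motive (RingQuot.mkAlgHom ℂ (SymRel Q) t * b) := by
    intro t
    induction t using TensorAlgebra.induction with
    | algebraMap r =>
      intro b hb
      rw [AlgHom.commutes, ← Algebra.smul_def]
      exact smul r b hb
    | ι x =>
      intro b hb
      have e : RingQuot.mkAlgHom ℂ (SymRel Q) (TensorAlgebra.ι ℂ x) = ι Q x := rfl
      rw [e, ← Q.even_add_odd x, map_add, add_mul]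
      exact add _ _ (mul 0 _ _ (Q.hasParity_even x) hb) (mul 1 _ _ (Q.hasParity_odd x) hb)
    | mul s t hs ht => intro b hb; rw [map_mul, mul_assoc]; exact hs _ (ht _ hb)
    | add s t hs ht => intro b hb; rw [map_add, add_mul]; exact add _ _ (hs _ hb) (ht _ hb)
  obtain ⟨t, rfl⟩ := RingQuot.mkAlgHom_surjective ℂ (SymRel Q) a
  simpa using key t 1 one

/-- Two linear maps on `S(Q)` agree if they agree on elements of pure parity. -/
theorem linearMap_ext_parity {A : Type*} [AddCommGroup A] [Module ℂ A] {F G : GSym Q →ₗ[ℂ] A}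
    (h : ∀ p a, HasParity p a → F a = G a) : F = G := by
  ext1 a
  have h0 : HasParity 0 (a + sgn Q a) := by simp [HasParity, sgn_sgn, add_comm]
  have h1 : HasParity 1 (a - sgn Q a) := by
    rw [HasParity, map_sub, sgn_sgn]; module
  have e : a = (1 / 2 : ℂ) • ((a + sgn Q a) + (a - sgn Q a)) := by module
  rw [e, map_smul, map_smul, F.map_add (a + sgn Q a), G.map_add (a + sgn Q a), h 0 _ h0, h 1 _ h1]

theorem tensor_ext_parity {A : Type*} [AddCommGroup A] [Module ℂ A]
    {F G : GSym Q ⊗[ℂ] GSym Q →ₗ[ℂ] A}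
    (h : ∀ p q a b, HasParity p a → HasParity q b → F (a ⊗ₜ b) = G (a ⊗ₜ b)) : F = G := by
  apply TensorProduct.ext
  refine linearMap_ext_parity fun p a ha => ?_
  exact linearMap_ext_parity fun q b hb => h p q a b ha hb

/-- The `p`-th power of the parity operator, as a linear map. -/
noncomputable def tw (Q : GradedSpace.{u}) (p : ℕ) : GSym Q →ₗ[ℂ] GSym Q :=
  (sgn Q).toLinearMap ^ p

theorem tw_zero : tw Q 0 = LinearMap.id := pow_zero _

theorem tw_one : tw Q 1 = (sgn Q).toLinearMap := pow_one _

theorem tw_apply (p : ℕ) (a : GSym Q) : tw Q p a = (sgn Q)^[p] a := by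
  rw [tw, Module.End.pow_apply]; rfl

theorem tw_tw (p q : ℕ) (a : GSym Q) : tw Q p (tw Q q a) = tw Q (p + q) a := by
  rw [tw, tw, tw, pow_add]; rfl

theorem tw_parity {p q : ℕ} {a : GSym Q} (ha : HasParity q a) :
    tw Q p a = (-1 : ℂ) ^ (p * q) • a := by
  induction p with
  | zero => simp [tw_zero]
  | succ p ih =>
    rw [add_comm, ← tw_tw, ih, map_smul, tw_one, AlgHom.toLinearMap_apply,
      show sgn Q a = _ from ha, smul_smul, ← pow_add]
    congr 2; ring

theorem tw_map_one (p : ℕ) : tw Q p 1 = 1 := by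
  rw [tw_parity hasParity_one]; simp

theorem tw_ι_mul (p : ℕ) {q : ℕ} {x : Q} (hx : Q.HasParity q x) (a : GSym Q) :
    tw Q p (ι Q x * a) = (-1 : ℂ) ^ (p * q) • (ι Q x * tw Q p a) := by
  rw [tw_apply, tw_apply, iter_sgn_ι p q x hx]

/-- Left multiplication by a generator. -/
noncomputable def lm (x : Q) : GSym Q →ₗ[ℂ] GSym Q := LinearMap.mulLeft ℂ (ι Q x)

@[simp] theorem lm_apply (x : Q) (a : GSym Q) : lm x a = ι Q x * a := rfl

theorem tw_comp_lm {A : Type*} [AddCommGroup A] [Module ℂ A] (p : ℕ) {q : ℕ} {x : Q}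
    (hx : Q.HasParity q x) (F : GSym Q →ₗ[ℂ] A) :
    (F ∘ₗ tw Q p) ∘ₗ lm x = (-1 : ℂ) ^ (p * q) • ((F ∘ₗ lm x) ∘ₗ tw Q p) := by
  ext1 b
  simp [tw_ι_mul p hx]

theorem tw_comp_tw {A : Type*} [AddCommGroup A] [Module ℂ A] (p q : ℕ) (F : GSym Q →ₗ[ℂ] A) :
    (F ∘ₗ tw Q p) ∘ₗ tw Q q = (F ∘ₗ tw Q q) ∘ₗ tw Q p := by
  ext1 b
  simp [tw_tw, add_comm]

/-- A linear map on `S(Q)` is determined by its value at `1` and its derivatives `F ∘ lm x`. -/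
theorem ext_lm {A : Type*} [AddCommGroup A] [Module ℂ A] {F G : GSym Q →ₗ[ℂ] A}
    (h1 : F 1 = G 1) (h : ∀ p x a, Q.HasParity p x → F a = G a → F (ι Q x * a) = G (ι Q x * a)) :
    F = G := by
  ext1 a
  induction a using induction with
  | one => exact h1
  | mul p x a hx ih => exact h p x a hx ih
  | add a b ha hb => rw [map_add, map_add, ha, hb]
  | smul c a ha => rw [map_smul, map_smul, ha]

theorem comul_one : comul Q 1 = 1 ⊗ₜ 1 := by simp [comul]

theorem comul_ι_mul (x : Q) (a : GSym Q) : comul Q (ι Q x * a) = comulGen Q x (comul Q a) := by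
  simp [comul, lift_ι]

section Conv
variable {A B C D E : Type*} [AddCommGroup A] [Module ℂ A] [AddCommGroup B] [Module ℂ B]
    [AddCommGroup C] [Module ℂ C] [AddCommGroup D] [Module ℂ D] [AddCommGroup E] [Module ℂ E]
variable (β : A →ₗ[ℂ] B →ₗ[ℂ] C)

theorem conv_one (F : GSym Q →ₗ[ℂ] A) (G : GSym Q →ₗ[ℂ] B) : conv β F G 1 = β (F 1) (G 1) := by
  simp [conv, comul_one]

/-- The derivative of a convolution in the direction `x`. This rule and the value at `1` determine
convolutions. -/
theorem conv_ι_mul (F : GSym Q →ₗ[ℂ] A) (G : GSym Q →ₗ[ℂ] B) {p : ℕ} {x : Q}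
    (hx : Q.HasParity p x) (a : GSym Q) : conv β F G (ι Q x * a) =
      conv β (F ∘ₗ lm x) G a + conv β (F ∘ₗ tw Q p) (G ∘ₗ lm x) a := by
  have : ∀ t : GSym Q ⊗[ℂ] GSym Q, TensorProduct.lift β (TensorProduct.map F G (comulGen Q x t)) =
      TensorProduct.lift β (TensorProduct.map (F ∘ₗ lm x) G t)
      + TensorProduct.lift β (TensorProduct.map (F ∘ₗ tw Q p) (G ∘ₗ lm x) t) := by
    intro t
    induction t using TensorProduct.induction_on with
    | zero => simp
    | add s t hs ht => simp only [map_add, hs, ht]; abel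
    | tmul a b => rw [comulGen_parity p x hx]; simp [tw_apply]
  simp only [conv, LinearMap.comp_apply, comul_ι_mul, this]

theorem conv_comp_lm (F : GSym Q →ₗ[ℂ] A) (G : GSym Q →ₗ[ℂ] B) {p : ℕ} {x : Q}
    (hx : Q.HasParity p x) : conv β F G ∘ₗ lm x =
      conv β (F ∘ₗ lm x) G + conv β (F ∘ₗ tw Q p) (G ∘ₗ lm x) :=
  LinearMap.ext fun a => conv_ι_mul β F G hx a

theorem conv_add_right (F : GSym Q →ₗ[ℂ] A) (G G' : GSym Q →ₗ[ℂ] B) :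
    conv β F (G + G') = conv β F G + conv β F G' := by
  simp only [conv, TensorProduct.map_add_right, LinearMap.add_comp, LinearMap.comp_add]

theorem conv_smul_right (c : ℂ) (F : GSym Q →ₗ[ℂ] A) (G : GSym Q →ₗ[ℂ] B) :
    conv β F (c • G) = c • conv β F G := by
  simp only [conv, TensorProduct.map_smul_right, LinearMap.smul_comp, LinearMap.comp_smul]

/-- Convolution as a bilinear map. -/
noncomputable def convB : (GSym Q →ₗ[ℂ] A) →ₗ[ℂ] (GSym Q →ₗ[ℂ] B) →ₗ[ℂ] (GSym Q →ₗ[ℂ] C) :=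
  LinearMap.mk₂ ℂ (conv β) (conv_add β) (conv_smul β) (conv_add_right β)
    (fun c F G => conv_smul_right β c F G)

theorem conv_neg_right (F : GSym Q →ₗ[ℂ] A) (G : GSym Q →ₗ[ℂ] B) :
    conv β F (-G) = - conv β F G := (convB β F).map_neg G

theorem conv_sub_left (F F' : GSym Q →ₗ[ℂ] A) (G : GSym Q →ₗ[ℂ] B) :
    conv β (F - F') G = conv β F G - conv β F' G := (convB β).map_sub₂ F F' G

theorem conv_sub_right (F : GSym Q →ₗ[ℂ] A) (G G' : GSym Q →ₗ[ℂ] B) :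
    conv β F (G - G') = conv β F G - conv β F G' := (convB β F).map_sub G G'

theorem conv_zero_left (G : GSym Q →ₗ[ℂ] B) : conv β (0 : GSym Q →ₗ[ℂ] A) G = 0 :=
  (convB β).map_zero₂ G

theorem conv_zero_right (F : GSym Q →ₗ[ℂ] A) : conv β F (0 : GSym Q →ₗ[ℂ] B) = 0 :=
  (convB β F).map_zero

theorem comp_conv (T : C →ₗ[ℂ] D) (F : GSym Q →ₗ[ℂ] A) (G : GSym Q →ₗ[ℂ] B) :
    T ∘ₗ conv β F G = conv (β.compr₂ T) F G := by
  have : T ∘ₗ TensorProduct.lift β = TensorProduct.lift (β.compr₂ T) :=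
    TensorProduct.ext' fun a b => by simp
  rw [conv, ← LinearMap.comp_assoc, this]; rfl

variable {β}

/-- A convolution is determined by the values of its integrand on elements of pure parity. -/
theorem conv_congr {A' B' : Type*} [AddCommGroup A'] [Module ℂ A'] [AddCommGroup B'] [Module ℂ B']
    {β' : A' →ₗ[ℂ] B' →ₗ[ℂ] C} {F : GSym Q →ₗ[ℂ] A} {G : GSym Q →ₗ[ℂ] B} {F' : GSym Q →ₗ[ℂ] A'}
    {G' : GSym Q →ₗ[ℂ] B'}
    (h : ∀ p q a b, HasParity p a → HasParity q b → β (F a) (G b) = β' (F' a) (G' b)) :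
    conv β F G = conv β' F' G' := by
  rw [conv, conv, ← LinearMap.comp_assoc, ← LinearMap.comp_assoc]
  congr 1
  refine tensor_ext_parity fun p q a b ha hb => ?_
  simpa using h p q a b ha hb

variable (β) in
theorem conv_comp_tw (p : ℕ) (F : GSym Q →ₗ[ℂ] A) (G : GSym Q →ₗ[ℂ] B) :
    conv β F G ∘ₗ tw Q p = conv β (F ∘ₗ tw Q p) (G ∘ₗ tw Q p) := by
  ext1 a
  induction a using induction generalizing F G with
  | one => simp [tw_map_one, conv_one]
  | mul q x a hx ih =>
    have i1 := ih (F ∘ₗ lm x) G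
    have i2 := ih (F ∘ₗ tw Q q) (G ∘ₗ lm x)
    rw [LinearMap.comp_apply] at i1 i2
    rw [conv_ι_mul β _ _ hx, tw_comp_lm p hx, tw_comp_lm p hx, tw_comp_tw, conv_smul,
      conv_smul_right, LinearMap.comp_apply, tw_ι_mul p hx, map_smul, conv_ι_mul β _ _ hx, i1, i2, smul_add]
    rfl
  | add a b ha hb => rw [map_add, map_add, ha, hb]
  | smul c a ha => rw [map_smul, map_smul, ha]

variable (Q) in
/-- The graded exchange of the factors of `S(Q) ⊗ S(Q)`. -/
noncomputable def gswap : GSym Q ⊗[ℂ] GSym Q →ₗ[ℂ] GSym Q ⊗[ℂ] GSym Q :=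
  (1 / 2 : ℂ) • ((TensorProduct.comm ℂ _ _).toLinearMap ∘ₗ
    (TensorProduct.map (LinearMap.id + tw Q 1) LinearMap.id
      + TensorProduct.map (LinearMap.id - tw Q 1) (tw Q 1)))

theorem gswap_tmul {p q : ℕ} {a b : GSym Q} (ha : HasParity p a) (hb : HasParity q b) :
    gswap Q (a ⊗ₜ b) = (-1 : ℂ) ^ (p * q) • (b ⊗ₜ a) := by
  have ha' := tw_parity (p := 1) ha
  have hb' := tw_parity (p := 1) hb
  rw [one_mul] at ha' hb'
  have e1 : (LinearMap.id + tw Q 1 : GSym Q →ₗ[ℂ] GSym Q) a = (1 + (-1 : ℂ) ^ p) • a := by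
    rw [LinearMap.add_apply, ha', LinearMap.id_apply]; module
  have e2 : (LinearMap.id - tw Q 1 : GSym Q →ₗ[ℂ] GSym Q) a = (1 - (-1 : ℂ) ^ p) • a := by
    rw [LinearMap.sub_apply, ha', LinearMap.id_apply]; module
  rw [gswap, LinearMap.smul_apply, LinearMap.comp_apply, LinearMap.add_apply,
    TensorProduct.map_tmul, TensorProduct.map_tmul, e1, e2, hb', LinearMap.id_apply,
    TensorProduct.smul_tmul_smul, ← TensorProduct.smul_tmul', LinearEquiv.coe_coe, map_add,
    map_smul, map_smul, TensorProduct.comm_tmul, pow_mul]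
  rcases Nat.even_or_odd p with hp | hp <;> rw [hp.neg_one_pow]
  · rw [one_pow]; module
  · module

theorem gswap_comulGen {p : ℕ} {x : Q} (hx : Q.HasParity p x) (t : GSym Q ⊗[ℂ] GSym Q) :
    gswap Q (comulGen Q x t) = comulGen Q x (gswap Q t) := by
  let D : GSym Q ⊗[ℂ] GSym Q →ₗ[ℂ] GSym Q ⊗[ℂ] GSym Q := comulGen Q x
  suffices h : (gswap Q).comp D = D.comp (gswap Q) by
    exact LinearMap.congr_fun h t
  refine tensor_ext_parity (A := GSym Q ⊗[ℂ] GSym Q) fun q r a b ha hb => ?_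
  have hx' := hasParity_ι hx
  rw [LinearMap.comp_apply, LinearMap.comp_apply, gswap_tmul ha hb, map_smul]
  dsimp only [D]
  rw [comulGen_parity p x hx, comulGen_parity p x hx, ← tw_apply, ← tw_apply, tw_parity ha,
    tw_parity hb, ← TensorProduct.smul_tmul', ← TensorProduct.smul_tmul', map_add, map_smul,
    gswap_tmul (hx'.mul ha) hb, gswap_tmul ha (hx'.mul hb), smul_add, smul_smul, smul_smul,
    add_comm]
  have e1 : (-1 : ℂ) ^ (p * q) * (-1 : ℂ) ^ (q * (p + r)) = (-1 : ℂ) ^ (q * r) := by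
    rw [mul_add, pow_add, ← mul_assoc, mul_comm p q, neg_one_pow_mul_self, one_mul]
  have e2 : (-1 : ℂ) ^ ((p + q) * r) = (-1 : ℂ) ^ (q * r) * (-1 : ℂ) ^ (p * r) := by
    rw [← pow_add]; congr 1; ring
  rw [e1, e2]

/-- The coproduct of `S(Q)` is graded cocommutative. -/
theorem gswap_comul (a : GSym Q) : gswap Q (comul Q a) = comul Q a := by
  induction a using induction with
  | one => rw [comul_one, gswap_tmul hasParity_one hasParity_one]; simp
  | mul p x a hx ih => rw [comul_ι_mul, gswap_comulGen hx, ih]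
  | add a b ha hb => rw [map_add, map_add, ha, hb]
  | smul c a ha => rw [map_smul, map_smul, ha]

/-- Convolutions may be exchanged at the cost of a Koszul sign. -/
theorem conv_comm {A' B' : Type*} [AddCommGroup A'] [Module ℂ A'] [AddCommGroup B'] [Module ℂ B']
    {β' : B' →ₗ[ℂ] A' →ₗ[ℂ] C} {F : GSym Q →ₗ[ℂ] A} {G : GSym Q →ₗ[ℂ] B} {F' : GSym Q →ₗ[ℂ] A'}
    {G' : GSym Q →ₗ[ℂ] B'}
    (h : ∀ p q a b, HasParity p a → HasParity q b →
      β (F a) (G b) = (-1 : ℂ) ^ (p * q) • β' (G' b) (F' a)) :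
    conv β F G = conv β' G' F' := by
  have e : conv β' G' F' = TensorProduct.lift β' ∘ₗ TensorProduct.map G' F' ∘ₗ gswap Q ∘ₗ comul Q :=
    LinearMap.ext fun a => by simp [conv, gswap_comul]
  rw [e, conv, ← LinearMap.comp_assoc, ← LinearMap.comp_assoc, ← LinearMap.comp_assoc]
  congr 1
  refine tensor_ext_parity fun p q a b ha hb => ?_
  simp only [LinearMap.comp_apply, gswap_tmul ha hb, map_smul, TensorProduct.map_tmul,
    TensorProduct.lift.tmul]
  exact h p q a b ha hb

/-- The associativity of convolution. -/
theorem conv_assoc {β₁ : A →ₗ[ℂ] B →ₗ[ℂ] C} {β₂ : C →ₗ[ℂ] D →ₗ[ℂ] E}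
    {C' : Type*} [AddCommGroup C'] [Module ℂ C']
    {β₃ : B →ₗ[ℂ] D →ₗ[ℂ] C'} {β₄ : A →ₗ[ℂ] C' →ₗ[ℂ] E} {F : GSym Q →ₗ[ℂ] A}
    {G : GSym Q →ₗ[ℂ] B} {H : GSym Q →ₗ[ℂ] D}
    (h : ∀ a b c, β₂ (β₁ a b) c = β₄ a (β₃ b c)) :
    conv β₂ (conv β₁ F G) H = conv β₄ F (conv β₃ G H) := by
  ext1 a
  induction a using induction generalizing F G H with
  | one => simp [conv_one, h]
  | mul p x a hx ih =>
    simp only [conv_ι_mul _ _ _ hx, conv_comp_lm _ _ _ hx, conv_comp_tw, conv_add, conv_add_right,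
      LinearMap.add_apply, ih]
    abel
  | add a b ha hb => rw [map_add, map_add, ha, hb]
  | smul c a ha => rw [map_smul, map_smul, ha]

theorem counit_ι_mul (x : Q) (a : GSym Q) : counit Q (ι Q x * a) = 0 := by
  rw [map_mul]; simp [counit, lift_ι]

/-- The counit is a right unit for convolution. -/
theorem conv_counit_right (h : A →ₗ[ℂ] C) {β : A →ₗ[ℂ] ℂ →ₗ[ℂ] C} (hβ : ∀ a, β a 1 = h a)
    (F : GSym Q →ₗ[ℂ] A) : conv β F (counit Q).toLinearMap = h ∘ₗ F := by
  ext1 a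
  induction a using induction generalizing F with
  | one => simp [conv_one, hβ]
  | mul p x a hx ih =>
    have : (counit Q).toLinearMap ∘ₗ lm x = 0 := by ext1 a; simp [counit_ι_mul]
    rw [conv_ι_mul _ _ _ hx, ih, this, conv_zero_right]; simp
  | add a b ha hb => rw [map_add, map_add, ha, hb]
  | smul c a ha => rw [map_smul, map_smul, ha]

theorem counit_tw (p : ℕ) : (counit Q).toLinearMap ∘ₗ tw Q p = (counit Q).toLinearMap := by
  refine ext_lm ?_ fun q x a hx _ => ?_
  · simp [tw_map_one]
  · simp [tw_ι_mul p hx, counit_ι_mul]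

/-- The counit is a left unit for convolution. -/
theorem conv_counit_left (h : B →ₗ[ℂ] C) {β : ℂ →ₗ[ℂ] B →ₗ[ℂ] C} (hβ : ∀ b, β 1 b = h b)
    (G : GSym Q →ₗ[ℂ] B) : conv β (counit Q).toLinearMap G = h ∘ₗ G := by
  ext1 a
  induction a using induction generalizing G with
  | one => simp [conv_one, hβ]
  | mul p x a hx ih =>
    have : (counit Q).toLinearMap ∘ₗ lm x = 0 := by ext1 a; simp [counit_ι_mul]
    rw [conv_ι_mul _ _ _ hx, counit_tw, ih, this, conv_zero_left]; simp
  | add a b ha hb => rw [map_add, map_add, ha, hb]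
  | smul c a ha => rw [map_smul, map_smul, ha]

end Conv

end GSym
end ExtDef

/-! ### Order of vanishing, fixed points, and parity of vector fields -/

namespace ExtDef

universe u

namespace GSym
variable {P Q : GradedSpace.{u}}

variable (Q) in
/-- The span of the words of length less than `k` in `S(Q)`. -/
noncomputable def words : ℕ → Submodule ℂ (GSym Q)
  | 0 => ⊥
  | k + 1 => Submodule.span ℂ
      ({1} ∪ {b | ∃ (p : ℕ) (x : Q) (a : GSym Q), Q.HasParity p x ∧ a ∈ words k ∧ b = ι Q x * a})

theorem mem_words_zero {a : GSym Q} : a ∈ words Q 0 ↔ a = 0 := Submodule.mem_bot ℂ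

theorem one_mem_words (k : ℕ) : (1 : GSym Q) ∈ words Q (k + 1) :=
  Submodule.subset_span (Or.inl rfl)

theorem ι_mul_mem_words {k : ℕ} {a : GSym Q} (ha : a ∈ words Q k) (x : Q) :
    ι Q x * a ∈ words Q (k + 1) := by
  rw [← Q.even_add_odd x, map_add, add_mul]
  exact Submodule.add_mem _ (Submodule.subset_span (Or.inr ⟨0, _, a, Q.hasParity_even x, ha, rfl⟩))
    (Submodule.subset_span (Or.inr ⟨1, _, a, Q.hasParity_odd x, ha, rfl⟩))

theorem words_induction {k : ℕ} {N : Submodule ℂ (GSym Q)} (one : (1 : GSym Q) ∈ N)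
    (mul : ∀ (p : ℕ) (x : Q) (a : GSym Q), Q.HasParity p x → a ∈ words Q k → ι Q x * a ∈ N) :
    words Q (k + 1) ≤ N := by
  refine Submodule.span_le.2 ?_
  rintro b (rfl | ⟨p, x, a, hx, ha, rfl⟩)
  · exact one
  · exact mul p x a hx ha

theorem words_le_succ (k : ℕ) : words Q k ≤ words Q (k + 1) := by
  induction k with
  | zero => exact bot_le
  | succ k ih =>
    exact words_induction (one_mem_words _) fun p x a _ ha => ι_mul_mem_words (ih ha) x

theorem words_mono {k l : ℕ} (h : k ≤ l) : words Q k ≤ words Q l :=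
  monotone_nat_of_le_succ words_le_succ h

theorem exists_mem_words (a : GSym Q) : ∃ k, a ∈ words Q k := by
  induction a using induction with
  | one => exact ⟨1, one_mem_words 0⟩
  | mul p x a _ ih => obtain ⟨k, hk⟩ := ih; exact ⟨k + 1, ι_mul_mem_words hk x⟩
  | add a b ha hb =>
    obtain ⟨k, hk⟩ := ha
    obtain ⟨l, hl⟩ := hb
    exact ⟨max k l, Submodule.add_mem _ (words_mono (le_max_left k l) hk)
      (words_mono (le_max_right k l) hl)⟩
  | smul c a ha => obtain ⟨k, hk⟩ := ha; exact ⟨k, Submodule.smul_mem _ c hk⟩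

theorem tw_mem_words (p : ℕ) {k : ℕ} {a : GSym Q} (ha : a ∈ words Q k) :
    tw Q p a ∈ words Q k := by
  induction k generalizing a with
  | zero => rw [mem_words_zero] at *; rw [ha, map_zero]
  | succ k ih =>
    suffices h : words Q (k + 1) ≤ (words Q (k + 1)).comap (tw Q p) from h ha
    refine words_induction ?_ fun q x a hx ha => ?_
    · rw [Submodule.mem_comap, tw_map_one]; exact one_mem_words k
    · rw [Submodule.mem_comap, tw_ι_mul p hx]
      exact Submodule.smul_mem _ _ (ι_mul_mem_words (ih ha) x)

section Order
variable {A B C : Type*} [AddCommGroup A] [Module ℂ A] [AddCommGroup B] [Module ℂ B]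
    [AddCommGroup C] [Module ℂ C]

/-- `F` vanishes to order `k` at the origin: it is zero on words of length less than `k`. -/
def Order (k : ℕ) (F : GSym Q →ₗ[ℂ] A) : Prop := ∀ a ∈ words Q k, F a = 0

theorem order_zero (F : GSym Q →ₗ[ℂ] A) : Order 0 F := by
  intro a ha
  rw [mem_words_zero.1 ha, map_zero]

theorem order_succ {k : ℕ} {F : GSym Q →ₗ[ℂ] A} (h1 : F 1 = 0)
    (h : ∀ p x, Q.HasParity p x → Order k (F ∘ₗ lm x)) : Order (k + 1) F := by
  suffices h : words Q (k + 1) ≤ LinearMap.ker F from fun a ha => h ha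
  exact words_induction h1 fun p x a hx ha => h p x hx a ha

theorem Order.map_one {k : ℕ} {F : GSym Q →ₗ[ℂ] A} (hF : Order (k + 1) F) : F 1 = 0 :=
  hF 1 (one_mem_words k)

theorem order_one {F : GSym Q →ₗ[ℂ] A} (h : F 1 = 0) : Order 1 F :=
  order_succ h fun _ _ _ => order_zero _

theorem Order.comp_lm {k : ℕ} {F : GSym Q →ₗ[ℂ] A} (hF : Order (k + 1) F) (x : Q) :
    Order k (F ∘ₗ lm x) := fun _ ha => hF _ (ι_mul_mem_words ha x)

theorem Order.mono {k l : ℕ} (h : k ≤ l) {F : GSym Q →ₗ[ℂ] A} (hF : Order l F) : Order k F :=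
  fun a ha => hF a (words_mono h ha)

theorem Order.comp_tw {k : ℕ} {F : GSym Q →ₗ[ℂ] A} (hF : Order k F) (p : ℕ) :
    Order k (F ∘ₗ tw Q p) := fun _ ha => hF _ (tw_mem_words p ha)

theorem Order.add {k : ℕ} {F G : GSym Q →ₗ[ℂ] A} (hF : Order k F) (hG : Order k G) :
    Order k (F + G) := fun a ha => by rw [LinearMap.add_apply, hF a ha, hG a ha, add_zero]

theorem Order.neg {k : ℕ} {F : GSym Q →ₗ[ℂ] A} (hF : Order k F) : Order k (-F) :=
  fun a ha => by rw [LinearMap.neg_apply, hF a ha, neg_zero]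

theorem Order.sub {k : ℕ} {F G : GSym Q →ₗ[ℂ] A} (hF : Order k F) (hG : Order k G) :
    Order k (F - G) := fun a ha => by rw [LinearMap.sub_apply, hF a ha, hG a ha, sub_zero]

theorem Order.smul {k : ℕ} {F : GSym Q →ₗ[ℂ] A} (hF : Order k F) (c : ℂ) : Order k (c • F) :=
  fun a ha => by rw [LinearMap.smul_apply, hF a ha, smul_zero]

theorem Order.comp_left {k : ℕ} {F : GSym Q →ₗ[ℂ] A} (hF : Order k F) (T : A →ₗ[ℂ] B) :
    Order k (T ∘ₗ F) := fun a ha => by rw [LinearMap.comp_apply, hF a ha, map_zero]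

/-- Formal functions vanishing to all orders are zero, because the words exhaust `S(Q)`. -/
theorem eq_zero_of_order {F : GSym Q →ₗ[ℂ] A} (h : ∀ k, Order k F) : F = 0 := by
  ext1 a
  obtain ⟨k, hk⟩ := exists_mem_words a
  exact h k a hk

/-- If `F` vanishes to order `j`, the convolution of `F` and `G` on words of length less than
`k + j` only sees the values of `G` on words of length less than `k`. -/
theorem conv_mem {β : A →ₗ[ℂ] B →ₗ[ℂ] C} {F : GSym Q →ₗ[ℂ] A} {G : GSym Q →ₗ[ℂ] B} {j k : ℕ}
    (hF : Order j F) {N : Submodule ℂ C} (h : ∀ a, ∀ b ∈ words Q k, β (F a) (G b) ∈ N) :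
    ∀ a ∈ words Q (k + j), conv β F G a ∈ N := by
  suffices key : ∀ n j k : ℕ, n = k + j → ∀ (F : GSym Q →ₗ[ℂ] A) (G : GSym Q →ₗ[ℂ] B), Order j F →
      (∀ a, ∀ b ∈ words Q k, β (F a) (G b) ∈ N) → words Q n ≤ N.comap (conv β F G) from
    fun a ha => key _ j k rfl F G hF h ha
  intro n
  induction n with
  | zero => intro j k _ F G _ _; exact bot_le
  | succ n ih =>
    intro j k hn F G hF h
    refine words_induction ?_ fun p x a hx ha => ?_
    · rw [Submodule.mem_comap, conv_one]
      cases j with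
      | succ j => rw [hF.map_one]; simp
      | zero =>
        refine h _ _ (?_ : _ ∈ words Q k)
        rw [show k = n + 1 from hn.symm]; exact one_mem_words n
    · rw [Submodule.mem_comap, conv_ι_mul β F G hx]
      refine Submodule.add_mem _ ?_ ?_
      · cases j with
        | succ j =>
          exact ih j k (by omega) (F ∘ₗ lm x) G (hF.comp_lm x) (fun a b hb => h _ b hb) ha
        | zero =>
          refine ih 0 n rfl (F ∘ₗ lm x) G (order_zero _) (fun a b hb => h _ b ?_) ha
          exact words_mono (by omega) hb
      · cases k with
        | zero =>
          exact ih n 0 (by omega) (F ∘ₗ tw Q p) (G ∘ₗ lm x)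
            ((hF.mono (by omega)).comp_tw p) (fun a b hb => by
              rw [mem_words_zero.1 hb]; simp) ha
        | succ k =>
          exact ih j k (by omega) (F ∘ₗ tw Q p) (G ∘ₗ lm x) (hF.comp_tw p)
            (fun a b hb => h _ _ (ι_mul_mem_words hb x)) ha

theorem Order.conv {β : A →ₗ[ℂ] B →ₗ[ℂ] C} {F : GSym Q →ₗ[ℂ] A} {G : GSym Q →ₗ[ℂ] B} {j k : ℕ}
    (hF : Order j F) (hG : Order k G) : Order (k + j) (conv β F G) := fun a ha =>
  (Submodule.mem_bot ℂ).1 (conv_mem (N := ⊥) hF (fun a b hb => by rw [hG b hb]; simp) a ha)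

/-- A sequence of linear maps on `S(Q)` that stabilizes on each `words Q n` has a limit. -/
theorem exists_limit (F : ℕ → GSym Q →ₗ[ℂ] A) (hF : ∀ n, ∀ a ∈ words Q n, F (n + 1) a = F n a) :
    ∃ G : GSym Q →ₗ[ℂ] A, ∀ n, ∀ a ∈ words Q n, G a = F n a := by
  have stab : ∀ n m, n ≤ m → ∀ a ∈ words Q n, F m a = F n a := by
    intro n m h a ha
    induction m, h using Nat.le_induction with
    | base => rfl
    | succ m h ih => rw [hF m a (words_mono h ha), ih]
  have stab' : ∀ n m a, a ∈ words Q n → a ∈ words Q m → F m a = F n a := by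
    intro n m a hn hm
    rcases le_total n m with h | h
    · exact stab n m h a hn
    · exact (stab m n h a hm).symm
  choose k hk using exists_mem_words (Q := Q)
  refine ⟨{ toFun := fun a => F (k a) a, map_add' := fun a b => ?_, map_smul' := fun c a => ?_ },
    fun n a ha => stab' n _ a ha (hk a)⟩
  · have ha := words_mono (le_max_left (k a) (k b)) (hk a)
    have hb := words_mono (le_max_right (k a) (k b)) (hk b)
    rw [stab' _ _ a ha (hk a), stab' _ _ b hb (hk b),
      stab' _ _ (a + b) (Submodule.add_mem _ ha hb) (hk _), map_add]
  · rw [stab' _ _ (c • a) (Submodule.smul_mem _ c (hk a)) (hk _), map_smul]; rfl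

/-- The fixed point theorem for maps of formal power series that raise the order of contact. -/
theorem exists_fixedPoint (Φ : (GSym Q →ₗ[ℂ] A) → (GSym Q →ₗ[ℂ] A))
    (hΦ : ∀ k F G, Order k (F - G) → Order (k + 1) (Φ F - Φ G)) :
    ∃ F, Φ F = F ∧ ∀ n, ∀ a ∈ words Q n, F a = Φ^[n] 0 a := by
  have h1 : ∀ n, Order n (Φ^[n + 1] 0 - Φ^[n] 0) := by
    intro n
    induction n with
    | zero => exact order_zero _
    | succ n ih =>
      have := hΦ n _ _ ih
      rwa [← Function.iterate_succ_apply' Φ, ← Function.iterate_succ_apply' Φ] at this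
  obtain ⟨F, hF⟩ := exists_limit (fun n => Φ^[n] 0) fun n a ha => sub_eq_zero.1 (h1 n a ha)
  refine ⟨F, ?_, hF⟩
  rw [← sub_eq_zero]
  refine eq_zero_of_order fun k => ?_
  cases k with
  | zero => exact order_zero _
  | succ k =>
    have h2 : Order (k + 1) (Φ F - Φ^[k + 1] 0) := by
      rw [Function.iterate_succ_apply']
      exact hΦ k _ _ fun a ha => sub_eq_zero.2 (hF k a ha)
    intro a ha
    have h3 := sub_eq_zero.1 (h2 a ha)
    rw [LinearMap.sub_apply, h3, hF (k + 1) a ha, sub_self]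

/-- An operator that raises the order has no nonzero fixed point. -/
theorem eq_zero_of_raising {T : (GSym Q →ₗ[ℂ] A) → (GSym Q →ₗ[ℂ] A)}
    (hT : ∀ k F, Order k F → Order (k + 1) (T F)) {F : GSym Q →ₗ[ℂ] A} (h : F = T F) : F = 0 := by
  refine eq_zero_of_order fun k => ?_
  induction k with
  | zero => exact order_zero F
  | succ k ih => rw [h]; exact hT k F ih

end Order

end GSym

section VFParity
variable {P Q : GradedSpace.{u}}

theorem conj_apply (V : VF P Q) (a : GSym P) : conj V a = Q.sgn (V (GSym.sgn P a)) := rfl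

theorem conj_conj (V : VF P Q) : conj (conj V) = V := by
  ext1 a
  simp [conj_apply, GSym.sgn_sgn, Q.sgn_sgn]

theorem conj_evenPart (V : VF P Q) : conj (evenPart V) = (-1 : ℂ) ^ 0 • evenPart V := by
  simp [evenPart, conj_conj, add_comm]

theorem conj_oddPart (V : VF P Q) : conj (oddPart V) = (-1 : ℂ) ^ 1 • oddPart V := by
  simp only [oddPart, LinearMap.smul_apply, LinearMap.sub_apply, LinearMap.id_apply, map_smul,
    map_sub, conj_conj]
  module

theorem evenPart_add_oddPart (V : VF P Q) : evenPart V + oddPart V = V := by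
  simp only [evenPart, oddPart, LinearMap.smul_apply, LinearMap.add_apply, LinearMap.sub_apply,
    LinearMap.id_apply]
  module

theorem evenPart_of_parity {v : ℕ} {V : VF P Q} (hV : conj V = (-1 : ℂ) ^ v • V) :
    evenPart V = if Even v then V else 0 := by
  simp only [evenPart, LinearMap.smul_apply, LinearMap.add_apply, LinearMap.id_apply, hV]
  split_ifs with h
  · rw [h.neg_one_pow]; module
  · rw [(Nat.not_even_iff_odd.1 h).neg_one_pow]; module

theorem oddPart_of_parity {v : ℕ} {V : VF P Q} (hV : conj V = (-1 : ℂ) ^ v • V) :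
    oddPart V = if Even v then 0 else V := by
  simp only [oddPart, LinearMap.smul_apply, LinearMap.sub_apply, LinearMap.id_apply, hV]
  split_ifs with h
  · rw [h.neg_one_pow]; module
  · rw [(Nat.not_even_iff_odd.1 h).neg_one_pow]; module

/-- An additive statement on vector fields may be checked on fields of pure parity. -/
theorem vf_parity_induction {motive : VF P Q → Prop} (hadd : ∀ V W, motive V → motive W →
    motive (V + W)) (h : ∀ v V, conj V = (-1 : ℂ) ^ v • V → motive V) (V : VF P Q) : motive V := by
  rw [← evenPart_add_oddPart V]
  exact hadd _ _ (h 0 _ (conj_evenPart V)) (h 1 _ (conj_oddPart V))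

theorem hasParity_apply {v p : ℕ} {V : VF P Q} (hV : conj V = (-1 : ℂ) ^ v • V) {a : GSym P}
    (ha : GSym.HasParity p a) : Q.HasParity (v + p) (V a) := by
  have h := LinearMap.congr_fun hV a
  rw [conj_apply, show GSym.sgn P a = _ from ha, map_smul, map_smul, LinearMap.smul_apply] at h
  have h2 := congrArg (fun y => (-1 : ℂ) ^ p • y) h
  simp only [smul_smul, neg_one_pow_mul_self, one_smul] at h2
  rw [GradedSpace.HasParity, h2, ← pow_add, add_comm]

theorem conj_eq_of_hasParity {v : ℕ} {V : VF P Q}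
    (h : ∀ p a, GSym.HasParity p a → Q.HasParity (v + p) (V a)) : conj V = (-1 : ℂ) ^ v • V := by
  refine GSym.linearMap_ext_parity fun p a ha => ?_
  have := h p a ha
  rw [conj_apply, show GSym.sgn P a = _ from ha, map_smul, map_smul, show Q.sgn (V a) = _ from this,
    smul_smul, LinearMap.smul_apply, pow_add, mul_left_comm, neg_one_pow_mul_self, mul_one]

theorem conj_comp_lm {v p : ℕ} {V : VF P Q} (hV : conj V = (-1 : ℂ) ^ v • V) {x : P}
    (hx : P.HasParity p x) : conj (V ∘ₗ GSym.lm x) = (-1 : ℂ) ^ (v + p) • (V ∘ₗ GSym.lm x) :=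
  conj_eq_of_hasParity fun q a ha => by
    have := hasParity_apply hV ((GSym.hasParity_ι hx).mul ha)
    rwa [← add_assoc] at this

end VFParity

end ExtDef

/-! ### Coderivations and quadratic vector fields -/

namespace ExtDef

universe u

namespace GSym
variable {P Q : GradedSpace.{u}}

/-- The exchange of the first two factors in a threefold convolution product. -/
theorem conv_mul_swap {A B A' B' G : GSym P →ₗ[ℂ] GSym Q}
    (h : ∀ p q a b, HasParity p a → HasParity q b →
      A a * B b = (-1 : ℂ) ^ (p * q) • (B' b * A' a)) :
    conv (LinearMap.mul ℂ (GSym Q)) A (conv (LinearMap.mul ℂ (GSym Q)) B G) =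
      conv (LinearMap.mul ℂ (GSym Q)) B' (conv (LinearMap.mul ℂ (GSym Q)) A' G) := by
  have as : ∀ A B : GSym P →ₗ[ℂ] GSym Q,
      conv (LinearMap.mul ℂ (GSym Q)) A (conv (LinearMap.mul ℂ (GSym Q)) B G) =
      conv (LinearMap.mul ℂ (GSym Q)) (conv (LinearMap.mul ℂ (GSym Q)) A B) G := fun A B =>
    (conv_assoc (by intro a b c; simp [mul_assoc])).symm
  rw [as, as]
  congr 1
  exact conv_comm h

/-- The sign for exchanging values `x = V(a)` and `y = W(b)` of vector fields of parities `v`, `w`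
at elements of parities `p`, `q`, with the sign for exchanging `a` and `b` split off. -/
theorem ι_mul_ι_parity {v w p q : ℕ} {x y : Q} (hx : Q.HasParity (v + p) x)
    (hy : Q.HasParity (w + q) y) : ι Q x * ι Q y =
      (-1 : ℂ) ^ (p * q) • ((-1 : ℂ) ^ (v * (w + q)) • (-1 : ℂ) ^ (w * p) • (ι Q y * ι Q x)) := by
  rw [ι_comm _ _ x y hx hy, smul_smul, smul_smul, ← pow_add, ← pow_add]
  congr 2; ring

end GSym

section Hat
variable {P Q R : GradedSpace.{u}}

theorem hatAlong_one (φ : GSym P →ₗ[ℂ] GSym Q) (Z : VF P Q) :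
    hatAlong φ Z 1 = GSym.ι Q (Z 1) * φ 1 := by
  simp [hatAlong, GSym.conv_one]

theorem hatAlong_add (φ : GSym P →ₗ[ℂ] GSym Q) (Z W : VF P Q) :
    hatAlong φ (Z + W) = hatAlong φ Z + hatAlong φ W := by
  rw [hatAlong, LinearMap.comp_add, GSym.conv_add]; rfl

theorem hatAlong_smul (φ : GSym P →ₗ[ℂ] GSym Q) (c : ℂ) (Z : VF P Q) :
    hatAlong φ (c • Z) = c • hatAlong φ Z := by
  rw [hatAlong, LinearMap.comp_smul, GSym.conv_smul]; rfl

theorem hatAlong_sub (φ : GSym P →ₗ[ℂ] GSym Q) (Z W : VF P Q) :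
    hatAlong φ (Z - W) = hatAlong φ Z - hatAlong φ W := by
  rw [hatAlong, LinearMap.comp_sub, GSym.conv_sub_left]; rfl

theorem hat_one (V : VF Q Q) : hat V 1 = GSym.ι Q (V 1) := by
  rw [hat, hatAlong_one]; simp

theorem hat_add (V W : VF Q Q) : hat (V + W) = hat V + hat W := hatAlong_add _ _ _

theorem hat_smul (c : ℂ) (V : VF Q Q) : hat (c • V) = c • hat V := hatAlong_smul _ _ _

theorem hat_sub (V W : VF Q Q) : hat (V - W) = hat V - hat W := hatAlong_sub _ _ _

/-- The graded commutator of the coderivation of `V` with multiplication by `x` is the coderivation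
of the derivative of `V` in the direction `x`. -/
theorem hat_comp_lm {v p : ℕ} {V : VF Q Q} (hV : conj V = (-1 : ℂ) ^ v • V) {x : Q}
    (hx : Q.HasParity p x) : hat V ∘ₗ GSym.lm x =
      hat (V ∘ₗ GSym.lm x) + (-1 : ℂ) ^ (v * p) • (GSym.lm x ∘ₗ hat V) := by
  have h2 : GSym.conv (LinearMap.mul ℂ (GSym Q)) ((GSym.ι Q ∘ₗ V) ∘ₗ GSym.tw Q p)
      (LinearMap.id ∘ₗ GSym.lm x) = (-1 : ℂ) ^ (v * p) • (GSym.lm x ∘ₗ hat V) := by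
    rw [hat, hatAlong, GSym.comp_conv, ← GSym.conv_smul]
    refine GSym.conv_congr fun q r a b ha hb => ?_
    simp only [LinearMap.comp_apply, GSym.tw_parity ha, map_smul, LinearMap.id_apply,
      GSym.lm_apply, LinearMap.compr₂_apply, LinearMap.mul_apply', LinearMap.smul_apply,
      ← mul_assoc]
    rw [GSym.ι_comm _ p _ x (hasParity_apply hV ha) hx, smul_mul_assoc, smul_smul, ← pow_add]
    congr 1
    rw [show p * q + (v + q) * p = v * p + 2 * (p * q) by ring, pow_add, pow_mul (-1 : ℂ) 2]
    simp
  rw [← h2, hat, hatAlong, GSym.conv_comp_lm _ _ _ hx]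
  rfl

theorem hat_ι_mul {v p : ℕ} {V : VF Q Q} (hV : conj V = (-1 : ℂ) ^ v • V) {x : Q}
    (hx : Q.HasParity p x) (a : GSym Q) : hat V (GSym.ι Q x * a) =
      hat (V ∘ₗ GSym.lm x) a + (-1 : ℂ) ^ (v * p) • (GSym.ι Q x * hat V a) :=
  LinearMap.congr_fun (hat_comp_lm hV hx) a

theorem hat_comp_tw {v : ℕ} (p : ℕ) {V : VF Q Q} (hV : conj V = (-1 : ℂ) ^ v • V) :
    hat V ∘ₗ GSym.tw Q p = (-1 : ℂ) ^ (v * p) • (GSym.tw Q p ∘ₗ hat V) := by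
  have : GSym.tw Q p ∘ₗ hat V = GSym.conv (LinearMap.mul ℂ (GSym Q))
      (GSym.tw Q p ∘ₗ GSym.ι Q ∘ₗ V) (GSym.tw Q p) := by
    rw [hat, hatAlong, GSym.comp_conv]
    refine GSym.conv_congr fun q r a b ha hb => ?_
    have hp := GSym.hasParity_ι (hasParity_apply hV ha)
    simp only [LinearMap.comp_apply, LinearMap.compr₂_apply, LinearMap.mul_apply',
      GSym.tw_parity (hp.mul hb), GSym.tw_parity hp, GSym.tw_parity hb, LinearMap.id_apply,
      smul_mul_smul_comm, ← pow_add, mul_add]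
  rw [this, hat, hatAlong, GSym.conv_comp_tw, ← GSym.conv_smul]
  refine GSym.conv_congr fun q r a b ha hb => ?_
  have hp := GSym.hasParity_ι (hasParity_apply hV ha)
  have hp' := GSym.tw_parity (p := p) hp
  simp only [LinearMap.comp_apply, GSym.tw_parity ha, map_smul, LinearMap.smul_apply, hp',
    smul_smul, LinearMap.id_apply]
  congr 3
  rw [← pow_add, show v * p + p * (v + q) = p * q + 2 * (v * p) by ring, pow_add,
    pow_mul (-1 : ℂ) 2]
  simp

section
variable {A B C : Type*} [AddCommGroup A] [Module ℂ A] [AddCommGroup B] [Module ℂ B]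
    [AddCommGroup C] [Module ℂ C]

/-- Vector fields act on convolutions by the graded Leibniz rule. -/
theorem conv_comp_hat (β : A →ₗ[ℂ] B →ₗ[ℂ] C) (F : GSym Q →ₗ[ℂ] A) (G : GSym Q →ₗ[ℂ] B) {v : ℕ}
    {V : VF Q Q} (hV : conj V = (-1 : ℂ) ^ v • V) : GSym.conv β F G ∘ₗ hat V =
      GSym.conv β (F ∘ₗ hat V) G + GSym.conv β (F ∘ₗ GSym.tw Q v) (G ∘ₗ hat V) := by
  ext1 a
  induction a using GSym.induction generalizing F G v V with
  | one =>
    have hy : Q.HasParity v (V 1) := hasParity_apply hV GSym.hasParity_one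
    have := GSym.conv_ι_mul β F G hy 1
    simp only [mul_one] at this
    simp only [LinearMap.comp_apply, hat_one, this, LinearMap.add_apply, GSym.conv_one,
      GSym.lm_apply, mul_one, GSym.tw_map_one]
  | mul p x a hx ih =>
    have e1 : (F ∘ₗ hat V) ∘ₗ GSym.lm x =
        F ∘ₗ hat (V ∘ₗ GSym.lm x) + (-1 : ℂ) ^ (v * p) • ((F ∘ₗ GSym.lm x) ∘ₗ hat V) := by
      rw [LinearMap.comp_assoc, hat_comp_lm hV hx, LinearMap.comp_add, LinearMap.comp_smul]; rfl
    have e2 : (G ∘ₗ hat V) ∘ₗ GSym.lm x =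
        G ∘ₗ hat (V ∘ₗ GSym.lm x) + (-1 : ℂ) ^ (v * p) • ((G ∘ₗ GSym.lm x) ∘ₗ hat V) := by
      rw [LinearMap.comp_assoc, hat_comp_lm hV hx, LinearMap.comp_add, LinearMap.comp_smul]; rfl
    have e3 := hat_comp_tw p hV
    have i1 := ih (F ∘ₗ GSym.lm x) G hV
    have i2 := ih (F ∘ₗ GSym.tw Q p) (G ∘ₗ GSym.lm x) hV
    have i3 := ih F G (conj_comp_lm hV hx)
    have e4 : (F ∘ₗ hat V) ∘ₗ GSym.tw Q p = (-1 : ℂ) ^ (v * p) • ((F ∘ₗ GSym.tw Q p) ∘ₗ hat V) := by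
      rw [LinearMap.comp_assoc, e3, LinearMap.comp_smul]; rfl
    have e5 : (F ∘ₗ GSym.tw Q v) ∘ₗ GSym.tw Q p = F ∘ₗ GSym.tw Q (v + p) :=
      LinearMap.ext fun a => by simp [GSym.tw_tw]
    have e6 : (F ∘ₗ GSym.tw Q p) ∘ₗ GSym.tw Q v = F ∘ₗ GSym.tw Q (v + p) :=
      LinearMap.ext fun a => by simp [GSym.tw_tw, add_comm]
    simp only [LinearMap.comp_apply, LinearMap.add_apply, GSym.conv_ι_mul _ _ _ hx] at i1 i2 i3 ⊢
    rw [e1, e2, e4, GSym.tw_comp_lm v hx, hat_ι_mul hV hx, map_add, map_smul, i3,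
      GSym.conv_ι_mul _ _ _ hx, i1, i2, e5, e6]
    simp only [GSym.conv_add, GSym.conv_add_right, GSym.conv_smul, GSym.conv_smul_right,
      LinearMap.add_apply, LinearMap.smul_apply, smul_add]
    abel
  | add a b ha hb => rw [map_add, map_add, ha F G hV, hb F G hV]
  | smul c a ha => rw [map_smul, map_smul, ha F G hV]

end

/-- The commutator of coderivations is the coderivation of the bracket of vector fields. -/
theorem hat_commutator {v w : ℕ} {V W : VF Q Q} (hV : conj V = (-1 : ℂ) ^ v • V)
    (hW : conj W = (-1 : ℂ) ^ w • W) : hat V ∘ₗ hat W - (-1 : ℂ) ^ (v * w) • (hat W ∘ₗ hat V) =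
      hat (V ∘ₗ hat W - (-1 : ℂ) ^ (v * w) • (W ∘ₗ hat V)) := by
  have h : ∀ {v w : ℕ} {V W : VF Q Q} (_ : conj V = (-1 : ℂ) ^ v • V)
      (_ : conj W = (-1 : ℂ) ^ w • W), hat V ∘ₗ hat W = hat (V ∘ₗ hat W) +
        GSym.conv (LinearMap.mul ℂ (GSym Q)) ((GSym.ι Q ∘ₗ V) ∘ₗ GSym.tw Q w) (hat W) := by
    intro v w V W hV hW
    rw [hat, hatAlong, conv_comp_hat _ _ _ hW]
    rfl
  have sw : GSym.conv (LinearMap.mul ℂ (GSym Q)) ((GSym.ι Q ∘ₗ V) ∘ₗ GSym.tw Q w) (hat W) =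
      (-1 : ℂ) ^ (v * w) •
        GSym.conv (LinearMap.mul ℂ (GSym Q)) ((GSym.ι Q ∘ₗ W) ∘ₗ GSym.tw Q v) (hat V) := by
    rw [← GSym.conv_smul]
    refine GSym.conv_mul_swap fun p q a b ha hb => ?_
    simp only [LinearMap.comp_apply, GSym.tw_parity ha, GSym.tw_parity hb, map_smul,
      LinearMap.smul_apply, smul_mul_assoc]
    rw [GSym.ι_mul_ι_parity (hasParity_apply hV ha) (hasParity_apply hW hb)]
    simp only [smul_smul, ← pow_add]
    congr 1
    rw [show w * p + (p * q + (v * (w + q) + w * p)) = p * q + (v * w + v * q) + 2 * (w * p) by ring,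
      pow_add, pow_mul (-1 : ℂ) 2]
    simp
  rw [h hV hW, h hW hV, sw, hat_sub, hat_smul]
  module

end Hat

namespace GSym
variable {P Q : GradedSpace.{u}}

section Quad
variable (d : Q →ₗ[ℂ] Q) (b : Q →ₗ[ℂ] Q →ₗ[ℂ] Q)
    (hb : ∀ (p q : ℕ) (x y : Q), Q.HasParity p x → Q.HasParity q y →
      b x y = (-1 : ℂ) ^ (p * q) • b y x)

theorem quad_one : quad d b hb 1 = 0 := by simp [quad]

theorem proj_one : proj Q 1 = 0 := quad_one _ _ _

theorem proj_ι (x : Q) : proj Q (ι Q x) = x := by simp [proj, quad_ι]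

/-- The recursion along words that defines `quad`: the state consists of the constant term, the
linear term and the value of the quadratic vector field. -/
theorem quad_state : ∃ S : GSym Q →ₗ[ℂ] ℂ × Q × Q, S 1 = (1, 0, 0) ∧
    (∀ x a, S (ι Q x * a) = (0, (S a).1 • x, (S a).1 • d x + b x (S a).2.1)) ∧
    ∀ a, quad d b hb a = (S a).2.2 := by
  refine ⟨LinearMap.applyₗ ((1, 0, 0) : ℂ × Q × Q) ∘ₗ
    (lift (B := Module.End ℂ (ℂ × Q × Q))
      (LinearMap.mk₂ ℂ
        (fun (x : Q) (v : ℂ × Q × Q) => ((0, v.1 • x, v.1 • d x + b x v.2.1) : ℂ × Q × Q))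
        (fun x y v => by ext <;> simp; abel)
        (fun c x v => by ext <;> simp [smul_comm c])
        (fun x v w => by ext <;> simp [add_smul]; abel)
        (fun c x v => by ext <;> simp [mul_smul]))
      (by
        intro p q x y hx hy
        ext v <;> simp [hb p q x y hx hy])).toLinearMap, ?_, ?_, fun a => rfl⟩
  · simp
  · intro x a
    simp [lift_ι]

theorem quad_ι_mul (x : Q) (a : GSym Q) : quad d b hb (ι Q x * a) =
    counit Q a • d x + b x (proj Q a) := by
  obtain ⟨S, h1, hm, hq⟩ := quad_state d b hb
  obtain ⟨S', h1', hm', hq'⟩ := quad_state (LinearMap.id : Q →ₗ[ℂ] Q) 0 (by simp)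
  have e1 : ∀ (S : GSym Q →ₗ[ℂ] ℂ × Q × Q), S 1 = (1, 0, 0) → (∀ x a, (S (ι Q x * a)).1 = 0) →
      ∀ a, (S a).1 = counit Q a := by
    intro S h1 hm a
    have : LinearMap.fst ℂ ℂ (Q × Q) ∘ₗ S = (counit Q).toLinearMap := by
      refine ext_lm ?_ fun p x a _ _ => ?_
      · simp [h1]
      · simp [hm, counit_ι_mul]
    exact LinearMap.congr_fun this a
  have c := e1 S h1 fun x a => by rw [hm]
  have c' := e1 S' h1' fun x a => by rw [hm']
  have e2 : ∀ a, (S a).2.1 = proj Q a := by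
    intro a
    have : LinearMap.fst ℂ Q Q ∘ₗ LinearMap.snd ℂ ℂ (Q × Q) ∘ₗ S = proj Q := by
      refine ext_lm ?_ fun p x a _ _ => ?_
      · simp [h1, proj_one]
      · rw [proj, hq', hm']
        simp [hm, c, c']
    exact LinearMap.congr_fun this a
  rw [hq, hm, c, e2]

theorem proj_ι_mul (x : Q) (a : GSym Q) : proj Q (ι Q x * a) = counit Q a • x := by
  rw [proj, quad_ι_mul]; simp

theorem proj_parity {p : ℕ} {a : GSym Q} (ha : HasParity p a) : Q.HasParity p (proj Q a) := by
  have h : Q.sgn ∘ₗ proj Q = proj Q ∘ₗ (sgn Q).toLinearMap := by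
    refine ext_lm ?_ fun p x a hx _ => ?_
    · simp [proj_one]
    · have h1 : counit Q (sgn Q a) = counit Q a := by
        have := LinearMap.congr_fun (counit_tw (Q := Q) 1) a
        rwa [tw_one] at this
      simp [proj_ι_mul, sgn_ι, h1]
  have := LinearMap.congr_fun h a
  simp only [LinearMap.comp_apply, AlgHom.toLinearMap_apply, show sgn Q a = _ from ha,
    map_smul] at this
  exact this

theorem conj_proj : conj (proj Q) = proj Q := by
  have := conj_eq_of_hasParity (v := 0) (V := proj Q) fun p a ha => by
    rw [zero_add]; exact proj_parity ha
  simpa using this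

/-- The value of a quadratic vector field on the coderivation along `φ` with component `Z`. -/
theorem quad_comp_hatAlong {φ : GSym P →ₗ[ℂ] GSym Q}
    (hφ : (counit Q).toLinearMap ∘ₗ φ = (counit P).toLinearMap) (Z : VF P Q) :
    quad d b hb ∘ₗ hatAlong φ Z = d ∘ₗ Z + conv b Z (proj Q ∘ₗ φ) := by
  have e1 : d ∘ₗ Z = conv (LinearMap.lsmul ℂ Q).flip (d ∘ₗ Z) (counit P).toLinearMap :=
    (conv_counit_right (β := (LinearMap.lsmul ℂ Q).flip) LinearMap.id (by simp) (d ∘ₗ Z)).symm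
  have e2 : quad d b hb ∘ₗ hatAlong φ Z =
      conv (LinearMap.mk₂ ℂ (fun z w => counit Q w • d z + b z (proj Q w))
        (by intro z z' w; simp; abel) (by intro c z w; simp [smul_comm c])
        (by intro z w w'; simp [add_smul]; abel) (by intro c z w; simp [mul_smul])) Z φ := by
    rw [hatAlong, comp_conv]
    exact conv_congr fun p q a c _ _ => by simp [quad_ι_mul]
  have e3 : d ∘ₗ Z = conv (LinearMap.mk₂ ℂ (fun z w => counit Q w • d z)
        (by intro z z' w; simp) (by intro c z w; simp [smul_comm c])
        (by intro z w w'; simp [add_smul]) (by intro c z w; simp [mul_smul])) Z φ := by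
    rw [e1]
    refine conv_congr fun p q a c _ _ => ?_
    have := LinearMap.congr_fun hφ c
    simp only [LinearMap.comp_apply, AlgHom.toLinearMap_apply] at this
    simp [this]
  have e4 : conv b Z (proj Q ∘ₗ φ) = conv (b.compl₂ (proj Q)) Z φ :=
    conv_congr fun p q a c _ _ => rfl
  rw [e2, e3, e4]
  ext1 a
  rw [conv, conv, conv]
  simp only [LinearMap.comp_apply, LinearMap.add_apply]
  rw [← LinearMap.add_apply]
  congr 1
  refine TensorProduct.ext' fun z w => ?_
  simp

end Quad
end GSym
end ExtDef

/-! ### Exponentials of formal maps -/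

namespace ExtDef

universe u

namespace GSym
variable {P Q : GradedSpace.{u}}

section
variable {A B C : Type*} [AddCommGroup A] [Module ℂ A] [AddCommGroup B] [Module ℂ B]
    [AddCommGroup C] [Module ℂ C]

theorem conv_zero_form (F : GSym P →ₗ[ℂ] A) (G : GSym P →ₗ[ℂ] B) :
    conv (0 : A →ₗ[ℂ] B →ₗ[ℂ] C) F G = 0 := by
  have : TensorProduct.lift (0 : A →ₗ[ℂ] B →ₗ[ℂ] C) = 0 := TensorProduct.ext' fun a b => by simp
  rw [conv, this, LinearMap.zero_comp]

theorem conv_add_form (β β' : A →ₗ[ℂ] B →ₗ[ℂ] C) (F : GSym P →ₗ[ℂ] A) (G : GSym P →ₗ[ℂ] B) :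
    conv (β + β') F G = conv β F G + conv β' F G := by
  have : TensorProduct.lift (β + β') = TensorProduct.lift β + TensorProduct.lift β' :=
    TensorProduct.ext' fun a b => by simp
  rw [conv, this, LinearMap.add_comp]; rfl

theorem conv_smul_form (c : ℂ) (β : A →ₗ[ℂ] B →ₗ[ℂ] C) (F : GSym P →ₗ[ℂ] A)
    (G : GSym P →ₗ[ℂ] B) : conv (c • β) F G = c • conv β F G := by
  have : TensorProduct.lift (c • β) = c • TensorProduct.lift β :=
    TensorProduct.ext' fun a b => by simp
  rw [conv, this, LinearMap.smul_comp]; rfl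

end

/-- `φ : S(P) → S(Q)` is the exponential of the formal map `f`, that is, the solution of
`∂_x φ = f(x ·) φ`, `φ(1) = 1`. -/
structure IsExp (f : VF P Q) (φ : GSym P →ₗ[ℂ] GSym Q) : Prop where
  map_one : φ 1 = 1
  comp_lm : ∀ p x, P.HasParity p x → φ ∘ₗ lm x = hatAlong φ (f ∘ₗ lm x)

/-- Uniqueness of the solutions of linear differential equations for formal functions. -/
theorem ode_unique {A : Type*} [AddCommGroup A] [Module ℂ A] (γ : Q →ₗ[ℂ] A →ₗ[ℂ] A) (f : VF P Q)
    {U U' : GSym P →ₗ[ℂ] A} (h1 : U 1 = U' 1)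
    (h : ∀ p x, P.HasParity p x → U ∘ₗ lm x = conv γ (f ∘ₗ lm x) U)
    (h' : ∀ p x, P.HasParity p x → U' ∘ₗ lm x = conv γ (f ∘ₗ lm x) U') : U = U' := by
  rw [← sub_eq_zero]
  refine eq_zero_of_order fun k => ?_
  induction k with
  | zero => exact order_zero _
  | succ k ih =>
    refine order_succ (by simp [h1]) fun p x hx => ?_
    rw [LinearMap.sub_comp, h p x hx, h' p x hx, ← conv_sub_right]
    exact (order_zero _).conv ih

/-- The powers of a formal map in the convolution algebra. -/
noncomputable def convPow (f : VF P Q) : ℕ → (GSym P →ₗ[ℂ] GSym Q)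
  | 0 => (Algebra.linearMap ℂ (GSym Q)) ∘ₗ (counit P).toLinearMap
  | n + 1 => hatAlong (convPow f n) f

theorem hatAlong_convPow_zero (f Z : VF P Q) : hatAlong (convPow f 0) Z = ι Q ∘ₗ Z := by
  have : hatAlong (convPow f 0) Z =
      conv ((LinearMap.lsmul ℂ (GSym Q)).flip) (ι Q ∘ₗ Z) (counit P).toLinearMap :=
    conv_congr fun p q a b _ _ => by
      simp [convPow, Algebra.algebraMap_eq_smul_one]
  rw [this]
  exact conv_counit_right (β := (LinearMap.lsmul ℂ (GSym Q)).flip) LinearMap.id (by simp) (ι Q ∘ₗ Z)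

/-- The power rule. The formal map is even in order that its values commute past each other. -/
theorem convPow_comp_lm {f : VF P Q} (hf : conj f = (-1 : ℂ) ^ 0 • f) (n : ℕ) {p : ℕ} {x : P}
    (hx : P.HasParity p x) :
    convPow f (n + 1) ∘ₗ lm x = ((n + 1 : ℕ) : ℂ) • hatAlong (convPow f n) (f ∘ₗ lm x) := by
  induction n with
  | zero =>
    have h0 : convPow f (0 + 1) = ι Q ∘ₗ f := hatAlong_convPow_zero f f
    rw [h0, hatAlong_convPow_zero]
    simp [LinearMap.comp_assoc]
  | succ n ih =>
    have h1 : convPow f (n + 1 + 1) ∘ₗ lm x = hatAlong (convPow f (n + 1)) (f ∘ₗ lm x) +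
        conv (LinearMap.mul ℂ (GSym Q)) ((ι Q ∘ₗ f) ∘ₗ tw P p)
          (convPow f (n + 1) ∘ₗ lm x) := by
      rw [convPow, hatAlong, conv_comp_lm _ _ _ hx]; rfl
    have h2 : conv (LinearMap.mul ℂ (GSym Q)) ((ι Q ∘ₗ f) ∘ₗ tw P p)
          (hatAlong (convPow f n) (f ∘ₗ lm x)) = hatAlong (convPow f (n + 1)) (f ∘ₗ lm x) := by
      refine conv_mul_swap fun q r a b ha hb => ?_
      have e := ι_mul_ι_parity (hasParity_apply hf ha) (hasParity_apply (conj_comp_lm hf hx) hb)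
      simp only [LinearMap.comp_apply, tw_parity ha, map_smul, smul_mul_assoc]
      rw [LinearMap.comp_apply] at e
      rw [e]
      simp only [smul_smul, ← pow_add]
      congr 1
      rw [show p * q + (q * r + (0 * (0 + p + r) + (0 + p) * q)) = q * r + 2 * (p * q) by ring,
        pow_add, pow_mul (-1 : ℂ) 2]
      simp
    rw [h1, ih, conv_smul_right, h2]
    push_cast
    module

theorem order_convPow {f : VF P Q} (h0 : f 1 = 0) (n : ℕ) : Order n (convPow f n) := by
  induction n with
  | zero => exact order_zero _
  | succ n ih => exact ((order_one h0).comp_left (ι Q)).conv ih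

/-- The exponential series `∑ fⁿ/n!` stabilizes on words of bounded length, as `f` vanishes at the
origin. -/
theorem exists_isExp {f : VF P Q} (hf : conj f = (-1 : ℂ) ^ 0 • f) (h0 : f 1 = 0) :
    ∃ φ, IsExp f φ := by
  set F : ℕ → GSym P →ₗ[ℂ] GSym Q := fun n =>
    ∑ j ∈ Finset.range n, ((Nat.factorial j : ℂ)⁻¹) • convPow f j with hF
  have hs : ∀ n, F (n + 1) = F n + ((Nat.factorial n : ℂ)⁻¹) • convPow f n := fun n =>
    Finset.sum_range_succ _ n
  have hlm : ∀ n p x, P.HasParity p x → F (n + 1) ∘ₗ lm x = hatAlong (F n) (f ∘ₗ lm x) := by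
    intro n p x hx
    induction n with
    | zero =>
      have : (counit P).toLinearMap ∘ₗ lm x = 0 := by ext1 a; simp [counit_ι_mul]
      rw [hs, LinearMap.add_comp, LinearMap.smul_comp, convPow, LinearMap.comp_assoc, this]
      simp [hF, hatAlong, conv_zero_right]
    | succ n ih =>
      rw [hs (n + 1), LinearMap.add_comp, ih, LinearMap.smul_comp, convPow_comp_lm hf n hx, hs n,
        hatAlong, hatAlong, hatAlong, conv_add_right, conv_smul_right, smul_smul,
        Nat.factorial_succ]
      congr 2
      have : ((n + 1 : ℕ) : ℂ) ≠ 0 := Nat.cast_ne_zero.2 (Nat.succ_ne_zero n)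
      rw [Nat.cast_mul, mul_inv, mul_comm, ← mul_assoc, mul_inv_cancel₀ this, one_mul]
  obtain ⟨φ, hφ⟩ := exists_limit F fun n a ha => by
    rw [hs, LinearMap.add_apply, LinearMap.smul_apply, order_convPow h0 n a ha]; simp
  refine ⟨φ, ?_, fun p x hx => ?_⟩
  · rw [hφ 1 1 (one_mem_words 0)]
    simp [hF, convPow]
  · rw [← sub_eq_zero]
    refine eq_zero_of_order fun n a ha => ?_
    have h1 : Order n (φ - F n) := fun a ha => sub_eq_zero.2 (hφ n a ha)
    have h2 := ((order_zero (ι Q ∘ₗ f ∘ₗ lm x)).conv (β := LinearMap.mul ℂ (GSym Q)) h1) a ha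
    rw [conv_sub_right] at h2
    rw [LinearMap.sub_apply, LinearMap.comp_apply, lm_apply, hφ (n + 1) _ (ι_mul_mem_words ha x)]
    have h3 := LinearMap.congr_fun (hlm n p x hx) a
    rw [LinearMap.comp_apply, lm_apply] at h3
    rw [h3]
    have h4 := sub_eq_zero.1 h2
    rw [sub_eq_zero]
    exact h4.symm

variable (Q) in
/-- The tensor square of `S(Q)` as a mere vector space; the type synonym hides the algebra structure of
the tensor product from instance search. -/
def TensorSquare : Type u := GSym Q ⊗[ℂ] GSym Q

noncomputable instance : AddCommGroup (TensorSquare Q) :=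
  inferInstanceAs (AddCommGroup (GSym Q ⊗[ℂ] GSym Q))

noncomputable instance : Module ℂ (TensorSquare Q) :=
  inferInstanceAs (Module ℂ (GSym Q ⊗[ℂ] GSym Q))

namespace IsExp
variable {f : VF P Q} {φ : GSym P →ₗ[ℂ] GSym Q} (hφ : IsExp f φ)
include hφ

theorem apply_ι_mul {p : ℕ} {x : P} (hx : P.HasParity p x) (a : GSym P) :
    φ (ι P x * a) = hatAlong φ (f ∘ₗ lm x) a := LinearMap.congr_fun (hφ.comp_lm p x hx) a

theorem counit_comp : (counit Q).toLinearMap ∘ₗ φ = (counit P).toLinearMap := by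
  refine ext_lm ?_ fun p x a hx _ => ?_
  · simp [hφ.map_one]
  · have : (counit Q).toLinearMap ∘ₗ hatAlong φ (f ∘ₗ lm x) = 0 := by
      rw [hatAlong, comp_conv]
      refine (conv_congr (β' := 0) (F' := φ) (G' := φ) fun p q a b _ _ => ?_).trans
        (conv_zero_form _ _)
      simp [counit_ι_mul]
    have h2 := LinearMap.congr_fun this a
    rw [LinearMap.comp_apply] at h2
    rw [LinearMap.comp_apply, hφ.apply_ι_mul hx, h2]
    simp [counit_ι_mul]

theorem proj_comp (h0 : f 1 = 0) : proj Q ∘ₗ φ = f := by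
  refine ext_lm ?_ fun p x a hx _ => ?_
  · simp [hφ.map_one, h0, proj_one]
  · have h := quad_comp_hatAlong (LinearMap.id : Q →ₗ[ℂ] Q) 0 (by simp) hφ.counit_comp
      (f ∘ₗ lm x)
    have h2 := LinearMap.congr_fun h a
    simp only [LinearMap.comp_apply, LinearMap.add_apply] at h2
    rw [LinearMap.comp_apply, hφ.apply_ι_mul hx, proj, h2, conv_zero_form]
    simp

theorem parity (hf : conj f = (-1 : ℂ) ^ 0 • f) {p : ℕ} {a : GSym P} (ha : HasParity p a) :
    HasParity p (φ a) := by
  have key : tw Q 1 ∘ₗ φ ∘ₗ tw P 1 = φ := by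
    refine ode_unique (LinearMap.mul ℂ (GSym Q) ∘ₗ ι Q) f (by simp [tw_map_one, hφ.map_one])
      (fun p x hx => ?_) (fun p x hx => ?_)
    · have e : (tw Q 1 ∘ₗ φ ∘ₗ tw P 1) ∘ₗ lm x =
          (-1 : ℂ) ^ (1 * p) • (tw Q 1 ∘ₗ (hatAlong φ (f ∘ₗ lm x) ∘ₗ tw P 1)) := by
        rw [← hφ.comp_lm p x hx]
        have := tw_comp_lm 1 hx (tw Q 1 ∘ₗ φ)
        simpa only [LinearMap.comp_assoc] using this
      rw [e, hatAlong, conv_comp_tw, comp_conv, ← conv_smul]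
      refine conv_congr fun q r a b ha hb => ?_
      have h1 := hasParity_ι (hasParity_apply (conj_comp_lm hf hx) ha)
      rw [LinearMap.comp_apply] at h1
      have h2 := tw_parity (p := 1) h1
      have tmul : ∀ y z : GSym Q, tw Q 1 (y * z) = tw Q 1 y * tw Q 1 z := fun y z => by
        rw [tw_one]; exact map_mul (sgn Q) y z
      simp only [LinearMap.comp_apply, LinearMap.smul_apply, map_smul, LinearMap.compr₂_apply,
        LinearMap.mul_apply', tw_parity ha, tmul] at h2 ⊢
      rw [h2, smul_mul_assoc, smul_smul, smul_smul, ← pow_add, ← pow_add,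
        show 1 * p + 1 * q + 1 * (0 + p + q) = 2 * (p + q) by ring, pow_mul]
      simp
    · rw [hφ.comp_lm p x hx, hatAlong]
      exact conv_congr fun _ _ _ _ _ _ => rfl
  have h := LinearMap.congr_fun key a
  simp only [LinearMap.comp_apply, tw_parity ha, map_smul] at h
  rw [one_mul] at h
  have h2 := congrArg (fun y => (-1 : ℂ) ^ p • y) h
  simp only [smul_smul, neg_one_pow_mul_self, one_smul, tw_one] at h2
  exact h2

/-- The exponential of an even formal map is a map of coalgebras: both sides solve the same linear
differential equation. -/
theorem comul_comp (hf : conj f = (-1 : ℂ) ^ 0 • f) :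
    comul Q ∘ₗ φ = TensorProduct.map φ φ ∘ₗ comul P := by
  let τ : GSym Q →ₗ[ℂ] GSym Q →ₗ[ℂ] TensorSquare Q := TensorProduct.mk ℂ (GSym Q) (GSym Q)
  let γ : Q →ₗ[ℂ] TensorSquare Q →ₗ[ℂ] TensorSquare Q := comulGen Q
  let Δ : GSym Q →ₗ[ℂ] TensorSquare Q := comul Q
  have eR : (conv τ φ φ : GSym P →ₗ[ℂ] TensorSquare Q) = TensorProduct.map φ φ ∘ₗ comul P := by
    have : TensorProduct.lift τ = LinearMap.id := TensorProduct.ext' fun a b => rfl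
    rw [conv, this]; rfl
  suffices key : Δ ∘ₗ φ = conv τ φ φ from key.trans eR
  refine ode_unique γ f ?_ (fun p x hx => ?_) (fun p x hx => ?_)
  · rw [LinearMap.comp_apply, hφ.map_one, conv_one, hφ.map_one]; exact comul_one
  · rw [LinearMap.comp_assoc, hφ.comp_lm p x hx, hatAlong, comp_conv]
    exact conv_congr fun _ _ a b _ _ => comul_ι_mul _ _
  · rw [conv_comp_lm _ _ _ hx, hφ.comp_lm p x hx]
    have hZ := conj_comp_lm hf hx
    set Z := f ∘ₗ lm x
    -- the two summands of `comulGen`, as bilinear maps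
    let γ₁ : Q →ₗ[ℂ] TensorSquare Q →ₗ[ℂ] TensorSquare Q :=
      (LinearMap.rTensorHom (GSym Q)) ∘ₗ (LinearMap.mul ℂ (GSym Q)) ∘ₗ ι Q
    let γ₂ : Q →ₗ[ℂ] TensorSquare Q →ₗ[ℂ] TensorSquare Q := γ - γ₁
    let κ : Q →ₗ[ℂ] GSym Q →ₗ[ℂ] TensorSquare Q :=
      (τ.compl₂ (ι Q ∘ₗ Q.even)).flip + ((τ ∘ₗ (sgn Q).toLinearMap).compl₂ (ι Q ∘ₗ Q.odd)).flip
    have hγ₂ : ∀ y a b, γ₂ y (τ a b) = τ a (ι Q (Q.even y) * b)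
        + τ (sgn Q a) (ι Q (Q.odd y) * b) := by
      intro y a b
      have h1 : γ₁ y (τ a b) = τ (ι Q y * a) b := rfl
      have h2 : γ y (τ a b) = τ (ι Q y * a) b + τ a (ι Q (Q.even y) * b)
        + τ (sgn Q a) (ι Q (Q.odd y) * b) := comulGen_tmul y a b
      rw [show γ₂ y (τ a b) = γ y (τ a b) - γ₁ y (τ a b) from rfl, h1, h2]
      abel
    have hκ : ∀ y a, κ y a = τ a (ι Q (Q.even y)) + τ (sgn Q a) (ι Q (Q.odd y)) :=
      fun _ _ => rfl
    let ξ : TensorSquare Q →ₗ[ℂ] GSym Q →ₗ[ℂ] TensorSquare Q :=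
      (LinearMap.lTensorHom (GSym Q) ∘ₗ (LinearMap.mul ℂ (GSym Q)).flip).flip
    have hξ : ∀ a b c, ξ (τ a b) c = τ a (b * c) := fun _ _ _ => rfl
    have t1 : conv τ (hatAlong φ Z) φ = conv γ₁ Z (conv τ φ φ) := by
      rw [hatAlong, show conv (LinearMap.mul ℂ (GSym Q)) (ι Q ∘ₗ Z) φ =
        conv (LinearMap.mul ℂ (GSym Q) ∘ₗ ι Q) Z φ from conv_congr fun _ _ _ _ _ _ => rfl]
      exact conv_assoc fun a b c => rfl
    have t2 : conv τ (φ ∘ₗ tw P p) (hatAlong φ Z) = conv γ₂ Z (conv τ φ φ) := by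
      have s1 : conv τ (φ ∘ₗ tw P p) (hatAlong φ Z) =
          conv ξ (conv τ (φ ∘ₗ tw P p) (ι Q ∘ₗ Z)) φ :=
        (conv_assoc fun a b c => hξ a b c).symm
      have s2 : conv τ (φ ∘ₗ tw P p) (ι Q ∘ₗ Z) = conv κ Z φ := by
        refine conv_comm fun q r a b ha hb => ?_
        have h1 := hφ.parity hf ha
        have h2 := hasParity_apply hZ hb
        have h3 : sgn Q (φ a) = (-1 : ℂ) ^ q • φ a := h1
        rw [hκ, GradedSpace.even_apply h2, GradedSpace.odd_apply h2, h3]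
        simp only [LinearMap.comp_apply, tw_parity ha, map_smul, LinearMap.smul_apply]
        rw [show (-1 : ℂ) ^ (p * q) = (-1 : ℂ) ^ (q * r) * (-1 : ℂ) ^ ((0 + p + r) * q) by
          rw [← pow_add, show q * r + (0 + p + r) * q = p * q + 2 * (q * r) by ring, pow_add,
            pow_mul (-1 : ℂ) 2]
          simp, mul_smul]
        congr 1
        split_ifs with h
        · rw [pow_mul, h.neg_one_pow]; simp
        · rw [pow_mul, (Nat.not_even_iff_odd.1 h).neg_one_pow]; simp
      rw [s1, s2]
      refine conv_assoc fun y a b => ?_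
      rw [hκ, hγ₂, map_add, LinearMap.add_apply, hξ, hξ]
    rw [t1, t2, show γ = γ₁ + γ₂ by simp [γ₂]]
    exact (conv_add_form _ _ _ _).symm

end IsExp
end GSym
end ExtDef

/-! ### Coalgebra maps, coderivations along them, and degrees -/

namespace ExtDef

universe u

section Conv
variable {P Q R S : GradedSpace.{u}}

namespace GSym
variable {A B C : Type*} [AddCommGroup A] [Module ℂ A] [AddCommGroup B] [Module ℂ B]
    [AddCommGroup C] [Module ℂ C]

/-- Maps of coalgebras pull back convolutions. -/
theorem conv_comp_coalgHom {φ : GSym P →ₗ[ℂ] GSym Q}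
    (hφ : comul Q ∘ₗ φ = TensorProduct.map φ φ ∘ₗ comul P) (β : A →ₗ[ℂ] B →ₗ[ℂ] C)
    (F : GSym Q →ₗ[ℂ] A) (G : GSym Q →ₗ[ℂ] B) :
    conv β F G ∘ₗ φ = conv β (F ∘ₗ φ) (G ∘ₗ φ) := by
  rw [conv, conv, LinearMap.comp_assoc, LinearMap.comp_assoc, hφ, TensorProduct.map_comp,
    LinearMap.comp_assoc]

theorem conv_conj {β : A →ₗ[ℂ] B →ₗ[ℂ] C} {σA : A →ₗ[ℂ] A} {σB : B →ₗ[ℂ] B} {σC : C →ₗ[ℂ] C} {ε : ℂ}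
    (h : ∀ a b, σC (β a b) = ε • β (σA a) (σB b)) (F : GSym Q →ₗ[ℂ] A) (G : GSym Q →ₗ[ℂ] B) :
    σC ∘ₗ conv β F G ∘ₗ tw Q 1 = ε • conv β (σA ∘ₗ F ∘ₗ tw Q 1) (σB ∘ₗ G ∘ₗ tw Q 1) := by
  rw [conv_comp_tw, comp_conv, ← conv_smul_form]
  exact conv_congr fun p q a b _ _ => h _ _

end GSym

theorem conj_eq (V : VF P Q) : conj V = Q.sgn ∘ₗ V ∘ₗ GSym.tw P 1 := by
  rw [GSym.tw_one]; rfl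

theorem conj_conv {β : Q →ₗ[ℂ] R →ₗ[ℂ] S} {ε : ℂ}
    (h : ∀ a b, S.sgn (β a b) = ε • β (Q.sgn a) (R.sgn b)) (V : VF P Q) (W : VF P R) :
    conj (GSym.conv β V W : VF P S) = ε • GSym.conv β (conj V) (conj W) := by
  rw [conj_eq, conj_eq, conj_eq, GSym.conv_conj h]

theorem conj_comp_hat {v : ℕ} {V : VF Q Q} (hV : conj V = (-1 : ℂ) ^ v • V) (Z : VF Q R) :
    conj (Z ∘ₗ hat V) = (-1 : ℂ) ^ v • (conj Z ∘ₗ hat V) := by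
  rw [conj_eq, conj_eq, LinearMap.comp_assoc, hat_comp_tw 1 hV, mul_one]
  simp [LinearMap.comp_assoc, LinearMap.comp_smul]

theorem conj_comp_hat_parity {v w : ℕ} {V : VF Q Q} (hV : conj V = (-1 : ℂ) ^ v • V) {Z : VF Q R}
    (hZ : conj Z = (-1 : ℂ) ^ w • Z) :
    conj (Z ∘ₗ hat V) = (-1 : ℂ) ^ (w + v) • (Z ∘ₗ hat V) := by
  rw [conj_comp_hat hV, hZ, LinearMap.smul_comp, smul_smul, pow_add, mul_comm]

theorem conj_comp_left {T : Q →ₗ[ℂ] R} {ε : ℂ} (h : ∀ x, R.sgn (T x) = ε • T (Q.sgn x)) (V : VF P Q) :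
    conj (T ∘ₗ V : VF P R) = ε • (T ∘ₗ conj V) := by
  ext1 a
  simp [conj_apply, h]

end Conv

namespace GSym
variable {P Q : GradedSpace.{u}}

namespace IsExp
variable {f : VF P Q} {φ : GSym P →ₗ[ℂ] GSym Q} (hφ : IsExp f φ)
include hφ

theorem comp_sgn (hf : conj f = (-1 : ℂ) ^ 0 • f) :
    (sgn Q).toLinearMap ∘ₗ φ = φ ∘ₗ (sgn P).toLinearMap := by
  refine linearMap_ext_parity fun p a ha => ?_
  have h1 : sgn Q (φ a) = _ := hφ.parity hf ha
  have h2 : sgn P a = _ := ha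
  simp [h1, h2]

theorem hat_comp (hf : conj f = (-1 : ℂ) ^ 0 • f) (U : VF Q Q) :
    hat U ∘ₗ φ = hatAlong φ (U ∘ₗ φ) := by
  rw [hat, hatAlong, conv_comp_coalgHom (hφ.comul_comp hf)]
  rfl

/-- The exponential of `f` maps the coderivation `V̂` to a coderivation along `φ`. -/
theorem comp_hat (hf : conj f = (-1 : ℂ) ^ 0 • f) (V : VF P P) :
    φ ∘ₗ hat V = hatAlong φ (f ∘ₗ hat V) := by
  induction V using vf_parity_induction with
  | hadd V W hV hW =>
    rw [hat_add, LinearMap.comp_add, hV, hW, ← hatAlong_add, ← LinearMap.comp_add]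
  | h v V hV =>
    rw [← sub_eq_zero]
    refine eq_zero_of_order fun k => ?_
    induction k generalizing v V with
    | zero => exact order_zero _
    | succ k ih =>
      refine order_succ ?_ fun p x hx => ?_
      · have h1 := hφ.apply_ι_mul (hasParity_apply hV hasParity_one) 1
        rw [mul_one] at h1
        rw [LinearMap.sub_apply, LinearMap.comp_apply, hat_one, h1, hatAlong_one, hatAlong_one,
          LinearMap.comp_apply, LinearMap.comp_apply, hat_one, lm_apply, mul_one, sub_self]
      · have e1 : (φ ∘ₗ hat V) ∘ₗ lm x = φ ∘ₗ hat (V ∘ₗ lm x) + (-1 : ℂ) ^ (v * p) •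
            (hatAlong φ ((f ∘ₗ lm x) ∘ₗ hat V) +
              conv (LinearMap.mul ℂ (GSym Q)) ((ι Q ∘ₗ f ∘ₗ lm x) ∘ₗ tw P v) (φ ∘ₗ hat V)) := by
          rw [LinearMap.comp_assoc, hat_comp_lm hV hx, LinearMap.comp_add, LinearMap.comp_smul,
            ← LinearMap.comp_assoc (hat V) (lm x) φ, hφ.comp_lm p x hx, hatAlong, conv_comp_hat _ _ _ hV]
          rfl
        have e2 : hatAlong φ (f ∘ₗ hat V) ∘ₗ lm x = hatAlong φ (f ∘ₗ hat (V ∘ₗ lm x)) +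
            (-1 : ℂ) ^ (v * p) • hatAlong φ ((f ∘ₗ lm x) ∘ₗ hat V) +
            conv (LinearMap.mul ℂ (GSym Q)) ((ι Q ∘ₗ f ∘ₗ hat V) ∘ₗ tw P p)
              (hatAlong φ (f ∘ₗ lm x)) := by
          rw [← hφ.comp_lm p x hx, ← hatAlong_smul, ← hatAlong_add]
          conv_lhs => rw [hatAlong, conv_comp_lm _ _ _ hx]
          congr 1
          rw [LinearMap.comp_assoc, LinearMap.comp_assoc, hat_comp_lm hV hx, LinearMap.comp_add,
            LinearMap.comp_smul]
          rfl
        have e3 : conv (LinearMap.mul ℂ (GSym Q)) ((ι Q ∘ₗ f ∘ₗ hat V) ∘ₗ tw P p)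
              (hatAlong φ (f ∘ₗ lm x)) = (-1 : ℂ) ^ (v * p) •
            conv (LinearMap.mul ℂ (GSym Q)) ((ι Q ∘ₗ f ∘ₗ lm x) ∘ₗ tw P v)
              (hatAlong φ (f ∘ₗ hat V)) := by
          rw [← conv_smul]
          refine conv_mul_swap fun q r a b ha hb => ?_
          have h1 := hasParity_apply (conj_comp_hat_parity hV hf) ha
          have h2 := hasParity_apply (conj_comp_lm hf hx) hb
          have e := ι_mul_ι_parity h1 h2
          simp only [LinearMap.comp_apply, tw_parity ha, tw_parity hb, map_smul, smul_mul_assoc,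
            LinearMap.smul_apply] at e ⊢
          rw [e]
          simp only [smul_smul, ← pow_add]
          congr 1
          rw [show p * q + (q * r + ((0 + v) * (0 + p + r) + (0 + p) * q)) =
            q * r + (v * p + v * r) + 2 * (p * q) by ring, pow_add _ _ (2 * _),
            pow_mul (-1 : ℂ) 2]
          simp
        rw [LinearMap.sub_comp, e1, e2, e3]
        have e4 := ih (v + p) _ (conj_comp_lm hV hx)
        have e5 := (order_zero ((ι Q ∘ₗ f ∘ₗ lm x) ∘ₗ tw P v)).conv
          (β := LinearMap.mul ℂ (GSym Q)) (ih v V hV)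
        rw [conv_sub_right] at e5
        convert e4.add (e5.smul ((-1 : ℂ) ^ (v * p))) using 1
        module

theorem mem_words {k : ℕ} {a : GSym P} (ha : a ∈ words P k) : φ a ∈ words Q k := by
  induction k generalizing a with
  | zero => rw [mem_words_zero] at *; rw [ha, map_zero]
  | succ k ih =>
    suffices h : words P (k + 1) ≤ (words Q (k + 1)).comap φ from h ha
    refine words_induction ?_ fun p x a hx ha => ?_
    · rw [Submodule.mem_comap, hφ.map_one]; exact one_mem_words k
    · rw [Submodule.mem_comap, hφ.apply_ι_mul hx, hatAlong]
      refine conv_mem (order_zero (ι Q ∘ₗ f ∘ₗ lm x)) (fun b c hc => ?_) a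
        (by rw [add_zero]; exact ha)
      exact ι_mul_mem_words (ih hc) _

end IsExp

end GSym

section Degree
variable {P Q R S : GradedSpace.{u}}

namespace GSym

/-- `Word e a`: `a` is a product of homogeneous generators of total degree `e`. -/
inductive Word : ℤ → GSym P → Prop
  | one : Word 0 1
  | mul {d e : ℤ} {x : P} {a : GSym P} (hx : x ∈ P.deg d) (ha : Word e a) : Word (d + e) (ι P x * a)

theorem Word.hasParity {e : ℤ} {a : GSym P} (ha : Word e a) :
    ∃ p : ℕ, (-1 : ℂ) ^ p = (-1 : ℂ) ^ e ∧ HasParity p a := by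
  induction ha with
  | one => exact ⟨0, by simp, hasParity_one⟩
  | @mul d e x a hx _ ih =>
    obtain ⟨p, hp, ha⟩ := ih
    obtain ⟨q, hq, hd⟩ := P.exists_parity_of_mem (i := d)
    refine ⟨q + p, ?_, (hasParity_ι (hd x hx)).mul ha⟩
    rw [pow_add, hp, hq, zpow_add₀ (by simp)]

theorem ext_word {A : Type*} [AddCommGroup A] [Module ℂ A] {F G : GSym P →ₗ[ℂ] A}
    (h : ∀ e a, Word e a → F a = G a) : F = G := by
  have key : ∀ a, a ∈ Submodule.span ℂ {a : GSym P | ∃ e, Word e a} := by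
    intro a
    induction a using induction with
    | one => exact Submodule.subset_span ⟨0, .one⟩
    | mul p x a hp ih =>
      clear hp
      induction x using P.induction with
      | mem d x hx =>
        have : Submodule.span ℂ {a : GSym P | ∃ e, Word e a} ≤
            (Submodule.span ℂ {a : GSym P | ∃ e, Word e a}).comap (lm x) := by
          refine Submodule.span_le.2 ?_
          rintro b ⟨e, hb⟩
          exact Submodule.subset_span ⟨d + e, .mul hx hb⟩
        exact this ih
      | zero => simp
      | add x y hx hy => rw [map_add, add_mul]; exact Submodule.add_mem _ hx hy
    | add a b ha hb => exact Submodule.add_mem _ ha hb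
    | smul c a ha => exact Submodule.smul_mem _ c ha
  have h2 : Submodule.span ℂ {a : GSym P | ∃ e, Word e a} ≤ LinearMap.eqLocus F G :=
    Submodule.span_le.2 fun a ⟨e, ha⟩ => h e a ha
  exact LinearMap.ext fun a => h2 (key a)

end GSym

/-- The degree of a vector field may be tested on words built one letter at a time. -/
theorem hasDegree_iff {V : VF P Q} {m : ℤ} :
    HasDegree V m ↔ ∀ e a, GSym.Word e a → V a ∈ Q.deg (e + m) := by
  constructor
  · intro h e a ha
    have : ∃ (k : ℕ) (d : Fin k → ℤ) (x : Fin k → P), (∀ i, x i ∈ P.deg (d i)) ∧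
        a = (List.ofFn fun i => GSym.ι P (x i)).prod ∧ e = ∑ i, d i := by
      induction ha with
      | one => exact ⟨0, Fin.elim0, Fin.elim0, fun i => i.elim0, by simp, by simp⟩
      | @mul d e x a hx _ ih =>
        obtain ⟨k, d', x', hx', rfl, rfl⟩ := ih
        refine ⟨k + 1, Fin.cons d d', Fin.cons x x', fun i => ?_, ?_, ?_⟩
        · refine Fin.cases ?_ (fun i => ?_) i
          · simpa using hx
          · simpa using hx' i
        · simp [List.ofFn_succ]
        · simp [Fin.sum_univ_succ]
    obtain ⟨k, d, x, hx, rfl, rfl⟩ := this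
    exact h k d x hx
  · intro h k d x hx
    refine h _ _ ?_
    clear h
    induction k with
    | zero => simpa using GSym.Word.one
    | succ k ih =>
      rw [List.ofFn_succ, List.prod_cons, Fin.sum_univ_succ]
      exact .mul (hx 0) (ih (fun i => d i.succ) (fun i => x i.succ) fun i => hx i.succ)

theorem HasDegree.map_one {V : VF P Q} {m : ℤ} (hV : HasDegree V m) : V 1 ∈ Q.deg m := by
  simpa using hasDegree_iff.1 hV 0 1 .one

theorem HasDegree.comp_lm {V : VF P Q} {m d : ℤ} (hV : HasDegree V m) {x : P} (hx : x ∈ P.deg d) :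
    HasDegree (V ∘ₗ GSym.lm x) (d + m) := by
  rw [hasDegree_iff] at *
  intro e a ha
  have := hV _ _ (.mul hx ha)
  rwa [show e + (d + m) = d + e + m by ring]

theorem HasDegree.comp_tw {V : VF P Q} {m : ℤ} (hV : HasDegree V m) (p : ℕ) :
    HasDegree (V ∘ₗ GSym.tw P p) m := by
  rw [hasDegree_iff] at *
  intro e a ha
  obtain ⟨q, _, hq⟩ := ha.hasParity
  rw [LinearMap.comp_apply, GSym.tw_parity hq, map_smul]
  exact Submodule.smul_mem _ _ (hV e a ha)

theorem HasDegree.conv {β : Q →ₗ[ℂ] R →ₗ[ℂ] S} {c : ℤ}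
    (hβ : ∀ i j, ∀ x ∈ Q.deg i, ∀ y ∈ R.deg j, β x y ∈ S.deg (i + j + c)) {V : VF P Q} {W : VF P R}
    {i j : ℤ} (hV : HasDegree V i) (hW : HasDegree W j) :
    HasDegree (GSym.conv β V W : VF P S) (i + j + c) := by
  rw [hasDegree_iff]
  intro e a ha
  induction ha generalizing V W i j with
  | one =>
    rw [GSym.conv_one, zero_add]
    exact hβ _ _ _ hV.map_one _ hW.map_one
  | @mul d e x a hx _ ih =>
    obtain ⟨p, _, hp⟩ := P.exists_parity_of_mem (i := d)
    rw [GSym.conv_ι_mul _ _ _ (hp x hx)]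
    have h1 := ih (hV.comp_lm hx) hW
    have h2 := ih (hV.comp_tw p) (hW.comp_lm hx)
    rw [show e + (d + i + j + c) = d + e + (i + j + c) by ring] at h1
    rw [show e + (i + (d + j) + c) = d + e + (i + j + c) by ring] at h2
    exact Submodule.add_mem _ h1 h2

theorem HasDegree.comp_left {T : Q →ₗ[ℂ] R} {c : ℤ} (hT : ∀ i, ∀ x ∈ Q.deg i, T x ∈ R.deg (i + c))
    {V : VF P Q} {m : ℤ} (hV : HasDegree V m) : HasDegree (T ∘ₗ V : VF P R) (m + c) := by
  rw [hasDegree_iff] at *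
  intro e a ha
  have := hT _ _ (hV e a ha)
  rwa [add_assoc] at this

theorem HasDegree.add {V W : VF P Q} {m : ℤ} (hV : HasDegree V m) (hW : HasDegree W m) :
    HasDegree (V + W) m := fun k d x hx => Submodule.add_mem _ (hV k d x hx) (hW k d x hx)

theorem HasDegree.sub {V W : VF P Q} {m : ℤ} (hV : HasDegree V m) (hW : HasDegree W m) :
    HasDegree (V - W) m := fun k d x hx => Submodule.sub_mem _ (hV k d x hx) (hW k d x hx)

theorem HasDegree.smul {V : VF P Q} {m : ℤ} (hV : HasDegree V m) (c : ℂ) :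
    HasDegree (c • V) m := fun k d x hx => Submodule.smul_mem _ c (hV k d x hx)

theorem hasDegree_zero (m : ℤ) : HasDegree (0 : VF P Q) m := fun _ _ _ _ => Submodule.zero_mem _

theorem hasDegree_proj : HasDegree (GSym.proj Q) 0 := by
  rw [hasDegree_iff]
  intro e a ha
  rw [add_zero]
  cases ha with
  | one => rw [GSym.proj_one]; exact Submodule.zero_mem _
  | @mul d e x a hx ha =>
    rw [GSym.proj_ι_mul]
    cases ha with
    | one => simpa using hx
    | mul _ _ => rw [GSym.counit_ι_mul, zero_smul]; exact Submodule.zero_mem _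

theorem HasDegree.conj_eq {V : VF P Q} {m : ℤ} (hV : HasDegree V m) {v : ℕ}
    (hv : (-1 : ℂ) ^ v = (-1 : ℂ) ^ m) : conj V = (-1 : ℂ) ^ v • V := by
  refine GSym.ext_word fun e a ha => ?_
  obtain ⟨p, hp, h⟩ := ha.hasParity
  have h' : GSym.sgn P a = (-1 : ℂ) ^ p • a := h
  rw [conj_apply, h', map_smul, map_smul, Q.sgn_apply _ _ (hasDegree_iff.1 hV e a ha),
    smul_smul, zpow_add₀ (by simp), ← hp, ← hv, LinearMap.smul_apply, ← mul_assoc,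
    neg_one_pow_mul_self, one_mul]

end Degree
end ExtDef

/-! ### Shifted dg Gerstenhaber algebras and contractions -/

namespace ExtDef

universe u

namespace GradedSpace
variable {Q R : GradedSpace.{u}}

/-- Linear maps which agree on homogeneous elements of one parity agree on all elements of that
parity. -/
theorem parity_ext {A : Type*} [AddCommGroup A] [Module ℂ A] {F G : Q →ₗ[ℂ] A} {p : ℕ}
    (h : ∀ i : ℤ, (-1 : ℂ) ^ i = (-1 : ℂ) ^ p → ∀ x ∈ Q.deg i, F x = G x) {x : Q}
    (hx : Q.HasParity p x) : F x = G x := by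
  have key : ∀ x, F (x + (-1 : ℂ) ^ p • Q.sgn x) = G (x + (-1 : ℂ) ^ p • Q.sgn x) := by
    intro x
    induction x using Q.induction with
    | mem i x hx =>
      rw [Q.sgn_apply i x hx]
      by_cases hi : (-1 : ℂ) ^ i = (-1 : ℂ) ^ p
      · rw [hi, smul_smul, neg_one_pow_mul_self, one_smul, map_add, map_add, h i hi x hx]
      · have : (-1 : ℂ) ^ i = -(-1 : ℂ) ^ p := by
          rcases Int.even_or_odd i with h1 | h1 <;> rcases Nat.even_or_odd p with h2 | h2 <;>
            simp [h1.neg_one_zpow, h2.neg_one_pow] at hi ⊢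
        rw [this, smul_smul, mul_neg, neg_one_pow_mul_self, neg_one_smul, add_neg_cancel]
        simp
    | zero => simp
    | add x y hx hy =>
      have : x + y + (-1 : ℂ) ^ p • Q.sgn (x + y) = (x + (-1 : ℂ) ^ p • Q.sgn x) +
          (y + (-1 : ℂ) ^ p • Q.sgn y) := by rw [map_add]; module
      rw [this, map_add F, map_add G, hx, hy]
  have h2 := key x
  rw [show Q.sgn x = _ from hx, smul_smul, neg_one_pow_mul_self, one_smul, ← two_smul ℂ x,
    map_smul, map_smul] at h2
  exact smul_right_injective _ two_ne_zero h2

theorem parity_ext₂ {A : Type*} [AddCommGroup A] [Module ℂ A] {F G : Q →ₗ[ℂ] R →ₗ[ℂ] A} {p q : ℕ}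
    (h : ∀ i j : ℤ, (-1 : ℂ) ^ (i * j) = (-1 : ℂ) ^ (p * q) →
      ∀ x ∈ Q.deg i, ∀ y ∈ R.deg j, F x y = G x y) {x : Q} {y : R}
    (hx : Q.HasParity p x) (hy : R.HasParity q y) : F x y = G x y := by
  refine parity_ext (F := F.flip y) (G := G.flip y) (fun i hi x hx => ?_) hx
  refine parity_ext (F := F x) (G := G x) (fun j hj y hy => h i j ?_ x hx y hy) hy
  rw [zpow_mul, hi, ← zpow_natCast, ← zpow_mul, mul_comm, zpow_mul, hj, zpow_natCast, ← pow_mul,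
    mul_comm]

theorem sgn_map {T : Q →ₗ[ℂ] R} {c : ℤ} (hT : ∀ i, ∀ x ∈ Q.deg i, T x ∈ R.deg (i + c)) (x : Q) :
    R.sgn (T x) = (-1 : ℂ) ^ c • T (Q.sgn x) := by
  induction x using Q.induction with
  | mem i x hx =>
    rw [R.sgn_apply _ _ (hT i x hx), Q.sgn_apply i x hx, map_smul, smul_smul,
      zpow_add₀ (by simp), mul_comm]
  | zero => simp
  | add x y hx hy => simp only [map_add, hx, hy, smul_add]

theorem sgn_map₂ {β : Q →ₗ[ℂ] Q →ₗ[ℂ] R} {c : ℤ}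
    (hβ : ∀ i j, ∀ x ∈ Q.deg i, ∀ y ∈ Q.deg j, β x y ∈ R.deg (i + j + c)) (x y : Q) :
    R.sgn (β x y) = (-1 : ℂ) ^ c • β (Q.sgn x) (Q.sgn y) := by
  induction x using Q.induction with
  | mem i x hx =>
    induction y using Q.induction with
    | mem j y hy =>
      rw [R.sgn_apply _ _ (hβ i j x hx y hy), Q.sgn_apply i x hx, Q.sgn_apply j y hy, map_smul,
        map_smul, LinearMap.smul_apply, smul_smul, smul_smul,
        zpow_add₀ (by simp), zpow_add₀ (by simp)]
      congr 1; ring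
    | zero => simp
    | add x y hx hy => simp only [map_add, hx, hy, smul_add]
  | zero => simp
  | add x y hx hy => simp only [map_add, LinearMap.add_apply, hx, hy, smul_add]

end GradedSpace

/-- A dg Lie algebra structure on a shift of `Q`, written as a differential `d` and a graded
symmetric bracket `b` of degree one. -/
structure IsShiftedDGLie {Q : GradedSpace.{u}} (d : Q →ₗ[ℂ] Q) (b : Q →ₗ[ℂ] Q →ₗ[ℂ] Q) : Prop where
  d_mem : ∀ i, ∀ x ∈ Q.deg i, d x ∈ Q.deg (i + 1)
  d_sq : ∀ x, d (d x) = 0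
  b_mem : ∀ i j, ∀ x ∈ Q.deg i, ∀ y ∈ Q.deg j, b x y ∈ Q.deg (i + j + 1)
  b_symm : ∀ (p q : ℕ) (x y : Q), Q.HasParity p x → Q.HasParity q y →
    b x y = (-1 : ℂ) ^ (p * q) • b y x
  d_b : ∀ x y, d (b x y) = - b (d x) y - b (Q.sgn x) (d y)
  jacobi : ∀ (p q : ℕ) (z x y : Q), Q.HasParity p x → Q.HasParity q y →
    b (b z x) y + (-1 : ℂ) ^ (p * q) • b (b z y) x + b (Q.sgn z) (b x y) = 0

/-- A dg Gerstenhaber algebra structure on a shift of `Q`, with the sign conventions of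
`IsShiftedDGLie`; `μ` is the product. -/
structure IsShiftedGerstenhaber {Q : GradedSpace.{u}} (d : Q →ₗ[ℂ] Q) (b μ : Q →ₗ[ℂ] Q →ₗ[ℂ] Q) : Prop
    extends IsShiftedDGLie d b where
  μ_mem : ∀ i j, ∀ x ∈ Q.deg i, ∀ y ∈ Q.deg j, μ x y ∈ Q.deg (i + j + 2)
  μ_comm : ∀ (p q : ℕ) (x y : Q), Q.HasParity p x → Q.HasParity q y →
    μ x y = (-1 : ℂ) ^ (p * q) • μ y x
  μ_assoc : ∀ x y z, μ (μ x y) z = μ x (μ y z)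
  d_μ : ∀ x y, d (μ x y) = μ (d x) y + μ (Q.sgn x) (d y)
  b_μ : ∀ (p q : ℕ) (z w y : Q), Q.HasParity p w → Q.HasParity q y →
    b (μ z w) y = (-1 : ℂ) ^ (p * q) • μ (b z y) w + μ (Q.sgn z) (b w y)

/-- A dg Gerstenhaber algebra satisfies the sign conventions of `IsShiftedGerstenhaber`, with the
bracket `b(x, y) = (-1)^{|x|} [x, y]`. -/
theorem IsDGGerstenhaber.isShifted {Q : GradedSpace.{u}} {mul : Q →ₗ[ℂ] Q →ₗ[ℂ] Q} {d : Q →ₗ[ℂ] Q}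
    {br : Q →ₗ[ℂ] Q →ₗ[ℂ] Q} (H : IsDGGerstenhaber Q mul d br) :
    IsShiftedGerstenhaber d (br ∘ₗ Q.sgn) mul where
  d_mem := H.d_mem
  d_sq := H.d_sq
  b_mem i j x hx y hy := by
    rw [LinearMap.comp_apply, Q.sgn_apply i x hx, map_smul, LinearMap.smul_apply]
    exact Submodule.smul_mem _ _ (H.br_mem i j x hx y hy)
  b_symm p q x y hx hy := by
    refine GradedSpace.parity_ext₂ (F := br ∘ₗ Q.sgn)
      (G := (-1 : ℂ) ^ (p * q) • (br ∘ₗ Q.sgn).flip) (fun i j e x hx y hy => ?_) hx hy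
    simp only [LinearMap.comp_apply, LinearMap.smul_apply, LinearMap.flip_apply,
      Q.sgn_apply i x hx, Q.sgn_apply j y hy, map_smul, ← e, H.br_symm i j x hx y hy]
    rcases Int.even_or_odd i with h1 | h1 <;> rcases Int.even_or_odd j with h2 | h2 <;>
      simp [h1, h2, parity_simps, Even.neg_one_zpow, Odd.neg_one_zpow]
  d_b x y := by
    induction x using Q.induction with
    | mem i x hx =>
      simp only [LinearMap.comp_apply, Q.sgn_apply i x hx, Q.sgn_apply _ _ (H.d_mem i x hx), map_smul,
        LinearMap.smul_apply, H.d_br i x hx y]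
      rw [smul_add, smul_smul, smul_smul, zpow_sub₀ (by simp), zpow_add₀ (by simp)]
      rcases Int.even_or_odd i with h1 | h1 <;> simp [h1.neg_one_zpow] <;> abel
    | zero => simp
    | add x x' hx hx' => simp only [map_add, LinearMap.add_apply, hx, hx']; abel
  jacobi p q z x y hx hy := by
    set c := br ∘ₗ Q.sgn with hc
    refine GradedSpace.parity_ext₂ (F := c.compr₂ LinearMap.id ∘ₗ c z +
      (-1 : ℂ) ^ (p * q) • (c.compr₂ LinearMap.id ∘ₗ c z).flip + c.compr₂ (c (Q.sgn z)))
      (G := 0) (fun i j e x hx y hy => ?_) hx hy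
    induction z using Q.induction with
    | mem k z hz =>
      have j1 := H.jacobi k i z hz x hx y
      have j2 := H.br_symm i (k + j + 1) x hx _ (H.br_mem k j z hz y hy)
      simp only [hc, LinearMap.add_apply, LinearMap.smul_apply, LinearMap.flip_apply,
        LinearMap.compr₂_apply, LinearMap.comp_apply, LinearMap.id_apply, Q.sgn_apply k z hz,
        Q.sgn_apply i x hx, map_smul, ← e,
        Q.sgn_apply _ _ (H.br_mem k i z hz x hx), Q.sgn_apply _ _ (H.br_mem k j z hz y hy),
        LinearMap.zero_apply, j1, j2, smul_add, smul_smul, smul_neg]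
      rcases Int.even_or_odd i with h1 | h1 <;> rcases Int.even_or_odd j with h2 | h2 <;>
      rcases Int.even_or_odd k with h3 | h3 <;>
        simp [h1.neg_one_zpow, h2.neg_one_zpow, h3.neg_one_zpow, zpow_add₀, zpow_sub₀, zpow_mul] <;> abel
    | zero => simp
    | add z z' hz hz' =>
      simp only [map_add, LinearMap.add_apply, LinearMap.smul_apply, LinearMap.flip_apply,
        LinearMap.compr₂_apply, LinearMap.comp_apply, LinearMap.zero_apply, LinearMap.id_apply,
        smul_add] at hz hz' ⊢
      have := congrArg₂ (· + ·) hz hz'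
      simp only [add_zero] at this
      rw [← this]
      abel
  μ_mem := H.mul_mem
  μ_comm p q x y hx hy := by
    refine GradedSpace.parity_ext₂ (F := mul) (G := (-1 : ℂ) ^ (p * q) • mul.flip)
      (fun i j e x hx y hy => ?_) hx hy
    rw [H.mul_comm i j x hx y hy, e]; rfl
  μ_assoc := H.mul_assoc
  d_μ x y := by
    induction x using Q.induction with
    | mem i x hx => rw [H.d_mul i x hx, Q.sgn_apply i x hx, map_smul, LinearMap.smul_apply]
    | zero => simp
    | add x x' hx hx' => simp only [map_add, LinearMap.add_apply, hx, hx']; abel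
  b_μ p q z w y hw hy := by
    set c := br ∘ₗ Q.sgn with hc
    refine GradedSpace.parity_ext₂ (F := c ∘ₗ mul z) (G := (-1 : ℂ) ^ (p * q) •
      (mul ∘ₗ c z).flip + c.compr₂ (mul (Q.sgn z))) (fun i j e w hw y hy => ?_) hw hy
    induction z using Q.induction with
    | mem k z hz =>
      have h1 := H.br_mul j k y hy z hz w
      have h2 := H.br_symm (k + i + 2) j _ (H.mul_mem k i z hz w hw) y hy
      have h3 := H.br_symm j k y hy z hz
      have h4 := H.br_symm j i y hy w hw
      simp only [hc, LinearMap.add_apply, LinearMap.smul_apply, LinearMap.flip_apply,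
        LinearMap.compr₂_apply, LinearMap.comp_apply, Q.sgn_apply k z hz,
        Q.sgn_apply i w hw, map_smul, ← e, Q.sgn_apply _ _ (H.mul_mem k i z hz w hw),
        h1, h2, h3, h4, smul_add, smul_smul, smul_neg, map_neg, LinearMap.neg_apply]
      rcases Int.even_or_odd i with h1 | h1 <;> rcases Int.even_or_odd j with h2 | h2 <;>
      rcases Int.even_or_odd k with h3 | h3 <;>
        simp [h1.neg_one_zpow, h2.neg_one_zpow, h3.neg_one_zpow, zpow_add₀, zpow_sub₀, zpow_mul] <;> abel
    | zero => simp
    | add z z' hz hz' =>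
      simp only [map_add, LinearMap.add_apply, LinearMap.smul_apply, LinearMap.flip_apply,
        LinearMap.compr₂_apply, LinearMap.comp_apply, smul_add] at hz hz' ⊢
      rw [hz, hz']
      abel

namespace IsShiftedDGLie
variable {Q : GradedSpace.{u}} {d : Q →ₗ[ℂ] Q} {b : Q →ₗ[ℂ] Q →ₗ[ℂ] Q} (H : IsShiftedDGLie d b)
include H

theorem sgn_d (x : Q) : Q.sgn (d x) = (-1 : ℂ) • d (Q.sgn x) := by
  rw [Q.sgn_d d H.d_mem, neg_one_smul]

theorem sgn_b (x y : Q) : Q.sgn (b x y) = (-1 : ℂ) • b (Q.sgn x) (Q.sgn y) := by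
  have := GradedSpace.sgn_map₂ H.b_mem x y
  simpa using this

end IsShiftedDGLie

/-- A contraction of the complex `(Q, d)` onto the graded vector space `P` with zero differential,
with the side conditions. The degrees are written `k + c`, the form that `GradedSpace.sgn_map` takes. -/
structure Contraction {Q : GradedSpace.{u}} (d : Q →ₗ[ℂ] Q) (P : GradedSpace.{u}) where
  i : P →ₗ[ℂ] Q
  p : Q →ₗ[ℂ] P
  h : Q →ₗ[ℂ] Q
  i_mem : ∀ k, ∀ x ∈ P.deg k, i x ∈ Q.deg (k + 0)
  p_mem : ∀ k, ∀ x ∈ Q.deg k, p x ∈ P.deg (k + 0)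
  h_mem : ∀ k, ∀ x ∈ Q.deg k, h x ∈ Q.deg (k + -1)
  p_i : ∀ x, p (i x) = x
  d_i : ∀ x, d (i x) = 0
  p_d : ∀ x, p (d x) = 0
  h_i : ∀ x, h (i x) = 0
  p_h : ∀ x, p (h x) = 0
  h_h : ∀ x, h (h x) = 0
  homotopy : ∀ x, d (h x) + h (d x) + i (p x) = x

namespace Contraction
variable {P Q : GradedSpace.{u}} {d : Q →ₗ[ℂ] Q} (c : Contraction d P)

theorem sgn_i (x : P) : Q.sgn (c.i x) = c.i (P.sgn x) := by
  simpa using GradedSpace.sgn_map c.i_mem x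

theorem sgn_p (x : Q) : P.sgn (c.p x) = c.p (Q.sgn x) := by
  simpa using GradedSpace.sgn_map c.p_mem x

theorem sgn_h (x : Q) : Q.sgn (c.h x) = (-1 : ℂ) • c.h (Q.sgn x) := by
  simpa using GradedSpace.sgn_map c.h_mem x

theorem h_d_h (x : Q) : c.h (d (c.h x)) = c.h x := by
  have := congrArg c.h (c.homotopy x)
  simpa [c.h_i, c.h_h] using this

end Contraction

/-- A graded complex over a field contracts onto its cohomology; the embedding picks representatives
of cohomology classes. -/
theorem exists_contraction {Q : GradedSpace.{u}} {d : Q →ₗ[ℂ] Q}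
    (hd : ∀ i, ∀ x ∈ Q.deg i, d x ∈ Q.deg (i + 1)) (d_sq : ∀ x, d (d x) = 0) :
    ∃ c : Contraction d (Q.cohomology d hd), ∀ a : LinearMap.ker d,
      c.i (Q.classOf d hd a) = a.1 - d (c.h a.1) := by
  -- a linear map `g` of degree `-1` with `d g d = d`
  obtain ⟨s, hs⟩ := LinearMap.exists_rightInverse_of_surjective d.rangeRestrict d.range_rangeRestrict
  obtain ⟨g₀, hg₀⟩ := LinearMap.exists_extend s
  have hdg₀ : ∀ x, d (g₀ (d x)) = d x := by
    intro x
    have h1 := LinearMap.congr_fun hs (d.rangeRestrict x)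
    have h2 := LinearMap.congr_fun hg₀ (d.rangeRestrict x)
    rw [LinearMap.comp_apply] at h2
    have h3 := congrArg Subtype.val h1
    rw [LinearMap.comp_apply, ← h2] at h3
    exact h3
  let g : Q →ₗ[ℂ] Q := DirectSum.toModule ℂ ℤ Q (fun i => Q.comp (i + -1) ∘ₗ g₀ ∘ₗ (Q.deg i).subtype) ∘ₗ
    (LinearEquiv.ofBijective (DirectSum.coeLinearMap Q.deg) Q.bijective).symm.toLinearMap
  have hg : ∀ i, ∀ x ∈ Q.deg i, g x = Q.comp (i + -1) (g₀ x) := by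
    intro i x hx
    have : (LinearEquiv.ofBijective (DirectSum.coeLinearMap Q.deg) Q.bijective).symm x =
        DirectSum.lof ℂ ℤ (fun i => Q.deg i) i ⟨x, hx⟩ := by
      rw [LinearEquiv.symm_apply_eq, LinearEquiv.ofBijective_apply, DirectSum.coeLinearMap_lof]
    simp only [g, LinearMap.comp_apply, LinearEquiv.coe_coe, this, DirectSum.toModule_lof]
    rfl
  have g_mem : ∀ i, ∀ x ∈ Q.deg i, g x ∈ Q.deg (i + -1) := fun i x hx => by
    rw [hg i x hx]; exact Q.comp_mem _ _
  have hdg : ∀ x, d (g (d x)) = d x := by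
    intro x
    induction x using Q.induction with
    | mem i x hx =>
      rw [hg _ _ (hd i x hx), ← Q.comp_d d hd, hdg₀, Q.comp_apply _ _ _ (hd i x hx), if_pos (by ring)]
    | zero => simp
    | add x y hx hy => simp only [map_add, hx, hy]
  let h₀ : Q →ₗ[ℂ] Q := g ∘ₗ d ∘ₗ g
  have h₀_mem : ∀ i, ∀ x ∈ Q.deg i, h₀ x ∈ Q.deg (i + -1) := fun i x hx => by
    have := g_mem _ _ (hd _ _ (g_mem i x hx))
    rwa [show i + -1 + 1 + -1 = i + -1 by ring] at this
  have e1 : ∀ x, d (h₀ (d x)) = d x := fun x => by simp [h₀, hdg]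
  have e2 : ∀ x, h₀ (d (h₀ x)) = h₀ x := fun x => by simp [h₀, hdg]
  let h : Q →ₗ[ℂ] Q := h₀ - h₀ ∘ₗ h₀ ∘ₗ d
  have hh : ∀ x, h x = h₀ x - h₀ (h₀ (d x)) := fun x => rfl
  have h_mem : ∀ i, ∀ x ∈ Q.deg i, h x ∈ Q.deg (i + -1) := fun i x hx => by
    refine Submodule.sub_mem _ (h₀_mem i x hx) ?_
    have := h₀_mem _ _ (h₀_mem _ _ (hd i x hx))
    rwa [show i + 1 + -1 + -1 = i + -1 by ring] at this
  have f1 : ∀ x, d (h (d x)) = d x := fun x => by simp [hh, d_sq, e1]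
  have f2 : ∀ x, h (h x) = 0 := fun x => by simp [hh, e2]
  have f3 : ∀ x, h (d (h x)) = h x := fun x => by
    have : d (h x) = d (h₀ x) - d (h₀ (h₀ (d x))) := by rw [hh, map_sub]
    rw [hh, d_sq, map_zero, map_zero, sub_zero, this, map_sub, e2, e2, hh]
  let π : Q →ₗ[ℂ] Q := LinearMap.id - d ∘ₗ h - h ∘ₗ d
  have hπ : ∀ x, π x = x - d (h x) - h (d x) := fun x => rfl
  have hπd : ∀ x, d (π x) = 0 := fun x => by simp [hπ, d_sq, f1]
  have hπ_mem : ∀ i, ∀ x ∈ Q.deg i, π x ∈ Q.deg i := fun i x hx => by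
    refine Submodule.sub_mem _ (Submodule.sub_mem _ hx ?_) ?_
    · have := hd _ _ (h_mem i x hx)
      rwa [show i + -1 + 1 = i by ring] at this
    · have := h_mem _ _ (hd i x hx)
      rwa [show i + 1 + -1 = i by ring] at this
  let i₀ : Q.Coh d →ₗ[ℂ] Q := Submodule.liftQ _ (π ∘ₗ (LinearMap.ker d).subtype) (by
    rintro ⟨x, hx⟩ ⟨y, rfl⟩
    simp [hπ, f1, d_sq])
  let p₀ : Q →ₗ[ℂ] Q.Coh d := Q.cls d ∘ₗ π.codRestrict (LinearMap.ker d) hπd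
  have hi₀ : ∀ a, i₀ (Q.cls d a) = π a.1 := fun a => Submodule.liftQ_apply _ _ _
  have cls_zero : ∀ a : LinearMap.ker d, (∃ y, d y = a.1) → Q.cls d a = 0 := fun a ha => by
    refine (Submodule.Quotient.mk_eq_zero _).2 ?_
    exact ha
  have hp₀ : ∀ x, (∃ y, d y = π x) → p₀ x = 0 := fun x hx => cls_zero _ hx
  have hπ2 : ∀ x, π (π x) = π x := fun x => by
    have h1 : h (π x) = 0 := by simp [hπ, f2, f3]
    rw [hπ (π x), h1, hπd]; simp
  let c : Contraction d (Q.cohomology d hd) :=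
    { i := i₀
      p := p₀
      h := h
      i_mem := by
        rintro k _ ⟨a, ha, rfl⟩
        refine (congrArg (fun y => y ∈ Q.deg (k + 0)) (hi₀ a)).mpr ?_
        rw [add_zero]
        exact hπ_mem k a.1 ha
      p_mem := by
        intro k x hx
        rw [add_zero]
        exact ⟨_, hπ_mem k x hx, rfl⟩
      h_mem := h_mem
      p_i := by
        intro x
        obtain ⟨a, rfl⟩ := Submodule.mkQ_surjective _ x
        refine (congrArg p₀ (hi₀ a)).trans ?_
        rw [← sub_eq_zero]
        refine (map_sub (Q.cls d) _ a).symm.trans (cls_zero _ ⟨- h a.1, ?_⟩)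
        have ha : d a.1 = 0 := a.2
        change d (-h a.1) = π (π a.1) - a.1
        rw [hπ2, hπ, ha]
        simp
      d_i := by
        intro x
        obtain ⟨a, rfl⟩ := Submodule.mkQ_surjective _ x
        exact (congrArg d (hi₀ a)).trans (hπd _)
      p_d := fun x => hp₀ _ ⟨0, by simp [hπ, f1, d_sq]⟩
      h_i := by
        intro x
        obtain ⟨a, rfl⟩ := Submodule.mkQ_surjective _ x
        refine (congrArg h (hi₀ a)).trans ?_
        simp [hπ, f3]
      p_h := fun x => hp₀ _ ⟨0, by simp [hπ, f2, f3]⟩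
      h_h := f2
      homotopy := fun x => by
        have : i₀ (p₀ x) = π (π x) := hi₀ _
        refine (congrArg (fun y => d (h x) + h (d x) + y) this).trans ?_
        rw [hπ2, hπ]
        abel }
  refine ⟨c, fun a => ?_⟩
  have ha : d a.1 = 0 := a.2
  refine (hi₀ a).trans ?_
  rw [hπ, ha, map_zero, sub_zero]

end ExtDef

/-! ### Brackets of vector fields along a map -/

namespace ExtDef

universe u

open GSym

section Quad
variable {P Q : GradedSpace.{u}} {d : Q →ₗ[ℂ] Q} {b : Q →ₗ[ℂ] Q →ₗ[ℂ] Q}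

theorem proj_comp_lm (x : Q) : proj Q ∘ₗ lm x =
    ((LinearMap.lsmul ℂ Q).flip x) ∘ₗ (counit Q).toLinearMap := by
  ext1 a
  simp [proj_ι_mul]

/-- The Taylor expansion `q ↦ d q + b(q, q)/2` of a quadratic vector field. -/
theorem quad_eq (hb : ∀ (p q : ℕ) (x y : Q), Q.HasParity p x → Q.HasParity q y →
      b x y = (-1 : ℂ) ^ (p * q) • b y x) :
    quad d b hb = d ∘ₗ proj Q + (1 / 2 : ℂ) • conv b (proj Q) (proj Q) := by
  refine ext_lm ?_ fun p x a hx _ => ?_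
  · simp [quad_one, proj_one, conv_one]
  · have h1 : conv b (proj Q ∘ₗ lm x) (proj Q) = b x ∘ₗ proj Q := by
      rw [proj_comp_lm]
      refine Eq.trans (conv_congr fun _ _ _ _ _ _ => ?_) (conv_counit_left (b x)
        (β := (LinearMap.lsmul ℂ (Q →ₗ[ℂ] Q)).flip (b x)) (by simp) (proj Q))
      simp
    have h2 : conv b (proj Q ∘ₗ tw Q p) (proj Q ∘ₗ lm x) = b x ∘ₗ proj Q := by
      rw [proj_comp_lm]
      refine Eq.trans (conv_congr fun _ _ _ _ _ _ => ?_) ((conv_counit_right (b.flip x)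
        (β := ((LinearMap.lsmul ℂ Q) : ℂ →ₗ[ℂ] Q →ₗ[ℂ] Q).flip ∘ₗ (b.flip x)) (by simp)
          (proj Q ∘ₗ tw Q p)).trans ?_)
      · simp
      · refine linearMap_ext_parity fun q a ha => ?_
        simp only [LinearMap.comp_apply, tw_parity ha, map_smul, LinearMap.flip_apply]
        rw [hb q p _ x (proj_parity ha) hx, smul_smul, mul_comm p q, neg_one_pow_mul_self, one_smul]
    rw [quad_ι_mul, LinearMap.add_apply, LinearMap.smul_apply, conv_ι_mul _ _ _ hx, h1, h2]
    simp only [LinearMap.comp_apply, proj_ι_mul, map_smul]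
    module

theorem quad_comp_coalgHom (hb : ∀ (p q : ℕ) (x y : Q), Q.HasParity p x → Q.HasParity q y →
      b x y = (-1 : ℂ) ^ (p * q) • b y x) {φ : GSym P →ₗ[ℂ] GSym Q}
    (hφ : comul Q ∘ₗ φ = TensorProduct.map φ φ ∘ₗ comul P) :
    quad d b hb ∘ₗ φ = d ∘ₗ proj Q ∘ₗ φ + (1 / 2 : ℂ) • conv b (proj Q ∘ₗ φ) (proj Q ∘ₗ φ) := by
  rw [quad_eq hb, LinearMap.add_comp, LinearMap.smul_comp, conv_comp_coalgHom hφ]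
  rfl

theorem proj_comp_hat (V : VF Q Q) : proj Q ∘ₗ hat V = V := by
  have h := quad_comp_hatAlong (LinearMap.id : Q →ₗ[ℂ] Q) 0 (by simp) (φ := LinearMap.id)
    (by simp) V
  rw [conv_zero_form, add_zero, LinearMap.id_comp] at h
  exact h

end Quad

theorem comp_sgn_of_parity {P Q : GradedSpace.{u}} {v : ℕ} {V : VF P Q}
    (hV : conj V = (-1 : ℂ) ^ v • V) : Q.sgn ∘ₗ V = (-1 : ℂ) ^ v • (V ∘ₗ tw P 1) := by
  refine linearMap_ext_parity fun p a ha => ?_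
  rw [LinearMap.comp_apply, show Q.sgn (V a) = _ from hasParity_apply hV ha, LinearMap.smul_apply,
    LinearMap.comp_apply, tw_parity ha, map_smul, smul_smul, pow_add, one_mul]

namespace IsShiftedDGLie
variable {P Q : GradedSpace.{u}} {d : Q →ₗ[ℂ] Q} {b : Q →ₗ[ℂ] Q →ₗ[ℂ] Q} (H : IsShiftedDGLie d b)
include H

theorem conj_d (Z : VF P Q) : conj (d ∘ₗ Z : VF P Q) = - (d ∘ₗ conj Z) := by
  rw [conj_comp_left H.sgn_d, neg_one_smul]

theorem conj_conv_b (V W : VF P Q) :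
    conj (conv b V W : VF P Q) = - conv b (conj V) (conj W) := by
  rw [conj_conv H.sgn_b, neg_one_smul]

theorem d_conv (V W : VF P Q) : d ∘ₗ conv b V W =
    - conv b (d ∘ₗ V) W - conv b (Q.sgn ∘ₗ V) (d ∘ₗ W) := by
  have : d ∘ₗ conv b V W = conv (-(b.compl₁₂ d LinearMap.id) - b.compl₁₂ Q.sgn d) V W := by
    rw [comp_conv]
    exact conv_congr fun _ _ _ _ _ _ => by simp [H.d_b]
  rw [this, sub_eq_add_neg, conv_add_form, ← neg_one_smul ℂ (b.compl₁₂ d LinearMap.id),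
    ← neg_one_smul ℂ (b.compl₁₂ Q.sgn d), conv_smul_form, conv_smul_form]
  have h1 : conv (b.compl₁₂ d LinearMap.id) V W = conv b (d ∘ₗ V) W :=
    conv_congr fun _ _ _ _ _ _ => rfl
  have h2 : conv (b.compl₁₂ Q.sgn d) V W = conv b (Q.sgn ∘ₗ V) (d ∘ₗ W) :=
    conv_congr fun _ _ _ _ _ _ => rfl
  rw [h1, h2]
  module

/-- Graded symmetry of the bracket of an even field with an odd one. -/
theorem conv_sgn_comm {f Z : VF P Q} (hf : conj f = (-1 : ℂ) ^ 0 • f)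
    (hZ : conj Z = (-1 : ℂ) ^ 1 • Z) : conv b (f ∘ₗ tw P 1) Z = conv b Z f := by
  refine conv_comm fun p q x y hx hy => ?_
  rw [LinearMap.comp_apply, tw_parity hx, map_smul, map_smul, LinearMap.smul_apply,
    H.b_symm _ _ _ _ (hasParity_apply hf hx) (hasParity_apply hZ hy), smul_smul, ← pow_add]
  congr 1
  rw [show 1 * p + (0 + p) * (1 + q) = p * q + 2 * p by ring, pow_add, pow_mul (-1 : ℂ) 2]
  simp

/-- The Jacobi identity for the bracket with an even field `f`. -/
theorem conv_jacobi {f : VF P Q} (hf : conj f = (-1 : ℂ) ^ 0 • f) (Z : VF P Q) :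
    conv b (conv b Z f) f = -((1 / 2 : ℂ) • conv b (Q.sgn ∘ₗ Z) (conv b f f)) := by
  let τ₁ : Q →ₗ[ℂ] Q →ₗ[ℂ] Q →ₗ[ℂ] Q := LinearMap.mk₂ ℂ (fun x y => b.flip y ∘ₗ b.flip x)
    (by intro x x' y; ext1 z; simp) (by intro r x y; ext1 z; simp)
    (by intro x y y'; ext1 z; simp) (by intro r x y; ext1 z; simp)
  let τ₂ : Q →ₗ[ℂ] Q →ₗ[ℂ] Q →ₗ[ℂ] Q := LinearMap.mk₂ ℂ (fun x y => b.flip (b x y) ∘ₗ Q.sgn)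
    (by intro x x' y; ext1 z; simp) (by intro r x y; ext1 z; simp)
    (by intro x y y'; ext1 z; simp) (by intro r x y; ext1 z; simp)
  have h1 : ∀ x y z, τ₁ x y z = b (b z x) y := fun _ _ _ => rfl
  have h2 : ∀ x y z, τ₂ x y z = b (Q.sgn z) (b x y) := fun _ _ _ => rfl
  have e1 : conv b (conv b Z f) f = conv LinearMap.applyₗ Z (conv τ₁ f f) :=
    conv_assoc fun z x y => (h1 x y z).symm
  have e2 : conv b (Q.sgn ∘ₗ Z) (conv b f f) = conv LinearMap.applyₗ Z (conv τ₂ f f) := by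
    have : conv LinearMap.applyₗ Z (conv τ₂ f f) = conv (b ∘ₗ Q.sgn) Z (conv b f f) := by
      refine (conv_assoc (β₁ := LinearMap.mk₂ ℂ (fun z x => b (Q.sgn z) ∘ₗ b x)
        (by intro x x' y; ext1 z; simp) (by intro r x y; ext1 z; simp)
        (by intro x y y'; ext1 z; simp) (by intro r x y; ext1 z; simp))
        (β₂ := LinearMap.id) fun z x y => ?_).symm.trans (conv_assoc fun z x y => ?_)
      · rfl
      · rfl
    rw [this]
    exact conv_congr fun _ _ _ _ _ _ => rfl
  -- exchange the two factors `f` in the second term of the Jacobi identity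
  have e3 : conv (τ₁ + τ₂) f f = conv ((-1 : ℂ) • τ₁) f f := by
    refine conv_comm fun p q x y hx hy => ?_
    have hx' := hasParity_apply hf hx
    have hy' := hasParity_apply hf hy
    rw [zero_add] at hx' hy'
    ext1 z
    have := H.jacobi p q z _ _ hx' hy'
    simp only [LinearMap.add_apply, LinearMap.smul_apply, h1, h2]
    rw [← sub_eq_zero, ← this]
    module
  rw [conv_add_form, conv_smul_form] at e3
  have e4 : conv τ₁ f f = -((1 / 2 : ℂ) • conv τ₂ f f) := by
    have : (2 : ℂ) • conv τ₁ f f = - conv τ₂ f f := by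
      rw [← sub_eq_zero, ← sub_eq_zero.2 e3]; module
    rw [← inv_smul_smul₀ (two_ne_zero (α := ℂ)) (conv τ₁ f f), this]
    module
  rw [e1, e2, e4, conv_neg_right, conv_smul_right]

/-- For even `f` the derivative of `b(f, f)/2`. -/
theorem d_half_conv {f : VF P Q} (hf : conj f = (-1 : ℂ) ^ 0 • f) :
    d ∘ₗ ((1 / 2 : ℂ) • conv b f f) = - conv b (d ∘ₗ f) f := by
  have hdf : conj (d ∘ₗ f : VF P Q) = (-1 : ℂ) ^ 1 • (d ∘ₗ f) := by rw [H.conj_d, hf]; simp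
  rw [LinearMap.comp_smul, H.d_conv, comp_sgn_of_parity hf, pow_zero, one_smul,
    H.conv_sgn_comm hf hdf]
  module

/-- For even `f` the Jacobi identity gives `3 b(b(f, f), f) = 0`. -/
theorem conv_half_conv {f : VF P Q} (hf : conj f = (-1 : ℂ) ^ 0 • f) :
    conv b ((1 / 2 : ℂ) • conv b f f : VF P Q) f = 0 := by
  have h1 := H.conv_jacobi hf f
  have h2 : conj (conv b f f : VF P Q) = (-1 : ℂ) ^ 1 • conv b f f := by
    rw [H.conj_conv_b, hf]; simp
  rw [comp_sgn_of_parity hf, pow_zero, one_smul, H.conv_sgn_comm hf h2] at h1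
  rw [conv_smul]
  have h3 : (3 / 2 : ℂ) • conv b (conv b f f) f = 0 := by
    rw [← sub_eq_zero.2 h1]; module
  rw [(smul_eq_zero.1 h3).resolve_left (by norm_num), smul_zero]

end IsShiftedDGLie
end ExtDef

/-! ### The complex of vector fields along a morphism and its product -/

namespace ExtDef

universe u

open GSym

theorem GSym.tw_even {Q : GradedSpace.{u}} {p : ℕ} (hp : Even p) : tw Q p = LinearMap.id := by
  have inv : Function.Involutive (sgn Q) := sgn_sgn
  ext1 a
  rw [tw_apply, inv.iterate_even hp]; rfl

theorem GSym.tw_odd {Q : GradedSpace.{u}} {p : ℕ} (hp : Odd p) : tw Q p = (sgn Q).toLinearMap := by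
  have inv : Function.Involutive (sgn Q) := sgn_sgn
  ext1 a
  rw [tw_apply, inv.iterate_odd hp]; rfl

section MulAlong
variable {P Q R S : GradedSpace.{u}} {A C E : Type*} [AddCommGroup A] [Module ℂ A]
  [AddCommGroup C] [Module ℂ C] [AddCommGroup E] [Module ℂ E]

/-- The product of `F` and `W` given by a constant pairing `β`, with the Koszul sign of moving `W`
past the formal variable. Both `vmul` and `fsmul` are of this form. -/
noncomputable def mulAlong (β : A →ₗ[ℂ] Q →ₗ[ℂ] C) :
    (GSym P →ₗ[ℂ] A) →ₗ[ℂ] VF P Q →ₗ[ℂ] (GSym P →ₗ[ℂ] C) :=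
  LinearMap.mk₂ ℂ (fun F W => conv β F (evenPart W) + conv β (F ∘ₗ (sgn P).toLinearMap) (oddPart W))
    (fun F F' W => by simp only [LinearMap.add_comp, conv_add]; abel)
    (fun c F W => by simp only [LinearMap.smul_comp, conv_smul, smul_add])
    (fun F W W' => by simp only [map_add, conv_add_right]; abel)
    (fun c F W => by simp only [map_smul, conv_smul_right, smul_add])

theorem mulAlong_apply (β : A →ₗ[ℂ] Q →ₗ[ℂ] C) (F : GSym P →ₗ[ℂ] A) (W : VF P Q) :
    mulAlong β F W = conv β F (evenPart W) + conv β (F ∘ₗ (sgn P).toLinearMap) (oddPart W) := rfl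

theorem fsmul_eq (g : Fun Q) (W : VF Q Q) : fsmul g W = mulAlong (LinearMap.lsmul ℂ Q) g W := rfl

theorem mulAlong_of_parity (β : A →ₗ[ℂ] Q →ₗ[ℂ] C) (F : GSym P →ₗ[ℂ] A) {w : ℕ} {W : VF P Q}
    (hW : conj W = (-1 : ℂ) ^ w • W) : mulAlong β F W = conv β (F ∘ₗ tw P w) W := by
  rw [mulAlong_apply, evenPart_of_parity hW, oddPart_of_parity hW]
  by_cases h : Even w
  · rw [if_pos h, if_pos h, conv_zero_right, tw_even h, add_zero]; rfl
  · rw [if_neg h, if_neg h, conv_zero_right, tw_odd (Nat.not_even_iff_odd.1 h), zero_add]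

theorem mulAlong_one (β : A →ₗ[ℂ] Q →ₗ[ℂ] C) (F : GSym P →ₗ[ℂ] A) (W : VF P Q) :
    mulAlong β F W 1 = β (F 1) (W 1) := by
  rw [mulAlong_apply, LinearMap.add_apply, conv_one, conv_one]
  conv_rhs => rw [← evenPart_add_oddPart W]
  simp

theorem conj_comp_tw (V : VF P Q) (w : ℕ) : conj (V ∘ₗ tw P w : VF P Q) = conj V ∘ₗ tw P w := by
  rw [conj_eq, conj_eq]
  ext1 a
  simp only [LinearMap.comp_apply, tw_tw, add_comm]

theorem tw_comp_tw_eq (F : GSym P →ₗ[ℂ] A) (p q : ℕ) : (F ∘ₗ tw P p) ∘ₗ tw P q = F ∘ₗ tw P (p + q) := by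
  ext1 a
  simp only [LinearMap.comp_apply, tw_tw]

theorem conj_comp_tw_succ (V : VF P Q) (w : ℕ) : conj V ∘ₗ tw P (w + 1) = Q.sgn ∘ₗ V ∘ₗ tw P w := by
  rw [conj_eq]
  ext1 a
  have : tw P (1 + (w + 1)) a = tw P w a := by
    rw [show 1 + (w + 1) = w + 2 by ring, ← tw_tw, tw_even even_two]; rfl
  simp only [LinearMap.comp_apply, tw_tw, this]

theorem conj_mulAlong {β : Q →ₗ[ℂ] R →ₗ[ℂ] S} (hβ : ∀ x y, S.sgn (β x y) = β (Q.sgn x) (R.sgn y))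
    {v w : ℕ} {V : VF P Q} {W : VF P R} (hV : conj V = (-1 : ℂ) ^ v • V)
    (hW : conj W = (-1 : ℂ) ^ w • W) :
    conj (mulAlong β V W : VF P S) = (-1 : ℂ) ^ (v + w) • mulAlong β V W := by
  rw [mulAlong_of_parity _ _ hW, conj_conv (ε := 1) (by intro x y; rw [hβ, one_smul]), conj_comp_tw,
    hV, hW, one_smul, LinearMap.smul_comp, conv_smul, conv_smul_right, smul_smul, pow_add]

theorem mulAlong_assoc {β₁ : A →ₗ[ℂ] Q →ₗ[ℂ] C} {β₂ : C →ₗ[ℂ] R →ₗ[ℂ] E}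
    {β₃ : Q →ₗ[ℂ] R →ₗ[ℂ] S} {β₄ : A →ₗ[ℂ] S →ₗ[ℂ] E}
    (hβ : ∀ x y, S.sgn (β₃ x y) = β₃ (Q.sgn x) (R.sgn y))
    (h : ∀ a x y, β₂ (β₁ a x) y = β₄ a (β₃ x y)) (F : GSym P →ₗ[ℂ] A) (V : VF P Q) (W : VF P R) :
    mulAlong β₂ (mulAlong β₁ F V) W = mulAlong β₄ F (mulAlong β₃ V W : VF P S) := by
  induction V using vf_parity_induction with
  | hadd V V' hV hV' => simp only [map_add, LinearMap.add_apply, hV, hV']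
  | h v V hV =>
    induction W using vf_parity_induction with
    | hadd W W' hW hW' => simp only [map_add, hW, hW']
    | h w W hW =>
      rw [mulAlong_of_parity _ _ hW, mulAlong_of_parity _ _ hV,
        mulAlong_of_parity _ _ (conj_mulAlong hβ hV hW), mulAlong_of_parity _ _ hW, conv_comp_tw,
        tw_comp_tw_eq]
      exact conv_assoc h

theorem mulAlong_comm {μ : Q →ₗ[ℂ] Q →ₗ[ℂ] R} (hμ : ∀ (p q : ℕ) (x y : Q), Q.HasParity p x →
      Q.HasParity q y → μ x y = (-1 : ℂ) ^ (p * q) • μ y x) {v w : ℕ} {V W : VF P Q}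
    (hV : conj V = (-1 : ℂ) ^ v • V) (hW : conj W = (-1 : ℂ) ^ w • W) :
    mulAlong μ V W = (-1 : ℂ) ^ (v * w) • mulAlong μ W V := by
  rw [mulAlong_of_parity _ _ hW, mulAlong_of_parity _ _ hV, ← conv_smul]
  refine conv_comm fun p q a c ha hc => ?_
  simp only [LinearMap.comp_apply, tw_parity ha, tw_parity hc, map_smul, LinearMap.smul_apply]
  rw [hμ _ _ _ _ (hasParity_apply hV ha) (hasParity_apply hW hc)]
  simp only [smul_smul, ← pow_add]
  congr 1
  rw [show w * p + (v + p) * (w + q) = p * q + (v * w + v * q) + 2 * (p * w) by ring, pow_add,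
    pow_mul (-1 : ℂ) 2]
  simp

theorem mulAlong_comp {φ : GSym P →ₗ[ℂ] GSym Q}
    (hφ : comul Q ∘ₗ φ = TensorProduct.map φ φ ∘ₗ comul P)
    (hs : (sgn Q).toLinearMap ∘ₗ φ = φ ∘ₗ (sgn P).toLinearMap) (β : A →ₗ[ℂ] R →ₗ[ℂ] C)
    (F : GSym Q →ₗ[ℂ] A) (W : VF Q R) :
    mulAlong β F W ∘ₗ φ = mulAlong β (F ∘ₗ φ) (W ∘ₗ φ : VF P R) := by
  have h : conj (W ∘ₗ φ : VF P R) = conj W ∘ₗ φ := by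
    ext1 a
    have := LinearMap.congr_fun hs a
    simp only [LinearMap.comp_apply, AlgHom.toLinearMap_apply] at this
    simp [conj_apply, this]
  have h0 : evenPart (W ∘ₗ φ : VF P R) = evenPart W ∘ₗ φ := by
    simp only [evenPart, LinearMap.smul_apply, LinearMap.add_apply, LinearMap.id_apply, h]
    rfl
  have h1 : oddPart (W ∘ₗ φ : VF P R) = oddPart W ∘ₗ φ := by
    simp only [oddPart, LinearMap.smul_apply, LinearMap.sub_apply, LinearMap.id_apply, h]
    rfl
  rw [mulAlong_apply, mulAlong_apply, LinearMap.add_comp, conv_comp_coalgHom hφ,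
    conv_comp_coalgHom hφ, h0, h1, LinearMap.comp_assoc, hs]
  rfl

end MulAlong

section AlongD
variable {P Q : GradedSpace.{u}}

/-- The differential `Z ↦ d Z + b(Z, f) - (-1)^{|Z|} X'(Z)` on the vector fields along a morphism
with Taylor coefficients `f` from `(P, X')` to the dg Lie algebra `(Q, d, b)`. -/
noncomputable def alongD (d : Q →ₗ[ℂ] Q) (b : Q →ₗ[ℂ] Q →ₗ[ℂ] Q) (X' : VF P P) (f : VF P Q) :
    VF P Q →ₗ[ℂ] VF P Q where
  toFun Z := d ∘ₗ Z + conv b Z f - conj Z ∘ₗ hat X'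
  map_add' V W := by
    simp only [LinearMap.comp_add, conv_add, map_add, LinearMap.add_comp]
    abel
  map_smul' c V := by
    simp only [LinearMap.comp_smul, conv_smul, map_smul, LinearMap.smul_comp, RingHom.id_apply,
      smul_sub, smul_add]

theorem alongD_apply (d : Q →ₗ[ℂ] Q) (b : Q →ₗ[ℂ] Q →ₗ[ℂ] Q) (X' : VF P P) (f Z : VF P Q) :
    alongD d b X' f Z = d ∘ₗ Z + conv b Z f - conj Z ∘ₗ hat X' := rfl

/-- `f` consists of the Taylor coefficients of a morphism of dg manifolds from `(P, X')` to the dg Lie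
algebra `(Q, d, b)`: an even solution of `d f + b(f, f)/2 = X'(f)`. -/
structure IsMC (d : Q →ₗ[ℂ] Q) (b : Q →ₗ[ℂ] Q →ₗ[ℂ] Q) (X' : VF P P) (f : VF P Q) : Prop where
  even : conj f = (-1 : ℂ) ^ 0 • f
  odd : conj X' = (-1 : ℂ) ^ 1 • X'
  sq : X' ∘ₗ hat X' = 0
  mc : d ∘ₗ f + (1 / 2 : ℂ) • conv b f f = f ∘ₗ hat X'

theorem hat_zero : hat (0 : VF P P) = 0 := by simpa using hat_smul (0 : ℂ) (0 : VF P P)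

theorem hat_comp_hat_eq_zero {X : VF P P} (hX : conj X = (-1 : ℂ) ^ 1 • X) (h : X ∘ₗ hat X = 0) :
    hat X ∘ₗ hat X = 0 := by
  have := hat_commutator hX hX
  rw [h, smul_zero, sub_zero, hat_zero] at this
  have h2 : (2 : ℂ) • (hat X ∘ₗ hat X) = 0 := by
    rw [← this]
    module
  exact (smul_eq_zero.1 h2).resolve_left two_ne_zero

/-- The coderivation of `[X, V]`. -/
theorem hat_dX {X : VF P P} (hX : conj X = (-1 : ℂ) ^ 1 • X) (V : VF P P) :
    hat (dX X V) = hat X ∘ₗ hat V - hat (conj V) ∘ₗ hat X := by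
  induction V using vf_parity_induction with
  | hadd V W hV hW =>
    rw [map_add, hat_add, hV, hW, map_add, hat_add, hat_add, LinearMap.comp_add, LinearMap.add_comp]
    abel
  | h v V hV =>
    have := hat_commutator hX hV
    rw [one_mul] at this
    rw [hV, hat_smul, LinearMap.smul_comp, this]
    congr 1
    change X ∘ₗ hat V - conj V ∘ₗ hat X = _
    rw [hV, LinearMap.smul_comp]

variable {d : Q →ₗ[ℂ] Q} {b μ : Q →ₗ[ℂ] Q →ₗ[ℂ] Q} {X' : VF P P} {f : VF P Q}

/-- The differential on vector fields along a morphism, in terms of coderivations along its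
exponential; this is the form in which it enters `DGMorphism.Related`. -/
theorem quad_comp_hatAlong_sub (hb : ∀ (p q : ℕ) (x y : Q), Q.HasParity p x → Q.HasParity q y →
      b x y = (-1 : ℂ) ^ (p * q) • b y x) {φ : GSym P →ₗ[ℂ] GSym Q} (hφ : IsExp f φ)
    (h0 : f 1 = 0) (Z : VF P Q) :
    quad d b hb ∘ₗ hatAlong φ Z - conj Z ∘ₗ hat X' = alongD d b X' f Z := by
  rw [quad_comp_hatAlong d b hb hφ.counit_comp, hφ.proj_comp h0, alongD_apply]

namespace IsMC
variable (hf : IsMC d b X' f)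
include hf

/-- The component in `Q` of `intertwines`; it is the equation satisfied by `f`. -/
theorem quad_comp (hb) {φ : GSym P →ₗ[ℂ] GSym Q} (hφ : IsExp f φ) (h0 : f 1 = 0) :
    quad d b hb ∘ₗ φ = f ∘ₗ hat X' := by
  rw [quad_comp_coalgHom hb (hφ.comul_comp hf.even), hφ.proj_comp h0, hf.mc]

/-- The coalgebra map with Taylor coefficients `f` intertwines the coderivations. -/
theorem intertwines (hb) {φ : GSym P →ₗ[ℂ] GSym Q} (hφ : IsExp f φ) (h0 : f 1 = 0) :
    φ ∘ₗ hat X' = hat (quad d b hb) ∘ₗ φ := by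
  rw [hφ.hat_comp hf.even, hf.quad_comp hb hφ h0, hφ.comp_hat hf.even]

/-- Pushing forward vector fields commutes with the differentials. -/
theorem alongD_push (hb : ∀ (p q : ℕ) (x y : Q), Q.HasParity p x → Q.HasParity q y →
      b x y = (-1 : ℂ) ^ (p * q) • b y x) {φ : GSym P →ₗ[ℂ] GSym Q} (hφ : IsExp f φ) (h0 : f 1 = 0) (V : VF P P) :
    alongD d b X' f (f ∘ₗ hat V) = f ∘ₗ hat (dX X' V) := by
  have hc : conj (f ∘ₗ hat V : VF P Q) = f ∘ₗ hat (conj V) := by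
    induction V using vf_parity_induction with
    | hadd V W hV hW => simp only [hat_add, map_add, LinearMap.comp_add, hV, hW]
    | h v V hV =>
      rw [conj_comp_hat_parity hV hf.even, hV, hat_smul, LinearMap.comp_smul, zero_add]
  rw [← quad_comp_hatAlong_sub hb hφ h0, ← hφ.comp_hat hf.even, ← LinearMap.comp_assoc,
    hf.quad_comp hb hφ h0, hc, hat_dX hf.odd, LinearMap.comp_sub]
  rfl

/-- Pulling back vector fields commutes with the differentials. -/
theorem alongD_pull (hb) {φ : GSym P →ₗ[ℂ] GSym Q} (hφ : IsExp f φ) (h0 : f 1 = 0) (W : VF Q Q) :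
    alongD d b X' f (W ∘ₗ φ) = dX (quad d b hb) W ∘ₗ φ := by
  have hc : conj (W ∘ₗ φ : VF P Q) = conj W ∘ₗ φ := by
    ext1 a
    have := LinearMap.congr_fun (hφ.comp_sgn hf.even) a
    simp only [LinearMap.comp_apply, AlgHom.toLinearMap_apply] at this
    simp [conj_apply, this]
  rw [← quad_comp_hatAlong_sub hb hφ h0, ← hφ.hat_comp hf.even, hc, LinearMap.comp_assoc,
    hf.intertwines hb hφ h0]
  rfl

theorem conj_alongD (H : IsShiftedDGLie d b) (Z : VF P Q) :
    conj (alongD d b X' f Z) = - alongD d b X' f (conj Z) := by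
  rw [alongD_apply, alongD_apply, map_sub, map_add, H.conj_d, H.conj_conv_b, conj_comp_hat hf.odd,
    hf.even]
  simp only [pow_zero, one_smul, pow_one, neg_smul]
  abel

/-- The differential squares to zero by the equation for `f` and the Jacobi identity. -/
theorem alongD_alongD (H : IsShiftedDGLie d b) (Z : VF P Q) :
    alongD d b X' f (alongD d b X' f Z) = 0 := by
  have e1 : conj (alongD d b X' f Z) ∘ₗ hat X' = - (d ∘ₗ conj Z ∘ₗ hat X') -
      (conv b (conj Z ∘ₗ hat X') f + conv b (Q.sgn ∘ₗ Z) (f ∘ₗ hat X')) := by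
    have h2 : conj Z ∘ₗ tw P 1 = Q.sgn ∘ₗ Z := by
      rw [show (1 : ℕ) = 0 + 1 from rfl, conj_comp_tw_succ, tw_zero, LinearMap.comp_id]
    rw [hf.conj_alongD H, alongD_apply, conj_conj, LinearMap.neg_comp, LinearMap.sub_comp,
      LinearMap.add_comp, conv_comp_hat _ _ _ hf.odd, h2, LinearMap.comp_assoc _ _ Z,
      hat_comp_hat_eq_zero hf.odd hf.sq, LinearMap.comp_zero, LinearMap.comp_assoc]
    abel
  have e2 : d ∘ₗ d ∘ₗ Z = 0 := LinearMap.ext fun a => H.d_sq _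
  rw [alongD_apply d b X' f (alongD d b X' f Z), e1, alongD_apply, LinearMap.comp_sub,
    LinearMap.comp_add, e2, H.d_conv, conv_sub_left, conv_add, H.conv_jacobi hf.even Z, ← hf.mc,
    conv_add_right, conv_smul_right]
  abel

/-- The Leibniz rule for the product of vector fields along a morphism. -/
theorem alongD_mul (H : IsShiftedGerstenhaber d b μ) (V W : VF P Q) :
    alongD d b X' f (mulAlong μ V W) =
      mulAlong μ (alongD d b X' f V) W + mulAlong μ (conj V) (alongD d b X' f W) := by
  induction W using vf_parity_induction with
  | hadd W W' hW hW' =>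
    simp only [map_add, hW, hW']
    abel
  | h w W hW =>
    have hDW : conj (alongD d b X' f W) = (-1 : ℂ) ^ (w + 1) • alongD d b X' f W := by
      rw [hf.conj_alongD H.toIsShiftedDGLie, hW, map_smul, pow_succ, mul_neg_one, neg_smul]
    rw [mulAlong_of_parity _ _ hW, mulAlong_of_parity _ _ hW, mulAlong_of_parity _ _ hDW,
      conj_comp_tw_succ]
    have sgn_μ : ∀ x y, Q.sgn (μ x y) = (1 : ℂ) • μ (Q.sgn x) (Q.sgn y) := by
      intro x y
      have := GradedSpace.sgn_map₂ H.μ_mem x y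
      simpa using this
    set V' : VF P Q := V ∘ₗ tw P w with hV'
    have e1 : d ∘ₗ conv μ V' W = conv μ (d ∘ₗ V') W + conv μ (Q.sgn ∘ₗ V') (d ∘ₗ W) := by
      have h1 : conv (μ.compl₁₂ d LinearMap.id) V' W = conv μ (d ∘ₗ V') W :=
        conv_congr fun _ _ _ _ _ _ => rfl
      have h2 : conv (μ.compl₁₂ Q.sgn d) V' W = conv μ (Q.sgn ∘ₗ V') (d ∘ₗ W) :=
        conv_congr fun _ _ _ _ _ _ => rfl
      rw [← h1, ← h2, ← conv_add_form, comp_conv]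
      exact conv_congr fun _ _ _ _ _ _ => by simp [H.d_μ]
    have e2 : conv b (conv μ V' W) f = conv μ (conv b V f ∘ₗ tw P w) W +
        conv μ (Q.sgn ∘ₗ V') (conv b W f) := by
      let τ : Q →ₗ[ℂ] Q →ₗ[ℂ] Q →ₗ[ℂ] Q := LinearMap.mk₂ ℂ (fun x y => b.flip y ∘ₗ μ.flip x)
        (by intro x x' y; ext1 z; simp) (by intro r x y; ext1 z; simp)
        (by intro x y y'; ext1 z; simp) (by intro r x y; ext1 z; simp)
      let τ₂ : Q →ₗ[ℂ] Q →ₗ[ℂ] Q →ₗ[ℂ] Q := LinearMap.mk₂ ℂ (fun y x => μ.flip x ∘ₗ b.flip y)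
        (by intro x x' y; ext1 z; simp) (by intro r x y; ext1 z; simp)
        (by intro x y y'; ext1 z; simp) (by intro r x y; ext1 z; simp)
      let τ₃ : Q →ₗ[ℂ] Q →ₗ[ℂ] Q →ₗ[ℂ] Q := LinearMap.mk₂ ℂ (fun x y => μ.flip (b x y) ∘ₗ Q.sgn)
        (by intro x x' y; ext1 z; simp) (by intro r x y; ext1 z; simp)
        (by intro x y y'; ext1 z; simp) (by intro r x y; ext1 z; simp)
      have a1 : conv b (conv μ V' W) f = conv LinearMap.applyₗ V' (conv τ W f) :=
        conv_assoc fun z x y => rfl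
      have a2 : conv μ (conv b V f ∘ₗ tw P w) W =
          conv LinearMap.applyₗ V' (conv τ₂ (f ∘ₗ tw P w) W) := by
        rw [conv_comp_tw]
        exact conv_assoc fun z x y => rfl
      have a3 : conv μ (Q.sgn ∘ₗ V') (conv b W f) = conv LinearMap.applyₗ V' (conv τ₃ W f) := by
        have : conv LinearMap.applyₗ V' (conv τ₃ W f) = conv (μ ∘ₗ Q.sgn) V' (conv b W f) := by
          refine (conv_assoc (β₁ := LinearMap.mk₂ ℂ (fun z x => μ (Q.sgn z) ∘ₗ b x)
            (by intro x x' y; ext1 z; simp) (by intro r x y; ext1 z; simp)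
            (by intro x y y'; ext1 z; simp) (by intro r x y; ext1 z; simp))
            (β₂ := LinearMap.id) fun z x y => ?_).symm.trans (conv_assoc fun z x y => ?_)
          · rfl
          · rfl
        rw [this]
        exact conv_congr fun _ _ _ _ _ _ => rfl
      have a4 : conv (τ + (-1 : ℂ) • τ₃) W f = conv τ₂ (f ∘ₗ tw P w) W := by
        refine conv_comm fun p q x y hx hy => ?_
        have hx' := hasParity_apply hW hx
        have hy' := hasParity_apply hf.even hy
        rw [zero_add] at hy'
        ext1 z
        have := H.b_μ (w + p) q z _ _ hx' hy'
        simp only [LinearMap.comp_apply, tw_parity hy, map_smul, LinearMap.add_apply,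
          LinearMap.smul_apply, smul_smul, ← pow_add]
        change b (μ z (W x)) (f y) + (-1 : ℂ) • μ (Q.sgn z) (b (W x) (f y)) =
          _ • μ (b z (f y)) (W x)
        rw [this, add_mul, add_comm (w * q)]
        module
      rw [a1, a2, a3, ← conv_add_right, ← a4, conv_add_form, conv_smul_form]
      congr 1
      module
    have e3 : conj (conv μ V' W : VF P Q) ∘ₗ hat X' =
        conv μ ((conj V ∘ₗ hat X') ∘ₗ tw P w) W + conv μ (Q.sgn ∘ₗ V') (conj W ∘ₗ hat X') := by
      have h1 : (conj V ∘ₗ tw P w) ∘ₗ tw P 1 = Q.sgn ∘ₗ V' := by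
        rw [tw_comp_tw_eq, conj_comp_tw_succ]
      have h2 : (conj V ∘ₗ tw P w) ∘ₗ hat X' = (-1 : ℂ) ^ w • ((conj V ∘ₗ hat X') ∘ₗ tw P w) := by
        rw [LinearMap.comp_assoc, LinearMap.comp_assoc, hat_comp_tw w hf.odd, LinearMap.comp_smul,
          smul_smul, one_mul, neg_one_pow_mul_self, one_smul]
      rw [conj_conv sgn_μ, one_smul, hV', conj_comp_tw, hW, conv_smul_right, LinearMap.smul_comp,
        conv_comp_hat _ _ _ hf.odd, h1, h2, conv_smul, LinearMap.smul_comp, conv_smul_right,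
        smul_add, smul_smul, neg_one_pow_mul_self, one_smul]
    rw [alongD_apply, alongD_apply, alongD_apply, e1, e2, e3, LinearMap.sub_comp, LinearMap.add_comp,
      conv_sub_left, conv_add, conv_sub_right, conv_add_right]
    simp only [hV', LinearMap.comp_assoc]
    abel

/-- Multiplication by a closed function commutes with the differential up to sign. -/
theorem alongD_fsmul {g : Fun P} (hg : g ∘ₗ hat X' = 0) (H : IsShiftedDGLie d b) (Z : VF P Q) :
    alongD d b X' f (mulAlong (LinearMap.lsmul ℂ Q) g Z) =
      mulAlong (LinearMap.lsmul ℂ Q) (g ∘ₗ (GSym.sgn P).toLinearMap) (alongD d b X' f Z) := by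
  induction Z using vf_parity_induction with
  | hadd W W' hW hW' => simp only [map_add, hW, hW']
  | h z Z hZ =>
    have hDZ : conj (alongD d b X' f Z) = (-1 : ℂ) ^ (z + 1) • alongD d b X' f Z := by
      rw [hf.conj_alongD H, hZ, map_smul, pow_succ, mul_neg_one, neg_smul]
    have hG : g ∘ₗ tw P (z + 2) = g ∘ₗ tw P z := by
      rw [← tw_comp_tw_eq, tw_even even_two, LinearMap.comp_id]
    have hG' : (g ∘ₗ (GSym.sgn P).toLinearMap) ∘ₗ tw P (z + 1) = g ∘ₗ tw P z := by
      rw [← tw_one, tw_comp_tw_eq, show 1 + (z + 1) = z + 2 by ring, hG]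
    rw [mulAlong_of_parity _ _ hZ, mulAlong_of_parity _ _ hDZ, hG', alongD_apply, alongD_apply,
      conv_sub_right, conv_add_right]
    have e1 : d ∘ₗ conv (LinearMap.lsmul ℂ Q) (g ∘ₗ tw P z) Z =
        conv (LinearMap.lsmul ℂ Q) (g ∘ₗ tw P z) (d ∘ₗ Z) := by
      rw [comp_conv]
      exact conv_congr fun _ _ _ _ _ _ => by simp
    have e2 : conv b (conv (LinearMap.lsmul ℂ Q) (g ∘ₗ tw P z) Z) f =
        conv (LinearMap.lsmul ℂ Q) (g ∘ₗ tw P z) (conv b Z f) :=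
      conv_assoc fun c x y => by simp
    have e3 : conj (conv (LinearMap.lsmul ℂ Q) (g ∘ₗ tw P z) Z : VF P Q) =
        conv (LinearMap.lsmul ℂ Q) (g ∘ₗ tw P (z + 1)) (conj Z) := by
      have h : ∀ (c : ℂ) (x : Q), Q.sgn (c • x) = (1 : ℂ) • LinearMap.lsmul ℂ Q c (Q.sgn x) := by
        simp
      rw [conj_eq, conj_eq, conv_conj (σA := LinearMap.id) h, one_smul, tw_comp_tw_eq]
      rfl
    have e4 : (g ∘ₗ tw P (z + 1)) ∘ₗ hat X' = 0 := by
      have := hat_comp_tw (z + 1) hf.odd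
      ext1 a
      have h1 := LinearMap.congr_fun this a
      have h2 := LinearMap.congr_fun hg (tw P (z + 1) a)
      simp only [LinearMap.comp_apply, LinearMap.smul_apply, LinearMap.zero_apply] at h1 h2 ⊢
      rw [h1, map_smul] at h2
      exact (smul_eq_zero.1 h2).resolve_left (pow_ne_zero _ (by simp))
    rw [e1, e2, e3, conv_comp_hat _ _ _ hf.odd, e4, conv_zero_left, zero_add, tw_comp_tw_eq, hG]

/-- Pushing forward vector fields is linear over functions. -/
theorem push_fsmul (g : Fun P) (V : VF P P) :
    f ∘ₗ hat (mulAlong (LinearMap.lsmul ℂ P) g V) =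
      mulAlong (LinearMap.lsmul ℂ Q) g (f ∘ₗ hat V : VF P Q) := by
  induction V using vf_parity_induction with
  | hadd V W hV hW => simp only [map_add, hat_add, LinearMap.comp_add, hV, hW]
  | h v V hV =>
    have hc : conj (f ∘ₗ hat V : VF P Q) = (-1 : ℂ) ^ v • (f ∘ₗ hat V) := by
      rw [conj_comp_hat_parity hV hf.even, zero_add]
    rw [mulAlong_of_parity _ _ hV, mulAlong_of_parity _ _ hc]
    have e1 : hat (conv (LinearMap.lsmul ℂ P) (g ∘ₗ tw P v) V) =
        conv (LinearMap.lsmul ℂ (GSym P)) (g ∘ₗ tw P v) (hat V) := by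
      have h : GSym.ι P ∘ₗ conv (LinearMap.lsmul ℂ P) (g ∘ₗ tw P v) V =
          conv (LinearMap.lsmul ℂ (GSym P)) (g ∘ₗ tw P v) (GSym.ι P ∘ₗ V) := by
        rw [comp_conv]
        exact conv_congr fun _ _ _ _ _ _ => by simp
      rw [hat, hatAlong, h]
      exact conv_assoc fun c x y => by simp
    rw [e1, comp_conv]
    exact conv_congr fun _ _ _ _ _ _ => by simp

end IsMC
end AlongD
end ExtDef

/-! ### Homotopy transfer -/

namespace ExtDef

universe u

open GSym

section Quadratic
variable {P Q : GradedSpace.{u}} {d : Q →ₗ[ℂ] Q} {b : Q →ₗ[ℂ] Q →ₗ[ℂ] Q}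

theorem GSym.words_two_ι (x : P) : ι P x ∈ words P 2 := by
  simpa using ι_mul_mem_words (one_mem_words (Q := P) 0) x

theorem IsCohomological.of_comp_hat {X : VF P P} (hX : HasDegree X 1) (h0 : X 1 = 0)
    (h : X ∘ₗ hat X = 0) : IsCohomological X where
  degree := hX
  zero := h0
  sq := by
    have hc : conj X = (-1 : ℂ) ^ 1 • X := hX.conj_eq (by simp)
    have he : evenPart X = 0 := by rw [evenPart_of_parity hc]; simp
    have ho : oddPart X = X := by rw [oddPart_of_parity hc]; simp
    rw [bracket, he, ho, hc, hat_smul, LinearMap.comp_smul, h]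
    simp

theorem IsShiftedDGLie.hasDegree_half_conv (H : IsShiftedDGLie d b) {f : VF P Q}
    (hf : HasDegree f 0) : HasDegree ((1 / 2 : ℂ) • conv b f f : VF P Q) 1 := by
  have := (HasDegree.conv H.b_mem hf hf).smul (1 / 2 : ℂ)
  simpa using this

/-- The vector field `q ↦ d q + b(q, q)/2`, with the identity as a morphism. -/
theorem IsShiftedDGLie.isMC_quad (H : IsShiftedDGLie d b) :
    IsMC d b (quad d b H.b_symm) (proj Q) := by
  have even : conj (proj Q) = (-1 : ℂ) ^ 0 • proj Q := by simpa using conj_proj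
  refine ⟨even, ?_, ?_, ?_⟩
  · rw [quad_eq, map_add, map_smul, H.conj_d, H.conj_conv_b, conj_proj]
    module
  · have h := quad_comp_hatAlong d b H.b_symm (φ := LinearMap.id) (by simp) (quad d b H.b_symm)
    refine Eq.trans h ?_
    have e : d ∘ₗ d ∘ₗ proj Q = 0 := LinearMap.ext fun a => H.d_sq _
    rw [LinearMap.comp_id, quad_eq, LinearMap.comp_add, conv_add, e, H.d_half_conv even,
      H.conv_half_conv even]
    abel
  · rw [proj_comp_hat, quad_eq]

theorem IsShiftedDGLie.isCohomological_quad (H : IsShiftedDGLie d b) :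
    IsCohomological (quad d b H.b_symm) := by
  refine .of_comp_hat ?_ (quad_one _ _ _) H.isMC_quad.sq
  rw [quad_eq]
  refine HasDegree.add ?_ (H.hasDegree_half_conv hasDegree_proj)
  simpa using HasDegree.comp_left H.d_mem (hasDegree_proj (Q := Q))

/-- The differential `[X, ·]` is the differential on vector fields along the identity. -/
theorem IsShiftedDGLie.dX_quad (H : IsShiftedDGLie d b) :
    dX (quad d b H.b_symm) = alongD d b (quad d b H.b_symm) (proj Q) := by
  ext1 V
  have h := quad_comp_hatAlong d b H.b_symm (φ := LinearMap.id) (by simp) V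
  rw [LinearMap.comp_id] at h
  rw [alongD_apply, ← h]
  rfl

end Quadratic

section Transfer
variable {P Q : GradedSpace.{u}} {d : Q →ₗ[ℂ] Q} {b : Q →ₗ[ℂ] Q →ₗ[ℂ] Q}

/-- The morphism `f` and the vector field `X'` obtained by homotopy transfer along the
contraction `c`. -/
structure IsHomotopyTransfer (c : Contraction d P) (b : Q →ₗ[ℂ] Q →ₗ[ℂ] Q) (X' : VF P P)
    (f : VF P Q) : Prop extends IsMC d b X' f where
  f_one : f 1 = 0
  f_ι : ∀ x, f (ι P x) = c.i x
  f_degree : HasDegree f 0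
  X_one : X' 1 = 0
  X_ι : ∀ x, X' (ι P x) = 0
  X_degree : HasDegree X' 1
  h_f : c.h ∘ₗ f = 0
  p_f : c.p ∘ₗ f = proj P

/-- Homotopy transfer: the fixed point equation `f = i - h(b(f, f)/2)` has a solution, and it is a
morphism from `X' = p(b(f, f)/2)`. -/
theorem exists_homotopyTransfer (H : IsShiftedDGLie d b) (c : Contraction d P) :
    ∃ X' f, IsHomotopyTransfer c b X' f := by
  -- `ρ` removes the constant term, so that the fixed point equation is contractive
  let ρ : GSym P →ₗ[ℂ] GSym P := LinearMap.id - (counit P).toLinearMap.smulRight 1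
  have hρ : ∀ (F : GSym P →ₗ[ℂ] Q) a, (F ∘ₗ ρ) a = F a - counit P a • F 1 := fun F a => by
    simp [ρ]
  have hρ1 : ∀ F : GSym P →ₗ[ℂ] Q, (F ∘ₗ ρ) 1 = 0 := fun F => by rw [hρ]; simp
  have hρ0 : ∀ F : GSym P →ₗ[ℂ] Q, F 1 = 0 → F ∘ₗ ρ = F := fun F hF => by
    ext1 a; rw [hρ, hF]; simp
  have hρo : ∀ k (F : GSym P →ₗ[ℂ] Q), Order k F → Order k (F ∘ₗ ρ) := fun k F hF a ha => by
    rw [hρ, hF a ha]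
    cases k with
    | zero => rw [mem_words_zero.1 ha]; simp
    | succ k => rw [hF.map_one]; simp
  let Φ : VF P Q → VF P Q := fun F =>
    c.i ∘ₗ proj P - c.h ∘ₗ ((1 / 2 : ℂ) • conv b (F ∘ₗ ρ) (F ∘ₗ ρ))
  obtain ⟨f, hf, hfn⟩ := exists_fixedPoint Φ (by
    intro k F G hFG
    have h1 := hρo _ _ hFG
    rw [LinearMap.sub_comp] at h1
    have h2 : Φ F - Φ G = -(c.h ∘ₗ ((1 / 2 : ℂ) • (conv b (F ∘ₗ ρ - G ∘ₗ ρ) (F ∘ₗ ρ) +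
        conv b (G ∘ₗ ρ) (F ∘ₗ ρ - G ∘ₗ ρ)))) := by
      simp only [Φ, conv_sub_left, conv_sub_right]
      rw [sub_sub_sub_cancel_left, ← LinearMap.comp_sub, ← neg_sub, LinearMap.comp_neg, ← smul_sub]
      congr 4
      abel
    rw [h2]
    refine (((Order.add ?_ (Order.conv (order_one (hρ1 G)) h1)).smul _).comp_left _).neg
    have := Order.conv (β := b) h1 (order_one (hρ1 F))
    rwa [add_comm] at this)
  have Φ_one : ∀ F, Φ F 1 = 0 := fun F => by
    have := hρ1 F
    simp only [Φ, LinearMap.sub_apply, LinearMap.comp_apply, LinearMap.smul_apply, conv_one,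
      proj_one] at this ⊢
    rw [this]
    simp
  have f_one : f 1 = 0 := by rw [← hf]; exact Φ_one f
  have Φ_degree : ∀ n, HasDegree (Φ^[n] 0) 0 ∧ (Φ^[n] 0) 1 = 0 := by
    intro n
    induction n with
    | zero => exact ⟨hasDegree_zero 0, rfl⟩
    | succ n ih =>
      rw [Function.iterate_succ_apply']
      refine ⟨?_, Φ_one _⟩
      have h1 : HasDegree (c.i ∘ₗ proj P : VF P Q) 0 := by
        simpa using HasDegree.comp_left c.i_mem (hasDegree_proj (Q := P))
      have h2 := HasDegree.comp_left c.h_mem (H.hasDegree_half_conv ih.1)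
      rw [← hρ0 _ ih.2, show (1 : ℤ) + -1 = 0 by norm_num] at h2
      exact h1.sub h2
  have f_degree : HasDegree f 0 := by
    rw [hasDegree_iff]
    intro e a ha
    obtain ⟨n, hn⟩ := exists_mem_words a
    rw [hfn n a hn]
    exact hasDegree_iff.1 (Φ_degree n).1 e a ha
  have even : conj f = (-1 : ℂ) ^ 0 • f := f_degree.conj_eq (by simp)
  obtain ⟨β, hβ⟩ : ∃ β : VF P Q, β = (1 / 2 : ℂ) • conv b f f := ⟨_, rfl⟩
  have hfβ : f = c.i ∘ₗ proj P - c.h ∘ₗ β := by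
    have : Φ f = c.i ∘ₗ proj P - c.h ∘ₗ β := by simp only [Φ, hρ0 f f_one, hβ]
    rw [← this, hf]
  have hβ2 : Order 2 β := by
    rw [hβ]
    exact (Order.conv (order_one f_one) (order_one f_one)).smul _
  have β_ι : ∀ x, β (ι P x) = 0 := fun x => hβ2 _ (words_two_ι x)
  have β_one : β 1 = 0 := hβ2 _ (one_mem_words 1)
  let X' : VF P P := c.p ∘ₗ β
  have X_degree : HasDegree X' 1 := by
    have := HasDegree.comp_left c.p_mem (H.hasDegree_half_conv f_degree)
    rwa [← hβ, add_zero] at this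
  have odd : conj X' = (-1 : ℂ) ^ 1 • X' := X_degree.conj_eq (by simp)
  have hβX : β ∘ₗ hat X' = conv b (f ∘ₗ hat X') f := by
    have h1 : conj (f ∘ₗ hat X' : VF P Q) = (-1 : ℂ) ^ 1 • (f ∘ₗ hat X') := by
      have := conj_comp_hat_parity odd even
      rwa [zero_add] at this
    rw [hβ, LinearMap.smul_comp, conv_comp_hat _ _ _ odd, H.conv_sgn_comm even h1]
    module
  have dβ : d ∘ₗ β = - conv b (d ∘ₗ f) f := by rw [hβ, H.d_half_conv even]
  have βf : conv b β f = 0 := by rw [hβ, H.conv_half_conv even]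
  have hdf : ∀ a, d (f a) = - d (c.h (β a)) := fun a => by
    rw [hfβ]; simp [c.d_i]
  -- the error term satisfies `E = -h(b(E, f))`
  have mc : d ∘ₗ f + β = f ∘ₗ hat X' := by
    rw [← sub_eq_zero]
    set E := d ∘ₗ f + β - f ∘ₗ hat X' with hE
    refine eq_zero_of_raising (T := fun Z => -(c.h ∘ₗ conv b Z f))
      (fun k F hF => ?_) ?_
    · have := Order.conv (β := b) hF (order_one f_one)
      rw [add_comm] at this
      exact (this.comp_left c.h).neg
    · have e1 : f ∘ₗ hat X' = c.i ∘ₗ X' - c.h ∘ₗ conv b (f ∘ₗ hat X') f := by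
        rw [← hβX]
        nth_rewrite 1 [hfβ]
        rw [LinearMap.sub_comp, LinearMap.comp_assoc, proj_comp_hat, LinearMap.comp_assoc]
      have e2 : E = c.h ∘ₗ conv b (f ∘ₗ hat X') f - c.h ∘ₗ conv b (d ∘ₗ f) f := by
        rw [hE]
        nth_rewrite 1 [e1]
        ext1 a
        have h1 := c.homotopy (β a)
        have h2 := LinearMap.congr_fun dβ a
        simp only [LinearMap.comp_apply, LinearMap.neg_apply] at h2
        simp only [LinearMap.add_apply, LinearMap.sub_apply, LinearMap.comp_apply, hdf, X']
        rw [h2, map_neg] at h1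
        nth_rewrite 2 [← h1]
        abel
      have e3 : conv b E f = conv b (d ∘ₗ f) f - conv b (f ∘ₗ hat X') f := by
        rw [hE, conv_sub_left, conv_add, βf, add_zero]
      change E = -(c.h ∘ₗ conv b E f)
      rw [e3, e2, LinearMap.comp_sub, neg_sub]
  refine ⟨X', f, ⟨even, odd, ?_, ?_⟩, f_one, ?_, f_degree, ?_, ?_, X_degree, ?_, ?_⟩
  · have h1 : X' ∘ₗ hat X' = c.p ∘ₗ conv b (f ∘ₗ hat X') f := by
      rw [← hβX]; rfl
    rw [h1, ← mc, conv_add, βf, add_zero, ← neg_neg (conv b (d ∘ₗ f) f), ← dβ]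
    ext1 a
    simp [c.p_d]
  · rw [← hβ, mc]
  · intro x
    rw [hfβ]
    simp [proj_ι, β_ι]
  · simp [X', β_one]
  · intro x
    simp [X', β_ι]
  · rw [hfβ]
    ext1 a
    simp [c.h_i, c.h_h]
  · rw [hfβ]
    ext1 a
    simp [c.p_i, c.p_h]

namespace IsHomotopyTransfer
variable {c : Contraction d P} {X' : VF P P} {f : VF P Q}

theorem isCohomological (hf : IsHomotopyTransfer c b X' f) : IsCohomological X' :=
  .of_comp_hat hf.X_degree hf.X_one hf.sq

/-- Homotopy transfer yields a quasi-isomorphism of dg manifolds. -/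
theorem exists_morphism (hf : IsHomotopyTransfer c b X' f) (H : IsShiftedDGLie d b) :
    ∃ F : DGMorphism X' (quad d b H.b_symm), IsExp f F.φ ∧ F.IsQuasiIso ∧
      ∀ x, F.linearPart x = c.i x := by
  obtain ⟨φ, hφ⟩ := exists_isExp hf.even hf.f_one
  have hproj : proj Q ∘ₗ φ = f := hφ.proj_comp hf.f_one
  let F : DGMorphism X' (quad d b H.b_symm) :=
    { φ := φ
      map_one := hφ.map_one
      counit := hφ.counit_comp
      comul := hφ.comul_comp hf.even
      degree := by rw [hproj]; exact hf.f_degree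
      intertwines := hf.intertwines H.b_symm hφ hf.f_one }
  have hlin : ∀ x, F.linearPart x = c.i x := fun x => by
    rw [← hf.f_ι, ← hproj]; rfl
  refine ⟨F, hφ, ⟨fun x _ ⟨y, hy⟩ => ⟨0, ?_⟩, fun y hy => ⟨c.p y, c.h y, hf.X_ι _, ?_⟩⟩, hlin⟩
  · rw [hlin, quad_ι] at hy
    have := congrArg c.p hy
    rw [c.p_i, c.p_d] at this
    rw [this, map_zero, map_zero]
  · rw [quad_ι] at hy ⊢
    rw [hlin]
    have := c.homotopy y
    rw [hy, map_zero, add_zero] at this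
    rw [← this]
    simp [c.p_d, c.p_i, c.h_i, add_comm, c.h_d_h]

end IsHomotopyTransfer
end Transfer
end ExtDef

/-! ### Homology, and the push-forward of vector fields -/

namespace ExtDef

universe u

open GSym

section Homology
variable {V W : Type*} [AddCommGroup V] [Module ℂ V] [AddCommGroup W] [Module ℂ W]

/-- The homology of an endomorphism: its kernel modulo the intersection with its image. Both `VFH`
and `GradedSpace.Coh` are of this form. -/
abbrev Homology (D : V →ₗ[ℂ] V) : Type _ :=
  ↥(LinearMap.ker D) ⧸ (LinearMap.range D).comap (LinearMap.ker D).subtype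

namespace Homology

/-- The homology class of a cycle. -/
noncomputable def mk (D : V →ₗ[ℂ] V) : LinearMap.ker D →ₗ[ℂ] Homology D := Submodule.mkQ _

theorem mk_surjective (D : V →ₗ[ℂ] V) (a : Homology D) : ∃ x, mk D x = a :=
  Submodule.mkQ_surjective _ a

theorem mk_eq_zero {D : V →ₗ[ℂ] V} {x : LinearMap.ker D} : mk D x = 0 ↔ ∃ z, x.1 = D z := by
  refine (Submodule.Quotient.mk_eq_zero _).trans ⟨fun ⟨z, hz⟩ => ⟨z, hz.symm⟩, fun ⟨z, hz⟩ => ⟨z, hz.symm⟩⟩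

theorem mk_eq_mk {D : V →ₗ[ℂ] V} {x y : LinearMap.ker D} :
    mk D x = mk D y ↔ ∃ z, x.1 - y.1 = D z := by
  rw [← sub_eq_zero, ← map_sub, mk_eq_zero]
  rfl

/-- A chain map which is bijective on homology, expressed by elements, induces an isomorphism. -/
theorem exists_equiv {D : V →ₗ[ℂ] V} {D' : W →ₗ[ℂ] W} (T : V →ₗ[ℂ] W) (hT : ∀ x, D' (T x) = T (D x))
    (inj : ∀ x, D x = 0 → (∃ z, T x = D' z) → ∃ y, x = D y)
    (surj : ∀ y, D' y = 0 → ∃ x z, D x = 0 ∧ y = T x + D' z) :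
    ∃ e : Homology D ≃ₗ[ℂ] Homology D', ∀ (x : LinearMap.ker D) (y : LinearMap.ker D'),
      e (mk D x) = mk D' y ↔ ∃ z, T x.1 - y.1 = D' z := by
  have hker : ∀ x ∈ LinearMap.ker D, T x ∈ LinearMap.ker D' := fun x hx => by
    rw [LinearMap.mem_ker, hT, LinearMap.mem_ker.1 hx, map_zero]
  let e₀ : Homology D →ₗ[ℂ] Homology D' := Submodule.mapQ _ _ (T.restrict hker) (by
    rintro ⟨x, hx⟩ ⟨y, hy⟩
    exact ⟨T y, by rw [hT, hy]; rfl⟩)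
  have he₀ : ∀ x : LinearMap.ker D, e₀ (mk D x) = mk D' ⟨T x.1, hker _ x.2⟩ := fun x => rfl
  refine ⟨LinearEquiv.ofBijective e₀ ⟨?_, fun b => ?_⟩, fun x y => ?_⟩
  · rw [← LinearMap.ker_eq_bot, LinearMap.ker_eq_bot']
    intro a ha
    obtain ⟨x, rfl⟩ := mk_surjective D a
    rw [he₀, mk_eq_zero] at ha
    exact mk_eq_zero.2 (inj x.1 (LinearMap.mem_ker.1 x.2) ha)
  · obtain ⟨⟨y, hy⟩, rfl⟩ := mk_surjective D' b
    obtain ⟨x, z, hx, h⟩ := surj y hy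
    refine ⟨mk D ⟨x, hx⟩, ?_⟩
    rw [he₀, mk_eq_mk]
    exact ⟨-z, by simp [h]⟩
  · change e₀ (mk D x) = _ ↔ _
    rw [he₀, mk_eq_mk]

/-- A product satisfying the Leibniz rule descends to homology. -/
theorem exists_mul {D : V →ₗ[ℂ] V} (m : V →ₗ[ℂ] V →ₗ[ℂ] V) (s : V →ₗ[ℂ] V)
    (s_s : ∀ x, s (s x) = x) (D_s : ∀ x, D (s x) = - s (D x))
    (leibniz : ∀ x y, D (m x y) = m (D x) y + m (s x) (D y)) :
    ∃ star : Homology D →ₗ[ℂ] Homology D →ₗ[ℂ] Homology D,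
      ∀ x y z : LinearMap.ker D, z.1 = m x.1 y.1 → star (mk D x) (mk D y) = mk D z := by
  have hm : ∀ x y : LinearMap.ker D, D (m x.1 y.1) = 0 := fun x y => by
    rw [leibniz, LinearMap.mem_ker.1 x.2, LinearMap.mem_ker.1 y.2]
    simp
  let m₁ : LinearMap.ker D →ₗ[ℂ] LinearMap.ker D →ₗ[ℂ] Homology D :=
    LinearMap.mk₂ ℂ (fun x y => mk D ⟨m x.1 y.1, hm x y⟩)
      (fun x x' y => by rw [← map_add]; congr 1; ext1; simp)
      (fun c x y => by rw [← map_smul]; congr 1; ext1; simp)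
      (fun x y y' => by rw [← map_add]; congr 1; ext1; simp)
      (fun c x y => by rw [← map_smul]; congr 1; ext1; simp)
  have hm₁ : ∀ x y, m₁ x y = mk D ⟨m x.1 y.1, hm x y⟩ := fun x y => rfl
  let m₂ : LinearMap.ker D →ₗ[ℂ] Homology D →ₗ[ℂ] Homology D :=
    LinearMap.mk₂ ℂ (fun x => Submodule.liftQ _ (m₁ x) (by
        rintro ⟨y, hy⟩ ⟨z, hz⟩
        rw [LinearMap.mem_ker, hm₁, mk_eq_zero]
        refine ⟨m (s x.1) z, ?_⟩
        have hx := LinearMap.mem_ker.1 x.2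
        change D z = y at hz
        rw [leibniz, D_s, hx, s_s, hz]
        simp))
      (fun x x' a => by obtain ⟨y, rfl⟩ := mk_surjective D a; exact LinearMap.map_add₂ m₁ x x' y)
      (fun c x a => by obtain ⟨y, rfl⟩ := mk_surjective D a; exact LinearMap.map_smul₂ m₁ c x y)
      (fun x a a' => map_add _ a a') (fun c x a => map_smul _ c a)
  have hm₂ : ∀ x y, m₂ x (mk D y) = m₁ x y := fun x y => rfl
  refine ⟨Submodule.liftQ _ m₂ ?_, fun x y z hz => ?_⟩
  · rintro ⟨x, hx⟩ ⟨z, hz⟩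
    rw [LinearMap.mem_ker]
    refine LinearMap.ext fun a => ?_
    obtain ⟨y, rfl⟩ := mk_surjective D a
    rw [hm₂, hm₁, LinearMap.zero_apply, mk_eq_zero]
    refine ⟨m z y.1, ?_⟩
    change D z = x at hz
    rw [leibniz, LinearMap.mem_ker.1 y.2, hz]
    simp
  · change m₁ x y = _
    rw [hm₁]
    congr 1
    ext1
    exact hz.symm

end Homology
end Homology

section Push
variable {P Q : GradedSpace.{u}} {d : Q →ₗ[ℂ] Q} {b : Q →ₗ[ℂ] Q →ₗ[ℂ] Q}
  {c : Contraction d P} {X' : VF P P} {f : VF P Q}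

theorem IsMC.conj_push (hf : IsMC d b X' f) (V : VF P P) :
    conj (f ∘ₗ hat V : VF P Q) = f ∘ₗ hat (conj V) := by
  induction V using vf_parity_induction with
  | hadd V W hV hW => simp only [hat_add, map_add, LinearMap.comp_add, hV, hW]
  | h v V hV =>
    rw [conj_comp_hat_parity hV hf.even, hV, hat_smul, LinearMap.comp_smul, zero_add]

namespace IsHomotopyTransfer
variable (hf : IsHomotopyTransfer c b X' f)
include hf

/-- Bracketing with `f` raises the order, as `f` vanishes at the origin. This makes the gauge
equation contractive. -/
theorem order_h_conv {k : ℕ} {Z : VF P Q} (hZ : Order k Z) : Order (k + 1) (-(c.h ∘ₗ conv b Z f)) := by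
  have := Order.conv (β := b) hZ (order_one hf.f_one)
  rw [add_comm] at this
  exact (this.comp_left c.h).neg

theorem p_push (U : VF P P) : c.p ∘ₗ f ∘ₗ hat U = U := by
  rw [← LinearMap.comp_assoc, hf.p_f, proj_comp_hat]

theorem h_push (U : VF P P) : c.h ∘ₗ f ∘ₗ hat U = 0 := by
  rw [← LinearMap.comp_assoc, hf.h_f, LinearMap.zero_comp]

omit hf in
theorem h_alongD {Z : VF P Q} (hZ : c.h ∘ₗ Z = 0) :
    c.h ∘ₗ alongD d b X' f Z = c.h ∘ₗ d ∘ₗ Z + c.h ∘ₗ conv b Z f := by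
  have h1 : c.h ∘ₗ conj Z = 0 := by
    have := conj_comp_left c.sgn_h Z
    rw [hZ, map_zero, eq_comm, smul_eq_zero] at this
    exact this.resolve_left (by simp)
  rw [alongD_apply, LinearMap.comp_sub, LinearMap.comp_add, ← LinearMap.comp_assoc (hat X'), h1]
  simp

/-- Every field along the morphism can be brought to the gauge `h Z = 0` by an exact one. -/
theorem exists_gauge (Z : VF P Q) :
    ∃ Y : VF P Q, c.h ∘ₗ (Z - alongD d b X' f Y) = 0 := by
  obtain ⟨Y, hY, _⟩ := exists_fixedPoint (fun Y : VF P Q => c.h ∘ₗ Z - c.h ∘ₗ conv b Y f) (by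
    intro k F G hFG
    have := hf.order_h_conv hFG
    rw [conv_sub_left, LinearMap.comp_sub] at this
    simp only [sub_sub_sub_cancel_left]
    rwa [neg_sub] at this)
  refine ⟨Y, ?_⟩
  have hY' : Y = c.h ∘ₗ (Z - conv b Y f) := by rw [LinearMap.comp_sub]; exact hY.symm
  have hhY : c.h ∘ₗ Y = 0 := by
    rw [hY']; ext1 a; exact c.h_h _
  have hdY : c.h ∘ₗ d ∘ₗ Y = Y := by
    rw [hY']; ext1 a; exact c.h_d_h _
  rw [LinearMap.comp_sub, h_alongD hhY, hdY]
  nth_rewrite 1 [← hY]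
  rw [sub_add_cancel, sub_self]

variable {φ : GSym P →ₗ[ℂ] GSym Q} (hφ : IsExp f φ) (H : IsShiftedDGLie d b)
include hφ H

/-- In the gauge `h Z = 0`, closed fields along the morphism come from fields on the source. -/
theorem eq_push {Z : VF P Q} (hZ : c.h ∘ₗ Z = 0) (hDZ : c.h ∘ₗ alongD d b X' f Z = 0) :
    Z = f ∘ₗ hat (c.p ∘ₗ Z) := by
  rw [← sub_eq_zero]
  set W : VF P Q := Z - f ∘ₗ hat (c.p ∘ₗ Z) with hW
  have h1 : c.h ∘ₗ W = 0 := by rw [hW, LinearMap.comp_sub, hZ, hf.h_push, sub_zero]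
  have h2 : c.p ∘ₗ W = 0 := by rw [hW, LinearMap.comp_sub, hf.p_push, sub_self]
  have h3 : c.h ∘ₗ alongD d b X' f W = 0 := by
    rw [hW, map_sub, hf.alongD_push H.b_symm hφ hf.f_one, LinearMap.comp_sub, hDZ, hf.h_push,
      sub_zero]
  have h4 : c.h ∘ₗ d ∘ₗ W = W := by
    ext1 a
    have := c.homotopy (W a)
    rw [show c.h (W a) = 0 from LinearMap.congr_fun h1 a,
      show c.p (W a) = 0 from LinearMap.congr_fun h2 a] at this
    simpa using this
  rw [h_alongD h1, h4] at h3
  exact eq_zero_of_raising (fun k F hF => hf.order_h_conv hF) (eq_neg_of_add_eq_zero_left h3)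

theorem push_surj (Z : VF P Q) (hZ : alongD d b X' f Z = 0) :
    ∃ V Y, dX X' V = 0 ∧ Z = f ∘ₗ hat V + alongD d b X' f Y := by
  obtain ⟨Y, hY⟩ := hf.exists_gauge Z
  have hD : alongD d b X' f (Z - alongD d b X' f Y) = 0 := by
    rw [map_sub, hf.alongD_alongD H, hZ, sub_zero]
  have h1 := hf.eq_push hφ H hY (by rw [hD, LinearMap.comp_zero])
  set V : VF P P := c.p ∘ₗ (Z - alongD d b X' f Y)
  refine ⟨V, Y, ?_, by rw [← h1, sub_add_cancel]⟩
  rw [h1, hf.alongD_push H.b_symm hφ hf.f_one] at hD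
  rw [← hf.p_push (dX X' V), hD, LinearMap.comp_zero]

theorem push_inj (V : VF P P) (hV : ∃ Z, f ∘ₗ hat V = alongD d b X' f Z) : ∃ U, V = dX X' U := by
  obtain ⟨Z, hZ⟩ := hV
  obtain ⟨Y, hY⟩ := hf.exists_gauge Z
  have hD : alongD d b X' f (Z - alongD d b X' f Y) = f ∘ₗ hat V := by
    rw [map_sub, hf.alongD_alongD H, ← hZ, sub_zero]
  have h1 := hf.eq_push hφ H hY (by rw [hD, hf.h_push])
  set U : VF P P := c.p ∘ₗ (Z - alongD d b X' f Y)
  refine ⟨U, ?_⟩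
  rw [h1, hf.alongD_push H.b_symm hφ hf.f_one] at hD
  rw [← hf.p_push V, ← hD, hf.p_push]

/-- Pushing forward vector fields is an isomorphism on cohomology. -/
theorem exists_pushEquiv : ∃ e : VFH X' ≃ₗ[ℂ] Homology (alongD d b X' f),
    ∀ V Z, e (VFH.mk X' V) = Homology.mk _ Z ↔ ∃ Y, f ∘ₗ hat V.1 - Z.1 = alongD d b X' f Y :=
  Homology.exists_equiv (D := dX X')
    { toFun := fun V => f ∘ₗ hat V
      map_add' := fun V W => by rw [hat_add, LinearMap.comp_add]
      map_smul' := fun a V => by rw [hat_smul, LinearMap.comp_smul]; rfl }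
    (fun V => hf.alongD_push H.b_symm hφ hf.f_one V)
    (fun V _ h => hf.push_inj hφ H V h)
    (fun Z hZ => hf.push_surj hφ H Z hZ)

end IsHomotopyTransfer
end Push
end ExtDef

/-! ### The contracting homotopy of the symmetric algebra -/

namespace ExtDef

universe u

open GSym

theorem GradedSpace.HasParity.map {P Q : GradedSpace.{u}} {g : P →ₗ[ℂ] Q} {p : ℕ} {x : P}
    (hx : P.HasParity p x) (hg : ∀ x, Q.sgn (g x) = g (P.sgn x)) : Q.HasParity p (g x) := by
  rw [GradedSpace.HasParity, hg, show P.sgn x = _ from hx, map_smul]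

theorem GradedSpace.HasParity.sub {Q : GradedSpace.{u}} {p : ℕ} {x y : Q}
    (hx : Q.HasParity p x) (hy : Q.HasParity p y) : Q.HasParity p (x - y) := by
  rw [GradedSpace.HasParity, map_sub, show Q.sgn x = _ from hx, show Q.sgn y = _ from hy, smul_sub]

namespace GSym
variable {P Q : GradedSpace.{u}}

/-- The algebra map `S(P) → S(Q)` induced by a linear map of degree zero. -/
noncomputable def mapHom (g : P →ₗ[ℂ] Q) (hg : ∀ x, Q.sgn (g x) = g (P.sgn x)) :
    GSym P →ₐ[ℂ] GSym Q :=
  lift (ι Q ∘ₗ g) fun p q _ _ hx hy =>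
    ι_comm p q _ _ (hx.map hg) (hy.map hg)

section MapHom
variable {g : P →ₗ[ℂ] Q} {hg : ∀ x, Q.sgn (g x) = g (P.sgn x)}

theorem mapHom_ι (x : P) : mapHom g hg (ι P x) = ι Q (g x) := lift_ι _ _ _

theorem mapHom_ι_mul (x : P) (a : GSym P) :
    mapHom g hg (ι P x * a) = ι Q (g x) * mapHom g hg a := by
  rw [map_mul, mapHom_ι]

theorem mapHom_mem_words {k : ℕ} {a : GSym P} (ha : a ∈ words P k) :
    mapHom g hg a ∈ words Q k := by
  induction k generalizing a with
  | zero => rw [mem_words_zero] at *; rw [ha, map_zero]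
  | succ k ih =>
    suffices h : words P (k + 1) ≤ (words Q (k + 1)).comap (mapHom g hg).toLinearMap from h ha
    refine words_induction ?_ fun p x a hx ha => ?_
    · simpa using one_mem_words k
    · simpa [mapHom_ι] using ι_mul_mem_words (ih ha) (g x)

end MapHom

/-- A vector field vanishing at the origin does not raise the length of words. -/
theorem hat_mem_words {V : VF Q Q} (hV : V 1 = 0) {k : ℕ} {a : GSym Q} (ha : a ∈ words Q k) :
    hat V a ∈ words Q k := by
  cases k with
  | zero => rw [mem_words_zero] at *; rw [ha, map_zero]
  | succ k => exact conv_mem ((order_one hV).comp_left (ι Q)) (fun a b hb => ι_mul_mem_words hb _) a ha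

/-- A vector field vanishing to second order lowers the length of words. -/
theorem hat_mem_words_of_order {V : VF Q Q} (hV : Order 2 V) {k : ℕ} {a : GSym Q}
    (ha : a ∈ words Q (k + 1)) : hat V a ∈ words Q k := by
  cases k with
  | zero =>
    refine conv_mem (β := LinearMap.mul ℂ (GSym Q)) (G := LinearMap.id) (k := 0) ((hV.mono one_le_two).comp_left (ι Q)) (fun a b hb => ?_) a ha
    simp [mem_words_zero.1 hb]
  | succ k => exact conv_mem (hV.comp_left (ι Q)) (fun a b hb => ι_mul_mem_words hb _) a ha

/-- To leading order the exponential of a formal map is the algebra map induced by its linear part.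
-/
theorem IsExp.sub_mapHom_mem_words {f : VF P Q} {φ : GSym P →ₗ[ℂ] GSym Q} (hφ : IsExp f φ)
    {g : P →ₗ[ℂ] Q} {hg : ∀ x, Q.sgn (g x) = g (P.sgn x)}
    (f_ι : ∀ x, f (ι P x) = g x) {k : ℕ} {a : GSym P} (ha : a ∈ words P (k + 1)) :
    φ a - mapHom g hg a ∈ words Q k := by
  suffices h : ∀ k, words P (k + 1) ≤ (words Q k).comap (φ - (mapHom g hg).toLinearMap) from h k ha
  clear ha a k
  intro k
  induction k with
  | zero =>
    refine words_induction ?_ fun p x a _ ha => ?_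
    · simp [hφ.map_one]
    · rw [mem_words_zero.1 ha]; simp
  | succ k ih =>
    refine words_induction ?_ fun p x a hx ha => ?_
    · simp [hφ.map_one]
    · have h1 := Submodule.mem_comap.1 (ih ha)
      simp only [LinearMap.sub_apply, AlgHom.toLinearMap_apply] at h1
      let r : VF P Q := f ∘ₗ lm x - (counit P).toLinearMap.smulRight (g x)
      have hr : r 1 = 0 := by simp [r, f_ι]
      have e : φ (ι P x * a) = ι Q (g x) * φ a + hatAlong φ r a := by
        have e1 : hatAlong φ ((counit P).toLinearMap.smulRight (g x)) = lm (g x) ∘ₗ φ := by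
          refine Eq.trans (conv_congr fun _ _ _ _ _ _ => ?_) (conv_counit_left (lm (g x))
            (β := (LinearMap.lsmul ℂ (GSym Q →ₗ[ℂ] GSym Q)).flip (lm (g x))) (by simp) φ)
          simp
        rw [hφ.apply_ι_mul hx, hatAlong_sub, e1]
        simp
      have e2 : hatAlong φ r a ∈ words Q (k + 1) :=
        conv_mem ((order_one hr).comp_left (ι Q))
          (fun a b hb => ι_mul_mem_words (hφ.mem_words hb) _) a ha
      have e3 := Submodule.add_mem _ (ι_mul_mem_words h1 (g x)) e2
      rw [Submodule.mem_comap, LinearMap.sub_apply, e, AlgHom.toLinearMap_apply, mapHom_ι_mul]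
      convert e3 using 1
      rw [mul_sub]
      abel

/-- A linear retraction of the linear part of a formal map whose image under the retraction is
linear extends to a retraction of its exponential. -/
theorem IsExp.mapHom_comp {f : VF P Q} {φ : GSym P →ₗ[ℂ] GSym Q} (hφ : IsExp f φ) {g : Q →ₗ[ℂ] P}
    {hg : ∀ x, P.sgn (g x) = g (Q.sgn x)} (h : g ∘ₗ f = proj P) (a : GSym P) :
    mapHom g hg (φ a) = a := by
  have : (mapHom g hg).toLinearMap ∘ₗ φ = LinearMap.id := by
    refine ode_unique (LinearMap.mul ℂ (GSym P) ∘ₗ ι P) (proj P) (by simp [hφ.map_one])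
      (fun p x hx => ?_) (fun p x _ => ?_)
    · rw [LinearMap.comp_assoc, hφ.comp_lm p x hx, hatAlong, comp_conv]
      refine conv_congr fun _ _ a b _ _ => ?_
      have := LinearMap.congr_fun h (ι P x * a)
      simp only [LinearMap.comp_apply] at this
      simp [mapHom_ι, this]
    · rw [proj_comp_lm]
      refine Eq.trans ?_ (Eq.trans (conv_counit_left (lm x)
        (β := (LinearMap.lsmul ℂ (GSym P →ₗ[ℂ] GSym P)).flip (lm x)) (by simp) LinearMap.id).symm
        (conv_congr fun _ _ _ _ _ _ => ?_))
      · simp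
      · simp
  exact LinearMap.congr_fun this a

section Linear
variable {T : Q →ₗ[ℂ] Q} {v : ℕ}

theorem hasParity_map (hT : ∀ x, Q.sgn (T x) = (-1 : ℂ) ^ v • T (Q.sgn x)) {p : ℕ} {x : Q}
    (hx : Q.HasParity p x) : Q.HasParity (v + p) (T x) := by
  rw [GradedSpace.HasParity, hT, show Q.sgn x = _ from hx, map_smul, smul_smul, pow_add]

theorem conj_linear (hT : ∀ x, Q.sgn (T x) = (-1 : ℂ) ^ v • T (Q.sgn x)) :
    conj (T ∘ₗ proj Q) = (-1 : ℂ) ^ v • (T ∘ₗ proj Q) := by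
  rw [conj_comp_left hT, conj_proj]

/-- The derivation of `S(Q)` extending a linear map. -/
theorem hat_linear_ι_mul (hT : ∀ x, Q.sgn (T x) = (-1 : ℂ) ^ v • T (Q.sgn x)) {p : ℕ} {x : Q}
    (hx : Q.HasParity p x) (a : GSym Q) : hat (T ∘ₗ proj Q) (ι Q x * a) =
      ι Q (T x) * a + (-1 : ℂ) ^ (v * p) • (ι Q x * hat (T ∘ₗ proj Q) a) := by
  rw [hat_ι_mul (conj_linear hT) hx, LinearMap.comp_assoc, proj_comp_lm]
  congr 1
  have : hat (T ∘ₗ (LinearMap.lsmul ℂ Q).flip x ∘ₗ (counit Q).toLinearMap) = lm (T x) := by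
    refine Eq.trans (conv_congr fun _ _ _ _ _ _ => ?_) ((conv_counit_left (lm (T x))
      (β := (LinearMap.lsmul ℂ (GSym Q →ₗ[ℂ] GSym Q)).flip (lm (T x))) (by simp)
      LinearMap.id).trans (LinearMap.comp_id _))
    simp
  rw [this, lm_apply]

theorem hat_linear_one : hat (T ∘ₗ proj Q) 1 = 0 := by simp [hat_one, proj_one]

theorem hat_linear_mem_words {k : ℕ} {a : GSym Q} (ha : a ∈ words Q k) :
    hat (T ∘ₗ proj Q) a ∈ words Q k := hat_mem_words (by simp [proj_one]) ha

end Linear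

/-- The projections of `S(Q)` to the words with `j` letters in the kernel of the idempotent `e` and
the other letters in its image. -/
structure IsWeights (e : Q →ₗ[ℂ] Q) (W : ℕ → GSym Q →ₗ[ℂ] GSym Q) : Prop where
  zero_one : W 0 1 = 1
  succ_one : ∀ j, W (j + 1) 1 = 0
  zero_ι_mul : ∀ x a, W 0 (ι Q x * a) = ι Q (e x) * W 0 a
  succ_ι_mul : ∀ j x a, W (j + 1) (ι Q x * a) = ι Q (e x) * W (j + 1) a + ι Q (x - e x) * W j a

/-- The projections to weights are the coefficients of the algebra map to `S(Q)[t]` with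
`x ↦ e x + t (x - e x)`. -/
theorem exists_isWeights (e : Q →ₗ[ℂ] Q) (he : ∀ x, Q.sgn (e x) = e (Q.sgn x)) :
    ∃ W, IsWeights e W := by
  let C : GSym Q →ₗ[ℂ] Polynomial (GSym Q) := (Polynomial.CAlgHom (R := ℂ)).toLinearMap
  let g : Q →ₗ[ℂ] Polynomial (GSym Q) :=
    C ∘ₗ ι Q ∘ₗ e + LinearMap.mulLeft ℂ Polynomial.X ∘ₗ C ∘ₗ ι Q ∘ₗ (LinearMap.id - e)
  have hg : ∀ x, g x = Polynomial.C (ι Q (e x)) + Polynomial.X * Polynomial.C (ι Q (x - e x)) :=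
    fun x => rfl
  have comm : ∀ (p q : ℕ) (x y : Q), Q.HasParity p x → Q.HasParity q y →
      g x * g y = (-1 : ℂ) ^ (p * q) • (g y * g x) := by
    intro p q x y hx hy
    have hex := hx.map he
    have hey := hy.map he
    have hx' := hx.sub hex
    have hy' := hy.sub hey
    have key : ∀ a b : Q, Q.HasParity p a → Q.HasParity q b →
        Polynomial.C (ι Q a) * Polynomial.C (ι Q b) =
          (-1 : ℂ) ^ (p * q) • (Polynomial.C (ι Q b) * Polynomial.C (ι Q a)) := by
      intro a b ha hb
      rw [← Polynomial.C_mul, ← Polynomial.C_mul, ι_comm p q a b ha hb, Polynomial.smul_C]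
    have hX : ∀ a b : GSym Q, Polynomial.C a * (Polynomial.X * Polynomial.C b) =
        Polynomial.X * (Polynomial.C a * Polynomial.C b) := fun a b => by
      rw [← mul_assoc, ← Polynomial.X_mul_C, mul_assoc]
    rw [hg, hg]
    simp only [mul_add, add_mul, hX, mul_assoc, key _ _ hex hey, key _ _ hex hy',
      key _ _ hx' hey, key _ _ hx' hy', mul_smul_comm, smul_add]
    abel
  let S : GSym Q →ₐ[ℂ] Polynomial (GSym Q) := lift g comm
  have hS : ∀ x a, S (ι Q x * a) = Polynomial.C (ι Q (e x)) * S a +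
      Polynomial.X * (Polynomial.C (ι Q (x - e x)) * S a) := fun x a => by
    rw [map_mul, show S (ι Q x) = g x from lift_ι _ _ _, hg, add_mul, mul_assoc]
  let W : ℕ → GSym Q →ₗ[ℂ] GSym Q := fun j =>
    { toFun := fun a => (S a).coeff j
      map_add' := fun a b => by simp
      map_smul' := fun c a => by simp }
  have hW : ∀ j a, W j a = (S a).coeff j := fun _ _ => rfl
  refine ⟨W, ?_, fun j => ?_, fun x a => ?_, fun j x a => ?_⟩
  · simp [hW]
  · simp [hW, Polynomial.coeff_one]
  · simp [hW, hS]
  · simp only [hW, hS, Polynomial.coeff_add, Polynomial.coeff_C_mul, Polynomial.coeff_X_mul]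

namespace IsWeights
variable {e : Q →ₗ[ℂ] Q} {W : ℕ → GSym Q →ₗ[ℂ] GSym Q} (hW : IsWeights e W)
include hW

theorem zero_eq (he : ∀ x, Q.sgn (e x) = e (Q.sgn x)) : W 0 = (mapHom e he).toLinearMap := by
  refine ext_lm (by simp [hW.zero_one]) fun p x a _ ih => ?_
  rw [AlgHom.toLinearMap_apply] at *
  rw [hW.zero_ι_mul, ih, mapHom_ι_mul]

theorem mem_words (j : ℕ) {k : ℕ} {a : GSym Q} (ha : a ∈ words Q k) : W j a ∈ words Q k := by
  induction k generalizing a j with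
  | zero => rw [mem_words_zero] at *; rw [ha, map_zero]
  | succ k ih =>
    suffices h : words Q (k + 1) ≤ (words Q (k + 1)).comap (W j) from h ha
    refine words_induction ?_ fun p x a hx ha => ?_
    · rw [Submodule.mem_comap]
      cases j with
      | zero => rw [hW.zero_one]; exact one_mem_words k
      | succ j => rw [hW.succ_one]; exact Submodule.zero_mem _
    · rw [Submodule.mem_comap]
      cases j with
      | zero => rw [hW.zero_ι_mul]; exact ι_mul_mem_words (ih _ ha) _
      | succ j =>
        rw [hW.succ_ι_mul]
        exact Submodule.add_mem _ (ι_mul_mem_words (ih _ ha) _) (ι_mul_mem_words (ih _ ha) _)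

theorem eq_zero {j k : ℕ} (hjk : k ≤ j) {a : GSym Q} (ha : a ∈ words Q k) : W j a = 0 := by
  induction k generalizing a j with
  | zero => rw [mem_words_zero.1 ha, map_zero]
  | succ k ih =>
    suffices h : words Q (k + 1) ≤ LinearMap.ker (W j) from h ha
    obtain ⟨j, rfl⟩ : ∃ i, j = i + 1 := ⟨j - 1, by omega⟩
    refine words_induction ?_ fun p x a hx ha => ?_
    · exact hW.succ_one j
    · rw [LinearMap.mem_ker, hW.succ_ι_mul, ih (by omega) ha, ih (by omega) ha]
      simp

theorem sum_eq {k : ℕ} {a : GSym Q} (ha : a ∈ words Q k) : ∑ j ∈ Finset.range k, W j a = a := by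
  induction k generalizing a with
  | zero => rw [mem_words_zero.1 ha]; simp
  | succ k ih =>
    suffices h : words Q (k + 1) ≤
        LinearMap.ker ((∑ j ∈ Finset.range (k + 1), W j) - LinearMap.id) by
      have := LinearMap.mem_ker.1 (h ha)
      simpa [sub_eq_zero, LinearMap.sum_apply] using this
    refine words_induction ?_ fun p x a hx ha => ?_
    · simp [LinearMap.sum_apply, Finset.sum_range_succ', hW.zero_one, hW.succ_one]
    · rw [LinearMap.mem_ker, LinearMap.sub_apply, LinearMap.sum_apply, sub_eq_zero,
        Finset.sum_range_succ']
      simp only [hW.succ_ι_mul, hW.zero_ι_mul, Finset.sum_add_distrib, ← Finset.mul_sum]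
      rw [ih ha, add_right_comm, ← mul_add, ← Finset.sum_range_succ' (fun j => W j a),
        Finset.sum_range_succ, ih ha, hW.eq_zero le_rfl ha, add_zero, ← add_mul, ← map_add]
      simp

theorem comp_sgn (he : ∀ x, Q.sgn (e x) = e (Q.sgn x)) (j : ℕ) (a : GSym Q) :
    W j (sgn Q a) = sgn Q (W j a) := by
  suffices h : ∀ j, W j ∘ₗ (sgn Q).toLinearMap = (sgn Q).toLinearMap ∘ₗ W j from
    LinearMap.congr_fun (h j) a
  suffices h : ∀ a j, W j (sgn Q a) = sgn Q (W j a) from fun j => LinearMap.ext fun a => h a j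
  intro a
  induction a using induction with
  | one => intro j; cases j <;> simp [hW.zero_one, hW.succ_one]
  | mul p x a hx ih =>
    intro j
    rw [map_mul, sgn_ι]
    cases j with
    | zero => rw [hW.zero_ι_mul, hW.zero_ι_mul, map_mul, sgn_ι, he, ih]
    | succ j =>
      rw [hW.succ_ι_mul, hW.succ_ι_mul, map_add, map_mul, map_mul, sgn_ι, sgn_ι, ih, ih]
      simp only [map_sub, he]
  | add a b ha hb => intro j; simp only [map_add, ha, hb]
  | smul c a ha => intro j; simp only [map_smul, ha]

/-- The weights are preserved by the derivations extending linear maps commuting with `e`. -/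
theorem comp_hat_linear {T : Q →ₗ[ℂ] Q} {v : ℕ}
    (hT : ∀ x, Q.sgn (T x) = (-1 : ℂ) ^ v • T (Q.sgn x))
    (he : ∀ x, Q.sgn (e x) = e (Q.sgn x)) (h : ∀ x, e (T x) = T (e x)) (j : ℕ) (a : GSym Q) :
    W j (hat (T ∘ₗ proj Q) a) = hat (T ∘ₗ proj Q) (W j a) := by
  induction a using induction generalizing j with
  | one => cases j <;> simp [hW.zero_one, hW.succ_one, hat_linear_one]
  | mul p x a hx ih =>
    have hex := hx.map he
    have hx' := hx.sub hex
    rw [hat_linear_ι_mul hT hx, map_add, map_smul]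
    cases j with
    | zero => simp only [hW.zero_ι_mul, ih, hat_linear_ι_mul hT hex, h]
    | succ j =>
      have h3 : T (x - e x) = T x - e (T x) := by rw [map_sub, h]
      simp only [hW.succ_ι_mul, ih, map_add, hat_linear_ι_mul hT hex, hat_linear_ι_mul hT hx', h3, h,
        smul_add]
      abel
  | add a b ha hb => simp only [map_add, ha, hb]
  | smul c a ha => simp only [map_smul, ha]

/-- The derivation extending the projection to the kernel of `e` multiplies by the weight. -/
theorem comp_hat_proj (he : ∀ x, Q.sgn (e x) = e (Q.sgn x)) (hee : ∀ x, e (e x) = e x) (j : ℕ)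
    (a : GSym Q) : W j (hat ((LinearMap.id - e) ∘ₗ proj Q) a) = (j : ℂ) • W j a := by
  have hT : ∀ x, Q.sgn ((LinearMap.id - e : Q →ₗ[ℂ] Q) x) =
        (-1 : ℂ) ^ 0 • (LinearMap.id - e : Q →ₗ[ℂ] Q) (Q.sgn x) :=
    fun x => by simp [he]
  induction a using induction generalizing j with
  | one => cases j <;> simp [hW.zero_one, hW.succ_one, hat_linear_one]
  | mul p x a hx ih =>
    have h0 : e (x - e x) = 0 := by rw [map_sub, hee, sub_self]
    rw [hat_linear_ι_mul hT hx, map_add, map_smul,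
      show (LinearMap.id - e : Q →ₗ[ℂ] Q) x = x - e x from rfl]
    cases j with
    | zero => simp only [hW.zero_ι_mul, ih, h0]; simp
    | succ j =>
      simp only [hW.succ_ι_mul, ih, h0, map_zero, zero_mul, sub_zero, pow_zero, one_smul,
        Nat.cast_add, Nat.cast_one, mul_smul_comm]
      module
  | add a b ha hb => simp only [map_add, ha, hb, smul_add]
  | smul c a ha => simp only [map_smul, ha]; rw [smul_comm]

end IsWeights

/-- A contraction of `(Q, d)` induces a contracting homotopy of `S(Q)` with the side conditions that
are needed below. -/
theorem exists_symHomotopy {d : Q →ₗ[ℂ] Q} (hd : ∀ x, Q.sgn (d x) = (-1 : ℂ) ^ 1 • d (Q.sgn x))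
    (c : Contraction d P) : ∃ κ : GSym Q →ₗ[ℂ] GSym Q,
      (∀ a, κ (hat (d ∘ₗ proj Q) a) + hat (d ∘ₗ proj Q) (κ a) =
        a - mapHom c.i c.sgn_i (mapHom c.p c.sgn_p a)) ∧
      (∀ a, κ (sgn Q a) = - sgn Q (κ a)) ∧
      (∀ a, κ (mapHom c.i c.sgn_i a) = 0) ∧ ∀ k, ∀ a ∈ words Q k, κ a ∈ words Q k := by
  have hh : ∀ x, Q.sgn (c.h x) = (-1 : ℂ) ^ 1 • c.h (Q.sgn x) := fun x => by
    rw [c.sgn_h, pow_one]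
  let e : Q →ₗ[ℂ] Q := c.i ∘ₗ c.p
  have he : ∀ x, Q.sgn (e x) = e (Q.sgn x) := fun x => by simp [e, c.sgn_i, c.sgn_p]
  have hee : ∀ x, e (e x) = e x := fun x => by simp [e, c.p_i]
  have hed : ∀ x, e (d x) = d (e x) := fun x => by simp [e, c.p_d, c.d_i]
  have heh : ∀ x, e (c.h x) = c.h (e x) := fun x => by simp [e, c.p_h, c.h_i]
  obtain ⟨W, hW⟩ := exists_isWeights e he
  -- `M` divides by the weight; since `0⁻¹ = 0`, it is zero on the part of weight zero
  obtain ⟨M, hM⟩ := exists_limit (fun n => ∑ j ∈ Finset.range n, (j : ℂ)⁻¹ • W j) fun n a ha => by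
    rw [Finset.sum_range_succ, LinearMap.add_apply, LinearMap.smul_apply, hW.eq_zero le_rfl ha,
      smul_zero, add_zero]
  have hM' : ∀ n, ∀ a ∈ words Q n, M a = ∑ j ∈ Finset.range n, (j : ℂ)⁻¹ • W j a :=
    fun n a ha => by rw [hM n a ha]; simp [LinearMap.sum_apply]
  have homotopy : ∀ a, hat (c.h ∘ₗ proj Q) (hat (d ∘ₗ proj Q) a) +
      hat (d ∘ₗ proj Q) (hat (c.h ∘ₗ proj Q) a) = hat ((LinearMap.id - e) ∘ₗ proj Q) a := by
    have hT : ∀ x, Q.sgn ((LinearMap.id - e : Q →ₗ[ℂ] Q) x) =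
        (-1 : ℂ) ^ 0 • (LinearMap.id - e : Q →ₗ[ℂ] Q) (Q.sgn x) :=
      fun x => by simp [he]
    intro a
    induction a using induction with
    | one => simp [hat_linear_one]
    | mul p x a hx ih =>
      have hdx : Q.HasParity (1 + p) (d x) := hasParity_map hd hx
      have hhx : Q.HasParity (1 + p) (c.h x) := hasParity_map hh hx
      have hπ : (LinearMap.id - e : Q →ₗ[ℂ] Q) x = c.h (d x) + d (c.h x) := by
        change x - c.i (c.p x) = _
        rw [sub_eq_iff_eq_add, add_comm (c.h _)]
        exact (c.homotopy x).symm
      rw [hat_linear_ι_mul hT hx, hat_linear_ι_mul hd hx, hat_linear_ι_mul hh hx, ← ih, hπ]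
      simp only [map_add, map_smul, hat_linear_ι_mul hd hx, hat_linear_ι_mul hh hx,
        hat_linear_ι_mul hh hdx, hat_linear_ι_mul hd hhx]
      simp only [one_mul, zero_mul, pow_zero, one_smul, smul_add, smul_smul, neg_one_pow_mul_self,
        mul_add, add_mul, pow_add, pow_one, neg_one_mul]
      module
    | add a b ha hb => simp only [map_add, ← ha, ← hb]; abel
    | smul r a ha => simp only [map_smul, ← ha, smul_add]
  have hi : ∀ a, hat (c.h ∘ₗ proj Q) (mapHom c.i c.sgn_i a) = 0 := by
    intro a
    induction a using induction with
    | one => simp [hat_linear_one]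
    | mul p x a hx ih =>
      have hix := hx.map c.sgn_i
      rw [mapHom_ι_mul, hat_linear_ι_mul hh hix, ih, c.h_i]
      simp
    | add a b ha hb => simp only [map_add, ha, hb, add_zero]
    | smul r a ha => simp only [map_smul, ha, smul_zero]
  have zero_eq : ∀ a, W 0 a = mapHom c.i c.sgn_i (mapHom c.p c.sgn_p a) := by
    intro a
    have : (mapHom e he) = (mapHom c.i c.sgn_i).comp (mapHom c.p c.sgn_p) :=
      hom_ext fun x => by simp [mapHom_ι, e]
    rw [hW.zero_eq he, this]
    rfl
  refine ⟨M ∘ₗ hat (c.h ∘ₗ proj Q), fun a => ?_, fun a => ?_, fun a => ?_, fun k a ha => ?_⟩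
  · obtain ⟨k, hk⟩ := exists_mem_words a
    have hk' := words_le_succ k hk
    rw [LinearMap.comp_apply, LinearMap.comp_apply,
      hM' (k + 1) _ (hat_linear_mem_words (hat_linear_mem_words hk')),
      hM' (k + 1) _ (hat_linear_mem_words hk'), map_sum, ← Finset.sum_add_distrib]
    have : ∀ j ∈ Finset.range (k + 1), (j : ℂ)⁻¹ • W j (hat (c.h ∘ₗ proj Q) (hat (d ∘ₗ proj Q) a)) +
        hat (d ∘ₗ proj Q) ((j : ℂ)⁻¹ • W j (hat (c.h ∘ₗ proj Q) a)) =
        ((j : ℂ)⁻¹ * j) • W j a := fun j _ => by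
      rw [map_smul, ← hW.comp_hat_linear hd he hed, ← smul_add, ← map_add, homotopy,
        hW.comp_hat_proj he hee, smul_smul]
    rw [Finset.sum_congr rfl this, Finset.sum_range_succ', ← zero_eq]
    have hs := hW.sum_eq hk'
    rw [Finset.sum_range_succ', ← eq_sub_iff_add_eq] at hs
    rw [← hs]
    simp only [Nat.cast_zero, mul_zero, zero_smul, add_zero]
    refine Finset.sum_congr rfl fun j _ => ?_
    rw [inv_mul_cancel₀ (by exact_mod_cast Nat.succ_ne_zero j), one_smul]
  · have h1 := LinearMap.congr_fun (hat_comp_tw 1 (conj_linear hh)) a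
    simp only [tw_one, LinearMap.comp_apply, AlgHom.toLinearMap_apply, LinearMap.smul_apply] at h1
    obtain ⟨k, hk⟩ := exists_mem_words a
    have hk' := hat_linear_mem_words (T := c.h) hk
    have hk2 : sgn Q (hat (c.h ∘ₗ proj Q) a) ∈ words Q k := by
      have := tw_mem_words 1 hk'
      rwa [tw_one] at this
    rw [LinearMap.comp_apply, h1, map_smul, LinearMap.comp_apply, hM' k _ hk2, hM' k _ hk', map_sum]
    simp only [hW.comp_sgn he, map_smul]
    rw [mul_one, pow_one]
    exact neg_one_smul ℂ (M := GSym Q) _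
  · rw [LinearMap.comp_apply, hi, map_zero]
  · rw [LinearMap.comp_apply, hM' k _ (hat_linear_mem_words ha)]
    exact Submodule.sum_mem _ fun j _ => Submodule.smul_mem _ _ (hW.mem_words j (hat_linear_mem_words ha))

end GSym
end ExtDef

/-! ### The pull-back of vector fields -/

namespace ExtDef

universe u

open GSym

section Pull
variable {P Q : GradedSpace.{u}} {d : Q →ₗ[ℂ] Q} {b : Q →ₗ[ℂ] Q →ₗ[ℂ] Q}
  {c : Contraction d P} {X' : VF P P} {f : VF P Q}

theorem GSym.Order.conj {k : ℕ} {W : VF P Q} (hW : Order k W) : Order k (conj W) := fun a ha => by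
  have h := tw_mem_words 1 ha
  rw [tw_one] at h
  rw [conj_apply, show W (GSym.sgn P a) = 0 from hW _ h, map_zero]

namespace IsHomotopyTransfer
variable (hf : IsHomotopyTransfer c b X' f) {φ : GSym P →ₗ[ℂ] GSym Q} (hφ : IsExp f φ)
  (H : IsShiftedDGLie d b)
include hf hφ H

/-- The vector fields on the target which vanish along the morphism form an acyclic complex. The
contracting homotopy of `S(Q)` is corrected to preserve them; it then inverts the differential up
to terms of higher order. -/
theorem pull_acyclic {W : VF Q Q} (hD : dX (quad d b H.b_symm) W = 0) (hW : W ∘ₗ φ = 0) :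
    ∃ Y, W = dX (quad d b H.b_symm) Y ∧ Y ∘ₗ φ = 0 := by
  have hd : ∀ x, Q.sgn (d x) = (-1 : ℂ) ^ 1 • d (Q.sgn x) := fun x => by rw [H.sgn_d, pow_one]
  obtain ⟨κ, hκ, κ_sgn, κ_i, κ_words⟩ := exists_symHomotopy hd c
  obtain ⟨D, hDef⟩ : ∃ D, D = dX (quad d b H.b_symm) := ⟨_, rfl⟩
  rw [← hDef] at hD ⊢
  let s : GSym Q →ₗ[ℂ] GSym P := (mapHom c.p c.sgn_p).toLinearMap
  have sφ : ∀ a, s (φ a) = a := hφ.mapHom_comp hf.p_f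
  -- `E` projects to the fields vanishing along the morphism, and `K` is the homotopy coming from `κ`
  let E : VF Q Q →ₗ[ℂ] VF Q Q := LinearMap.id - LinearMap.lcomp ℂ Q (φ ∘ₗ s)
  let K : VF Q Q →ₗ[ℂ] VF Q Q := LinearMap.lcomp ℂ Q κ ∘ₗ conj
  have hE : ∀ W a, E W a = W a - W (φ (s a)) := fun W a => rfl
  have hK : ∀ W a, K W a = conj W (κ a) := fun W a => rfl
  have E_φ : ∀ W, E W ∘ₗ φ = 0 := fun W => by
    ext1 a
    rw [LinearMap.comp_apply, hE, sφ, sub_self, LinearMap.zero_apply]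
  have E_eq : ∀ W : VF Q Q, W ∘ₗ φ = 0 → E W = W := fun W hW => by
    ext1 a
    have := LinearMap.congr_fun hW (s a)
    rw [LinearMap.comp_apply] at this
    rw [hE, this, LinearMap.zero_apply, sub_zero]
  have D_φ : ∀ W : VF Q Q, W ∘ₗ φ = 0 → D W ∘ₗ φ = 0 := fun W hW => by
    rw [hDef, ← hf.alongD_pull H.b_symm hφ hf.f_one, hW, map_zero]
  have D_D : ∀ W, D (D W) = 0 := fun W => by
    rw [hDef, H.dX_quad, H.isMC_quad.alongD_alongD H]
  -- `D₀` is the part of `D` coming from `d`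
  let D₀ : VF Q Q → VF Q Q := fun W => d ∘ₗ W - conj W ∘ₗ hat (d ∘ₗ proj Q)
  have o_s : ∀ {k a}, a ∈ words Q k → s a ∈ words P k := fun ha => mapHom_mem_words ha
  have o_E : ∀ k W, Order k W → Order k (E W) := fun k W hW a ha => by
    rw [hE, hW a ha, hW _ (hφ.mem_words (o_s ha)), sub_zero]
  have o_K : ∀ k W, Order k W → Order k (K W) := fun k W hW a ha => hW.conj _ (κ_words k a ha)
  have o_EK : ∀ k W, Order k W → Order (k + 1) (E (K W) - K W) := fun k W hW a ha => by
    have h1 := hφ.sub_mapHom_mem_words (hg := c.sgn_i) hf.f_ι (o_s ha)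
    have h2 := o_K k W hW _ h1
    rw [map_sub, hK W (mapHom c.i c.sgn_i (s a)), κ_i, map_zero, sub_zero] at h2
    rw [LinearMap.sub_apply, hE, h2, sub_zero, sub_self]
  have o_D : ∀ k W, Order k W → Order (k + 1) (D W - D₀ W) := fun k W hW => by
    have hβ : Order 2 (conv b (proj Q) (proj Q)) :=
      Order.conv (order_one proj_one) (order_one proj_one)
    have e : D W - D₀ W = conv b W (proj Q) -
        (1 / 2 : ℂ) • (conj W ∘ₗ hat (conv b (proj Q) (proj Q))) := by
      rw [hDef, H.dX_quad, alongD_apply]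
      nth_rewrite 1 [quad_eq]
      simp only [D₀, hat_add, hat_smul, LinearMap.comp_add, LinearMap.comp_smul]
      abel
    rw [e]
    have h2 : Order (k + 1) (conj W ∘ₗ hat (conv b (proj Q) (proj Q))) := fun a ha =>
      hW.conj _ (hat_mem_words_of_order hβ ha)
    refine Order.sub ?_ (h2.smul _)
    have := Order.conv (β := b) hW (order_one (proj_one (Q := Q)))
    rwa [add_comm] at this
  have o_D₀ : ∀ k W, Order k W → Order k (D₀ W) := fun k W hW =>
    (hW.comp_left d).sub fun a ha => hW.conj _ (hat_linear_mem_words ha)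
  have o_D' : ∀ k W, Order k W → Order k (D W) := fun k W hW => by
    have := ((o_D k W hW).mono (Nat.le_succ k)).add (o_D₀ k W hW)
    rwa [sub_add_cancel] at this
  have D₀_K : ∀ W a, D₀ (K W) a + K (D₀ W) a = W a - W (mapHom c.i c.sgn_i (s a)) := fun W a => by
    have h1 : ∀ a, conj (K W) a = - W (κ a) := fun a => by
      rw [conj_apply, hK, κ_sgn, map_neg, map_neg, conj_apply, GSym.sgn_sgn, Q.sgn_sgn]
    have h2 : conj (D₀ W) = - (d ∘ₗ conj W) + W ∘ₗ hat (d ∘ₗ proj Q) := by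
      simp only [D₀, map_sub, H.conj_d, conj_comp_hat (conj_linear hd), conj_conj, pow_one,
        neg_smul, one_smul]
      abel
    have h3 := congrArg W (hκ a)
    rw [map_sub, map_add] at h3
    change _ = W a - W (mapHom c.i c.sgn_i (mapHom c.p c.sgn_p a))
    rw [← h3, hK, h2]
    simp only [D₀, LinearMap.sub_apply, LinearMap.comp_apply, LinearMap.add_apply,
      LinearMap.neg_apply, h1, hK]
    abel
  -- on fields vanishing along the morphism, `E ∘ K` is a homotopy between the identity and `N`, which
  -- raises the order
  let N : VF Q Q →ₗ[ℂ] VF Q Q := E - (D ∘ₗ E ∘ₗ K + E ∘ₗ K ∘ₗ D)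
  have hN : ∀ W, N W = E W - (D (E (K W)) + E (K (D W))) := fun W => rfl
  have o_N : ∀ k W, Order k W → Order (k + 1) (N W) := fun k W hW => by
    have h1 : Order (k + 1) (E W - (D₀ (K W) + K (D₀ W))) := fun a ha => by
      have h1 := hW _ (hφ.sub_mapHom_mem_words (hg := c.sgn_i) hf.f_ι (o_s ha))
      rw [map_sub] at h1
      rw [LinearMap.sub_apply, LinearMap.add_apply, D₀_K, hE, sub_sub_sub_cancel_left, ← neg_sub,
        h1, neg_zero]
    have h2 := o_D' _ _ (o_EK k W hW)
    have h3 := o_D k _ (o_K k W hW)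
    have h4 := o_EK k _ (o_D' k W hW)
    have h5 := o_K _ _ (o_D k W hW)
    have e : N W = (E W - (D₀ (K W) + K (D₀ W))) - (D (E (K W) - K W) + (D (K W) - D₀ (K W)) +
        (E (K (D W)) - K (D W)) + K (D W - D₀ W)) := by
      have e1 : D (E (K W) - K W) = D (E (K W)) - D (K W) := map_sub _ _ _
      have e2 : K (D W - D₀ W) = K (D W) - K (D₀ W) := map_sub _ _ _
      rw [hN, e1, e2]
      abel
    rw [e]
    exact h1.sub (((h2.add h3).add h4).add h5)
  obtain ⟨V, hV, -⟩ := exists_fixedPoint (fun V => W + N V) (by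
    intro k F G hFG
    have := o_N k _ hFG
    rwa [map_sub, ← add_sub_add_left_eq_sub _ _ W] at this)
  have hNφ : N V ∘ₗ φ = 0 := by
    rw [hN, LinearMap.sub_comp, LinearMap.add_comp, E_φ, E_φ, D_φ _ (E_φ _)]
    simp
  have hVφ : V ∘ₗ φ = 0 := by
    rw [← hV, LinearMap.add_comp, hW, hNφ, add_zero]
  have hWV : W = D (E (K V)) + E (K (D V)) := by
    have h := hV
    rw [hN, E_eq V hVφ] at h
    have h2 := eq_sub_of_add_eq h
    rw [h2]
    abel
  have hDV : D V = 0 := by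
    refine eq_zero_of_raising o_N ?_
    have h := hD
    rw [hWV, map_add, D_D, zero_add] at h
    rw [hN, E_eq _ (D_φ _ hVφ), h, D_D]
    simp
  refine ⟨E (K V), ?_, E_φ _⟩
  rw [hWV, hDV]
  simp

omit H in
/-- Pulling back along the morphism is surjective, since its exponential has a retraction. -/
theorem exists_section (Z : VF P Q) : ∃ W : VF Q Q, W ∘ₗ φ = Z := by
  refine ⟨Z ∘ₗ (mapHom c.p c.sgn_p).toLinearMap, ?_⟩
  ext1 a
  simp [hφ.mapHom_comp hf.p_f]

/-- Pulling back vector fields is an isomorphism on cohomology. -/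
theorem exists_pullEquiv : ∃ e : VFH (quad d b H.b_symm) ≃ₗ[ℂ] Homology (alongD d b X' f),
    ∀ W Z, e (VFH.mk _ W) = Homology.mk _ Z ↔ ∃ Y, W.1 ∘ₗ φ - Z.1 = alongD d b X' f Y := by
  have pull := hf.alongD_pull H.b_symm hφ hf.f_one
  have D_D : ∀ W, dX (quad d b H.b_symm) (dX (quad d b H.b_symm) W) = 0 := fun W => by
    rw [H.dX_quad, H.isMC_quad.alongD_alongD H]
  refine Homology.exists_equiv (D := dX (quad d b H.b_symm)) (LinearMap.lcomp ℂ Q φ) pull ?_ ?_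
  · rintro W hW ⟨Z, hZ⟩
    obtain ⟨V, rfl⟩ := hf.exists_section hφ Z
    change W ∘ₗ φ = _ at hZ
    rw [pull] at hZ
    obtain ⟨Y, hY, -⟩ := hf.pull_acyclic hφ H (W := W - dX (quad d b H.b_symm) V)
      (by rw [map_sub, hW, D_D, sub_zero]) (by rw [LinearMap.sub_comp, hZ, sub_self])
    exact ⟨Y + V, by rw [map_add, ← hY, sub_add_cancel]⟩
  · intro Z hZ
    obtain ⟨V, rfl⟩ := hf.exists_section hφ Z
    rw [pull] at hZ
    obtain ⟨Y, hY, hYφ⟩ := hf.pull_acyclic hφ H (D_D V) hZ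
    refine ⟨V - Y, 0, by rw [map_sub, hY, sub_self], ?_⟩
    rw [map_zero, add_zero]
    change _ = (V - Y) ∘ₗ φ
    rw [LinearMap.sub_comp, hYφ, sub_zero]

end IsHomotopyTransfer
end Pull
end ExtDef

/-! ### Transfer of cohomology F-manifold structures -/

namespace ExtDef

universe u

open GSym

section Star
variable {P Q : GradedSpace.{u}} {d : Q →ₗ[ℂ] Q} {b μ : Q →ₗ[ℂ] Q →ₗ[ℂ] Q} {X' : VF P P} {f : VF P Q}
  {D : VF P Q →ₗ[ℂ] VF P Q}

/-- The product `star` on the homology of vector fields along a morphism is the one induced by the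
constant product `μ`. -/
structure IsStar (μ : Q →ₗ[ℂ] Q →ₗ[ℂ] Q) (X' : VF P P) (D : VF P Q →ₗ[ℂ] VF P Q)
    (star : Homology D →ₗ[ℂ] Homology D →ₗ[ℂ] Homology D) : Prop where
  closed : ∀ V W : LinearMap.ker D, D (mulAlong μ V.1 W.1) = 0
  star_mk : ∀ V W U : LinearMap.ker D, U.1 = mulAlong μ V.1 W.1 →
    star (Homology.mk D V) (Homology.mk D W) = Homology.mk D U
  comm : ∀ (p q : ℕ) (V W : LinearMap.ker D), conj V.1 = (-1 : ℂ) ^ p • V.1 →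
    conj W.1 = (-1 : ℂ) ^ q • W.1 → star (Homology.mk D V) (Homology.mk D W) =
      (-1 : ℂ) ^ (p * q) • star (Homology.mk D W) (Homology.mk D V)
  assoc : ∀ a b c, star (star a b) c = star a (star b c)
  fsmul : ∀ g : Fun P, g ∘ₗ hat X' = 0 → ∀ V W U V' U' : LinearMap.ker D,
    V'.1 = mulAlong (LinearMap.lsmul ℂ Q) g V.1 → U'.1 = mulAlong (LinearMap.lsmul ℂ Q) g U.1 →
    star (Homology.mk D V) (Homology.mk D W) = Homology.mk D U →
    star (Homology.mk D V') (Homology.mk D W) = Homology.mk D U'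

theorem IsShiftedGerstenhaber.sgn_μ (H : IsShiftedGerstenhaber d b μ) (x y : Q) :
    Q.sgn (μ x y) = μ (Q.sgn x) (Q.sgn y) := by
  have := GradedSpace.sgn_map₂ H.μ_mem x y
  simpa using this

/-- The product on vector fields along a morphism to a dg Gerstenhaber algebra descends to
homology. -/
theorem IsMC.exists_star (hf : IsMC d b X' f) (H : IsShiftedGerstenhaber d b μ)
    (hD : D = alongD d b X' f) : ∃ star, IsStar μ X' D star := by
  have leibniz : ∀ V W, D (mulAlong μ V W) = mulAlong μ (D V) W + mulAlong μ (conj V) (D W) := by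
    rw [hD]; exact hf.alongD_mul H
  have closed : ∀ V W : LinearMap.ker D, D (mulAlong μ V.1 W.1) = 0 := fun V W => by
    rw [leibniz, LinearMap.mem_ker.1 V.2, LinearMap.mem_ker.1 W.2]
    simp
  obtain ⟨star, hstar⟩ := Homology.exists_mul (D := D) (mulAlong μ) conj conj_conj
    (fun V => by rw [hD, hf.conj_alongD H.toIsShiftedDGLie, neg_neg]) leibniz
  have mk' : ∀ V W : LinearMap.ker D, star (Homology.mk D V) (Homology.mk D W) =
      Homology.mk D ⟨mulAlong μ V.1 W.1, closed V W⟩ := fun V W => hstar V W _ rfl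
  refine ⟨star, closed, hstar, fun p q V W hV hW => ?_, fun a b c => ?_,
    fun g hg V W U V' U' hV' hU' h => ?_⟩
  · rw [mk' V W, mk' W V, ← map_smul]
    congr 1
    ext1
    exact mulAlong_comm H.μ_comm hV hW
  · obtain ⟨V, rfl⟩ := Homology.mk_surjective D a
    obtain ⟨W, rfl⟩ := Homology.mk_surjective D b
    obtain ⟨U, rfl⟩ := Homology.mk_surjective D c
    rw [mk', mk', mk', mk']
    congr 1
    ext1
    exact mulAlong_assoc H.sgn_μ H.μ_assoc _ _ _
  · rw [mk', Homology.mk_eq_mk] at h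
    obtain ⟨Z, hZ⟩ := h
    rw [mk', Homology.mk_eq_mk]
    refine ⟨mulAlong (LinearMap.lsmul ℂ Q) (g ∘ₗ (GSym.sgn P).toLinearMap) Z, ?_⟩
    have hg' : (g ∘ₗ (GSym.sgn P).toLinearMap) ∘ₗ hat X' = 0 := by
      have h1 := hat_comp_tw 1 hf.odd
      rw [tw_one] at h1
      have h2 := congrArg (fun F => g ∘ₗ F) h1
      simp only [← LinearMap.comp_assoc, hg, LinearMap.comp_smul, LinearMap.zero_comp] at h2
      exact (smul_eq_zero.1 h2.symm).resolve_left (pow_ne_zero _ (by simp))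
    have h3 : (g ∘ₗ (GSym.sgn P).toLinearMap) ∘ₗ (GSym.sgn P).toLinearMap = g := by
      ext1 a
      simp [GSym.sgn_sgn]
    have hfs : D (mulAlong (LinearMap.lsmul ℂ Q) (g ∘ₗ (GSym.sgn P).toLinearMap) Z) =
        mulAlong (LinearMap.lsmul ℂ Q) g (D Z) := by
      rw [hD, hf.alongD_fsmul hg' H.toIsShiftedDGLie, h3]
    change mulAlong μ V'.1 W.1 - U'.1 = _
    rw [hV', hU', mulAlong_assoc (β₄ := LinearMap.lsmul ℂ Q) H.sgn_μ (fun c x y => by simp) g V.1 W.1,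
      hfs, ← map_sub]
    exact congrArg _ hZ

end Star

section FManifold
variable {P Q : GradedSpace.{u}} {d : Q →ₗ[ℂ] Q} {b μ : Q →ₗ[ℂ] Q →ₗ[ℂ] Q}

/-- A dg Gerstenhaber algebra is a cohomology F-manifold. -/
theorem IsShiftedGerstenhaber.exists_fManifold (H : IsShiftedGerstenhaber d b μ) :
    ∃ 𝓕 : CohomologyFManifold Q, ∃ _ : 𝓕.X = quad d b H.b_symm,
      IsStar μ 𝓕.X (dX 𝓕.X) 𝓕.star := by
  obtain ⟨star, hs⟩ := H.isMC_quad.exists_star H H.dX_quad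
  refine ⟨⟨quad d b H.b_symm, H.isCohomological_quad, star, ?_, ?_, hs.assoc, hs.fsmul⟩, rfl, hs⟩
  · rintro p q _ _ ⟨V, hV, rfl⟩ ⟨W, hW, rfl⟩
    exact ⟨⟨mulAlong μ V.1 W.1, hs.closed V W⟩, conj_mulAlong H.sgn_μ hV hW, (hs.star_mk V W _ rfl).symm⟩
  · rintro p q _ _ ⟨V, hV, rfl⟩ ⟨W, hW, rfl⟩
    exact hs.comm p q V W hV hW

namespace IsHomotopyTransfer
variable {c : Contraction d P} {X' : VF P P} {f : VF P Q}

/-- The even and odd parts of closed vector fields on the source are closed, because this holds for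
fields along the morphism. -/
theorem dX_conj (hf : IsHomotopyTransfer c b X' f) {φ : GSym P →ₗ[ℂ] GSym Q} (hφ : IsExp f φ)
    (H : IsShiftedDGLie d b) {V : VF P P} (hV : dX X' V = 0) : dX X' (conj V) = 0 := by
  have h : f ∘ₗ hat (dX X' (conj V)) = 0 := by
    rw [← hf.alongD_push H.b_symm hφ hf.f_one, ← hf.conj_push,
      ← neg_neg (alongD d b X' f _), ← hf.conj_alongD H, hf.alongD_push H.b_symm hφ hf.f_one, hV,
      hat_zero]
    simp
  rw [← hf.p_push (dX X' (conj V)), h, LinearMap.comp_zero]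

set_option maxHeartbeats 1000000 in
/-- The cohomology F-manifold structure transfers along a contraction. -/
theorem exists_fManifold (hf : IsHomotopyTransfer c b X' f) (H : IsShiftedGerstenhaber d b μ)
    {F : DGMorphism X' (quad d b H.b_symm)} (hφ : IsExp f F.φ)
    {star : VFH (quad d b H.b_symm) →ₗ[ℂ] VFH (quad d b H.b_symm) →ₗ[ℂ] VFH (quad d b H.b_symm)}
    (hs : IsStar μ (quad d b H.b_symm) (dX (quad d b H.b_symm)) star) :
    ∃ 𝓗 : CohomologyFManifold P, ∃ h : 𝓗.X = X',
      (∃ vf : VFH 𝓗.X ≃ₗ[ℂ] VFH (quad d b H.b_symm),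
        (∀ V W, vf (VFH.mk 𝓗.X V) = VFH.mk _ W ↔ (h ▸ F : DGMorphism 𝓗.X _).Related V.1 W.1) ∧
        ∀ a b, vf (𝓗.star a b) = star (vf a) (vf b)) ∧
      ∀ V W U : LinearMap.ker (dX 𝓗.X), 𝓗.star (VFH.mk 𝓗.X V) (VFH.mk 𝓗.X W) = VFH.mk 𝓗.X U →
        ∃ z, μ (c.i (V.1 1)) (c.i (W.1 1)) - c.i (U.1 1) = d z := by
  have HL := H.toIsShiftedDGLie
  obtain ⟨e, he⟩ := hf.exists_pushEquiv hφ HL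
  obtain ⟨e', he'⟩ := hf.exists_pullEquiv hφ HL
  obtain ⟨sf, hsf⟩ := hf.exists_star H rfl
  have push : ∀ V : LinearMap.ker (dX X'), alongD d b X' f (f ∘ₗ hat V.1) = 0 := fun V => by
    rw [hf.alongD_push HL.b_symm hφ hf.f_one, LinearMap.mem_ker.1 V.2, hat_zero]
    simp
  have he_mk : ∀ V : LinearMap.ker (dX X'), e (VFH.mk X' V) = Homology.mk (alongD d b X' f) ⟨_, push V⟩ := fun V =>
    (he V ⟨_, push V⟩).2 ⟨0, by simp⟩
  have pull : ∀ W : LinearMap.ker (dX (quad d b H.b_symm)), alongD d b X' f (W.1 ∘ₗ F.φ) = 0 := fun W => by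
    rw [hf.alongD_pull HL.b_symm hφ hf.f_one, LinearMap.mem_ker.1 W.2, LinearMap.zero_comp]
  have he'_mk : ∀ W : LinearMap.ker (dX (quad d b H.b_symm)),
      e' (VFH.mk _ W) = Homology.mk (alongD d b X' f) ⟨_, pull W⟩ := fun W => (he' W ⟨_, pull W⟩).2 ⟨0, by simp⟩
  have he'_star : ∀ x y, e' (star x y) = sf (e' x) (e' y) := by
    intro x y
    obtain ⟨V, rfl⟩ := Homology.mk_surjective _ x
    obtain ⟨W, rfl⟩ := Homology.mk_surjective _ y
    rw [hs.star_mk V W ⟨_, hs.closed V W⟩ rfl]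
    refine (he'_mk _).trans (Eq.trans ?_ (congrArg₂ (fun a b => sf a b) (he'_mk V) (he'_mk W)).symm)
    refine (hsf.star_mk _ _ _ ?_).symm
    exact mulAlong_comp (hφ.comul_comp hf.even) (hφ.comp_sgn hf.even) μ V.1 W.1
  -- both the product on `Q` and the new product on `P` correspond to the one along the morphism
  obtain ⟨star', hstar'⟩ : ∃ star' : VFH X' →ₗ[ℂ] VFH X' →ₗ[ℂ] VFH X',
      ∀ a b, star' a b = e.symm (sf (e a) (e b)) :=
    ⟨(sf.compl₁₂ e.toLinearMap e.toLinearMap).compr₂ e.symm.toLinearMap, fun _ _ => rfl⟩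
  have he_star : ∀ x y : VFH X', e (star' x y) = sf (e x) (e y) := fun x y =>
    (congrArg e (hstar' x y)).trans (e.apply_symm_apply _)
  have star'_assoc : ∀ x y z : VFH X', star' (star' x y) z = star' x (star' y z) := fun x y z =>
    e.injective ((he_star _ _).trans (Eq.trans (congrArg (fun w => sf w (e z)) (he_star x y))
      ((hsf.assoc _ _ _).trans (Eq.trans (congrArg (sf (e x)) (he_star y z)).symm
        (he_star _ _).symm))))
  have he_star_mk : ∀ V W : LinearMap.ker (dX X'), e (star' (VFH.mk X' V) (VFH.mk X' W)) =
      sf (Homology.mk (alongD d b X' f) ⟨_, push V⟩) (Homology.mk (alongD d b X' f) ⟨_, push W⟩) :=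
    fun V W => (he_star _ _).trans (congrArg₂ (fun x y => sf x y) (he_mk V) (he_mk W))
  have mk_iff : ∀ V W U : LinearMap.ker (dX X'), star' (VFH.mk X' V) (VFH.mk X' W) = VFH.mk X' U ↔
      ∃ Z, mulAlong μ (f ∘ₗ hat V.1) (f ∘ₗ hat W.1 : VF P Q) - f ∘ₗ hat U.1 = alongD d b X' f Z := fun V W U => by
    rw [hstar', LinearEquiv.symm_apply_eq, he_mk, he_mk, he_mk,
      hsf.star_mk _ _ ⟨_, hsf.closed ⟨_, push V⟩ ⟨_, push W⟩⟩ rfl, Homology.mk_eq_mk]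
  have parity : ∀ {p : ℕ} {V : LinearMap.ker (dX X')}, conj V.1 = (-1 : ℂ) ^ p • V.1 →
      conj (f ∘ₗ hat V.1 : VF P Q) = (-1 : ℂ) ^ p • (f ∘ₗ hat V.1) := fun {p V} hV => by
    have := conj_comp_hat_parity hV hf.even
    rwa [zero_add] at this
  have star'_one : ∀ V W U : LinearMap.ker (dX X'),
      star' (VFH.mk X' V) (VFH.mk X' W) = VFH.mk X' U →
      ∃ z, μ (c.i (V.1 1)) (c.i (W.1 1)) - c.i (U.1 1) = d z := fun V W U h => by
    obtain ⟨Z, hZ⟩ := (mk_iff V W U).1 h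
    -- at the origin all terms of the differential except `d` vanish
    refine ⟨Z 1, ?_⟩
    have h1 := LinearMap.congr_fun hZ 1
    rw [LinearMap.sub_apply, mulAlong_one, alongD_apply] at h1
    simp only [LinearMap.comp_apply, LinearMap.sub_apply, LinearMap.add_apply, conv_one, hat_one,
      hf.f_ι, hf.f_one, hf.X_one, map_zero, add_zero, sub_zero] at h1
    exact h1
  refine ⟨⟨X', hf.isCohomological, star', ?_, ?_, star'_assoc, ?_⟩, rfl,
    ⟨e.trans e'.symm, fun V W => ?_, fun a b => ?_⟩, star'_one⟩
  · rintro p q _ _ ⟨V, hV, rfl⟩ ⟨W, hW, rfl⟩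
    obtain ⟨U, hU⟩ := Homology.mk_surjective _ (star' (VFH.mk X' V) (VFH.mk X' W))
    obtain ⟨Z, hZ⟩ := (mk_iff V W U).1 hU.symm
    -- the part of the representative of parity `p + q` represents the product as well
    have hU' : dX X' ((1 / 2 : ℂ) • (U.1 + (-1 : ℂ) ^ (p + q) • conj U.1)) = 0 := by
      rw [map_smul, map_add, map_smul, hf.dX_conj hφ HL (LinearMap.mem_ker.1 U.2),
        LinearMap.mem_ker.1 U.2]
      simp
    refine ⟨⟨_, hU'⟩, ?_, ?_⟩
    · simp only [map_smul, map_add, conj_conj]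
      rw [smul_comm ((-1 : ℂ) ^ (p + q)), smul_add ((-1 : ℂ) ^ (p + q)), smul_smul,
        neg_one_pow_mul_self, one_smul, smul_add, smul_add, add_comm]
    · refine ((mk_iff V W ⟨_, hU'⟩).2 ⟨(1 / 2 : ℂ) • (Z - (-1 : ℂ) ^ (p + q) • conj Z), ?_⟩).symm
      have hM := conj_mulAlong H.sgn_μ (parity hV) (parity hW)
      set M : VF P Q := mulAlong μ (f ∘ₗ hat V.1) (f ∘ₗ hat W.1 : VF P Q)
      have h1 : f ∘ₗ hat U.1 = M - alongD d b X' f Z := by rw [← hZ, sub_sub_cancel]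
      have h2 : f ∘ₗ hat (conj U.1) = (-1 : ℂ) ^ (p + q) • M + alongD d b X' f (conj Z) := by
        rw [← hf.conj_push, h1, map_sub, hM, hf.conj_alongD HL, sub_neg_eq_add]
      change M - f ∘ₗ hat ((1 / 2 : ℂ) • (U.1 + (-1 : ℂ) ^ (p + q) • conj U.1)) = _
      rw [hat_smul, hat_add, hat_smul, LinearMap.comp_smul, LinearMap.comp_add, LinearMap.comp_smul,
        h1, h2, smul_add ((-1 : ℂ) ^ (p + q)), smul_smul ((-1 : ℂ) ^ (p + q)), neg_one_pow_mul_self,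
        one_smul, map_smul, map_sub, map_smul]
      module
  · rintro p q _ _ ⟨V, hV, rfl⟩ ⟨W, hW, rfl⟩
    have h1 := hsf.comm p q ⟨_, push V⟩ ⟨_, push W⟩ (parity hV) (parity hW)
    have h2 : e (star' (VFH.mk X' V) (VFH.mk X' W)) =
        (-1 : ℂ) ^ (p * q) • e (star' (VFH.mk X' W) (VFH.mk X' V)) := by
      rw [he_star_mk V W, he_star_mk W V]
      exact h1
    exact e.injective (h2.trans (e.map_smul _ _).symm)
  · intro g hg V W U V' U' hV' hU' h
    refine e.injective ((he_star_mk V' W).trans (Eq.trans ?_ (he_mk U').symm))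
    refine hsf.fsmul g hg _ _ _ _ _ ?_ ?_ ((he_star_mk V W).symm.trans
      ((congrArg e h).trans (he_mk U)))
    · change f ∘ₗ hat V'.1 = _
      rw [hV', fsmul_eq, hf.push_fsmul]
    · change f ∘ₗ hat U'.1 = _
      rw [hU', fsmul_eq, hf.push_fsmul]
  · change e'.symm (e (VFH.mk X' V)) = _ ↔ F.Related V.1 W.1
    have h0 : e'.symm (e (VFH.mk X' V)) = VFH.mk _ W ↔
        e (VFH.mk X' V) = Homology.mk (alongD d b X' f) ⟨_, pull W⟩ :=
      (LinearEquiv.symm_apply_eq e').trans (by rw [he'_mk W])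
    refine h0.trans ((he V _).trans ?_)
    have h1 : proj Q ∘ₗ F.φ = f := hφ.proj_comp hf.f_one
    simp only [DGMorphism.Related, h1, quad_comp_hatAlong_sub H.b_symm hφ hf.f_one]
  · change e'.symm (e (star' a b)) = star (e'.symm (e a)) (e'.symm (e b))
    have h2 := he'_star (e'.symm (e a)) (e'.symm (e b))
    rw [e'.apply_symm_apply, e'.apply_symm_apply, ← he_star a b] at h2
    exact e'.injective ((e'.apply_symm_apply _).trans h2.symm)

end IsHomotopyTransfer

/-- The cohomology F-manifold of a dg Gerstenhaber algebra transfers to its cohomology. -/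
theorem IsDGGerstenhaber.exists_transfer {mul br : Q →ₗ[ℂ] Q →ₗ[ℂ] Q}
    (hd : ∀ i, ∀ x ∈ Q.deg i, d x ∈ Q.deg (i + 1))
    (hbr : ∀ (p q : ℕ) (x y : Q), Q.HasParity p x → Q.HasParity q y →
      br (Q.sgn x) y = (-1 : ℂ) ^ (p * q) • br (Q.sgn y) x)
    (hG : IsDGGerstenhaber Q mul d br) :
    ∃ (𝓗 : CohomologyFManifold (Q.cohomology d hd)) (𝓕 : CohomologyFManifold Q),
      IsGerstenhaberFManifold mul d br hbr 𝓕 ∧ IsTransfer mul d hd 𝓕 𝓗 := by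
  have H := hG.isShifted
  obtain ⟨⟨X, hX, star, h1, h2, h3, h4⟩, rfl : X = _, hs⟩ := H.exists_fManifold
  obtain ⟨c, hc⟩ := exists_contraction hd H.d_sq
  obtain ⟨X', f, hf⟩ := exists_homotopyTransfer H.toIsShiftedDGLie c
  obtain ⟨F, hφ, hF, hlin⟩ := hf.exists_morphism H.toIsShiftedDGLie
  obtain ⟨⟨Y, hY, star', g1, g2, g3, g4⟩, rfl : Y = _, ⟨vf, hvf, hvf'⟩, hz⟩ :=
    hf.exists_fManifold H hφ hs
  have p_eq : ∀ a : LinearMap.ker d, c.p a.1 = Q.classOf d hd a := fun a => by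
    rw [← c.p_i (Q.classOf d hd a), hc, map_sub, c.p_d, sub_zero]
  refine ⟨⟨Y, hY, star', g1, g2, g3, g4⟩, ⟨_, hX, star, h1, h2, h3, h4⟩, ⟨rfl, hs.closed, hs.star_mk⟩,
    ⟨hf.X_ι, ⟨⟨F, hF, vf, hvf, hvf'⟩, fun x => ⟨⟨c.i x, c.d_i x⟩, hlin x, ?_⟩⟩, ?_⟩⟩
  · rw [← p_eq, c.p_i]
  · intro V W U h a b' c' ha hb hc'
    obtain ⟨z, hz⟩ := hz V W U h
    have h5 := congrArg c.p hz
    rw [map_sub, c.p_d, c.p_i, sub_eq_zero] at h5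
    rw [← h5, ← p_eq, hc', ha, hb, hc, hc]
    have ha0 : d a.1 = 0 := a.2
    have hb0 : d b'.1 = 0 := b'.2
    have e1 : mul (d (c.h a.1)) b'.1 = d (mul (c.h a.1) b'.1) := by
      rw [H.d_μ, hb0]; simp
    have e2 : mul (a.1 - d (c.h a.1)) (d (c.h b'.1)) =
        d (mul (Q.sgn (a.1 - d (c.h a.1))) (c.h b'.1)) := by
      have : d (Q.sgn (a.1 - d (c.h a.1))) = 0 := by
        rw [← neg_eq_zero, ← Q.sgn_d d hd, map_sub, ha0, H.d_sq]; simp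
      rw [H.d_μ, this, Q.sgn_sgn]; simp
    rw [map_sub (mul _), e2, map_sub mul, LinearMap.sub_apply, e1, map_sub, map_sub, c.p_d, c.p_d]
    simp

end FManifold
end ExtDef

/-! ### Polyvector-valued forms in a chart -/

namespace PolyForm

section Local
variable {R : Type*} [CommRing R] [Algebra ℂ R] {n : ℕ}

theorem sum_sum_eq_zero {ι A : Type*} [Fintype ι] [AddCommGroup A] [Module ℂ A] {f : ι → ι → A}
    (h : ∀ i j, f i j = - f j i) : ∑ i, ∑ j, f i j = 0 := by
  have : ∑ i, ∑ j, f i j = - ∑ i, ∑ j, f i j := by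
    conv_lhs => rw [Finset.sum_comm]
    simp only [← Finset.sum_neg_distrib]
    exact Finset.sum_congr rfl fun i _ => Finset.sum_congr rfl fun j _ => h j i
  have h2 : (2 : ℂ) • ∑ i, ∑ j, f i j = 0 := by
    rw [two_smul]; nth_rewrite 1 [this]; simp
  exact (smul_eq_zero.1 h2).resolve_left two_ne_zero

theorem locTheta_locTheta (i j : Fin n) (a : R ⊗[ℂ] Fib n) :
    locTheta i (locTheta j a) = - locTheta j (locTheta i a) := by
  induction a using TensorProduct.induction_on with
  | zero => simp
  | add x y hx hy => simp only [map_add, hx, hy, neg_add]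
  | tmul f l =>
    simp only [locTheta, LinearMap.lTensor_tmul, ← TensorProduct.tmul_neg]
    exact congrArg _ (CliffordAlgebra.contractLeft_comm _ _ _)

theorem locDer_locTheta (δ : Derivation ℂ R R) (i : Fin n) (a : R ⊗[ℂ] Fib n) :
    locDer δ (locTheta i a) = locTheta i (locDer δ a) := by
  induction a using TensorProduct.induction_on with
  | zero => simp
  | add x y hx hy => simp only [map_add, hx, hy]
  | tmul f l => rfl

theorem locDer_comm {δ δ' : Derivation ℂ R R} (h : ∀ f, δ (δ' f) = δ' (δ f)) (a : R ⊗[ℂ] Fib n) :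
    locDer δ (locDer δ' a) = locDer δ' (locDer δ a) := by
  induction a using TensorProduct.induction_on with
  | zero => simp
  | add x y hx hy => simp only [map_add, hx, hy]
  | tmul f l => exact congrArg (fun g => g ⊗ₜ[ℂ] l) (h f)

theorem locDer_gen_mul (δ : Derivation ℂ R R) (l : Fib n) (a : R ⊗[ℂ] Fib n) :
    locDer δ (((1 : R) ⊗ₜ[ℂ] l) * a) = ((1 : R) ⊗ₜ[ℂ] l) * locDer δ a := by
  rw [locDer_mul, locDer_gen, zero_mul, zero_add]

theorem zeta_mul_zeta (i j : Fin n) (a : R ⊗[ℂ] Fib n) :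
    ((1 : R) ⊗ₜ[ℂ] zeta i) * (((1 : R) ⊗ₜ[ℂ] zeta j) * a) =
      -(((1 : R) ⊗ₜ[ℂ] zeta j) * (((1 : R) ⊗ₜ[ℂ] zeta i) * a)) := by
  rw [← mul_assoc, zeta, zeta, gen_mul_comm, neg_mul, mul_assoc]

theorem locTheta_zeta_mul (i j : Fin n) (a : R ⊗[ℂ] Fib n) :
    locTheta i (((1 : R) ⊗ₜ[ℂ] zeta j) * a) = -(((1 : R) ⊗ₜ[ℂ] zeta j) * locTheta i a) := by
  rw [zeta, locTheta_gen_mul]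
  simp

/-- The operator `∑ ∂/∂θ_i δ_i` on polyvector fields (the divergence with respect to the constant
volume form); it is of second order and generates the Schouten bracket. -/
noncomputable def bv (δ : Fin n → Derivation ℂ R R) : R ⊗[ℂ] Fib n →ₗ[ℂ] R ⊗[ℂ] Fib n :=
  ∑ i, locTheta i ∘ₗ locDer (δ i)

variable (δ : Fin n → Derivation ℂ R R)

theorem bv_apply (a : R ⊗[ℂ] Fib n) : bv δ a = ∑ i, locTheta i (locDer (δ i) a) := by
  simp [bv]

theorem bv_bv (hδ : ∀ i j f, δ i (δ j f) = δ j (δ i f)) (a : R ⊗[ℂ] Fib n) :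
    bv δ (bv δ a) = 0 := by
  simp only [bv_apply, map_sum]
  refine sum_sum_eq_zero fun i j => ?_
  rw [locDer_locTheta, locDer_locTheta, locTheta_locTheta, locDer_comm (hδ i j)]

theorem bv_locSgn (a : R ⊗[ℂ] Fib n) : bv δ (locSgn a) = - locSgn (bv δ a) := by
  simp only [bv_apply, locDer_locSgn, locTheta_locSgn, map_sum, Finset.sum_neg_distrib]

/-- The Schouten bracket measures the failure of `bv` to be a derivation. -/
theorem locBracket_locSgn (x y : R ⊗[ℂ] Fib n) : locBracket δ (locSgn x) y =
    bv δ x * y + locSgn x * bv δ y - bv δ (x * y) := by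
  simp only [bv_apply, locBracket_apply, Finset.sum_mul, Finset.mul_sum, ← Finset.sum_add_distrib,
    ← Finset.sum_sub_distrib]
  refine Finset.sum_congr rfl fun i _ => ?_
  rw [locDer_mul, map_add, locTheta_mul, locTheta_mul, locTheta_locSgn, locDer_locSgn, map_neg,
    locSgn_locSgn]
  noncomm_ring

theorem locSgn_locBracket (x y : R ⊗[ℂ] Fib n) :
    locSgn (locBracket δ x y) = - locBracket δ (locSgn x) (locSgn y) := by
  simp only [locBracket_apply, map_sum, ← Finset.sum_neg_distrib]
  refine Finset.sum_congr rfl fun i _ => ?_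
  simp only [map_sub, map_mul, locTheta_locSgn, locDer_locSgn, map_neg]
  noncomm_ring

/-- The operator `bv` is a derivation of the bracket it generates, as it squares to zero. -/
theorem bv_locBracket (hδ : ∀ i j f, δ i (δ j f) = δ j (δ i f)) (x y : R ⊗[ℂ] Fib n) :
    bv δ (locBracket δ x y) = locBracket δ (bv δ x) y - locBracket δ (locSgn x) (bv δ y) := by
  have h : ∀ x y, locBracket δ x y =
      - locSgn (bv δ x) * y + x * bv δ y - bv δ (locSgn x * y) := fun x y => by
    conv_lhs => rw [← locSgn_locSgn x, locBracket_locSgn, bv_locSgn, locSgn_locSgn]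
  rw [h x, h (bv δ x), h (locSgn x)]
  simp only [map_sub, map_add, neg_mul, map_neg, bv_bv δ hδ, bv_locSgn, locSgn_locSgn, map_zero]
  noncomm_ring

/-- The Schouten bracket is a derivation of the wedge product. -/
theorem locBracket_mul (p q : ℕ) (x y z : R ⊗[ℂ] Fib n) (hx : locSgn x = (-1 : ℂ) ^ p • x)
    (hy : locSgn y = (-1 : ℂ) ^ q • y) : locBracket δ x (y * z) =
      locBracket δ x y * z + (-1 : ℂ) ^ ((p + 1) * q) • (y * locBracket δ x z) := by
  simp only [locBracket_apply, Finset.sum_mul, Finset.mul_sum, Finset.smul_sum,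
    ← Finset.sum_add_distrib]
  refine Finset.sum_congr rfl fun i _ => ?_
  have h1 : locSgn (locTheta i x) = (-1 : ℂ) ^ (p + 1) • locTheta i x := by
    have := locTheta_locSgn i x
    rw [hx, map_smul] at this
    rw [pow_succ, mul_neg_one, neg_smul, this, neg_neg]
  have h2 : locSgn (locDer (δ i) x) = (-1 : ℂ) ^ p • locDer (δ i) x := by
    rw [← locDer_locSgn, hx, map_smul]
  have h3 : locTheta i x * y = (-1 : ℂ) ^ ((p + 1) * q) • (y * locTheta i x) :=
    loc_mul_comm _ _ _ _ h1 hy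
  have h4 : locDer (δ i) x * locSgn y = (-1 : ℂ) ^ ((p + 1) * q) • (y * locDer (δ i) x) := by
    rw [hy, mul_smul_comm, loc_mul_comm _ _ _ _ h2 hy, smul_smul]
    congr 1
    ring
  have h5 : locDer (δ i) x * (locSgn y * locTheta i z) =
      (-1 : ℂ) ^ ((p + 1) * q) • (y * (locDer (δ i) x * locTheta i z)) := by
    rw [← mul_assoc, h4, smul_mul_assoc, mul_assoc]
  have h6 : locSgn (locTheta i x) * (y * locDer (δ i) z) =
      (-1 : ℂ) ^ ((p + 1) * q) • (y * (locSgn (locTheta i x) * locDer (δ i) z)) := by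
    rw [h1, ← mul_assoc, smul_mul_assoc, h3]
    simp only [smul_mul_assoc, mul_smul_comm, smul_smul, mul_assoc, mul_comm]
  rw [locDer_mul, locTheta_mul, mul_add, mul_add, h5, h6, mul_sub, smul_sub, sub_mul, mul_assoc,
    mul_assoc]
  abel

/-- The Jacobi identity, a consequence of the fact that `bv` generates the bracket, is a derivation
of it, and that the bracket is a derivation of the product. -/
theorem locBracket_jacobi (hδ : ∀ i j f, δ i (δ j f) = δ j (δ i f)) (p q : ℕ)
    (x y z : R ⊗[ℂ] Fib n) (hx : locSgn x = (-1 : ℂ) ^ p • x) (hy : locSgn y = (-1 : ℂ) ^ q • y) :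
    locBracket δ x (locBracket δ y z) = locBracket δ (locBracket δ x y) z +
      (-1 : ℂ) ^ ((p + 1) * (q + 1)) • locBracket δ y (locBracket δ x z) := by
  have hbx : locSgn (bv δ x) = (-1 : ℂ) ^ (p + 1) • bv δ x := by
    rw [← neg_neg (locSgn _), ← bv_locSgn, hx, map_smul, pow_succ, mul_neg_one, neg_smul]
  have hby : locSgn (bv δ y) = (-1 : ℂ) ^ (q + 1) • bv δ y := by
    rw [← neg_neg (locSgn _), ← bv_locSgn, hy, map_smul, pow_succ, mul_neg_one, neg_smul]
  have hxy : locSgn (locBracket δ x y) = (-1 : ℂ) ^ (p + q + 1) • locBracket δ x y := by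
    rw [locSgn_locBracket, hx, hy]
    simp only [map_smul, LinearMap.smul_apply, smul_smul, pow_add, pow_one]
    rw [mul_comm, mul_neg_one, neg_smul]
  -- the bracket in terms of `bv`, when the first argument has parity `r`
  have h : ∀ (r : ℕ) (u w : R ⊗[ℂ] Fib n), locSgn u = (-1 : ℂ) ^ r • u → locBracket δ u w =
      (-1 : ℂ) ^ r • (bv δ u * w) + u * bv δ w - (-1 : ℂ) ^ r • bv δ (u * w) := by
    intro r u w hu
    have := locBracket_locSgn δ u w
    rw [hu] at this
    have h2 := congrArg (fun v => (-1 : ℂ) ^ r • v) this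
    simp only [map_smul, LinearMap.smul_apply, smul_smul, smul_sub, smul_add, smul_mul_assoc,
      ExtDef.neg_one_pow_mul_self, one_smul] at h2
    exact h2
  have hbv : ∀ w, locBracket δ x (bv δ w) =
      (-1 : ℂ) ^ p • (locBracket δ (bv δ x) w - bv δ (locBracket δ x w)) := by
    intro w
    rw [bv_locBracket δ hδ, hx, map_smul, LinearMap.smul_apply, sub_sub_cancel, smul_smul,
      ExtDef.neg_one_pow_mul_self, one_smul]
  rw [h q y z hy, h _ (locBracket δ x y) z hxy, h q y (locBracket δ x z) hy]
  simp only [map_add, map_sub, map_smul]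
  rw [locBracket_mul δ p (q + 1) x (bv δ y) z hx hby, locBracket_mul δ p q x y (bv δ z) hx hy,
    hbv (y * z), locBracket_mul δ p q x y z hx hy, locBracket_mul δ (p + 1) q _ y z hbx hy,
    hbv y, hbv z]
  simp only [map_add, map_smul, mul_sub, sub_mul, smul_mul_assoc, mul_smul_comm]
  rcases Nat.even_or_odd p with hp | hp <;> rcases Nat.even_or_odd q with hq | hq <;>
    simp [hp.neg_one_pow, hq.neg_one_pow, pow_mul, pow_succ, pow_add, mul_add] <;> abel

section Dbar
variable (δ' : Fin n → Derivation ℂ R R)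

theorem locDbar_mul (x y : R ⊗[ℂ] Fib n) :
    locDbar δ' (x * y) = locDbar δ' x * y + locSgn x * locDbar δ' y := by
  simp only [locDbar_apply, Finset.sum_mul, Finset.mul_sum, ← Finset.sum_add_distrib]
  refine Finset.sum_congr rfl fun i _ => ?_
  rw [locDer_mul, mul_add, zeta, ← mul_assoc, ← mul_assoc, gen_mul _ x, mul_assoc (locSgn x)]

theorem locDbar_locDbar (hδ : ∀ i j f, δ' i (δ' j f) = δ' j (δ' i f)) (x : R ⊗[ℂ] Fib n) :
    locDbar δ' (locDbar δ' x) = 0 := by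
  simp only [locDbar_apply, map_sum]
  refine sum_sum_eq_zero fun i j => ?_
  rw [locDer_gen_mul, locDer_gen_mul, zeta_mul_zeta, locDer_comm (hδ i j)]

theorem locDbar_locSgn (x : R ⊗[ℂ] Fib n) :
    locDbar δ' (locSgn x) = - locSgn (locDbar δ' x) := by
  simp only [locDbar_apply, map_sum, ← Finset.sum_neg_distrib]
  refine Finset.sum_congr rfl fun i _ => ?_
  rw [map_mul, zeta, locSgn_gen, locDer_locSgn, neg_mul, neg_neg]

theorem locDbar_bv (h : ∀ i j f, δ i (δ' j f) = δ' j (δ i f)) (x : R ⊗[ℂ] Fib n) :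
    locDbar δ' (bv δ x) = - bv δ (locDbar δ' x) := by
  simp only [locDbar_apply, bv_apply, map_sum, ← Finset.sum_neg_distrib]
  rw [Finset.sum_comm]
  refine Finset.sum_congr rfl fun i _ => Finset.sum_congr rfl fun j _ => ?_
  rw [locDer_gen_mul, locTheta_zeta_mul, neg_neg, locDer_locTheta, locDer_comm (h j i)]

/-- The operator `∂̄` is a derivation of the bracket, as it is a derivation of the product and
anticommutes with `bv`. -/
theorem locDbar_locBracket (h : ∀ i j f, δ i (δ' j f) = δ' j (δ i f)) (x y : R ⊗[ℂ] Fib n) :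
    locDbar δ' (locBracket δ x y) =
      locBracket δ (locDbar δ' x) y - locBracket δ (locSgn x) (locDbar δ' y) := by
  have h' : ∀ x y, locBracket δ x y =
      - locSgn (bv δ x) * y + x * bv δ y - bv δ (locSgn x * y) := fun x y => by
    conv_lhs => rw [← locSgn_locSgn x, locBracket_locSgn, bv_locSgn, locSgn_locSgn]
  rw [h' x, h' (locDbar δ' x), h' (locSgn x)]
  simp only [map_sub, map_add, neg_mul, map_neg, locDbar_mul, locDbar_bv δ δ' h, locDbar_locSgn,
    bv_locSgn, locSgn_locSgn, mul_neg]
  noncomm_ring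

end Dbar

theorem locProj_mul (p k : ℕ) (x y : R ⊗[ℂ] Fib n) :
    locProj (p + k) (locProj p x * y) = locProj p x * locProj k y := by
  induction x using loc_induction generalizing p with
  | coef f =>
    rw [locProj_coef]
    split_ifs with hp
    · subst hp
      rw [zero_add]
      induction y using TensorProduct.induction_on with
      | zero => simp
      | add x y hx hy => simp only [map_add, mul_add, hx, hy]
      | tmul g l => simp [locProj]
    · simp
  | mul v a h =>
    cases p with
    | zero => simp [locProj_zero (gen_mem v)]
    | succ p =>
      rw [locProj_succ p (gen_mem v), mul_assoc, mul_assoc, add_right_comm,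
        locProj_succ _ (gen_mem v), h]
  | add x y hx hy => simp only [map_add, add_mul, hx, hy]

theorem locTheta_locProj_zero (i : Fin n) (a : R ⊗[ℂ] Fib n) : locTheta i (locProj 0 a) = 0 := by
  induction a using loc_induction with
  | coef f => rw [locProj_coef, if_pos rfl, locTheta_coef]
  | mul v a h => rw [locProj_zero (gen_mem v), map_zero]
  | add x y hx hy => simp only [map_add, hx, hy, add_zero]

theorem locTheta_locProj_succ (i : Fin n) (k : ℕ) (a : R ⊗[ℂ] Fib n) :
    locTheta i (locProj (k + 1) a) = locProj k (locTheta i a) := by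
  induction a using loc_induction generalizing k with
  | coef f => rw [locProj_coef, if_neg (Nat.succ_ne_zero k), locTheta_coef, map_zero, map_zero]
  | mul v a h =>
    rw [locProj_succ k (gen_mem v), locTheta_gen_mul, locTheta_gen_mul, map_sub, map_smul]
    cases k with
    | zero => rw [locProj_zero (gen_mem v), locTheta_locProj_zero, mul_zero]
    | succ k => rw [locProj_succ k (gen_mem v), h]
  | add x y hx hy => simp only [map_add, hx, hy]

theorem locProj_locSgn (k : ℕ) (a : R ⊗[ℂ] Fib n) : locProj k (locSgn a) = locSgn (locProj k a) := by
  induction a using loc_induction generalizing k with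
  | coef f => rw [locSgn_coef, locProj_coef]; split_ifs <;> simp [locSgn_coef]
  | mul v a h =>
    rw [map_mul, locSgn_gen, neg_mul, map_neg]
    cases k with
    | zero => simp [locProj_zero (gen_mem v)]
    | succ k => rw [locProj_succ k (gen_mem v), locProj_succ k (gen_mem v), h, map_mul, locSgn_gen,
        neg_mul]
  | add x y hx hy => simp only [map_add, hx, hy]

theorem locProj_mul_of_eq {p q : ℕ} {x y : R ⊗[ℂ] Fib n} (hx : locProj p x = x)
    (hy : locProj q y = y) : locProj (p + q) (x * y) = x * y := by
  have := locProj_mul p q x y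
  rwa [hx, hy] at this

theorem locProj_locTheta_of_eq {k : ℕ} {x : R ⊗[ℂ] Fib n} (i : Fin n)
    (hx : locProj (k + 1) x = x) : locProj k (locTheta i x) = locTheta i x := by
  rw [← locTheta_locProj_succ, hx]

theorem locTheta_of_locProj_zero {x : R ⊗[ℂ] Fib n} (i : Fin n) (hx : locProj 0 x = x) :
    locTheta i x = 0 := by
  rw [← hx, locTheta_locProj_zero]

theorem locBracket_of_locProj_zero {x y : R ⊗[ℂ] Fib n} (hx : locProj 0 x = x)
    (hy : locProj 0 y = y) : locBracket δ x y = 0 := by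
  simp [locBracket_apply, locTheta_of_locProj_zero _ hx, locTheta_of_locProj_zero _ hy]

theorem locProj_locBracket {p q k : ℕ} {x y : R ⊗[ℂ] Fib n} (hx : locProj p x = x)
    (hy : locProj q y = y) (h : p + q = k + 1) :
    locProj k (locBracket δ x y) = locBracket δ x y := by
  have hD : ∀ {r : ℕ} {w : R ⊗[ℂ] Fib n} (i), locProj r w = w →
      locProj r (locDer (δ i) w) = locDer (δ i) w := fun i hw => by rw [← locDer_locProj, hw]
  rw [locBracket_apply, map_sum]
  refine Finset.sum_congr rfl fun i _ => ?_
  rw [map_sub]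
  congr 1
  · cases p with
    | zero => simp [locTheta_of_locProj_zero i hx]
    | succ p =>
      obtain rfl : k = p + q := by omega
      exact locProj_mul_of_eq (by rw [locProj_locSgn, locProj_locTheta_of_eq i hx]) (hD i hy)
  · cases q with
    | zero => simp [locTheta_of_locProj_zero i hy]
    | succ q =>
      obtain rfl : k = p + q := by omega
      exact locProj_mul_of_eq (hD i hx) (locProj_locTheta_of_eq i hy)

end Local
end PolyForm

/-! ### Polyvector-valued forms on a complex manifold -/

namespace PolyForm
open ExtDef

section Global
variable {n : ℕ} {M : Type*} [TopologicalSpace M] [ChartedSpace (Fin n → ℂ) M]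
  [IsManifold 𝓘(ℂ, Fin n → ℂ) ω M]

theorem at_dbar (e : atlas (Fin n → ℂ) M) (x : Forms n M) :
    at_ e (dbar n M x) = locDbar (dzbar e (dom_subset e)) (at_ e x) := rfl

theorem at_sgn (e : atlas (Fin n → ℂ) M) (x : Forms n M) : at_ e (sgn n M x) = locSgn (at_ e x) := rfl

theorem at_schouten (e : atlas (Fin n → ℂ) M) (x y : Forms n M) :
    at_ e (schouten n M x y) = locBracket (dz e (dom_subset e)) (at_ e x) (at_ e y) := rfl

/-- Forms of degree `i` are those whose local representations have total degree `i + 2`. -/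
theorem mem_formsGraded_deg {i : ℤ} {x : formsGraded n M} : x ∈ (formsGraded n M).deg i ↔
    x = 0 ∨ ∃ k : ℕ, i + 2 = k ∧ ∀ e, locProj k (at_ e x) = at_ e x := by
  change shiftProj n M i x = x ↔ _
  by_cases h : 0 ≤ i + 2
  · obtain ⟨k, hk⟩ : ∃ k : ℕ, i + 2 = k := ⟨(i + 2).toNat, by omega⟩
    have e2 : (i + 2).toNat = k := by omega
    rw [shiftProj, if_pos h, e2]
    constructor
    · exact fun hx => Or.inr ⟨k, hk, fun e => congrArg (at_ e) hx⟩
    · rintro (rfl | ⟨l, hl, hx⟩)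
      · exact map_zero _
      · obtain rfl : k = l := by omega
        exact Forms.ext hx
  · rw [shiftProj, if_neg h]
    constructor
    · exact fun hx => Or.inl hx.symm
    · rintro (rfl | ⟨l, hl, hx⟩)
      · rfl
      · omega

theorem neg_one_zpow_congr {a b : ℤ} (h : Even (a - b)) : (-1 : ℂ) ^ a = (-1 : ℂ) ^ b := by
  rw [← sub_add_cancel a b, zpow_add₀ (by simp), h.neg_one_zpow, one_mul]

theorem exists_parity {i : ℤ} {x : Forms n M} (hx : x ∈ (formsGraded n M).deg i) :
    ∃ p : ℕ, Even (i - p) ∧ ∀ e, locSgn (at_ e x) = (-1 : ℂ) ^ p • at_ e x := by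
  obtain ⟨p, hp⟩ : ∃ p : ℕ, Even (i - p) := by
    rcases Int.even_or_odd i with h | h
    · exact ⟨0, by simpa using h⟩
    · exact ⟨1, by simpa using h.sub_odd odd_one⟩
  refine ⟨p, hp, fun e => ?_⟩
  rw [← at_sgn, ← map_smul, ← zpow_natCast, ← neg_one_zpow_congr hp]
  exact congrArg (at_ e) ((formsGraded n M).sgn_apply _ _ hx)

theorem exists_sgn {i : ℤ} {x : Forms n M} (hx : x ∈ (formsGraded n M).deg i) (e) :
    locSgn (at_ e x) = (-1 : ℂ) ^ i • at_ e x := by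
  rw [← at_sgn, ← map_smul]
  exact congrArg (at_ e) ((formsGraded n M).sgn_apply _ _ hx)

variable (n M) in
/-- The polyvector-valued forms of a complex manifold are a dg Gerstenhaber algebra. -/
theorem isDGGerstenhaber_forms :
    IsDGGerstenhaber (formsGraded n M) (wedge n M) (del n M) (brk n M) where
  mul_mem i j x hx y hy := by
    rcases mem_formsGraded_deg.1 hx with rfl | ⟨p, hp, hx⟩
    · rw [map_zero, LinearMap.zero_apply]
      exact Submodule.zero_mem _
    rcases mem_formsGraded_deg.1 hy with rfl | ⟨q, hq, hy⟩
    · rw [map_zero]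
      exact Submodule.zero_mem _
    refine mem_formsGraded_deg.2 (Or.inr ⟨p + q, by push_cast; omega, fun e => ?_⟩)
    exact locProj_mul_of_eq (hx e) (hy e)
  mul_comm i j x hx y hy := by
    obtain ⟨p, hp, hx⟩ := exists_parity hx
    obtain ⟨q, hq, hy⟩ := exists_parity hy
    have hs : (-1 : ℂ) ^ (i * j) = (-1 : ℂ) ^ (p * q) := by
      rw [← zpow_natCast, Nat.cast_mul]
      refine neg_one_zpow_congr ?_
      rw [show i * j - (p : ℤ) * q = (i - p) * j + p * (j - q) by ring]
      exact (hp.mul_right _).add (hq.mul_left _)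
    rw [hs]
    exact Forms.ext fun e => loc_mul_comm _ _ p q (hx e) (hy e)
  mul_assoc x y z := mul_assoc (G := Forms n M) x y z
  d_mem := del_degree n M
  d_sq x := Forms.ext fun e => locDbar_locDbar _ (dzbar_dzbar e _) _
  d_mul i x hx y := by
    refine Forms.ext fun e => ?_
    have h := locDbar_mul (dzbar e (dom_subset e)) (at_ e x) (at_ e y)
    rw [exists_sgn hx e, smul_mul_assoc] at h
    exact h
  br_mem i j x hx y hy := by
    rcases mem_formsGraded_deg.1 hx with rfl | ⟨p, hp, hx⟩
    · rw [map_zero, LinearMap.zero_apply]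
      exact Submodule.zero_mem _
    rcases mem_formsGraded_deg.1 hy with rfl | ⟨q, hq, hy⟩
    · rw [map_zero]
      exact Submodule.zero_mem _
    refine mem_formsGraded_deg.2 ?_
    cases h : p + q with
    | zero =>
      obtain ⟨rfl, rfl⟩ : p = 0 ∧ q = 0 := by omega
      exact Or.inl (Forms.ext fun e => locBracket_of_locProj_zero _ (hx e) (hy e))
    | succ k => exact Or.inr ⟨k, by omega, fun e => locProj_locBracket _ (hx e) (hy e) h⟩
  br_symm i j x hx y hy := by
    obtain ⟨p, hp, hx⟩ := exists_parity hx
    obtain ⟨q, hq, hy⟩ := exists_parity hy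
    have hs : (-1 : ℂ) ^ ((i - 1) * (j - 1)) = (-1 : ℂ) ^ ((p + 1) * (q + 1)) := by
      rw [← zpow_natCast]
      refine neg_one_zpow_congr ?_
      push_cast
      rw [show (i - 1) * (j - 1) - ((p : ℤ) + 1) * (q + 1) =
        (i - p) * (j - 1) + (p + 1) * (j - q) - 2 * (j - 1) - 2 * (p + 1) by ring]
      exact (((hp.mul_right _).add (hq.mul_left _)).sub (even_two_mul _)).sub (even_two_mul _)
    rw [hs]
    refine Forms.ext fun e => ?_
    have h := locBracket_symm (dz e (dom_subset e)) p q _ _ (hx e) (hy e)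
    rw [hx, hy, map_smul, map_smul, LinearMap.smul_apply, LinearMap.smul_apply] at h
    have h2 := congrArg (fun v => (-1 : ℂ) ^ p • v) h
    simp only [smul_smul, neg_one_pow_mul_self, one_smul] at h2
    have h3 : (-1 : ℂ) ^ p * ((-1 : ℂ) ^ (p * q) * (-1 : ℂ) ^ q) = -(-1 : ℂ) ^ ((p + 1) * (q + 1)) := by
      ring
    rw [h3, neg_smul] at h2
    exact h2
  jacobi i j x hx y hy z := by
    obtain ⟨p, hp, hx⟩ := exists_parity hx
    obtain ⟨q, hq, hy⟩ := exists_parity hy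
    have hs : (-1 : ℂ) ^ ((i - 1) * (j - 1)) = (-1 : ℂ) ^ ((p + 1) * (q + 1)) := by
      rw [← zpow_natCast]
      refine neg_one_zpow_congr ?_
      push_cast
      rw [show (i - 1) * (j - 1) - ((p : ℤ) + 1) * (q + 1) =
        (i - p) * (j - 1) + (p + 1) * (j - q) - 2 * (j - 1) - 2 * (p + 1) by ring]
      exact (((hp.mul_right _).add (hq.mul_left _)).sub (even_two_mul _)).sub (even_two_mul _)
    rw [hs]
    exact Forms.ext fun e => locBracket_jacobi _ (dz_dz e _) p q _ _ _ (hx e) (hy e)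
  d_br i x hx y := by
    refine Forms.ext fun e => ?_
    have h := locDbar_locBracket _ _ (dz_dzbar e (dom_subset e)) (at_ e x) (at_ e y)
    have hs : -(-1 : ℂ) ^ i = (-1 : ℂ) ^ (i - 1) := by
      rw [zpow_sub₀ (by simp), zpow_one, div_neg, div_one]
    rw [exists_sgn hx e, map_smul, LinearMap.smul_apply, sub_eq_add_neg, ← neg_smul, hs] at h
    exact h
  br_mul i j x hx y hy z := by
    obtain ⟨p, hp, hx⟩ := exists_parity hx
    obtain ⟨q, hq, hy⟩ := exists_parity hy
    have hs : (-1 : ℂ) ^ ((i - 1) * j) = (-1 : ℂ) ^ ((p + 1) * q) := by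
      rw [← zpow_natCast]
      refine neg_one_zpow_congr ?_
      push_cast
      rw [show (i - 1) * j - ((p : ℤ) + 1) * q = (i - p) * j + (p + 1) * (j - q) - 2 * j by ring]
      exact ((hp.mul_right _).add (hq.mul_left _)).sub (even_two_mul _)
    rw [hs]
    exact Forms.ext fun e => locBracket_mul _ p q _ _ _ (hx e) (hy e)

variable (n M) in
/-- The extended deformation theory of a complex manifold exists. -/
theorem exists_deformationFManifold :
    ∃ 𝓗 : CohomologyFManifold (dolbeault n M), IsDeformationFManifold n M 𝓗 := by
  obtain ⟨𝓗, 𝓕, h⟩ := (isDGGerstenhaber_forms n M).exists_transfer (del_degree n M) (brk_symm n M)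
  exact ⟨𝓗, 𝓕, h⟩

end Global
end PolyForm

/-! ### Smoothness and the bracket on cohomology -/

namespace ExtDef

universe u

open GSym

namespace GSym
variable {Q : GradedSpace.{u}}

/-- The Euler vector field multiplies words of length `k` by `k`. -/
theorem hat_proj_sub_mem_words {k : ℕ} {a : GSym Q} (ha : a ∈ words Q (k + 1)) :
    hat (proj Q) a - (k : ℂ) • a ∈ words Q k := by
  induction k generalizing a with
  | zero =>
    suffices h : words Q 1 ≤ LinearMap.ker (hat (proj Q)) by
      rw [Nat.cast_zero, zero_smul, sub_zero, LinearMap.mem_ker.1 (h ha)]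
      exact Submodule.zero_mem _
    refine words_induction ?_ fun p x a _ ha => ?_
    · rw [LinearMap.mem_ker, hat_one, proj_one, map_zero]
    · rw [mem_words_zero.1 ha, mul_zero]
      exact Submodule.zero_mem _
  | succ k ih =>
    suffices h : words Q (k + 1 + 1) ≤ (words Q (k + 1)).comap
        ((hat (proj Q) : GSym Q →ₗ[ℂ] GSym Q) - ((k + 1 : ℕ) : ℂ) • LinearMap.id) from h ha
    refine words_induction ?_ fun p x a hx ha => ?_
    · rw [Submodule.mem_comap, LinearMap.sub_apply, hat_one, proj_one, map_zero, zero_sub]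
      exact Submodule.neg_mem _ (Submodule.smul_mem _ _ (one_mem_words k))
    · have h1 : hat (proj Q ∘ₗ lm x) a = ι Q x * a := by
        rw [proj_comp_lm]
        refine (LinearMap.congr_fun (conv_congr fun _ _ _ _ _ _ => ?_) a).trans
          (LinearMap.congr_fun (conv_counit_left (LinearMap.mulLeft ℂ (ι Q x))
          (β := LinearMap.mul ℂ (GSym Q) ∘ₗ ι Q ∘ₗ (LinearMap.lsmul ℂ Q).flip x) (by simp)
          LinearMap.id) a)
        rfl
      have h2 : hat (proj Q) (ι Q x * a) = ι Q x * a + ι Q x * hat (proj Q) a := by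
        rw [hat_ι_mul (v := 0) (by simpa using conj_proj) hx, h1]
        simp
      have h3 : ((hat (proj Q) - ((k + 1 : ℕ) : ℂ) • LinearMap.id : GSym Q →ₗ[ℂ] GSym Q)) (ι Q x * a) =
          ι Q x * (hat (proj Q) a - (k : ℂ) • a) := by
        rw [LinearMap.sub_apply, h2, mul_sub, mul_smul_comm]
        simp only [LinearMap.smul_apply, LinearMap.id_apply]
        push_cast
        module
      rw [Submodule.mem_comap, h3]
      exact ι_mul_mem_words (ih ha) x

/-- The Euler vector field is injective on the augmentation ideal. -/
theorem eq_zero_of_hat_proj {a : GSym Q} (h0 : counit Q a = 0) (h : hat (proj Q) a = 0) : a = 0 := by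
  obtain ⟨k, hk⟩ := exists_mem_words a
  induction k with
  | zero => exact mem_words_zero.1 hk
  | succ k ih =>
    rcases Nat.eq_zero_or_pos k with rfl | hk0
    · have h1 : words Q 1 ≤ LinearMap.eqLocus LinearMap.id
          ((counit Q).toLinearMap.smulRight (1 : GSym Q)) := by
        refine words_induction (by simp) fun p x a _ ha => ?_
        rw [mem_words_zero.1 ha, mul_zero]
        exact Submodule.zero_mem _
      have h2 : a = counit Q a • 1 := h1 hk
      rw [h2, h0, zero_smul]
    · have h1 := hat_proj_sub_mem_words hk
      rw [h, zero_sub, Submodule.neg_mem_iff] at h1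
      exact ih ((Submodule.smul_mem_iff _ (Nat.cast_ne_zero.2 hk0.ne')).1 h1)

section
variable {A B C : Type*} [AddCommGroup A] [Module ℂ A] [AddCommGroup B] [Module ℂ B]
  [AddCommGroup C] [Module ℂ C] (β : A →ₗ[ℂ] B →ₗ[ℂ] C)

theorem conv_ι (F : GSym Q →ₗ[ℂ] A) (G : GSym Q →ₗ[ℂ] B) {p : ℕ} {x : Q}
    (hx : Q.HasParity p x) : conv β F G (ι Q x) = β (F (ι Q x)) (G 1) + β (F 1) (G (ι Q x)) := by
  rw [← mul_one (ι Q x), conv_ι_mul β F G hx, conv_one, conv_one]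
  simp [tw_map_one]

theorem conv_ι_mul_ι (F : GSym Q →ₗ[ℂ] A) (G : GSym Q →ₗ[ℂ] B) {p q : ℕ} {x y : Q}
    (hx : Q.HasParity p x) (hy : Q.HasParity q y) (hF : F 1 = 0) (hG : G 1 = 0) :
    conv β F G (ι Q x * ι Q y) = β (F (ι Q x)) (G (ι Q y)) +
      (-1 : ℂ) ^ (p * q) • β (F (ι Q y)) (G (ι Q x)) := by
  rw [conv_ι_mul β F G hx, conv_ι β _ _ hy, conv_ι β _ _ hy]
  simp [tw_map_one, hF, hG, tw_parity (hasParity_ι hy)]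

end
end GSym

namespace DGMorphism
variable {P Q : GradedSpace.{u}} {X : VF P P} {Y : VF Q Q} (F : DGMorphism X Y)

theorem counit_apply (a : GSym P) : GSym.counit Q (F.φ a) = GSym.counit P a :=
  LinearMap.congr_fun F.counit a

/-- Morphisms map generators to generators, because they preserve primitive elements. -/
theorem φ_ι (x : P) : F.φ (ι P x) = ι Q (F.linearPart x) := by
  suffices h : ∀ p x, P.HasParity p x → F.φ (ι P x) = ι Q (F.linearPart x) by
    rw [← P.even_add_odd x]
    simp only [map_add]
    rw [h 0 _ (P.hasParity_even x), h 1 _ (P.hasParity_odd x)]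
  intro p x hx
  rw [← sub_eq_zero]
  refine eq_zero_of_hat_proj ?_ ?_
  · have : ∀ {R : GradedSpace.{u}} (y : R), GSym.counit R (ι R y) = 0 := fun y => by
      simpa using counit_ι_mul y 1
    rw [map_sub, F.counit_apply, this, this, sub_zero]
  · have h1 : hat (proj Q) (F.φ (ι P x)) = ι Q (F.linearPart x) := by
      have h2 := LinearMap.congr_fun (conv_comp_coalgHom F.comul (β := LinearMap.mul ℂ (GSym Q))
        (F := ι Q ∘ₗ proj Q) (G := LinearMap.id)) (ι P x)
      refine h2.trans ((conv_ι _ _ _ hx).trans ?_)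
      simp [F.map_one, proj_one, linearPart]
    have h3 : ∀ y, hat (proj Q) (ι Q y) = ι Q y := fun y => by
      suffices h : ∀ p y, Q.HasParity p y → hat (proj Q) (ι Q y) = ι Q y by
        rw [← Q.even_add_odd y]
        simp only [map_add]
        rw [h 0 _ (Q.hasParity_even y), h 1 _ (Q.hasParity_odd y)]
      intro q y hy
      refine (conv_ι _ _ _ hy).trans ?_
      simp [proj_one, proj_ι]
    rw [map_sub, h1, h3, sub_self]

theorem sgn_linearPart (x : P) : Q.sgn (F.linearPart x) = F.linearPart (P.sgn x) := by
  have h := F.degree.conj_eq (v := 0) (by simp)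
  rw [pow_zero, one_smul] at h
  have h1 := LinearMap.congr_fun h (ι P (P.sgn x))
  rw [conj_apply] at h1
  simpa [linearPart, GSym.sgn_ι, GradedSpace.sgn_sgn] using h1

end DGMorphism

section Smooth
variable {P Q K : GradedSpace.{u}} {d : Q →ₗ[ℂ] Q} {b : Q →ₗ[ℂ] Q →ₗ[ℂ] Q} {X : VF P P} {Y : VF Q Q}

/-- On the image of a linear space with zero vector field, the quadratic part of the vector field
`q ↦ d q + b(q, q)/2` is exact: this is its Taylor coefficient at the product of two vectors. -/
theorem IsShiftedDGLie.exists_b_eq_d (H : IsShiftedDGLie d b) (hY : Y = quad d b H.b_symm)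
    (G : DGMorphism (0 : VF K K) X) (F : DGMorphism X Y) (x y : K) :
    ∃ z, b (F.linearPart (G.linearPart x)) (F.linearPart (G.linearPart y)) = d z := by
  subst hY
  suffices h : ∀ p q x y, K.HasParity p x → K.HasParity q y →
      ∃ z, b (F.linearPart (G.linearPart x)) (F.linearPart (G.linearPart y)) = d z by
    obtain ⟨z₁, h₁⟩ := h 0 0 _ _ (K.hasParity_even x) (K.hasParity_even y)
    obtain ⟨z₂, h₂⟩ := h 0 1 _ _ (K.hasParity_even x) (K.hasParity_odd y)
    obtain ⟨z₃, h₃⟩ := h 1 0 _ _ (K.hasParity_odd x) (K.hasParity_even y)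
    obtain ⟨z₄, h₄⟩ := h 1 1 _ _ (K.hasParity_odd x) (K.hasParity_odd y)
    refine ⟨z₁ + z₂ + (z₃ + z₄), ?_⟩
    rw [← K.even_add_odd x, ← K.even_add_odd y]
    simp only [map_add, LinearMap.add_apply, h₁, h₂, h₃, h₄]
    abel
  intro p q x y hx hy
  have hψ : comul Q ∘ₗ (F.φ ∘ₗ G.φ) = TensorProduct.map (F.φ ∘ₗ G.φ) (F.φ ∘ₗ G.φ) ∘ₗ comul K := by
    rw [← LinearMap.comp_assoc, F.comul, LinearMap.comp_assoc, G.comul, ← LinearMap.comp_assoc,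
      ← TensorProduct.map_comp]
  have h0 : quad d b H.b_symm ∘ₗ (F.φ ∘ₗ G.φ) = 0 := by
    have h1 : proj Q ∘ₗ hat (quad d b H.b_symm) ∘ₗ F.φ ∘ₗ G.φ = 0 := by
      rw [← LinearMap.comp_assoc G.φ, ← F.intertwines, LinearMap.comp_assoc, ← G.intertwines,
        hat_zero]
      simp
    rwa [← LinearMap.comp_assoc, proj_comp_hat] at h1
  rw [quad_comp_coalgHom H.b_symm hψ] at h0
  have h1 := LinearMap.congr_fun h0 (ι K x * ι K y)
  have f_one : (proj Q ∘ₗ F.φ ∘ₗ G.φ) 1 = 0 := by simp [G.map_one, F.map_one, proj_one]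
  have f_ι : ∀ w, (proj Q ∘ₗ F.φ ∘ₗ G.φ) (ι K w) = F.linearPart (G.linearPart w) := fun w => by
    simp [DGMorphism.φ_ι, proj_ι]
  have par : ∀ {r : ℕ} {w : K}, K.HasParity r w →
      Q.HasParity r (F.linearPart (G.linearPart w)) := fun {r w} hw => by
    have hw' : K.sgn w = (-1 : ℂ) ^ r • w := hw
    rw [GradedSpace.HasParity, F.sgn_linearPart, G.sgn_linearPart, hw', map_smul, map_smul]
  rw [LinearMap.add_apply, LinearMap.smul_apply, conv_ι_mul_ι b _ _ hx hy f_one f_one, f_ι, f_ι,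
    H.b_symm q p _ _ (par hy) (par hx), smul_smul, mul_comm q p, neg_one_pow_mul_self, one_smul,
    ← two_smul ℂ, smul_smul] at h1
  refine ⟨-((proj Q ∘ₗ F.φ ∘ₗ G.φ) (ι K x * ι K y)), ?_⟩
  rw [map_neg, eq_neg_iff_add_eq_zero, add_comm]
  norm_num at h1
  exact h1

variable {mul br : Q →ₗ[ℂ] Q →ₗ[ℂ] Q} {hd : ∀ i, ∀ x ∈ Q.deg i, d x ∈ Q.deg (i + 1)}
  {hbr : ∀ (p q : ℕ) (x y : Q), Q.HasParity p x → Q.HasParity q y →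
      br (Q.sgn x) y = (-1 : ℂ) ^ (p * q) • br (Q.sgn y) x}
  {𝓕 : CohomologyFManifold Q} {𝓗 : CohomologyFManifold (Q.cohomology d hd)}

/-- If the transferred dg manifold is smooth, then the bracket vanishes on cohomology. -/
theorem IsTransfer.exists_br_eq_d (hG : IsDGGerstenhaber Q mul d br)
    (hF : IsGerstenhaberFManifold mul d br hbr 𝓕) (hT : IsTransfer mul d hd 𝓕 𝓗)
    (hs : IsSmooth 𝓗.X) {x y : Q} (hx : d x = 0) (hy : d y = 0) :
    ∃ z, br (Q.sgn x) y = d z := by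
  have H := hG.isShifted.toIsShiftedDGLie
  obtain ⟨K, G, hGq⟩ := hs
  obtain ⟨E, hE⟩ := hT.equivalent
  -- every cocycle is, up to a coboundary, in the image of the linear part of the composite morphism
  have key : ∀ w, d w = 0 → ∃ k v, w = E.toMorphism.linearPart (G.linearPart k) + d v := by
    intro w hw
    obtain ⟨k, z, -, hk⟩ := hGq.surj (Q.classOf d hd ⟨w, hw⟩) (hT.minimal _)
    rw [hT.minimal, add_zero] at hk
    obtain ⟨a, ha, ha'⟩ := hE (G.linearPart k)
    rw [← hk] at ha'
    obtain ⟨v, hv⟩ := (Homology.mk_eq_mk (D := d)).1 ha'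
    exact ⟨k, v, by rw [ha, ← hv]; simp⟩
  obtain ⟨k, u, hk⟩ := key x hx
  obtain ⟨l, v, hl⟩ := key y hy
  obtain ⟨z, hz⟩ := H.exists_b_eq_d hF.X_eq G E.toMorphism k l
  set x' := E.toMorphism.linearPart (G.linearPart k)
  set y' := E.toMorphism.linearPart (G.linearPart l)
  have hx' : d x' = 0 := by
    have := congrArg d hk
    rwa [map_add, H.d_sq, add_zero, hx, eq_comm] at this
  have e1 : br (Q.sgn (d u)) y = d (-br (Q.sgn u) y) := by
    have := H.d_b u y
    rw [hy, map_zero, sub_zero] at this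
    rw [map_neg]
    exact (neg_eq_iff_eq_neg.2 this).symm
  have e2 : br (Q.sgn x') (d v) = d (-br x' v) := by
    have := H.d_b (Q.sgn x') v
    have h3 : d (Q.sgn x') = 0 := by
      rw [← neg_eq_zero, ← Q.sgn_d d hd, hx', map_zero]
    rw [h3, map_zero, LinearMap.zero_apply, neg_zero, zero_sub, Q.sgn_sgn] at this
    have h4 : d (br x' v) = - br (Q.sgn x') (d v) := by
      simpa [Q.sgn_sgn] using this
    rw [map_neg, h4, neg_neg]
  have hz' : br (Q.sgn x') y' = d z := hz
  refine ⟨z + -br x' v + -br (Q.sgn u) y, ?_⟩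
  rw [map_add, map_add, ← e1, ← e2, ← hz', ← map_add, ← hl, hk, map_add, map_add,
    LinearMap.add_apply]

/-- The vector field of a formal Frobenius manifold is zero, so that an equivalence from it is in
particular a quasi-isomorphism witnessing smoothness. -/
theorem LiftsToFrobenius.isSmooth (h : LiftsToFrobenius 𝓗) : IsSmooth 𝓗.X := by
  obtain ⟨K, _, ⟨X, _, _, _, _, _, _⟩, _, rfl : X = 0, _, ⟨E⟩⟩ := h
  exact ⟨K, E.toMorphism, E.isQuasiIso⟩

end Smooth
end ExtDef

/-! ### Affine space -/

namespace PolyForm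
open ExtDef

section Affine
variable {n : ℕ}

theorem atlas_model_eq (e : atlas (Fin n → ℂ) (Fin n → ℂ)) :
    e.1 = OpenPartialHomeomorph.refl (Fin n → ℂ) := by
  exact chartedSpaceSelf_atlas.1 e.2

theorem jac_model (e e' : atlas (Fin n → ℂ) (Fin n → ℂ)) (x : Fin n → ℂ) : jac e e' x = 1 := by
  ext k i
  have h : (⇑e'.1 ∘ ⇑e.1.symm : (Fin n → ℂ) → Fin n → ℂ) = id := by
    rw [atlas_model_eq e, atlas_model_eq e']
    rfl
  rw [jac, h, fderiv_id, Matrix.one_apply]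
  simp [Pi.single_apply]

variable (n) in
/-- Affine space is a Calabi-Yau manifold, with the flat metric and the constant volume form. -/
theorem isCalabiYau_model : IsCalabiYau n (Fin n → ℂ) := by
  refine ⟨⟨fun _ _ => 1, ?_, ?_, ?_⟩, ⟨fun _ _ => 1, ?_, ?_, ?_, ?_, ?_⟩⟩
  · simp
  · exact fun e => differentiableOn_const _
  · intro e e' x _
    simp [jac_model]
  · exact fun e i j => contDiffOn_const
  · exact fun e x _ => Matrix.isHermitian_one
  · intro e x _ v hv
    obtain ⟨i, hi⟩ := Function.ne_iff.1 hv
    have h : ∀ i, ∑ j, v i * (starRingEnd ℂ) (v j) * (1 : Matrix (Fin n) (Fin n) ℂ) i j =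
        ((Complex.normSq (v i) : ℝ) : ℂ) := fun i => by
      simp [Matrix.one_apply, Complex.mul_conj]
    simp only [h]
    rw [← Complex.ofReal_sum, Complex.ofReal_re]
    exact Finset.sum_pos' (fun i _ => Complex.normSq_nonneg _)
      ⟨i, Finset.mem_univ _, Complex.normSq_pos.2 hi⟩
  · intro e e' x _ i j
    simp [jac_model, Matrix.one_apply, eq_comm]
  · intro e x _ i j k
    simp [wirt, pd, Function.comp_def]

/-- A vector field `f ∂/∂z_j` on affine space. -/
noncomputable def coordField (j : Fin n)
    (f : ∀ e : atlas (Fin n → ℂ) (Fin n → ℂ), SmoothFun n (dom e)) :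
    Forms n (Fin n → ℂ) :=
  ⟨fun e => f e ⊗ₜ theta j, fun e e' => by
    obtain rfl : e = e' := Subtype.ext ((atlas_model_eq e).trans (atlas_model_eq e').symm)
    have h : ∀ g : SmoothFun n (dom e ⊓ dom e), transition e e (inter_left e e) (inter_right e e)
        (g ⊗ₜ theta j) = g ⊗ₜ theta j := by
      intro g
      have h1 : g ⊗ₜ[ℂ] (theta j : Fib n) = (g ⊗ₜ 1) * (1 ⊗ₜ theta j) := by simp
      rw [h1, map_mul, transition, frameChange_coef, theta, frameChange_gen, frameLin_zero_single]
      simp only [dz_coordFun_self]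
      congr 1
      rw [Finset.sum_eq_single j]
      · simp [theta]
      · intro i _ hi
        simp [hi.symm]
      · simp
    exact (h _).symm⟩

theorem at_coordField (j : Fin n) (f) (e : atlas (Fin n → ℂ) (Fin n → ℂ)) :
    at_ e (coordField j f) = f e ⊗ₜ theta j := rfl

/-- `∂̄`-exact forms have no component without `dz̄`. -/
theorem not_locDbar_eq_theta {R : Type*} [CommRing R] [Algebra ℂ R] (ε : R →ₐ[ℂ] ℂ)
    (δ : Fin n → Derivation ℂ R R) (j : Fin n) (a : R ⊗[ℂ] Fib n) :
    (1 : R) ⊗ₜ[ℂ] (theta j : Fib n) ≠ locDbar δ a := by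
  -- evaluation at a point followed by setting `dz̄ = 0` kills the image of `∂̄`
  let π : Fib n →ₐ[ℂ] Fib n := ExteriorAlgebra.map
    (LinearMap.inr ℂ (Fin n → ℂ) (Fin n → ℂ) ∘ₗ LinearMap.snd ℂ (Fin n → ℂ) (Fin n → ℂ))
  let T : R ⊗[ℂ] Fib n →ₐ[ℂ] ℂ ⊗[ℂ] Fib n := Algebra.TensorProduct.map ε π
  intro h
  have h1 := congrArg (fun x => TensorProduct.lid ℂ (Fib n) (T x)) h
  have h2 : ∀ i x, T (((1 : R) ⊗ₜ[ℂ] zeta i) * x) = 0 := fun i x => by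
    have hz : π (zeta i) = 0 := by simp [π, zeta, Prod.mk_zero_zero]
    simp [T, hz]
  simp only [locDbar_apply, map_sum, h2, map_zero, Finset.sum_const_zero] at h1
  simp [T, π, theta] at h1

/-- On affine space of positive dimension the vector fields `∂/∂z` and `z ∂/∂z` have a bracket which
is not exact. -/
theorem exists_bracket_ne_dbar (j : Fin n) : ∃ x y : Forms n (Fin n → ℂ),
    dbar n (Fin n → ℂ) x = 0 ∧ dbar n (Fin n → ℂ) y = 0 ∧
    ∀ w, schouten n (Fin n → ℂ) (sgn n (Fin n → ℂ) x) y ≠ dbar n (Fin n → ℂ) w := by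
  refine ⟨coordField j fun e => 1, coordField j fun e => coordFun e (dom_subset e) j, ?_, ?_,
    fun w hw => ?_⟩
  · refine Forms.ext fun e => ?_
    rw [at_dbar, at_coordField, locDbar_apply]
    simp [locDer]
  · refine Forms.ext fun e => ?_
    rw [at_dbar, at_coordField, locDbar_apply]
    simp [locDer, dzbar_coordFun]
  -- up to sign, the bracket is `∂/∂z`
  · let e : atlas (Fin n → ℂ) (Fin n → ℂ) := ⟨chartAt (Fin n → ℂ) 0, chart_mem_atlas _ _⟩
    have h := congrArg (at_ e) hw
    have hθ : ∀ i f, locTheta i (f ⊗ₜ[ℂ] theta j) =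
        (if i = j then f ⊗ₜ[ℂ] (1 : Fib n) else (0 : LocForm n (dom e))) := fun i f => by
      rw [locTheta, LinearMap.lTensor_tmul, dTheta_theta]
      split_ifs <;> simp
    rw [at_schouten, at_sgn, at_dbar, at_coordField, at_coordField, locBracket_apply,
      Finset.sum_eq_single j] at h
    · rw [locTheta_locSgn, map_neg, locSgn_locSgn, locDer_locSgn, hθ, hθ] at h
      refine not_locDbar_eq_theta (evalAt ⟨0, mem_chart_source _ _⟩) _ j (-at_ e w)
        (Eq.trans ?_ (congrArg Neg.neg h)|>.trans (map_neg _ _).symm)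
      simp [locDer, dz_coordFun_self]
    · intro i _ hi
      rw [locTheta_locSgn, hθ, if_neg hi, hθ, if_neg hi]
      simp
    · simp

end Affine
end PolyForm

open ExtDef PolyForm in
theorem theorem7p1 :
    (∀ (n : ℕ) (M : Type*) [TopologicalSpace M] [ChartedSpace (Fin n → ℂ) M]
        [IsManifold 𝓘(ℂ, Fin n → ℂ) ω M] [T2Space M] [SecondCountableTopology M]
        [NoncompactSpace M],
      IsDGGerstenhaber (formsGraded n M) (wedge n M) (del n M) (brk n M) ∧
      ∃ 𝓗 : CohomologyFManifold (dolbeault n M), IsDeformationFManifold n M 𝓗) ∧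
    (∃ (n : ℕ) (M : Type) (_ : TopologicalSpace M) (_ : ChartedSpace (Fin n → ℂ) M)
        (_ : IsManifold 𝓘(ℂ, Fin n → ℂ) ω M),
      T2Space M ∧ SecondCountableTopology M ∧ ConnectedSpace M ∧ NoncompactSpace M ∧
      IsCalabiYau n M ∧
      ∀ 𝓗 : CohomologyFManifold (dolbeault n M), IsDeformationFManifold n M 𝓗 →
        ¬ IsSmooth 𝓗.X ∧ ¬ LiftsToFrobenius 𝓗) := by
  refine ⟨fun n M _ _ _ _ _ => ⟨isDGGerstenhaber_forms n M, exists_deformationFManifold n M⟩,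
    1, Fin 1 → ℂ, inferInstance, inferInstance, inferInstance, inferInstance, inferInstance,
    inferInstance, inferInstance, isCalabiYau_model 1, ?_⟩
  rintro 𝓗 ⟨𝓕, h𝓕, h𝓗⟩
  have h : ¬ IsSmooth 𝓗.X := fun hs => by
    obtain ⟨x, y, hx, hy, hxy⟩ := exists_bracket_ne_dbar (0 : Fin 1)
    obtain ⟨w, hw⟩ := h𝓗.exists_br_eq_d (isDGGerstenhaber_forms 1 _) h𝓕 hs hx hy
    exact hxy w hw
  exact ⟨h, fun hl => h hl.isSmooth⟩
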